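/- Let $G$ be a group, $k$ a commutative ring, and $\mathcal V$ the monoidal category of $k$-modules, so that a (small) $\mathcal V$-category is a $k$-linear category. Let $G^{\mathrm{aut}}$ be the groupoid whose objects are the elements of $G$ and whose morphisms $g:a\to b$ are the $g\in G$ with $ga=bg$. The bicategory $\mathrm{Ps}(G^{\mathrm{aut}},\mathcal V\text{-}\mathrm{Cat})$ of pseudofunctors carries the convolution product $(S\star T)(c)=\sum_{ab=c}Sa\otimes Tb$, with unit the pseudofunctor that is the unit $\mathcal V$-category at $1$ and the initial $\mathcal V$-category elsewhere. A *monoidale* $M$ therein is a pseudofunctor $M$ with $k$-bilinear functors $\square_{a,b}:Ma\times Mb\to M(ab)$, an object $I\in M1$, and invertible associativity and unit constraints $\alpha,\lambda,\rho$, where $\square$ and $I$ are pseudonatural in $G^{\mathrm{aut}}$, the constraints are modifications, and the pentagon and triangle axioms hold. Monoidales form a bicategory: 1-cells are pseudonatural transformations that are strong monoidal (with coherent invertible modifications for $\square$ and $I$), and 2-cells are the modifications compatible with these. A *$G$-crossed category* is a $k$-linear monoidal category $\mathcal C$ with finite direct sums and pairwise disjoint full subcategories $\mathcal C_a$ $(a\in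 G)$, each with finite direct sums, such that every object is a direct sum $\bigoplus_a X_a$ with $X_a\in\mathcal C_a$ and $a$ running over a finite subset of $G$; $\mathcal C_a\otimes\mathcal C_b\subseteq\mathcal C_{ab}$; $\mathcal C(X,Y)=0$ for $X\in\mathcal C_a$, $Y\in\mathcal C_b$, $a\ne b$; and the unit object lies in $\mathcal C_1$; together with $k$-linear monoidal auto-equivalences $\phi_a$ of $\mathcal C$ $(a\in G)$ and coherent monoidal isomorphisms $\phi_a\circ\phi_b\cong\phi_{ba}$ and $1_{\mathcal C}\cong\phi_1$, such that $\phi_a(\mathcal C_b)\subseteq\mathcal C_{a^{-1}ba}$. ("Finite direct sums" includes the empty one, a zero object.) $G$-crossed categories form a bicategory: 1-cells are $k$-linear strong monoidal functors $F$ with $F(\mathcal C_a)\subseteq\mathcal D_a$ together with coherent monoidal isomorphisms $F\phi_a\cong\phi_aF$; 2-cells are monoidal natural transformations compatible with these. For a $G$-crossed category $\mathcal C$ let $H\mathcal C$ be the monoidale with $(H\mathcal C)a=\mathcal C_a$, in which $f:a\to b$ acts as the restriction $\mathcal C_a\to\mathcal C_b$ of $\phi_{f^{-1}}$, and with $\square$,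 $I$ and the constraints those of $\mathcal C$. This is the object part of a pseudofunctor $H$ from $G$-crossed categories to monoidales. Say that a 1-cell $\eta:M\to H\mathcal C$ *exhibits $\mathcal C$ as the finite direct sum completion of the coproduct of the components of $M$* if the induced functor $\sum_a Ma\to\mathcal C$ is fully faithful and every object of $\mathcal C$ is a finite direct sum of objects in its image. (Since $\eta$ is pseudonatural, $\phi_f$ then restricts along $\eta$ to $Mf^{-1}$ up to coherent isomorphism.) Then monoidales are equivalent to $G$-crossed categories, up to finite direct sum completion, in the following sense. 1. $H$ is locally an equivalence: for all $\mathcal C,\mathcal D$ the functor $\mathrm{Hom}(\mathcal C,\mathcal D)\to\mathrm{Hom}(H\mathcal C,H\mathcal D)$ is an equivalence of categories. 2. A monoidale $M$ is equivalent to $H\mathcal C$ for some $G$-crossed category $\mathcal C$ if and only if every $Ma$ has finite direct sums. (So $H$ is a biequivalence onto the monoidales whose components have finite direct sums.) 3. For every monoidale $M$ there are a $G$-crossed category $\mathcal C$ and a 1-cell $\eta:M\to H\mathcal C$ that exhibits $\mathcal C$ as the finite direct sum completion of the coproduct of the components of $M$. 4. For every such $\eta:M\to H\mathcal C$ and every $G$-crossed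 category $\mathcal D$, the functor $\mathrm{Hom}(\mathcal C,\mathcal D)\to\mathrm{Hom}(M,H\mathcal D)$, $F\mapsto HF\circ\eta$, is an equivalence of categories; moreover $\eta$ is itself an equivalence if and only if every $Ma$ has finite direct sums. 5. For every $G$-crossed category $\mathcal C$, the identity of $H\mathcal C$ exhibits $\mathcal C$ as the finite direct sum completion of the coproduct of its homogeneous parts $\mathcal C_a$. -/

import Mathlib

universe w v u

namespace GCrossed

open CategoryTheory MonoidalCategory Limits
open scoped CategoryTheory.Pseudofunctor.StrongTrans


set_option linter.unusedVariables false

section Bicat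

open Bicategory

set_option linter.checkUnivs false

/-- A (small) category enriched in `k`-modules. -/
structure LinCat (k : Type w) [CommRing k] where
  carrier : Type u
  [category : Category.{v} carrier]
  [preadditive : Preadditive carrier]
  [linear : Linear k carrier]

namespace LinCat

variable {k : Type w} [CommRing k]

instance : CoeSort (LinCat.{w, v, u} k) (Type u) := ⟨carrier⟩

attribute [instance] category preadditive linear

/-- A `k`-linear functor. -/
structure Hom (A B : LinCat.{w, v, u} k) where
  toFunctor : A ⥤ B
  [additive : toFunctor.Additive]
  [linear : toFunctor.Linear k]

attribute [instance] Hom.additive Hom.linear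

/-- A natural transformation between `k`-linear functors. -/
structure Hom₂ {A B : LinCat.{w, v, u} k} (F F' : Hom A B) where
  toNatTrans : F.toFunctor ⟶ F'.toFunctor

instance : CategoryStruct (LinCat.{w, v, u} k) where
  Hom := Hom
  id A := { toFunctor := 𝟭 A }
  comp F F' := { toFunctor := F.toFunctor ⋙ F'.toFunctor }

instance homCategory (A B : LinCat.{w, v, u} k) : Category (A ⟶ B) where
  Hom F F' := Hom₂ F F'
  id F := ⟨𝟙 F.toFunctor⟩
  comp s t := ⟨s.toNatTrans ≫ t.toNatTrans⟩
  id_comp s := congrArg Hom₂.mk (Category.id_comp s.toNatTrans)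
  comp_id s := congrArg Hom₂.mk (Category.comp_id s.toNatTrans)
  assoc s t r := congrArg Hom₂.mk (Category.assoc s.toNatTrans t.toNatTrans r.toNatTrans)

theorem hom₂_ext {A B : LinCat.{w, v, u} k} {F F' : A ⟶ B} {s t : F ⟶ F'}
    (h : ∀ X, s.toNatTrans.app X = t.toNatTrans.app X) : s = t := by
  exact congrArg Hom₂.mk (NatTrans.ext (funext h) : s.toNatTrans = t.toNatTrans)

/-- An invertible 2-cell from a natural isomorphism. -/
def isoMk {A B : LinCat.{w, v, u} k} {F F' : A ⟶ B} (e : F.toFunctor ≅ F'.toFunctor) :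
    F ≅ F' where
  hom := ⟨e.hom⟩
  inv := ⟨e.inv⟩
  hom_inv_id := congrArg Hom₂.mk e.hom_inv_id
  inv_hom_id := congrArg Hom₂.mk e.inv_hom_id

/-- The component of an invertible 2-cell at an object. -/
def isoApp {A B : LinCat.{w, v, u} k} {F F' : A ⟶ B} (e : F ≅ F') (X : A) :
    F.toFunctor.obj X ≅ F'.toFunctor.obj X where
  hom := e.hom.toNatTrans.app X
  inv := e.inv.toNatTrans.app X
  hom_inv_id := congrArg (fun t => Hom₂.toNatTrans t |>.app X) e.hom_inv_id
  inv_hom_id := congrArg (fun t => Hom₂.toNatTrans t |>.app X) e.inv_hom_id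

/-- The 2-category of `k`-linear categories, `k`-linear functors and natural transformations. -/
instance bicategory : Bicategory (LinCat.{w, v, u} k) where
  homCategory := homCategory
  whiskerLeft F _ _ t := ⟨Functor.whiskerLeft F.toFunctor t.toNatTrans⟩
  whiskerRight t F := ⟨Functor.whiskerRight t.toNatTrans F.toFunctor⟩
  associator F F' F'' := isoMk (Functor.associator F.toFunctor F'.toFunctor F''.toFunctor)
  leftUnitor F := isoMk F.toFunctor.leftUnitor
  rightUnitor F := isoMk F.toFunctor.rightUnitor
  whiskerLeft_id F F' := rfl
  whiskerLeft_comp F _ _ _ s t := rfl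
  id_whiskerLeft t := hom₂_ext fun X =>
    ((Category.id_comp _).trans (Category.comp_id (t.toNatTrans.app X))).symm
  comp_whiskerLeft F F' _ _ t := hom₂_ext fun X =>
    ((Category.id_comp _).trans (Category.comp_id _)).symm
  id_whiskerRight F F' := hom₂_ext fun X => F'.toFunctor.map_id _
  comp_whiskerRight s t F := hom₂_ext fun X => F.toFunctor.map_comp _ _
  whiskerRight_id t := hom₂_ext fun X =>
    ((Category.id_comp _).trans (Category.comp_id (t.toNatTrans.app X))).symm
  whiskerRight_comp t F F' := hom₂_ext fun X =>
    ((Category.id_comp _).trans (Category.comp_id _)).symm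
  whisker_assoc F _ _ t F' := hom₂_ext fun X =>
    ((Category.id_comp _).trans (Category.comp_id _)).symm
  whisker_exchange s t := hom₂_ext fun X => (t.toNatTrans.naturality (s.toNatTrans.app X)).symm
  pentagon F F' F'' F''' := hom₂_ext fun X => by
    change F'''.toFunctor.map (𝟙 _) ≫ 𝟙 _ ≫ 𝟙 _ = 𝟙 _ ≫ 𝟙 _
    simp
  triangle F F' := hom₂_ext fun X => by
    change 𝟙 _ ≫ 𝟙 _ = F'.toFunctor.map (𝟙 _)
    simp

/-- A `k`-linear functor `A ⊗ B ⥤ C` out of the tensor product of `k`-linear categories, that is,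
a functor of two variables which is `k`-bilinear on morphisms. -/
structure Bilin (A B C : LinCat.{w, v, u} k) where
  obj : A → B → C
  map {X X' : A} {Y Y' : B} : (X ⟶ X') → (Y ⟶ Y') → (obj X Y ⟶ obj X' Y')
  map_id (X : A) (Y : B) : map (𝟙 X) (𝟙 Y) = 𝟙 (obj X Y)
  map_comp {X X' X'' : A} {Y Y' Y'' : B} (f : X ⟶ X') (f' : X' ⟶ X'') (g : Y ⟶ Y')
    (g' : Y' ⟶ Y'') : map (f ≫ f') (g ≫ g') = map f g ≫ map f' g'
  map_add_left {X X' : A} {Y Y' : B} (f f' : X ⟶ X') (g : Y ⟶ Y') :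
    map (f + f') g = map f g + map f' g
  map_add_right {X X' : A} {Y Y' : B} (f : X ⟶ X') (g g' : Y ⟶ Y') :
    map f (g + g') = map f g + map f g'
  map_smul_left {X X' : A} {Y Y' : B} (r : k) (f : X ⟶ X') (g : Y ⟶ Y') :
    map (r • f) g = r • map f g
  map_smul_right {X X' : A} {Y Y' : B} (r : k) (f : X ⟶ X') (g : Y ⟶ Y') :
    map f (r • g) = r • map f g

/-- The action of a functor of two variables on isomorphisms. -/
def Bilin.mapIso {A B C : LinCat.{w, v, u} k} (T : Bilin A B C) {X X' : A} {Y Y' : B}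
    (e : X ≅ X') (e' : Y ≅ Y') : T.obj X Y ≅ T.obj X' Y' where
  hom := T.map e.hom e'.hom
  inv := T.map e.inv e'.inv
  hom_inv_id := by rw [← T.map_comp, e.hom_inv_id, e'.hom_inv_id, T.map_id]
  inv_hom_id := by rw [← T.map_comp, e.inv_hom_id, e'.inv_hom_id, T.map_id]

end LinCat

/-- The groupoid `G^aut` of automorphisms in the one-object groupoid `G`: an object is an element
`a` of `G`, and a morphism `a ⟶ b` is an element `g` of `G` with `g * a = b * g`. -/
structure GAut (G : Type u) where
  el : G

namespace GAut

variable {G : Type u} [Group G]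

@[ext]
structure Hom (a b : GAut G) where
  el : G
  comm : el * a.el = b.el * el

/-- The composite of `g : a ⟶ b` followed by `h : b ⟶ c` is `h * g`. -/
instance : Groupoid (GAut G) where
  Hom := Hom
  id a := ⟨1, by simp⟩
  comp g h := ⟨h.el * g.el, by rw [mul_assoc, g.comm, ← mul_assoc, h.comm, mul_assoc]⟩
  id_comp g := Hom.ext (mul_one _)
  comp_id g := Hom.ext (one_mul _)
  assoc g h i := Hom.ext (mul_assoc _ _ _).symm
  inv g := ⟨g.el⁻¹, by
    rw [inv_mul_eq_iff_eq_mul, ← mul_assoc, g.comm, mul_assoc, mul_inv_cancel, mul_one]⟩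
  inv_comp g := Hom.ext (mul_inv_cancel _)
  comp_inv g := Hom.ext (inv_mul_cancel _)

/-- The morphism `a ⟶ a'` of `G^aut` given by `g`, in the locally discrete bicategory. -/
abbrev ofEl (g : G) {a a' : G} (h : g * a = a' * g) :
    (⟨⟨a⟩⟩ : LocallyDiscrete (GAut G)) ⟶ ⟨⟨a'⟩⟩ :=
  Discrete.mk (Hom.mk (a := ⟨a⟩) (b := ⟨a'⟩) g h)

end GAut

/-- The bicategory `Ps(G^aut, V-Cat)` of pseudofunctors, pseudonatural transformations and
modifications. -/
abbrev Ps (G : Type u) [Group G] (k : Type w) [CommRing k] :=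
  LocallyDiscrete (GAut G) ⥤ᵖ LinCat.{w, v, u} k

namespace Ps

variable {G : Type u} [Group G] {k : Type w} [CommRing k]

/-- The value of `S` at the object `a` of `G^aut`. -/
abbrev at_ (S : Ps.{w, v, u} G k) (a : G) : LinCat.{w, v, u} k := S.obj ⟨⟨a⟩⟩

/-- The value `S g : S a ⥤ S a'` of `S` at a morphism `g : a ⟶ a'` of `G^aut`. -/
abbrev act (S : Ps.{w, v, u} G k) (g : G) {a a' : G} (h : g * a = a' * g) :
    S.at_ a ⥤ S.at_ a' :=
  (S.map (GAut.ofEl g h)).toFunctor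

/-- The unit constraint `S 1 ≅ 𝟭` of `S`. -/
def actOne (S : Ps.{w, v, u} G k) {a : G} (h : 1 * a = a * 1) (X : S.at_ a) :
    (S.act 1 h).obj X ≅ X :=
  LinCat.isoApp (S.mapId ⟨⟨a⟩⟩) X

/-- The composition constraint `S (g' * g) ≅ S g' ∘ S g` of `S`. -/
def actMul (S : Ps.{w, v, u} G k) (g g' : G) {a a' a'' : G} (h : g * a = a' * g)
    (h' : g' * a' = a'' * g') (h'' : g' * g * a = a'' * (g' * g)) (X : S.at_ a) :
    (S.act (g' * g) h'').obj X ≅ (S.act g' h').obj ((S.act g h).obj X) :=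
  LinCat.isoApp (S.mapComp (GAut.ofEl g h) (GAut.ofEl g' h')) X

/-- The component at `a` of a pseudonatural transformation. -/
abbrev app {S T : Ps.{w, v, u} G k} (F : S ⟶ T) (a : G) : S.at_ a ⥤ T.at_ a :=
  (Pseudofunctor.StrongTrans.app F ⟨⟨a⟩⟩).toFunctor

/-- The pseudonaturality constraint of a pseudonatural transformation. -/
def appAct {S T : Ps.{w, v, u} G k} (F : S ⟶ T) (g : G) {a a' : G} (h : g * a = a' * g)
    (X : S.at_ a) : (T.act g h).obj ((app F a).obj X) ≅ (app F a').obj ((S.act g h).obj X) :=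
  (LinCat.isoApp (Pseudofunctor.StrongTrans.naturality F (GAut.ofEl g h)) X).symm

/-- The component at `a` and `X` of a modification. -/
abbrev app₂ {S T : Ps.{w, v, u} G k} {F F' : S ⟶ T} (t : F ⟶ F') {a : G} (X : S.at_ a) :
    (app F a).obj X ⟶ (app F' a).obj X :=
  (t.as.app ⟨⟨a⟩⟩).toNatTrans.app X

theorem appAct_id (S : Ps.{w, v, u} G k) (g : G) {a a' : G} (h : g * a = a' * g)
    (X : S.at_ a) : (appAct (𝟙 S) g h X).hom = 𝟙 ((S.act g h).obj X) := by
  refine Eq.trans ?_ (Category.id_comp (𝟙 ((S.act g h).obj X)))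
  rfl

theorem appAct_comp {S T R : Ps.{w, v, u} G k} (F : S ⟶ T) (F' : T ⟶ R) (g : G) {a a' : G}
    (h : g * a = a' * g) (X : S.at_ a) :
    (appAct (F ≫ F') g h X).hom =
      (appAct F' g h ((app F a).obj X)).hom ≫ (app F' a').map (appAct F g h X).hom := by
  have e : (appAct (F ≫ F') g h X).hom = ((((𝟙 _ ≫ (appAct F' g h ((app F a).obj X)).hom) ≫ 𝟙 _)
     ≫ (app F' a').map (appAct F g h X).hom) ≫ 𝟙 _) := rfl
  rw [e]
  simp only [Category.id_comp, Category.comp_id]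
  rfl

theorem appAct_natural {S T : Ps.{w, v, u} G k} (F : S ⟶ T) (g : G) {a a' : G}
    (h : g * a = a' * g) {X X' : S.at_ a} (x : X ⟶ X') :
    (appAct F g h X).hom ≫ (app F a').map ((S.act g h).map x) =
      (T.act g h).map ((app F a).map x) ≫ (appAct F g h X').hom :=
  ((Pseudofunctor.StrongTrans.naturality F (GAut.ofEl g h)).inv.toNatTrans.naturality x).symm

end Ps

/-- A monoidale (pseudomonoid) in the convolution monoidal bicategory `Ps(G^aut, V-Cat)`.
The convolution tensor product is `(S ⋆ T) c = ∑_{a * b = c} S a ⊗ T b`, and its unit `𝕁` is the unit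
`V`-category at `1` and the initial `V`-category `0` elsewhere. A pseudonatural transformation
`M ⋆ M ⟶ M` therefore has as components functors `M a ⊗ M b ⥤ M c`, one for each decomposition
`a * b = c`, with the constraint `tensorAct` for pseudonaturality. -/
structure Monoidale (G : Type u) [Group G] (k : Type w) [CommRing k] where
  /-- the underlying object of `Ps(G^aut, V-Cat)` -/
  ps : Ps.{w, v, u} G k
  /-- the multiplication `M ⋆ M ⟶ M` -/
  tensor {a b c : G} (h : a * b = c) : LinCat.Bilin (ps.at_ a) (ps.at_ b) (ps.at_ c)
  tensorAct (g : G) {a b c a' b' c' : G} (h : a * b = c) (h' : a' * b' = c')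
    (ha : g * a = a' * g) (hb : g * b = b' * g) (hc : g * c = c' * g)
    (X : ps.at_ a) (Y : ps.at_ b) :
    (ps.act g hc).obj ((tensor h).obj X Y) ≅
      (tensor h').obj ((ps.act g ha).obj X) ((ps.act g hb).obj Y)
  tensorAct_natural (g : G) {a b c a' b' c' : G} (h : a * b = c) (h' : a' * b' = c')
    (ha : g * a = a' * g) (hb : g * b = b' * g) (hc : g * c = c' * g)
    {X X' : ps.at_ a} {Y Y' : ps.at_ b} (x : X ⟶ X') (y : Y ⟶ Y') :
    (ps.act g hc).map ((tensor h).map x y) ≫ (tensorAct g h h' ha hb hc X' Y').hom =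
      (tensorAct g h h' ha hb hc X Y).hom ≫
        (tensor h').map ((ps.act g ha).map x) ((ps.act g hb).map y)
  tensorAct_one {a b c : G} (h : a * b = c) (ha : 1 * a = a * 1) (hb : 1 * b = b * 1)
    (hc : 1 * c = c * 1) (X : ps.at_ a) (Y : ps.at_ b) :
    (tensorAct 1 h h ha hb hc X Y).hom ≫
      (tensor h).map (ps.actOne ha X).hom (ps.actOne hb Y).hom =
        (ps.actOne hc ((tensor h).obj X Y)).hom
  tensorAct_mul (g g' : G) {a b c a' b' c' a'' b'' c'' : G} (h : a * b = c) (h' : a' * b' = c')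
    (h'' : a'' * b'' = c'') (ha : g * a = a' * g) (hb : g * b = b' * g) (hc : g * c = c' * g)
    (ha' : g' * a' = a'' * g') (hb' : g' * b' = b'' * g') (hc' : g' * c' = c'' * g')
    (ha'' : g' * g * a = a'' * (g' * g)) (hb'' : g' * g * b = b'' * (g' * g))
    (hc'' : g' * g * c = c'' * (g' * g)) (X : ps.at_ a) (Y : ps.at_ b) :
    (tensorAct (g' * g) h h'' ha'' hb'' hc'' X Y).hom ≫
        (tensor h'').map (ps.actMul g g' ha ha' ha'' X).hom (ps.actMul g g' hb hb' hb'' Y).hom =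
      (ps.actMul g g' hc hc' hc'' ((tensor h).obj X Y)).hom ≫
        (ps.act g' hc').map (tensorAct g h h' ha hb hc X Y).hom ≫
          (tensorAct g' h' h'' ha' hb' hc' ((ps.act g ha).obj X) ((ps.act g hb).obj Y)).hom
  /-- the unit `𝕁 ⟶ M` -/
  unit : ps.at_ 1
  unitAct (g : G) (h : g * 1 = 1 * g) : (ps.act g h).obj unit ≅ unit
  unitAct_one (h : (1 : G) * 1 = 1 * 1) : (unitAct 1 h).hom = (ps.actOne h unit).hom
  unitAct_mul (g g' : G) (h : g * 1 = 1 * g) (h' : g' * 1 = 1 * g')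
    (h'' : g' * g * 1 = 1 * (g' * g)) :
    (unitAct (g' * g) h'').hom =
      (ps.actMul g g' h h' h'' unit).hom ≫ (ps.act g' h').map (unitAct g h).hom ≫
        (unitAct g' h').hom
  /-- the associativity constraint, an invertible modification -/
  assoc {a b c ab bc abc : G} (h₁ : a * b = ab) (h₂ : ab * c = abc) (h₃ : b * c = bc)
    (h₄ : a * bc = abc) (X : ps.at_ a) (Y : ps.at_ b) (Z : ps.at_ c) :
    (tensor h₂).obj ((tensor h₁).obj X Y) Z ≅ (tensor h₄).obj X ((tensor h₃).obj Y Z)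
  assoc_natural {a b c ab bc abc : G} (h₁ : a * b = ab) (h₂ : ab * c = abc) (h₃ : b * c = bc)
    (h₄ : a * bc = abc) {X X' : ps.at_ a} {Y Y' : ps.at_ b} {Z Z' : ps.at_ c}
    (x : X ⟶ X') (y : Y ⟶ Y') (z : Z ⟶ Z') :
    (tensor h₂).map ((tensor h₁).map x y) z ≫ (assoc h₁ h₂ h₃ h₄ X' Y' Z').hom =
      (assoc h₁ h₂ h₃ h₄ X Y Z).hom ≫ (tensor h₄).map x ((tensor h₃).map y z)
  assoc_act (g : G) {a b c ab bc abc a' b' c' ab' bc' abc' : G}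
    (h₁ : a * b = ab) (h₂ : ab * c = abc) (h₃ : b * c = bc) (h₄ : a * bc = abc)
    (h₁' : a' * b' = ab') (h₂' : ab' * c' = abc') (h₃' : b' * c' = bc') (h₄' : a' * bc' = abc')
    (ha : g * a = a' * g) (hb : g * b = b' * g) (hc : g * c = c' * g) (hab : g * ab = ab' * g)
    (hbc : g * bc = bc' * g) (habc : g * abc = abc' * g)
    (X : ps.at_ a) (Y : ps.at_ b) (Z : ps.at_ c) :
    (ps.act g habc).map (assoc h₁ h₂ h₃ h₄ X Y Z).hom ≫
        (tensorAct g h₄ h₄' ha hbc habc X ((tensor h₃).obj Y Z)).hom ≫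
          (tensor h₄').map (𝟙 _) (tensorAct g h₃ h₃' hb hc hbc Y Z).hom =
      (tensorAct g h₂ h₂' hab hc habc ((tensor h₁).obj X Y) Z).hom ≫
        (tensor h₂').map (tensorAct g h₁ h₁' ha hb hab X Y).hom (𝟙 _) ≫
          (assoc h₁' h₂' h₃' h₄' ((ps.act g ha).obj X) ((ps.act g hb).obj Y)
            ((ps.act g hc).obj Z)).hom
  /-- the left unit constraint, an invertible modification -/
  left {a : G} (h : 1 * a = a) (X : ps.at_ a) : (tensor h).obj unit X ≅ X
  left_natural {a : G} (h : 1 * a = a) {X X' : ps.at_ a} (x : X ⟶ X') :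
    (tensor h).map (𝟙 unit) x ≫ (left h X').hom = (left h X).hom ≫ x
  left_act (g : G) {a a' : G} (h : 1 * a = a) (h' : 1 * a' = a') (h₁ : g * 1 = 1 * g)
    (ha : g * a = a' * g) (X : ps.at_ a) :
    (ps.act g ha).map (left h X).hom =
      (tensorAct g h h' h₁ ha ha unit X).hom ≫ (tensor h').map (unitAct g h₁).hom (𝟙 _) ≫
        (left h' ((ps.act g ha).obj X)).hom
  /-- the right unit constraint, an invertible modification -/
  right {a : G} (h : a * 1 = a) (X : ps.at_ a) : (tensor h).obj X unit ≅ X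
  right_natural {a : G} (h : a * 1 = a) {X X' : ps.at_ a} (x : X ⟶ X') :
    (tensor h).map x (𝟙 unit) ≫ (right h X').hom = (right h X).hom ≫ x
  right_act (g : G) {a a' : G} (h : a * 1 = a) (h' : a' * 1 = a') (h₁ : g * 1 = 1 * g)
    (ha : g * a = a' * g) (X : ps.at_ a) :
    (ps.act g ha).map (right h X).hom =
      (tensorAct g h h' ha h₁ ha X unit).hom ≫ (tensor h').map (𝟙 _) (unitAct g h₁).hom ≫
        (right h' ((ps.act g ha).obj X)).hom
  pentagon {a b c d ab bc cd abc bcd abcd : G} (h₁ : a * b = ab) (h₂ : b * c = bc)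
    (h₃ : c * d = cd) (h₄ : ab * c = abc) (h₅ : a * bc = abc) (h₆ : bc * d = bcd)
    (h₇ : b * cd = bcd) (h₈ : abc * d = abcd) (h₉ : a * bcd = abcd) (h₁₀ : ab * cd = abcd)
    (W : ps.at_ a) (X : ps.at_ b) (Y : ps.at_ c) (Z : ps.at_ d) :
    (tensor h₈).map (assoc h₁ h₄ h₂ h₅ W X Y).hom (𝟙 Z) ≫
        (assoc h₅ h₈ h₆ h₉ W ((tensor h₂).obj X Y) Z).hom ≫
          (tensor h₉).map (𝟙 W) (assoc h₂ h₆ h₃ h₇ X Y Z).hom =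
      (assoc h₄ h₈ h₃ h₁₀ ((tensor h₁).obj W X) Y Z).hom ≫
        (assoc h₁ h₁₀ h₇ h₉ W X ((tensor h₃).obj Y Z)).hom
  triangle {a b c : G} (h₁ : a * 1 = a) (h₂ : a * b = c) (h₃ : 1 * b = b)
    (X : ps.at_ a) (Y : ps.at_ b) :
    (assoc h₁ h₂ h₃ h₂ X unit Y).hom ≫ (tensor h₂).map (𝟙 X) (left h₃ Y).hom =
      (tensor h₂).map (right h₁ X).hom (𝟙 Y)

namespace Monoidale

variable {G : Type u} [Group G] {k : Type w} [CommRing k]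

/-- A morphism of monoidales: a 1-cell `F` of `Ps(G^aut, V-Cat)` with coherent invertible
2-cells `F X ⊗ F Y ≅ F (X ⊗ Y)` and `I ≅ F I`. -/
structure Hom (M N : Monoidale.{w, v, u} G k) where
  F : M.ps ⟶ N.ps
  tensorIso {a b c : G} (h : a * b = c) (X : M.ps.at_ a) (Y : M.ps.at_ b) :
    (N.tensor h).obj ((Ps.app F a).obj X) ((Ps.app F b).obj Y) ≅
      (Ps.app F c).obj ((M.tensor h).obj X Y)
  tensorIso_natural {a b c : G} (h : a * b = c) {X X' : M.ps.at_ a} {Y Y' : M.ps.at_ b}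
    (x : X ⟶ X') (y : Y ⟶ Y') :
    (N.tensor h).map ((Ps.app F a).map x) ((Ps.app F b).map y) ≫ (tensorIso h X' Y').hom =
      (tensorIso h X Y).hom ≫ (Ps.app F c).map ((M.tensor h).map x y)
  tensorIso_act (g : G) {a b c a' b' c' : G} (h : a * b = c) (h' : a' * b' = c')
    (ha : g * a = a' * g) (hb : g * b = b' * g) (hc : g * c = c' * g)
    (X : M.ps.at_ a) (Y : M.ps.at_ b) :
    (N.ps.act g hc).map (tensorIso h X Y).hom ≫
        (Ps.appAct F g hc ((M.tensor h).obj X Y)).hom ≫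
          (Ps.app F c').map (M.tensorAct g h h' ha hb hc X Y).hom =
      (N.tensorAct g h h' ha hb hc ((Ps.app F a).obj X) ((Ps.app F b).obj Y)).hom ≫
        (N.tensor h').map (Ps.appAct F g ha X).hom (Ps.appAct F g hb Y).hom ≫
          (tensorIso h' ((M.ps.act g ha).obj X) ((M.ps.act g hb).obj Y)).hom
  unitIso : N.unit ≅ (Ps.app F 1).obj M.unit
  unitIso_act (g : G) (h : g * 1 = 1 * g) :
    (N.ps.act g h).map unitIso.hom ≫ (Ps.appAct F g h M.unit).hom ≫
        (Ps.app F 1).map (M.unitAct g h).hom =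
      (N.unitAct g h).hom ≫ unitIso.hom
  assoc {a b c ab bc abc : G} (h₁ : a * b = ab) (h₂ : ab * c = abc) (h₃ : b * c = bc)
    (h₄ : a * bc = abc) (X : M.ps.at_ a) (Y : M.ps.at_ b) (Z : M.ps.at_ c) :
    (N.tensor h₂).map (tensorIso h₁ X Y).hom (𝟙 _) ≫
        (tensorIso h₂ ((M.tensor h₁).obj X Y) Z).hom ≫
          (Ps.app F abc).map (M.assoc h₁ h₂ h₃ h₄ X Y Z).hom =
      (N.assoc h₁ h₂ h₃ h₄ ((Ps.app F a).obj X) ((Ps.app F b).obj Y) ((Ps.app F c).obj Z)).hom ≫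
        (N.tensor h₄).map (𝟙 _) (tensorIso h₃ Y Z).hom ≫
          (tensorIso h₄ X ((M.tensor h₃).obj Y Z)).hom
  left {a : G} (h : 1 * a = a) (X : M.ps.at_ a) :
    (N.left h ((Ps.app F a).obj X)).hom =
      (N.tensor h).map unitIso.hom (𝟙 _) ≫ (tensorIso h M.unit X).hom ≫
        (Ps.app F a).map (M.left h X).hom
  right {a : G} (h : a * 1 = a) (X : M.ps.at_ a) :
    (N.right h ((Ps.app F a).obj X)).hom =
      (N.tensor h).map (𝟙 _) unitIso.hom ≫ (tensorIso h X M.unit).hom ≫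
        (Ps.app F a).map (M.right h X).hom

/-- A 2-cell between morphisms of monoidales: a modification compatible with the constraints. -/
structure Hom₂ {M N : Monoidale.{w, v, u} G k} (F F' : Hom M N) where
  t : F.F ⟶ F'.F
  tensor {a b c : G} (h : a * b = c) (X : M.ps.at_ a) (Y : M.ps.at_ b) :
    (F.tensorIso h X Y).hom ≫ Ps.app₂ t ((M.tensor h).obj X Y) =
      (N.tensor h).map (Ps.app₂ t X) (Ps.app₂ t Y) ≫ (F'.tensorIso h X Y).hom
  unit : F.unitIso.hom ≫ Ps.app₂ t M.unit = F'.unitIso.hom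

theorem _root_.GCrossed.LinCat.Bilin.comp_left {A B C : LinCat.{w, v, u} k}
    (T : LinCat.Bilin A B C) {X X' X'' : A} (f : X ⟶ X') (f' : X' ⟶ X'') (Y : B) :
    T.map (f ≫ f') (𝟙 Y) = T.map f (𝟙 Y) ≫ T.map f' (𝟙 Y) := by
  rw [← T.map_comp, Category.comp_id]

theorem _root_.GCrossed.LinCat.Bilin.comp_right {A B C : LinCat.{w, v, u} k}
    (T : LinCat.Bilin A B C) (X : A) {Y Y' Y'' : B} (f : Y ⟶ Y') (f' : Y' ⟶ Y'') :
    T.map (𝟙 X) (f ≫ f') = T.map (𝟙 X) f ≫ T.map (𝟙 X) f' := by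
  rw [← T.map_comp, Category.comp_id]

namespace Hom

theorem natural_left {M N : Monoidale.{w, v, u} G k} (F : Hom M N) {a b c : G} (h : a * b = c)
    {X X' : M.ps.at_ a} (x : X ⟶ X') (Y : M.ps.at_ b) :
    (N.tensor h).map ((Ps.app F.F a).map x) (𝟙 ((Ps.app F.F b).obj Y)) ≫
      (F.tensorIso h X' Y).hom =
      (F.tensorIso h X Y).hom ≫ (Ps.app F.F c).map ((M.tensor h).map x (𝟙 Y)) := by
  rw [← F.tensorIso_natural, CategoryTheory.Functor.map_id]

theorem natural_right {M N : Monoidale.{w, v, u} G k} (F : Hom M N) {a b c : G} (h : a * b = c)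
    (X : M.ps.at_ a) {Y Y' : M.ps.at_ b} (y : Y ⟶ Y') :
    (N.tensor h).map (𝟙 ((Ps.app F.F a).obj X)) ((Ps.app F.F b).map y) ≫
      (F.tensorIso h X Y').hom =
      (F.tensorIso h X Y).hom ≫ (Ps.app F.F c).map ((M.tensor h).map (𝟙 X) y) := by
  rw [← F.tensorIso_natural, CategoryTheory.Functor.map_id]

/-- The identity morphism of a monoidale. -/
def id (M : Monoidale.{w, v, u} G k) : Hom M M where
  F := 𝟙 M.ps
  tensorIso h X Y := Iso.refl _
  tensorIso_natural h _ _ _ _ x y := (Category.comp_id _).trans (Category.id_comp _).symm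
  tensorIso_act g _ _ _ _ _ _ h h' ha hb hc X Y := by
    rw [Ps.appAct_id, Ps.appAct_id, Ps.appAct_id]
    change (M.ps.act g hc).map (𝟙 _) ≫ 𝟙 _ ≫ (M.tensorAct g h h' ha hb hc X Y).hom =
      (M.tensorAct g h h' ha hb hc X Y).hom ≫ (M.tensor h').map (𝟙 _) (𝟙 _) ≫ 𝟙 _
    rw [(M.tensor h').map_id, CategoryTheory.Functor.map_id]
    simp only [Category.id_comp, Category.comp_id]
  unitIso := Iso.refl _
  unitIso_act g h := by
    rw [Ps.appAct_id]
    change (M.ps.act g h).map (𝟙 _) ≫ 𝟙 _ ≫ (M.unitAct g h).hom = (M.unitAct g h).hom ≫ 𝟙 _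
    rw [CategoryTheory.Functor.map_id]
    simp only [Category.id_comp, Category.comp_id]
  assoc h₁ h₂ h₃ h₄ X Y Z := by
    change (M.tensor h₂).map (𝟙 _) (𝟙 _) ≫ 𝟙 _ ≫ (M.assoc h₁ h₂ h₃ h₄ X Y Z).hom =
      (M.assoc h₁ h₂ h₃ h₄ X Y Z).hom ≫ (M.tensor h₄).map (𝟙 _) (𝟙 _) ≫ 𝟙 _
    rw [(M.tensor h₂).map_id, (M.tensor h₄).map_id]
    simp only [Category.id_comp, Category.comp_id]
  left h X := by
    change _ = (M.tensor h).map (𝟙 _) (𝟙 _) ≫ 𝟙 _ ≫ (M.left h X).hom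
    rw [(M.tensor h).map_id]
    simp only [Category.id_comp]
    rfl
  right h X := by
    change _ = (M.tensor h).map (𝟙 _) (𝟙 _) ≫ 𝟙 _ ≫ (M.right h X).hom
    rw [(M.tensor h).map_id]
    simp only [Category.id_comp]
    rfl

/-- The composite of morphisms of monoidales. -/
def comp {L M N : Monoidale.{w, v, u} G k} (F : Hom L M) (F' : Hom M N) : Hom L N where
  F := F.F ≫ F'.F
  tensorIso {a b c} h X Y := F'.tensorIso h ((Ps.app F.F a).obj X) ((Ps.app F.F b).obj Y) ≪≫
    (Ps.app F'.F c).mapIso (F.tensorIso h X Y)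
  tensorIso_natural {a b c} h X X' Y Y' x y := by
    change (N.tensor h).map ((Ps.app F'.F a).map ((Ps.app F.F a).map x))
      ((Ps.app F'.F b).map ((Ps.app F.F b).map y)) ≫ (F'.tensorIso h _ _).hom ≫
        (Ps.app F'.F c).map (F.tensorIso h X' Y').hom =
      ((F'.tensorIso h _ _).hom ≫ (Ps.app F'.F c).map (F.tensorIso h X Y).hom) ≫
        (Ps.app F'.F c).map ((Ps.app F.F c).map ((L.tensor h).map x y))
    rw [← Category.assoc, F'.tensorIso_natural, Category.assoc, Category.assoc,
      ← Functor.map_comp, ← Functor.map_comp, F.tensorIso_natural]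
  tensorIso_act g {a b c a' b' c'} h h' ha hb hc X Y := by
    rw [Ps.appAct_comp, Ps.appAct_comp, Ps.appAct_comp]
    change (N.ps.act g hc).map ((F'.tensorIso h ((Ps.app F.F a).obj X)
          ((Ps.app F.F b).obj Y)).hom ≫ (Ps.app F'.F c).map (F.tensorIso h X Y).hom) ≫
        ((Ps.appAct F'.F g hc ((Ps.app F.F c).obj ((L.tensor h).obj X Y))).hom ≫
          (Ps.app F'.F c').map (Ps.appAct F.F g hc ((L.tensor h).obj X Y)).hom) ≫
        (Ps.app F'.F c').map ((Ps.app F.F c').map (L.tensorAct g h h' ha hb hc X Y).hom) =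
      (N.tensorAct g h h' ha hb hc ((Ps.app F'.F a).obj ((Ps.app F.F a).obj X))
          ((Ps.app F'.F b).obj ((Ps.app F.F b).obj Y))).hom ≫
        (N.tensor h').map ((Ps.appAct F'.F g ha ((Ps.app F.F a).obj X)).hom ≫
            (Ps.app F'.F a').map (Ps.appAct F.F g ha X).hom)
          ((Ps.appAct F'.F g hb ((Ps.app F.F b).obj Y)).hom ≫
            (Ps.app F'.F b').map (Ps.appAct F.F g hb Y).hom) ≫
        (F'.tensorIso h' ((Ps.app F.F a').obj ((L.ps.act g ha).obj X))
          ((Ps.app F.F b').obj ((L.ps.act g hb).obj Y))).hom ≫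
          (Ps.app F'.F c').map (F.tensorIso h' ((L.ps.act g ha).obj X)
            ((L.ps.act g hb).obj Y)).hom
    have e := F'.tensorIso_act g h h' ha hb hc ((Ps.app F.F a).obj X) ((Ps.app F.F b).obj Y)
    have e' := congrArg (Ps.app F'.F c').map (F.tensorIso_act g h h' ha hb hc X Y)
    simp only [Functor.map_comp] at e'
    rw [LinCat.Bilin.map_comp]
    simp only [Category.assoc]
    rw [← Category.assoc ((N.tensor h').map ((Ps.app F'.F a').map _) _), F'.tensorIso_natural,
      Category.assoc, ← reassoc_of% e, ← e', Functor.map_comp, Category.assoc,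
      ← reassoc_of% Ps.appAct_natural F'.F g hc (F.tensorIso h X Y).hom]
  unitIso := F'.unitIso ≪≫ (Ps.app F'.F 1).mapIso F.unitIso
  unitIso_act g h := by
    rw [Ps.appAct_comp]
    change (N.ps.act g h).map (F'.unitIso.hom ≫ (Ps.app F'.F 1).map F.unitIso.hom) ≫
        ((Ps.appAct F'.F g h ((Ps.app F.F 1).obj L.unit)).hom ≫
          (Ps.app F'.F 1).map (Ps.appAct F.F g h L.unit).hom) ≫
        (Ps.app F'.F 1).map ((Ps.app F.F 1).map (L.unitAct g h).hom) =
      (N.unitAct g h).hom ≫ F'.unitIso.hom ≫ (Ps.app F'.F 1).map F.unitIso.hom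
    have e := F'.unitIso_act g h
    have e' := congrArg (Ps.app F'.F 1).map (F.unitIso_act g h)
    simp only [Functor.map_comp] at e'
    simp only [Category.assoc]
    rw [← reassoc_of% e, ← e', Functor.map_comp, Category.assoc,
      ← reassoc_of% Ps.appAct_natural F'.F g h F.unitIso.hom]
  assoc {a b c ab bc abc} h₁ h₂ h₃ h₄ X Y Z := by
    change (N.tensor h₂).map ((F'.tensorIso h₁ ((Ps.app F.F a).obj X)
          ((Ps.app F.F b).obj Y)).hom ≫ (Ps.app F'.F ab).map (F.tensorIso h₁ X Y).hom)
          (𝟙 ((Ps.app F'.F c).obj ((Ps.app F.F c).obj Z))) ≫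
        ((F'.tensorIso h₂ ((Ps.app F.F ab).obj ((L.tensor h₁).obj X Y))
          ((Ps.app F.F c).obj Z)).hom ≫
          (Ps.app F'.F abc).map (F.tensorIso h₂ ((L.tensor h₁).obj X Y) Z).hom) ≫
        (Ps.app F'.F abc).map ((Ps.app F.F abc).map (L.assoc h₁ h₂ h₃ h₄ X Y Z).hom) =
      (N.assoc h₁ h₂ h₃ h₄ ((Ps.app F'.F a).obj ((Ps.app F.F a).obj X))
          ((Ps.app F'.F b).obj ((Ps.app F.F b).obj Y))
          ((Ps.app F'.F c).obj ((Ps.app F.F c).obj Z))).hom ≫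
        (N.tensor h₄).map (𝟙 ((Ps.app F'.F a).obj ((Ps.app F.F a).obj X)))
          ((F'.tensorIso h₃ ((Ps.app F.F b).obj Y) ((Ps.app F.F c).obj Z)).hom ≫
            (Ps.app F'.F bc).map (F.tensorIso h₃ Y Z).hom) ≫
        (F'.tensorIso h₄ ((Ps.app F.F a).obj X) ((Ps.app F.F bc).obj ((L.tensor h₃).obj Y Z))).hom ≫
          (Ps.app F'.F abc).map (F.tensorIso h₄ X ((L.tensor h₃).obj Y Z)).hom
    have e := F'.assoc h₁ h₂ h₃ h₄ ((Ps.app F.F a).obj X) ((Ps.app F.F b).obj Y)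
      ((Ps.app F.F c).obj Z)
    have e' := congrArg (Ps.app F'.F abc).map (F.assoc h₁ h₂ h₃ h₄ X Y Z)
    simp only [Functor.map_comp] at e'
    rw [LinCat.Bilin.comp_left, LinCat.Bilin.comp_right]
    simp only [Category.assoc]
    rw [reassoc_of% F'.natural_left h₂ (F.tensorIso h₁ X Y).hom ((Ps.app F.F c).obj Z),
      reassoc_of% F'.natural_right h₄ ((Ps.app F.F a).obj X) (F.tensorIso h₃ Y Z).hom,
      ← reassoc_of% e, ← e']
  left {a} h X := by
    change (N.left h ((Ps.app F'.F a).obj ((Ps.app F.F a).obj X))).hom =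
      (N.tensor h).map (F'.unitIso.hom ≫ (Ps.app F'.F 1).map F.unitIso.hom)
          (𝟙 ((Ps.app F'.F a).obj ((Ps.app F.F a).obj X))) ≫
        ((F'.tensorIso h ((Ps.app F.F 1).obj L.unit) ((Ps.app F.F a).obj X)).hom ≫
          (Ps.app F'.F a).map (F.tensorIso h L.unit X).hom) ≫
        (Ps.app F'.F a).map ((Ps.app F.F a).map (L.left h X).hom)
    rw [F'.left, F.left, LinCat.Bilin.comp_left]
    simp only [Category.assoc, Functor.map_comp]
    rw [reassoc_of% F'.natural_left h F.unitIso.hom ((Ps.app F.F a).obj X)]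
  right {a} h X := by
    change (N.right h ((Ps.app F'.F a).obj ((Ps.app F.F a).obj X))).hom =
      (N.tensor h).map (𝟙 ((Ps.app F'.F a).obj ((Ps.app F.F a).obj X)))
          (F'.unitIso.hom ≫ (Ps.app F'.F 1).map F.unitIso.hom) ≫
        ((F'.tensorIso h ((Ps.app F.F a).obj X) ((Ps.app F.F 1).obj L.unit)).hom ≫
          (Ps.app F'.F a).map (F.tensorIso h X L.unit).hom) ≫
        (Ps.app F'.F a).map ((Ps.app F.F a).map (L.right h X).hom)
    rw [F'.right, F.right, LinCat.Bilin.comp_right]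
    simp only [Category.assoc, Functor.map_comp]
    rw [reassoc_of% F'.natural_right h ((Ps.app F.F a).obj X) F.unitIso.hom]

end Hom

instance : CategoryStruct (Monoidale.{w, v, u} G k) where
  Hom := Hom
  id := Hom.id
  comp := Hom.comp

theorem hom₂_ext {M N : Monoidale.{w, v, u} G k} {F F' : Hom M N} {s t : Hom₂ F F'}
    (h : s.t = t.t) : s = t := by
  cases s; cases t; cases h; rfl

instance homCategory (M N : Monoidale.{w, v, u} G k) : Category (M ⟶ N) where
  Hom := Hom₂
  id F :=
    { t := 𝟙 F.F
      tensor h X Y := by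
        change _ ≫ 𝟙 _ = (N.tensor h).map (𝟙 _) (𝟙 _) ≫ _
        rw [(N.tensor h).map_id, Category.comp_id, Category.id_comp]
      unit := Category.comp_id _ }
  comp {F F' F''} s s' :=
    { t := s.t ≫ s'.t
      tensor h X Y := by
        change (F.tensorIso h X Y).hom ≫ Ps.app₂ s.t _ ≫ Ps.app₂ s'.t _ =
          (N.tensor h).map (Ps.app₂ s.t X ≫ Ps.app₂ s'.t X) (Ps.app₂ s.t Y ≫ Ps.app₂ s'.t Y) ≫ _
        rw [(N.tensor h).map_comp, reassoc_of% s.tensor, s'.tensor, Category.assoc]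
      unit := by
        change F.unitIso.hom ≫ Ps.app₂ s.t _ ≫ Ps.app₂ s'.t _ = _
        rw [reassoc_of% s.unit, s'.unit] }
  id_comp s := hom₂_ext (Category.id_comp s.t)
  comp_id s := hom₂_ext (Category.comp_id s.t)
  assoc s s' s'' := hom₂_ext (Category.assoc s.t s'.t s''.t)

/-- An invertible 2-cell from an invertible modification compatible with the constraints. -/
def isoMk {M N : Monoidale.{w, v, u} G k} {F F' : M ⟶ N} (e : Hom.F F ≅ Hom.F F')
    (tensor : ∀ {a b c : G} (h : a * b = c) (X : M.ps.at_ a) (Y : M.ps.at_ b),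
      (Hom.tensorIso F h X Y).hom ≫ Ps.app₂ e.hom ((M.tensor h).obj X Y) =
        (N.tensor h).map (Ps.app₂ e.hom X) (Ps.app₂ e.hom Y) ≫ (Hom.tensorIso F' h X Y).hom)
    (unit : (Hom.unitIso F).hom ≫ Ps.app₂ e.hom M.unit = (Hom.unitIso F').hom) : F ≅ F' where
  hom := { t := e.hom, tensor := tensor, unit := unit }
  inv :=
    { t := e.inv
      tensor {a b c} h X Y := by
        have he : ∀ {d : G} (Z : M.ps.at_ d), Ps.app₂ e.hom Z ≫ Ps.app₂ e.inv Z = 𝟙 _ :=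
          fun {d} Z => congrArg (fun r => Ps.app₂ r Z) e.hom_inv_id
        have he' : ∀ {d : G} (Z : M.ps.at_ d), Ps.app₂ e.inv Z ≫ Ps.app₂ e.hom Z = 𝟙 _ :=
          fun {d} Z => congrArg (fun r => Ps.app₂ r Z) e.inv_hom_id
        have e₁ : (N.tensor h).map (Ps.app₂ e.inv X) (Ps.app₂ e.inv Y) ≫
            (N.tensor h).map (Ps.app₂ e.hom X) (Ps.app₂ e.hom Y) = 𝟙 _ := by
          rw [← (N.tensor h).map_comp, he', he', (N.tensor h).map_id]
        have e₂ := (N.tensor h).map (Ps.app₂ e.inv X) (Ps.app₂ e.inv Y) ≫=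
          tensor h X Y =≫ Ps.app₂ e.inv _
        simp only [Category.assoc] at e₂
        rw [he, Category.comp_id, reassoc_of% e₁] at e₂
        exact e₂.symm
      unit := by
        have he : Ps.app₂ e.hom M.unit ≫ Ps.app₂ e.inv M.unit = 𝟙 _ :=
          congrArg (fun r => Ps.app₂ r M.unit) e.hom_inv_id
        have e₂ := unit =≫ Ps.app₂ e.inv _
        rw [Category.assoc, he, Category.comp_id] at e₂
        exact e₂.symm }
  hom_inv_id := hom₂_ext e.hom_inv_id
  inv_hom_id := hom₂_ext e.inv_hom_id

/-- The bicategory of monoidales in `Ps(G^aut, V-Cat)`. -/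
instance bicategory : Bicategory (Monoidale.{w, v, u} G k) where
  homCategory := homCategory
  whiskerLeft {L M N} F {F' F''} s :=
    { t := Hom.F F ◁ s.t
      tensor {a b c} h X Y := by
        change ((Hom.tensorIso F' h ((Ps.app (Hom.F F) a).obj X)
            ((Ps.app (Hom.F F) b).obj Y)).hom ≫
              (Ps.app (Hom.F F') c).map (Hom.tensorIso F h X Y).hom) ≫
            Ps.app₂ s.t ((Ps.app (Hom.F F) c).obj ((L.tensor h).obj X Y)) =
          (N.tensor h).map (Ps.app₂ s.t ((Ps.app (Hom.F F) a).obj X))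
              (Ps.app₂ s.t ((Ps.app (Hom.F F) b).obj Y)) ≫
            (Hom.tensorIso F'' h ((Ps.app (Hom.F F) a).obj X)
              ((Ps.app (Hom.F F) b).obj Y)).hom ≫
              (Ps.app (Hom.F F'') c).map (Hom.tensorIso F h X Y).hom
        rw [Category.assoc, NatTrans.naturality, reassoc_of% s.tensor]
      unit := by
        change ((Hom.unitIso F').hom ≫ (Ps.app (Hom.F F') 1).map (Hom.unitIso F).hom) ≫
          Ps.app₂ s.t ((Ps.app (Hom.F F) 1).obj L.unit) =
          (Hom.unitIso F'').hom ≫ (Ps.app (Hom.F F'') 1).map (Hom.unitIso F).hom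
        rw [Category.assoc, NatTrans.naturality, reassoc_of% s.unit] }
  whiskerRight {L M N} F F' s F'' :=
    { t := s.t ▷ Hom.F F''
      tensor {a b c} h X Y := by
        change ((Hom.tensorIso F'' h ((Ps.app (Hom.F F) a).obj X)
            ((Ps.app (Hom.F F) b).obj Y)).hom ≫
              (Ps.app (Hom.F F'') c).map (Hom.tensorIso F h X Y).hom) ≫
            (Ps.app (Hom.F F'') c).map (Ps.app₂ s.t ((L.tensor h).obj X Y)) =
          (N.tensor h).map ((Ps.app (Hom.F F'') a).map (Ps.app₂ s.t X))
              ((Ps.app (Hom.F F'') b).map (Ps.app₂ s.t Y)) ≫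
            (Hom.tensorIso F'' h ((Ps.app (Hom.F F') a).obj X)
              ((Ps.app (Hom.F F') b).obj Y)).hom ≫
              (Ps.app (Hom.F F'') c).map (Hom.tensorIso F' h X Y).hom
        rw [← Category.assoc ((N.tensor h).map _ _), Hom.tensorIso_natural, Category.assoc,
          Category.assoc, ← Functor.map_comp, ← Functor.map_comp, s.tensor]
      unit := by
        change ((Hom.unitIso F'').hom ≫ (Ps.app (Hom.F F'') 1).map (Hom.unitIso F).hom) ≫
          (Ps.app (Hom.F F'') 1).map (Ps.app₂ s.t L.unit) =
          (Hom.unitIso F'').hom ≫ (Ps.app (Hom.F F'') 1).map (Hom.unitIso F').hom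
        rw [Category.assoc, ← Functor.map_comp, s.unit] }
  associator {K L M N} F F' F'' := isoMk (α_ (Hom.F F) (Hom.F F') (Hom.F F''))
    (fun {a b c} h X Y => by
      change ((Hom.tensorIso F'' h _ _).hom ≫ (Ps.app (Hom.F F'') c).map
          ((Hom.tensorIso F' h ((Ps.app (Hom.F F) a).obj X) ((Ps.app (Hom.F F) b).obj Y)).hom ≫
            (Ps.app (Hom.F F') c).map (Hom.tensorIso F h X Y).hom)) ≫ 𝟙 _ =
        (N.tensor h).map (𝟙 _) (𝟙 _) ≫ ((Hom.tensorIso F'' h _ _).hom ≫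
          (Ps.app (Hom.F F'') c).map (Hom.tensorIso F' h _ _).hom) ≫
            (Ps.app (Hom.F F'') c).map ((Ps.app (Hom.F F') c).map (Hom.tensorIso F h X Y).hom)
      rw [(N.tensor h).map_id, Functor.map_comp]
      simp only [Category.comp_id, Category.id_comp, Category.assoc])
    (by
      change ((Hom.unitIso F'').hom ≫ (Ps.app (Hom.F F'') 1).map
          ((Hom.unitIso F').hom ≫ (Ps.app (Hom.F F') 1).map (Hom.unitIso F).hom)) ≫ 𝟙 _ =
        ((Hom.unitIso F'').hom ≫ (Ps.app (Hom.F F'') 1).map (Hom.unitIso F').hom) ≫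
            (Ps.app (Hom.F F'') 1).map ((Ps.app (Hom.F F') 1).map (Hom.unitIso F).hom)
      rw [Functor.map_comp]
      simp only [Category.comp_id, Category.assoc])
  leftUnitor {M N} F := isoMk (λ_ (Hom.F F))
    (fun {a b c} h X Y => by
      change ((Hom.tensorIso F h X Y).hom ≫ (Ps.app (Hom.F F) c).map (𝟙 _)) ≫ 𝟙 _ =
        (N.tensor h).map (𝟙 _) (𝟙 _) ≫ (Hom.tensorIso F h X Y).hom
      rw [(N.tensor h).map_id, CategoryTheory.Functor.map_id]
      simp only [Category.comp_id, Category.id_comp])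
    (by
      change ((Hom.unitIso F).hom ≫ (Ps.app (Hom.F F) 1).map (𝟙 _)) ≫ 𝟙 _ = (Hom.unitIso F).hom
      rw [CategoryTheory.Functor.map_id, Category.comp_id, Category.comp_id])
  rightUnitor {M N} F := isoMk (ρ_ (Hom.F F))
    (fun {a b c} h X Y => by
      change (𝟙 _ ≫ (Hom.tensorIso F h X Y).hom) ≫ 𝟙 _ =
        (N.tensor h).map (𝟙 _) (𝟙 _) ≫ (Hom.tensorIso F h X Y).hom
      rw [(N.tensor h).map_id]
      simp only [Category.comp_id, Category.id_comp])
    (by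
      change (𝟙 _ ≫ (Hom.unitIso F).hom) ≫ 𝟙 _ = (Hom.unitIso F).hom
      rw [Category.id_comp, Category.comp_id])
  whiskerLeft_id F F' := hom₂_ext (Bicategory.whiskerLeft_id (Hom.F F) (Hom.F F'))
  whiskerLeft_comp F _ _ _ s t := hom₂_ext (Bicategory.whiskerLeft_comp (Hom.F F) s.t t.t)
  id_whiskerLeft s := hom₂_ext (Bicategory.id_whiskerLeft s.t)
  comp_whiskerLeft F F' _ _ s := hom₂_ext (Bicategory.comp_whiskerLeft (Hom.F F) (Hom.F F') s.t)
  id_whiskerRight F F' := hom₂_ext (Bicategory.id_whiskerRight (Hom.F F) (Hom.F F'))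
  comp_whiskerRight s t F := hom₂_ext (Bicategory.comp_whiskerRight s.t t.t (Hom.F F))
  whiskerRight_id s := hom₂_ext (Bicategory.whiskerRight_id s.t)
  whiskerRight_comp s F F' := hom₂_ext (Bicategory.whiskerRight_comp s.t (Hom.F F) (Hom.F F'))
  whisker_assoc F _ _ s F' := hom₂_ext (Bicategory.whisker_assoc (Hom.F F) s.t (Hom.F F'))
  whisker_exchange s t := hom₂_ext (Bicategory.whisker_exchange s.t t.t)
  pentagon F F' F'' F''' := hom₂_ext
    (Bicategory.pentagon (Hom.F F) (Hom.F F') (Hom.F F'') (Hom.F F'''))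
  triangle F F' := hom₂_ext (Bicategory.triangle (Hom.F F) (Hom.F F'))

end Monoidale

end Bicat

/-- A `G`-crossed category over `k`: a `G`-graded category over `k` together with a crossing. -/
structure CrossedCat (G : Type u) [Group G] (k : Type w) [CommRing k] where
  carrier : Type u
  [category : Category.{v} carrier]
  [preadditive : Preadditive carrier]
  [linear : Linear k carrier]
  [monoidal : MonoidalCategory carrier]
  [monoidalPreadditive : MonoidalPreadditive carrier]
  [monoidalLinear : MonoidalLinear k carrier]
  [hasFiniteBiproducts : HasFiniteBiproducts carrier]
  /-- the objects of the full subcategory of degree `a` -/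
  deg : G → ObjectProperty carrier
  deg_disjoint {a b : G} {X : carrier} : deg a X → deg b X → a = b
  deg_hasFiniteBiproducts (a : G) : HasFiniteBiproducts (deg a).FullSubcategory
  exists_decomposition (X : carrier) : ∃ (s : Finset G) (Y : s → carrier),
    (∀ a : s, deg a (Y a)) ∧ Nonempty (X ≅ ⨁ Y)
  deg_tensor {a b : G} {X Y : carrier} : deg a X → deg b Y → deg (a * b) (X ⊗ Y)
  hom_eq_zero {a b : G} {X Y : carrier} : a ≠ b → deg a X → deg b Y → ∀ f : X ⟶ Y, f = 0
  deg_unit : deg 1 (𝟙_ carrier)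
  /-- the `k`-linear monoidal auto-equivalences `φ_a` -/
  φ : G → carrier ⥤ carrier
  [φ_monoidal (a : G) : (φ a).Monoidal]
  [φ_additive (a : G) : (φ a).Additive]
  [φ_linear (a : G) : (φ a).Linear k]
  [φ_isEquivalence (a : G) : (φ a).IsEquivalence]
  /-- the monoidal isomorphism `φ_a ∘ φ_b ≅ φ_{b * a}`; the tensor product of `a` and `b` in the
  discrete monoidal category on which `φ` is strong monoidal is `b * a` -/
  φComp {a b c : G} (h : b * a = c) : φ b ⋙ φ a ≅ φ c
  [φComp_isMonoidal {a b c : G} (h : b * a = c) : NatTrans.IsMonoidal (φComp h).hom]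
  /-- the monoidal isomorphism `𝟭 ≅ φ_1` -/
  φId : 𝟭 carrier ≅ φ 1
  [φId_isMonoidal : NatTrans.IsMonoidal φId.hom]
  φComp_assoc {a b c ab bc abc : G} (h₁ : b * a = ab) (h₂ : c * b = bc) (h₃ : c * ab = abc)
    (h₄ : bc * a = abc) (X : carrier) :
    (φ a).map ((φComp h₂).hom.app X) ≫ (φComp h₄).hom.app X =
      (φComp h₁).hom.app ((φ c).obj X) ≫ (φComp h₃).hom.app X
  φ_map_φId {a : G} (h : 1 * a = a) (X : carrier) :
    (φ a).map (φId.hom.app X) ≫ (φComp h).hom.app X = 𝟙 ((φ a).obj X)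
  φId_φ {a : G} (h : a * 1 = a) (X : carrier) :
    φId.hom.app ((φ a).obj X) ≫ (φComp h).hom.app X = 𝟙 ((φ a).obj X)
  deg_φ (a : G) {b : G} {X : carrier} : deg b X → deg (a⁻¹ * b * a) ((φ a).obj X)

namespace CrossedCat

variable {G : Type u} [Group G] {k : Type w} [CommRing k]

instance : CoeSort (CrossedCat.{w, v, u} G k) (Type u) := ⟨carrier⟩

attribute [instance] category preadditive linear monoidal monoidalPreadditive monoidalLinear
  hasFiniteBiproducts deg_hasFiniteBiproducts φ_monoidal φ_additive φ_linear φ_isEquivalence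
  φComp_isMonoidal φId_isMonoidal

/-- A morphism of `G`-crossed categories: a `k`-linear strong monoidal functor which preserves
degrees and commutes with the crossings up to coherent monoidal isomorphism. -/
structure Hom (C D : CrossedCat.{w, v, u} G k) where
  F : C ⥤ D
  [monoidal : F.Monoidal]
  [additive : F.Additive]
  [linear : F.Linear k]
  deg {a : G} {X : C} : C.deg a X → D.deg a (F.obj X)
  φIso (a : G) : C.φ a ⋙ F ≅ F ⋙ D.φ a
  [φIso_isMonoidal (a : G) : NatTrans.IsMonoidal (φIso a).hom]
  φIso_comp {a b c : G} (h : b * a = c) (X : C) :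
    F.map ((C.φComp h).hom.app X) ≫ (φIso c).hom.app X =
      (φIso a).hom.app ((C.φ b).obj X) ≫ (D.φ a).map ((φIso b).hom.app X) ≫
        (D.φComp h).hom.app (F.obj X)
  φIso_id (X : C) :
    F.map (C.φId.hom.app X) ≫ (φIso 1).hom.app X = D.φId.hom.app (F.obj X)

attribute [instance] Hom.monoidal Hom.additive Hom.linear Hom.φIso_isMonoidal

/-- A 2-cell between morphisms of `G`-crossed categories: a monoidal natural transformation which is
compatible with the crossings. -/
structure Hom₂ {C D : CrossedCat.{w, v, u} G k} (F F' : Hom C D) where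
  t : F.F ⟶ F'.F
  [isMonoidal : NatTrans.IsMonoidal t]
  φ (a : G) (X : C) :
    t.app ((C.φ a).obj X) ≫ (F'.φIso a).hom.app X =
      (F.φIso a).hom.app X ≫ (D.φ a).map (t.app X)

attribute [instance] Hom₂.isMonoidal

instance isMonoidal_inv {C D : Type*} [Category C] [Category D] [MonoidalCategory C]
    [MonoidalCategory D] {F F' : C ⥤ D} [F.LaxMonoidal] [F'.LaxMonoidal] (e : F ≅ F')
    [NatTrans.IsMonoidal e.hom] : NatTrans.IsMonoidal e.inv where
  unit := by
    rw [← NatTrans.IsMonoidal.unit (τ := e.hom), Category.assoc, e.hom_inv_id_app,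
      Category.comp_id]
  tensor X Y := by
    have h := NatTrans.IsMonoidal.tensor (τ := e.hom) X Y
    rw [← cancel_mono (e.hom.app (X ⊗ Y)), Category.assoc, e.inv_hom_id_app, Category.comp_id,
      Category.assoc, h, ← Category.assoc, tensorHom_comp_tensorHom, e.inv_hom_id_app,
      e.inv_hom_id_app, id_tensorHom_id, Category.id_comp]

namespace Hom

/-- The identity morphism. -/
def id (C : CrossedCat.{w, v, u} G k) : Hom C C where
  F := 𝟭 C
  deg h := h
  φIso a := (C.φ a).rightUnitor ≪≫ (C.φ a).leftUnitor.symm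
  φIso_isMonoidal a :=
    inferInstanceAs (NatTrans.IsMonoidal ((C.φ a).rightUnitor.hom ≫ (C.φ a).leftUnitor.inv))
  φIso_comp {a b c} h X := by
    change (C.φComp h).hom.app X ≫ 𝟙 _ ≫ 𝟙 _ =
      (𝟙 _ ≫ 𝟙 _) ≫ (C.φ a).map (𝟙 _ ≫ 𝟙 _) ≫ (C.φComp h).hom.app X
    simp only [Category.id_comp, Category.comp_id, CategoryTheory.Functor.map_id]
  φIso_id X := by
    change C.φId.hom.app X ≫ 𝟙 _ ≫ 𝟙 _ = C.φId.hom.app X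
    simp only [Category.comp_id]

/-- The composite of morphisms. -/
def comp {C D E : CrossedCat.{w, v, u} G k} (F : Hom C D) (F' : Hom D E) : Hom C E where
  F := F.F ⋙ F'.F
  deg h := F'.deg (F.deg h)
  φIso a := (Functor.associator _ _ _).symm ≪≫ Functor.isoWhiskerRight (F.φIso a) F'.F ≪≫
    Functor.associator _ _ _ ≪≫ Functor.isoWhiskerLeft F.F (F'.φIso a) ≪≫
      (Functor.associator _ _ _).symm
  φIso_isMonoidal a :=
    inferInstanceAs (NatTrans.IsMonoidal ((Functor.associator _ _ _).inv ≫
      Functor.whiskerRight (F.φIso a).hom F'.F ≫ (Functor.associator _ _ _).hom ≫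
        Functor.whiskerLeft F.F (F'.φIso a).hom ≫ (Functor.associator _ _ _).inv))
  φIso_comp {a b c} h X := by
    change F'.F.map (F.F.map ((C.φComp h).hom.app X)) ≫ 𝟙 _ ≫ F'.F.map ((F.φIso c).hom.app X) ≫
        𝟙 _ ≫ (F'.φIso c).hom.app (F.F.obj X) ≫ 𝟙 _ =
      (𝟙 _ ≫ F'.F.map ((F.φIso a).hom.app ((C.φ b).obj X)) ≫ 𝟙 _ ≫
        (F'.φIso a).hom.app (F.F.obj ((C.φ b).obj X)) ≫ 𝟙 _) ≫
      (E.φ a).map (𝟙 _ ≫ F'.F.map ((F.φIso b).hom.app X) ≫ 𝟙 _ ≫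
        (F'.φIso b).hom.app (F.F.obj X) ≫ 𝟙 _) ≫ (E.φComp h).hom.app (F'.F.obj (F.F.obj X))
    simp only [Category.id_comp, Category.comp_id, Category.assoc]
    rw [← Functor.map_comp_assoc, F.φIso_comp, Functor.map_comp, Functor.map_comp,
      Category.assoc, Category.assoc, F'.φIso_comp, Functor.map_comp, Category.assoc]
    have e := (F'.φIso a).hom.naturality ((F.φIso b).hom.app X)
    dsimp only [Functor.comp_map, Functor.comp_obj] at e
    erw [reassoc_of% e]
  φIso_id X := by
    change F'.F.map (F.F.map (C.φId.hom.app X)) ≫ 𝟙 _ ≫ F'.F.map ((F.φIso 1).hom.app X) ≫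
        𝟙 _ ≫ (F'.φIso 1).hom.app (F.F.obj X) ≫ 𝟙 _ = E.φId.hom.app (F'.F.obj (F.F.obj X))
    simp only [Category.id_comp, Category.comp_id]
    rw [← Functor.map_comp_assoc, F.φIso_id, F'.φIso_id]

theorem comp_φIso_app {C D E : CrossedCat.{w, v, u} G k} (F : Hom C D) (F' : Hom D E) (a : G)
    (X : C) : ((comp F F').φIso a).hom.app X =
      F'.F.map ((F.φIso a).hom.app X) ≫ (F'.φIso a).hom.app (F.F.obj X) := by
  change 𝟙 _ ≫ F'.F.map ((F.φIso a).hom.app X) ≫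
        𝟙 _ ≫ (F'.φIso a).hom.app (F.F.obj X) ≫ 𝟙 _ = _
  simp only [Category.id_comp, Category.comp_id]

theorem id_φIso_app (C : CrossedCat.{w, v, u} G k) (a : G) (X : C) :
    ((id C).φIso a).hom.app X = 𝟙 ((C.φ a).obj X) := by
  exact Category.comp_id (𝟙 ((C.φ a).obj X))

end Hom

instance : CategoryStruct (CrossedCat.{w, v, u} G k) where
  Hom := Hom
  id := Hom.id
  comp := Hom.comp

theorem hom₂_ext {C D : CrossedCat.{w, v, u} G k} {F F' : Hom C D} {s t : Hom₂ F F'}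
    (h : ∀ X, s.t.app X = t.t.app X) : s = t := by
  have h' : s.t = t.t := NatTrans.ext (funext h)
  cases s; cases t; cases h'; rfl

instance homCategory (C D : CrossedCat.{w, v, u} G k) : Category (C ⟶ D) where
  Hom := Hom₂
  id F :=
    { t := 𝟙 F.F
      φ a X := by
        rw [NatTrans.id_app, NatTrans.id_app, CategoryTheory.Functor.map_id]
        exact (Category.id_comp _).trans (Category.comp_id _).symm }
  comp s s' :=
    { t := s.t ≫ s'.t
      φ a X := by
        rw [NatTrans.comp_app, NatTrans.comp_app, Functor.map_comp, Category.assoc, s'.φ,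
          ← Category.assoc, s.φ, Category.assoc] }
  id_comp s := hom₂_ext fun X => Category.id_comp (s.t.app X)
  comp_id s := hom₂_ext fun X => Category.comp_id (s.t.app X)
  assoc s s' s'' := hom₂_ext fun X => Category.assoc (s.t.app X) (s'.t.app X) (s''.t.app X)

/-- An invertible 2-cell from a monoidal natural isomorphism compatible with the crossings. -/
def isoMk {C D : CrossedCat.{w, v, u} G k} {F F' : C ⟶ D} (e : Hom.F F ≅ Hom.F F')
    [NatTrans.IsMonoidal e.hom]
    (φ : ∀ (a : G) (X : C), e.hom.app ((C.φ a).obj X) ≫ (Hom.φIso F' a).hom.app X =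
      (Hom.φIso F a).hom.app X ≫ (D.φ a).map (e.hom.app X)) : F ≅ F' where
  hom := { t := e.hom, φ := φ }
  inv :=
    { t := e.inv
      φ a X := by
        rw [← cancel_epi (e.hom.app _), e.hom_inv_id_app_assoc, reassoc_of% φ a X,
          ← Functor.map_comp, e.hom_inv_id_app, CategoryTheory.Functor.map_id]
        exact (Category.comp_id _).symm }
  hom_inv_id := hom₂_ext fun X => e.hom_inv_id_app X
  inv_hom_id := hom₂_ext fun X => e.inv_hom_id_app X

/-- The bicategory of `G`-crossed categories. -/
instance bicategory : Bicategory (CrossedCat.{w, v, u} G k) where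
  homCategory := homCategory
  whiskerLeft {C D E} F {F' F''} s :=
    { t := Functor.whiskerLeft (Hom.F F) s.t
      isMonoidal := inferInstanceAs (NatTrans.IsMonoidal (Functor.whiskerLeft (Hom.F F) s.t))
      φ a X := by
        have key : s.t.app ((Hom.F F).obj ((C.φ a).obj X)) ≫
            (Hom.F F'').map ((Hom.φIso F a).hom.app X) ≫
              (Hom.φIso F'' a).hom.app ((Hom.F F).obj X) =
            ((Hom.F F').map ((Hom.φIso F a).hom.app X) ≫
              (Hom.φIso F' a).hom.app ((Hom.F F).obj X)) ≫
                (E.φ a).map (s.t.app ((Hom.F F).obj X)) := by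
          rw [Category.assoc, ← s.φ]
          exact (NatTrans.naturality_assoc s.t ((Hom.φIso F a).hom.app X) _).symm
        exact (congrArg (fun r => _ ≫ r) (Hom.comp_φIso_app F F'' a X)).trans (key.trans
          (congrArg (fun r => r ≫ _) (Hom.comp_φIso_app F F' a X).symm)) }
  whiskerRight {C D E} F F' s F'' :=
    { t := Functor.whiskerRight s.t (Hom.F F'')
      isMonoidal := inferInstanceAs (NatTrans.IsMonoidal (Functor.whiskerRight s.t (Hom.F F'')))
      φ a X := by
        have key : (Hom.F F'').map (s.t.app ((C.φ a).obj X)) ≫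
            (Hom.F F'').map ((Hom.φIso F' a).hom.app X) ≫
              (Hom.φIso F'' a).hom.app ((Hom.F F').obj X) =
            ((Hom.F F'').map ((Hom.φIso F a).hom.app X) ≫
              (Hom.φIso F'' a).hom.app ((Hom.F F).obj X)) ≫
                (E.φ a).map ((Hom.F F'').map (s.t.app X)) := by
          have e := congrArg (Hom.F F'').map (s.φ a X)
          rw [Functor.map_comp, Functor.map_comp] at e
          rw [← Category.assoc, e, Category.assoc, Category.assoc]
          congr 1
          exact (Hom.φIso F'' a).hom.naturality (s.t.app X)
        exact (congrArg (fun r => _ ≫ r) (Hom.comp_φIso_app F' F'' a X)).trans (key.trans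
          (congrArg (fun r => r ≫ _) (Hom.comp_φIso_app F F'' a X).symm)) }
  associator {B C D E} F F' F'' :=
    @isoMk _ _ _ _ _ _ _ _ (Functor.associator (Hom.F F) (Hom.F F') (Hom.F F''))
      (inferInstanceAs (NatTrans.IsMonoidal
        (Functor.associator (Hom.F F) (Hom.F F') (Hom.F F'')).hom)) fun a X => by
      have e₁ : ((Hom.comp F (Hom.comp F' F'')).φIso a).hom.app X =
          (Hom.F F'').map ((Hom.F F').map ((Hom.φIso F a).hom.app X)) ≫
            (Hom.F F'').map ((Hom.φIso F' a).hom.app ((Hom.F F).obj X)) ≫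
              (Hom.φIso F'' a).hom.app ((Hom.F F').obj ((Hom.F F).obj X)) :=
        (Hom.comp_φIso_app F (Hom.comp F' F'') a X).trans
          (congrArg (fun r => _ ≫ r) (Hom.comp_φIso_app F' F'' a ((Hom.F F).obj X)))
      have e₂ : ((Hom.comp (Hom.comp F F') F'').φIso a).hom.app X =
          (Hom.F F'').map ((Hom.F F').map ((Hom.φIso F a).hom.app X) ≫
            (Hom.φIso F' a).hom.app ((Hom.F F).obj X)) ≫
              (Hom.φIso F'' a).hom.app ((Hom.F F').obj ((Hom.F F).obj X)) :=
        (Hom.comp_φIso_app (Hom.comp F F') F'' a X).trans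
          (congrArg (fun r => (Hom.F F'').map r ≫ _) (Hom.comp_φIso_app F F' a X))
      rw [Functor.map_comp, Category.assoc] at e₂
      exact (Category.id_comp _).trans ((e₁.trans e₂.symm).trans
        ((congrArg (fun r => _ ≫ r) ((E.φ a).map_id _)).trans (Category.comp_id _)).symm)
  leftUnitor {C D} F :=
    @isoMk _ _ _ _ _ _ _ _ (Hom.F F).leftUnitor
      (inferInstanceAs (NatTrans.IsMonoidal (Hom.F F).leftUnitor.hom)) fun a X => by
      have e : ((Hom.comp (Hom.id C) F).φIso a).hom.app X = (Hom.φIso F a).hom.app X :=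
        (Hom.comp_φIso_app (Hom.id C) F a X).trans
          ((congrArg (fun r => (Hom.F F).map r ≫ _) (Hom.id_φIso_app C a X)).trans
            ((congrArg (fun r => r ≫ _) ((Hom.F F).map_id _)).trans (Category.id_comp _)))
      exact (Category.id_comp _).trans (e.symm.trans
        ((congrArg (fun r => _ ≫ r) ((D.φ a).map_id _)).trans (Category.comp_id _)).symm)
  rightUnitor {C D} F :=
    @isoMk _ _ _ _ _ _ _ _ (Hom.F F).rightUnitor
      (inferInstanceAs (NatTrans.IsMonoidal (Hom.F F).rightUnitor.hom)) fun a X => by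
      have e : ((Hom.comp F (Hom.id D)).φIso a).hom.app X = (Hom.φIso F a).hom.app X :=
        (Hom.comp_φIso_app F (Hom.id D) a X).trans
          ((congrArg (fun r => _ ≫ r) (Hom.id_φIso_app D a ((Hom.F F).obj X))).trans
            (Category.comp_id _))
      exact (Category.id_comp _).trans (e.symm.trans
        ((congrArg (fun r => _ ≫ r) ((D.φ a).map_id _)).trans (Category.comp_id _)).symm)
  whiskerLeft_id F F' := rfl
  whiskerLeft_comp F _ _ _ s t := rfl
  id_whiskerLeft s := hom₂_ext fun X =>
    ((Category.id_comp _).trans (Category.comp_id (s.t.app X))).symm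
  comp_whiskerLeft F F' _ _ s := hom₂_ext fun X =>
    ((Category.id_comp _).trans (Category.comp_id _)).symm
  id_whiskerRight F F' := hom₂_ext fun X => (Hom.F F').map_id _
  comp_whiskerRight s t F := hom₂_ext fun X => (Hom.F F).map_comp _ _
  whiskerRight_id s := hom₂_ext fun X =>
    ((Category.id_comp _).trans (Category.comp_id (s.t.app X))).symm
  whiskerRight_comp s F F' := hom₂_ext fun X =>
    ((Category.id_comp _).trans (Category.comp_id _)).symm
  whisker_assoc F _ _ s F' := hom₂_ext fun X =>
    ((Category.id_comp _).trans (Category.comp_id _)).symm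
  whisker_exchange s t := hom₂_ext fun X => (t.t.naturality (s.t.app X)).symm
  pentagon F F' F'' F''' := hom₂_ext fun X => by
    change (Hom.F F''').map (𝟙 _) ≫ 𝟙 _ ≫ 𝟙 _ = 𝟙 _ ≫ 𝟙 _
    rw [CategoryTheory.Functor.map_id]
    simp only [Category.comp_id]
  triangle F F' := hom₂_ext fun X => by
    change 𝟙 _ ≫ 𝟙 _ = (Hom.F F').map (𝟙 _)
    rw [CategoryTheory.Functor.map_id, Category.comp_id]

end CrossedCat

namespace CrossedCat

variable {G : Type u} [Group G] {k : Type w} [CommRing k]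

section Homogeneous

variable (C : CrossedCat.{w, v, u} G k)

/-- The isomorphism `𝟭 ≅ φ_e` for `e = 1`. -/
def φId' {e : G} (h : e = 1) : 𝟭 C ≅ C.φ e := C.φId ≪≫ eqToIso (congrArg C.φ h.symm)

theorem φId'_unit {e : G} (h : e = 1) :
    (C.φId' h).hom.app (𝟙_ C) = Functor.LaxMonoidal.ε (C.φ e) := by
  subst h
  have := NatTrans.IsMonoidal.unit (τ := C.φId.hom)
  change C.φId.hom.app (𝟙_ C) ≫ 𝟙 _ = _
  rw [Category.comp_id, ← this]
  exact (Category.id_comp _).symm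

theorem φId'_tensor {e : G} (h : e = 1) (X Y : C) :
    (C.φId' h).hom.app (X ⊗ Y) = ((C.φId' h).hom.app X ⊗ₘ (C.φId' h).hom.app Y) ≫
      Functor.LaxMonoidal.μ (C.φ e) X Y := by
  subst h
  have := NatTrans.IsMonoidal.tensor (τ := C.φId.hom) X Y
  change C.φId.hom.app (X ⊗ Y) ≫ 𝟙 _ = ((C.φId.hom.app X ≫ 𝟙 _) ⊗ₘ (C.φId.hom.app Y ≫ 𝟙 _)) ≫ _
  rw [Category.comp_id, Category.comp_id, Category.comp_id, ← this]
  exact (Category.id_comp _).symm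

theorem φ_map_φId' {e a c : G} (h : e = 1) (h' : e * a = c) (h'' : a = c) (X : C) :
    (C.φ a).map ((C.φId' h).hom.app X) ≫ (C.φComp h').hom.app X =
      eqToHom (congrArg (fun b => (C.φ b).obj X) h'') := by
  subst h; subst h''
  change (C.φ a).map (C.φId.hom.app X ≫ 𝟙 _) ≫ _ = 𝟙 _
  rw [Category.comp_id]
  exact C.φ_map_φId h' X

theorem φId'_φ {e a c : G} (h : e = 1) (h' : a * e = c) (h'' : a = c) (X : C) :
    (C.φId' h).hom.app ((C.φ a).obj X) ≫ (C.φComp h').hom.app X =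
      eqToHom (congrArg (fun b => (C.φ b).obj X) h'') := by
  subst h; subst h''
  change (C.φId.hom.app ((C.φ a).obj X) ≫ 𝟙 _) ≫ _ = 𝟙 _
  rw [Category.comp_id]
  exact C.φId_φ h' X

theorem φComp_eqToHom {a b c c' : G} (h : b * a = c) (h' : b * a = c') (e : c = c') (X : C) :
    (C.φComp h).hom.app X ≫ eqToHom (congrArg (fun d => (C.φ d).obj X) e) =
      (C.φComp h').hom.app X := by
  subst e
  exact Category.comp_id _

/-- The `k`-linear category `C_a` of homogeneous objects of degree `a`. -/
abbrev homogCat (a : G) : LinCat.{w, v, u} k where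
  carrier := (C.deg a).FullSubcategory

/-- The restriction `C_a ⥤ C_b` of `φ_{g⁻¹}`, for `g * a = b * g`. -/
abbrev homogMap (g : G) {a b : G} (h : g * a = b * g) : C.homogCat a ⟶ C.homogCat b where
  toFunctor := (C.deg b).lift ((C.deg a).ι ⋙ C.φ g⁻¹) fun X => by
    have e := C.deg_φ g⁻¹ X.property
    rwa [inv_inv, h, mul_inv_cancel_right] at e
  additive := ⟨fun {X Y f g'} => ObjectProperty.hom_ext _ (by
    change (C.φ g⁻¹).map (f.hom + g'.hom) = (C.φ g⁻¹).map f.hom + (C.φ g⁻¹).map g'.hom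
    exact Functor.map_add _)⟩
  linear := ⟨fun {X Y} f r => ObjectProperty.hom_ext _ (by
    change (C.φ g⁻¹).map (r • f.hom) = r • (C.φ g⁻¹).map f.hom
    exact Functor.map_smul _ _ _)⟩

theorem homogCat_eqToHom {a b : G} {g g' : G} (h : g * a = b * g) (h' : g' * a = b * g')
    (e : g = g') (e' : C.homogMap g h = C.homogMap g' h') (X : (C.deg a).FullSubcategory) :
    ((eqToHom e' : C.homogMap g h ⟶ C.homogMap g' h').toNatTrans.app X).hom =
      eqToHom (congrArg (fun d => (C.φ d⁻¹).obj X.obj) e) := by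
  subst e
  rfl

/-- The pseudofunctor `a ↦ C_a`, taking `g : a ⟶ b` to the restriction `C_a ⥤ C_b` of
`φ_{g⁻¹}`. -/
def homogPs : Ps.{w, v, u} G k :=
  pseudofunctorOfIsLocallyDiscrete
    (fun x => C.homogCat x.as.el)
    (fun f => C.homogMap f.as.el f.as.comm)
    (fun x => LinCat.isoMk (NatIso.ofComponents
      (fun X => ObjectProperty.isoMk _ ((C.φId' inv_one).app X.obj).symm)
      (fun {X Y} f => ObjectProperty.hom_ext _ ((C.φId' inv_one).inv.naturality f.hom))))
    (fun f g => LinCat.isoMk (NatIso.ofComponents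
      (fun X => ObjectProperty.isoMk _ ((C.φComp (mul_inv_rev g.as.el f.as.el).symm).app X.obj).symm)
      (fun {X Y} f' => ObjectProperty.hom_ext _
        ((C.φComp (mul_inv_rev g.as.el f.as.el).symm).inv.naturality f'.hom))))
    (fun f g h => LinCat.hom₂_ext fun X => ObjectProperty.hom_ext _ (by
      refine Eq.trans ?_ (C.homogCat_eqToHom _ _ (mul_assoc _ _ _).symm _ X).symm
      change (C.φComp _).inv.app X.obj ≫ (C.φ h.as.el⁻¹).map ((C.φComp _).inv.app X.obj) ≫ 𝟙 _ ≫
        (C.φComp _).hom.app ((C.φ f.as.el⁻¹).obj X.obj) ≫ (C.φComp _).hom.app X.obj = _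
      have e : (h.as.el * (g.as.el * f.as.el))⁻¹ = (h.as.el * g.as.el * f.as.el)⁻¹ := by
        rw [mul_assoc]
      rw [← C.φComp_eqToHom ((mul_inv_rev _ _).symm.trans e.symm) _ e, Category.id_comp,
        ← reassoc_of% C.φComp_assoc (mul_inv_rev h.as.el g.as.el).symm
          (mul_inv_rev g.as.el f.as.el).symm _ (mul_inv_rev h.as.el (g.as.el * f.as.el)).symm,
        ← Functor.map_comp_assoc, Iso.inv_hom_id_app, CategoryTheory.Functor.map_id]
      exact (congrArg (fun r => _ ≫ r) (Category.id_comp _)).trans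
        ((C.φComp _).inv_hom_id_app_assoc X.obj _)))
    (fun f => LinCat.hom₂_ext fun X => ObjectProperty.hom_ext _ (by
      refine Eq.trans ?_ (C.homogCat_eqToHom _ _ (mul_one _) _ X).symm
      change (C.φComp (mul_inv_rev f.as.el 1).symm).inv.app X.obj ≫ (C.φ f.as.el⁻¹).map ((C.φId' inv_one).inv.app X.obj) ≫
        𝟙 _ = _
      have e := C.φ_map_φId' inv_one (mul_inv_rev f.as.el 1).symm (by rw [mul_one]) X.obj
      rw [Category.comp_id, ← cancel_epi ((C.φComp (mul_inv_rev f.as.el 1).symm).hom.app X.obj), Iso.hom_inv_id_app_assoc,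
        ← cancel_epi ((C.φ f.as.el⁻¹).map ((C.φId' inv_one).hom.app X.obj)), ← Functor.map_comp,
        Iso.hom_inv_id_app, CategoryTheory.Functor.map_id, reassoc_of% e]
      exact ((eqToHom_trans _ _).trans (eqToHom_refl _ _)).symm))
    (fun f => LinCat.hom₂_ext fun X => ObjectProperty.hom_ext _ (by
      refine Eq.trans ?_ (C.homogCat_eqToHom _ _ (one_mul _) _ X).symm
      change (C.φComp (mul_inv_rev 1 f.as.el).symm).inv.app X.obj ≫ (C.φId' inv_one).inv.app ((C.φ f.as.el⁻¹).obj X.obj) ≫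
        𝟙 _ = _
      have e := C.φId'_φ inv_one (mul_inv_rev 1 f.as.el).symm (by rw [one_mul]) X.obj
      rw [Category.comp_id, ← cancel_epi ((C.φComp (mul_inv_rev 1 f.as.el).symm).hom.app X.obj), Iso.hom_inv_id_app_assoc,
        ← cancel_epi ((C.φId' inv_one).hom.app _), Iso.hom_inv_id_app, reassoc_of% e]
      exact ((eqToHom_trans _ _).trans (eqToHom_refl _ _)).symm))

end Homogeneous

end CrossedCat

namespace CrossedCat

variable {G : Type u} [Group G] {k : Type w} [CommRing k]

open Functor.LaxMonoidal Functor.OplaxMonoidal Functor.Monoidal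

/-- The tensor product `C_a ⊗ C_b ⥤ C_c` for `a * b = c`. -/
abbrev homogTensor (C : CrossedCat.{w, v, u} G k) {a b c : G} (h : a * b = c) :
    LinCat.Bilin (C.homogCat a) (C.homogCat b) (C.homogCat c) where
  obj X Y := ⟨X.obj ⊗ Y.obj, h ▸ C.deg_tensor X.property Y.property⟩
  map x y := ObjectProperty.homMk (x.hom ⊗ₘ y.hom)
  map_id X Y := ObjectProperty.hom_ext _ (id_tensorHom_id X.obj Y.obj)
  map_comp f f' g g' := ObjectProperty.hom_ext _ (tensorHom_comp_tensorHom _ _ _ _).symm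
  map_add_left f f' g := ObjectProperty.hom_ext _ (MonoidalPreadditive.add_tensor f.hom f'.hom g.hom)
  map_add_right f g g' := ObjectProperty.hom_ext _ (MonoidalPreadditive.tensor_add f.hom g.hom g'.hom)
  map_smul_left r f g := ObjectProperty.hom_ext _ (by
    change (r • f.hom) ⊗ₘ g.hom = r • (f.hom ⊗ₘ g.hom)
    rw [MonoidalCategory.tensorHom_def, MonoidalCategory.tensorHom_def, MonoidalLinear.smul_whiskerRight, Linear.smul_comp])
  map_smul_right r f g := ObjectProperty.hom_ext _ (by
    change f.hom ⊗ₘ (r • g.hom) = r • (f.hom ⊗ₘ g.hom)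
    rw [MonoidalCategory.tensorHom_def, MonoidalCategory.tensorHom_def, MonoidalLinear.whiskerLeft_smul, Linear.comp_smul])

/-- The monoidale of homogeneous objects of a `G`-crossed category. Its underlying pseudofunctor is
`a ↦ C_a`, with `g` acting as `φ_{g⁻¹}`. -/
def homog (C : CrossedCat.{w, v, u} G k) : Monoidale.{w, v, u} G k where
  ps := C.homogPs
  tensor h := C.homogTensor h
  tensorAct g {a b c a' b' c'} h h' ha hb hc X Y :=
    ObjectProperty.isoMk _ (μIso (C.φ g⁻¹) X.obj Y.obj).symm
  tensorAct_natural g {a b c a' b' c'} h h' ha hb hc X X' Y Y' x y :=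
    ObjectProperty.hom_ext _ (by
      change (C.φ g⁻¹).map (x.hom ⊗ₘ y.hom) ≫ δ (C.φ g⁻¹) X'.obj Y'.obj =
        δ (C.φ g⁻¹) X.obj Y.obj ≫ ((C.φ g⁻¹).map x.hom ⊗ₘ (C.φ g⁻¹).map y.hom)
      exact (δ_natural (C.φ g⁻¹) x.hom y.hom).symm)
  tensorAct_one {a b c} h ha hb hc X Y := ObjectProperty.hom_ext _ (by
    change δ (C.φ 1⁻¹) X.obj Y.obj ≫ ((C.φId' inv_one).inv.app X.obj ⊗ₘ
      (C.φId' inv_one).inv.app Y.obj) = (C.φId' inv_one).inv.app (X.obj ⊗ Y.obj)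
    rw [← cancel_epi ((C.φId' inv_one).hom.app (X.obj ⊗ Y.obj)), Iso.hom_inv_id_app,
      C.φId'_tensor, Category.assoc, μ_δ_assoc, tensorHom_comp_tensorHom, Iso.hom_inv_id_app,
      Iso.hom_inv_id_app]
    exact id_tensorHom_id _ _)
  tensorAct_mul g g' {a b c a' b' c' a'' b'' c''} h h' h'' ha hb hc ha' hb' hc' ha'' hb'' hc'' X Y :=
    ObjectProperty.hom_ext _ (by
    have hg : g⁻¹ * g'⁻¹ = (g' * g)⁻¹ := (mul_inv_rev g' g).symm
    change δ (C.φ (g' * g)⁻¹) X.obj Y.obj ≫ ((C.φComp hg).inv.app X.obj ⊗ₘ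
        (C.φComp hg).inv.app Y.obj) =
      (C.φComp hg).inv.app (X.obj ⊗ Y.obj) ≫ (C.φ g'⁻¹).map (δ (C.φ g⁻¹) X.obj Y.obj) ≫
        δ (C.φ g'⁻¹) ((C.φ g⁻¹).obj X.obj) ((C.φ g⁻¹).obj Y.obj)
    have e := NatTrans.IsMonoidal.tensor (τ := (C.φComp hg).inv) X.obj Y.obj
    rw [comp_μ] at e
    rw [← cancel_epi (μ (C.φ (g' * g)⁻¹) X.obj Y.obj), μ_δ_assoc, reassoc_of% e]
    simp only [← Functor.map_comp_assoc, μ_δ, CategoryTheory.Functor.map_id, Category.id_comp,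
      Category.comp_id])
  unit := ⟨𝟙_ C, C.deg_unit⟩
  unitAct g h := ObjectProperty.isoMk _ (εIso (C.φ g⁻¹)).symm
  unitAct_one h := ObjectProperty.hom_ext _ (by
    change η (C.φ 1⁻¹) = (C.φId' inv_one).inv.app (𝟙_ C)
    rw [← cancel_epi ((C.φId' inv_one).hom.app (𝟙_ C)), Iso.hom_inv_id_app, C.φId'_unit, ε_η]
    rfl)
  unitAct_mul g g' h h' h'' := ObjectProperty.hom_ext _ (by
    have hg : g⁻¹ * g'⁻¹ = (g' * g)⁻¹ := (mul_inv_rev g' g).symm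
    change η (C.φ (g' * g)⁻¹) =
      (C.φComp hg).inv.app (𝟙_ C) ≫ (C.φ g'⁻¹).map (η (C.φ g⁻¹)) ≫ η (C.φ g'⁻¹)
    have e := NatTrans.IsMonoidal.unit (τ := (C.φComp hg).inv)
    rw [comp_ε] at e
    rw [← cancel_epi (Functor.LaxMonoidal.ε (C.φ (g' * g)⁻¹)), ε_η, reassoc_of% e, ← Functor.map_comp_assoc, ε_η,
      CategoryTheory.Functor.map_id, Category.id_comp, ε_η])
  assoc h₁ h₂ h₃ h₄ X Y Z := ObjectProperty.isoMk _ (α_ X.obj Y.obj Z.obj)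
  assoc_natural h₁ h₂ h₃ h₄ _ _ _ _ _ _ x y z :=
    ObjectProperty.hom_ext _ (associator_naturality x.hom y.hom z.hom)
  assoc_act g _ _ _ _ _ _ _ _ _ _ _ _ h₁ h₂ h₃ h₄ _ _ _ _ ha hb hc hab hbc habc X Y Z :=
    ObjectProperty.hom_ext _ (by
      change (C.φ g⁻¹).map (α_ X.obj Y.obj Z.obj).hom ≫ δ (C.φ g⁻¹) X.obj (Y.obj ⊗ Z.obj) ≫
          (𝟙 ((C.φ g⁻¹).obj X.obj) ⊗ₘ δ (C.φ g⁻¹) Y.obj Z.obj) =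
        δ (C.φ g⁻¹) (X.obj ⊗ Y.obj) Z.obj ≫
          (δ (C.φ g⁻¹) X.obj Y.obj ⊗ₘ 𝟙 ((C.φ g⁻¹).obj Z.obj)) ≫ (α_ _ _ _).hom
      rw [id_tensorHom, tensorHom_id, Functor.OplaxMonoidal.associativity])
  left h X := ObjectProperty.isoMk _ (λ_ X.obj)
  left_natural h _ _ x := ObjectProperty.hom_ext _ (by
    change (𝟙 (𝟙_ C) ⊗ₘ x.hom) ≫ (λ_ _).hom = (λ_ _).hom ≫ x.hom
    rw [id_tensorHom, leftUnitor_naturality])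
  left_act g _ _ h h' h₁ ha X := ObjectProperty.hom_ext _ (by
    change (C.φ g⁻¹).map (λ_ X.obj).hom = δ (C.φ g⁻¹) (𝟙_ C) X.obj ≫
      (η (C.φ g⁻¹) ⊗ₘ 𝟙 _) ≫ (λ_ ((C.φ g⁻¹).obj X.obj)).hom
    rw [tensorHom_id, map_leftUnitor])
  right h X := ObjectProperty.isoMk _ (ρ_ X.obj)
  right_natural h _ _ x := ObjectProperty.hom_ext _ (by
    change (x.hom ⊗ₘ 𝟙 (𝟙_ C)) ≫ (ρ_ _).hom = (ρ_ _).hom ≫ x.hom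
    rw [tensorHom_id, rightUnitor_naturality])
  right_act g _ _ h h' h₁ ha X := ObjectProperty.hom_ext _ (by
    change (C.φ g⁻¹).map (ρ_ X.obj).hom = δ (C.φ g⁻¹) X.obj (𝟙_ C) ≫
      (𝟙 _ ⊗ₘ η (C.φ g⁻¹)) ≫ (ρ_ ((C.φ g⁻¹).obj X.obj)).hom
    rw [id_tensorHom, map_rightUnitor])
  pentagon h₁ h₂ h₃ h₄ h₅ h₆ h₇ h₈ h₉ h₁₀ W X Y Z := ObjectProperty.hom_ext _ (by
    change ((α_ _ _ _).hom ⊗ₘ 𝟙 Z.obj) ≫ (α_ _ _ _).hom ≫ (𝟙 W.obj ⊗ₘ (α_ _ _ _).hom) =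
      (α_ _ _ _).hom ≫ (α_ _ _ _).hom
    rw [id_tensorHom, tensorHom_id, MonoidalCategory.pentagon])
  triangle h₁ h₂ h₃ X Y := ObjectProperty.hom_ext _ (by
    change (α_ _ _ _).hom ≫ (𝟙 X.obj ⊗ₘ (λ_ Y.obj).hom) = (ρ_ X.obj).hom ⊗ₘ 𝟙 Y.obj
    rw [id_tensorHom, tensorHom_id, MonoidalCategory.triangle])

/-- The restriction `C_a ⥤ D_a` of a morphism `C ⟶ D` of `G`-crossed categories. -/
abbrev homogApp {C D : CrossedCat.{w, v, u} G k} (F : Hom C D) (a : G) :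
    C.homogCat a ⟶ D.homogCat a where
  toFunctor := (D.deg a).lift ((C.deg a).ι ⋙ F.F) fun X => F.deg X.property
  additive := ⟨fun {X Y f g} => ObjectProperty.hom_ext _ (by
    change F.F.map (f.hom + g.hom) = F.F.map f.hom + F.F.map g.hom
    exact Functor.map_add _)⟩
  linear := ⟨fun {X Y} f r => ObjectProperty.hom_ext _ (by
    change F.F.map (r • f.hom) = r • F.F.map f.hom
    exact Functor.map_smul _ _ _)⟩

/-- The pseudonaturality constraint of `homogApp`. -/
abbrev homogNat {C D : CrossedCat.{w, v, u} G k} (F : Hom C D) (g : G) {a b : G}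
    (h : g * a = b * g) :
    C.homogMap g h ≫ homogApp F b ≅ homogApp F a ≫ D.homogMap g h :=
  LinCat.isoMk (NatIso.ofComponents
    (fun X => ObjectProperty.isoMk _ ((F.φIso g⁻¹).app X.obj))
    (fun {X Y} f => ObjectProperty.hom_ext _ ((F.φIso g⁻¹).hom.naturality f.hom)))

theorem φIso_id' {C D : CrossedCat.{w, v, u} G k} (F : Hom C D) {e : G} (h : e = 1) (X : C) :
    F.F.map ((C.φId' h).hom.app X) ≫ (F.φIso e).hom.app X = (D.φId' h).hom.app (F.F.obj X) := by
  subst h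
  change F.F.map (C.φId.hom.app X ≫ 𝟙 _) ≫ _ = D.φId.hom.app _ ≫ 𝟙 _
  rw [Category.comp_id, Category.comp_id]
  exact F.φIso_id X

theorem φIso_id_inv {C D : CrossedCat.{w, v, u} G k} (F : Hom C D) {e : G} (h : e = 1) (X : C) :
    (F.φIso e).hom.app X ≫ (D.φId' h).inv.app (F.F.obj X) =
      F.F.map ((C.φId' h).inv.app X) ≫ 𝟙 (F.F.obj X) ≫ 𝟙 (F.F.obj X) := by
  have e' := φIso_id' F h X
  have key : (F.φIso e).hom.app X ≫ (D.φId' h).inv.app (F.F.obj X) =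
      F.F.map ((C.φId' h).inv.app X) := by
    rw [← cancel_epi (F.F.map ((C.φId' h).hom.app X)), reassoc_of% e', Iso.hom_inv_id_app,
      ← Functor.map_comp, Iso.hom_inv_id_app]
    exact (F.F.map_id X).symm
  exact key.trans ((Category.comp_id (F.F.map ((C.φId' h).inv.app X))).symm.trans
    (congrArg (fun r => _ ≫ r) (Category.comp_id (𝟙 (F.F.obj X))).symm))

theorem φIso_comp_inv {C D : CrossedCat.{w, v, u} G k} (F : Hom C D) {a b c : G} (h : b * a = c)
    (X : C) :
    (F.φIso c).hom.app X ≫ (D.φComp h).inv.app (F.F.obj X) =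
      F.F.map ((C.φComp h).inv.app X) ≫ 𝟙 (F.F.obj ((C.φ a).obj ((C.φ b).obj X))) ≫
        (F.φIso a).hom.app ((C.φ b).obj X) ≫ 𝟙 ((D.φ a).obj (F.F.obj ((C.φ b).obj X))) ≫
          (D.φ a).map ((F.φIso b).hom.app X) ≫
            𝟙 ((D.φ a).obj ((D.φ b).obj (F.F.obj X))) := by
  have e := F.φIso_comp h X
  have e' : (D.φComp h).hom.app (F.F.obj X) ≫ (D.φComp h).inv.app (F.F.obj X) = 𝟙 _ :=
    Iso.hom_inv_id_app _ _
  rw [← cancel_epi (F.F.map ((C.φComp h).hom.app X)), reassoc_of% e, e',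
    ← Functor.map_comp_assoc, Iso.hom_inv_id_app, CategoryTheory.Functor.map_id]
  simp only [Category.id_comp]
  exact (congrArg (fun r => _ ≫ r) (Category.id_comp _).symm).trans (Category.id_comp _).symm

theorem naturality_aux {S T : Ps.{w, v, u} G k} (app : ∀ x, S.obj x ⟶ T.obj x)
    (nat : ∀ {x y : LocallyDiscrete (GAut G)} (f : x ⟶ y), S.map f ≫ app y ≅ app x ≫ T.map f)
    {x y : LocallyDiscrete (GAut G)} {f g : x ⟶ y} (t : f ⟶ g) :
    Bicategory.whiskerRight (S.map₂ t) (app y) ≫ (nat g).hom =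
      (nat f).hom ≫ Bicategory.whiskerLeft (app x) (T.map₂ t) := by
  obtain rfl := LocallyDiscrete.eq_of_hom t
  obtain rfl : t = 𝟙 f := Subsingleton.elim _ _
  rw [PrelaxFunctor.map₂_id, PrelaxFunctor.map₂_id, Bicategory.id_whiskerRight,
    Bicategory.whiskerLeft_id, Category.id_comp, Category.comp_id]

/-- The action of `homog` on 1-cells, on underlying pseudonatural transformations. -/
def homogTrans {C D : CrossedCat.{w, v, u} G k} (F : Hom C D) : C.homogPs ⟶ D.homogPs where
  app x := homogApp F x.as.el
  naturality {x y} f := homogNat F f.as.el f.as.comm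
  naturality_naturality {x y f g} t := naturality_aux (S := C.homogPs) (T := D.homogPs)
    (fun x => homogApp F x.as.el) (fun f => homogNat F f.as.el f.as.comm) t
  naturality_id x := LinCat.hom₂_ext fun X => ObjectProperty.hom_ext _
    (φIso_id_inv F inv_one _)
  naturality_comp {x y z} f g := LinCat.hom₂_ext fun X => ObjectProperty.hom_ext _
    (φIso_comp_inv F (mul_inv_rev g.as.el f.as.el).symm _)

theorem homogTrans_appAct {C D : CrossedCat.{w, v, u} G k} (F : Hom C D) (g : G) {a a' : G}
    (h : g * a = a' * g) (X : (C.deg a).FullSubcategory) :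
    (Ps.appAct (homogTrans F) g h X).hom = ObjectProperty.homMk ((F.φIso g⁻¹).inv.app X.obj) :=
  rfl

theorem tensorIso_act_aux {C D : CrossedCat.{w, v, u} G k} (F : Hom C D) (a : G) (X Y : C) :
    (D.φ a).map (μ F.F X Y) ≫ (F.φIso a).inv.app (X ⊗ Y) ≫ F.F.map (δ (C.φ a) X Y) =
      δ (D.φ a) (F.F.obj X) (F.F.obj Y) ≫
        ((F.φIso a).inv.app X ⊗ₘ (F.φIso a).inv.app Y) ≫
          μ F.F ((C.φ a).obj X) ((C.φ a).obj Y) := by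
  have e := NatTrans.IsMonoidal.tensor (τ := (F.φIso a).inv) X Y
  rw [comp_μ, comp_μ, Category.assoc] at e
  rw [← cancel_epi (μ (D.φ a) (F.F.obj X) (F.F.obj Y)), reassoc_of% e, ← Functor.map_comp, μ_δ,
    CategoryTheory.Functor.map_id, μ_δ_assoc]
  exact congrArg (fun r => _ ≫ r) (Category.comp_id _)

theorem unitIso_act_aux {C D : CrossedCat.{w, v, u} G k} (F : Hom C D) (a : G) :
    (D.φ a).map (ε F.F) ≫ (F.φIso a).inv.app (𝟙_ C) ≫ F.F.map (η (C.φ a)) =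
      η (D.φ a) ≫ ε F.F := by
  have e := NatTrans.IsMonoidal.unit (τ := (F.φIso a).inv)
  rw [comp_ε, comp_ε, Category.assoc] at e
  rw [← cancel_epi (Functor.LaxMonoidal.ε (D.φ a)), reassoc_of% e, ← Functor.map_comp, ε_η,
    CategoryTheory.Functor.map_id, ε_η_assoc]
  exact Category.comp_id _

/-- The action of `homog` on 1-cells. -/
def homogHom {C D : CrossedCat.{w, v, u} G k} (F : Hom C D) :
    Monoidale.Hom C.homog D.homog where
  F := homogTrans F
  tensorIso h X Y := ObjectProperty.isoMk _ (μIso F.F X.obj Y.obj)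
  tensorIso_natural h _ _ _ _ x y := ObjectProperty.hom_ext _ (μ_natural F.F x.hom y.hom)
  tensorIso_act g _ _ _ _ _ _ h h' ha hb hc X Y :=
    ObjectProperty.hom_ext _ (tensorIso_act_aux F g⁻¹ X.obj Y.obj)
  unitIso := ObjectProperty.isoMk _ (εIso F.F)
  unitIso_act g h := ObjectProperty.hom_ext _ (unitIso_act_aux F g⁻¹)
  assoc h₁ h₂ h₃ h₄ X Y Z := ObjectProperty.hom_ext _ (by
    change (μ F.F X.obj Y.obj ⊗ₘ 𝟙 (F.F.obj Z.obj)) ≫ μ F.F (X.obj ⊗ Y.obj) Z.obj ≫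
        F.F.map (α_ X.obj Y.obj Z.obj).hom =
      (α_ (F.F.obj X.obj) (F.F.obj Y.obj) (F.F.obj Z.obj)).hom ≫
        (𝟙 (F.F.obj X.obj) ⊗ₘ μ F.F Y.obj Z.obj) ≫ μ F.F X.obj (Y.obj ⊗ Z.obj)
    rw [id_tensorHom, tensorHom_id, Functor.LaxMonoidal.associativity])
  left h X := ObjectProperty.hom_ext _ (by
    change (λ_ (F.F.obj X.obj)).hom = (ε F.F ⊗ₘ 𝟙 (F.F.obj X.obj)) ≫ μ F.F (𝟙_ C) X.obj ≫
      F.F.map (λ_ X.obj).hom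
    rw [tensorHom_id, Functor.LaxMonoidal.left_unitality])
  right h X := ObjectProperty.hom_ext _ (by
    change (ρ_ (F.F.obj X.obj)).hom = (𝟙 (F.F.obj X.obj) ⊗ₘ ε F.F) ≫ μ F.F X.obj (𝟙_ C) ≫
      F.F.map (ρ_ X.obj).hom
    rw [id_tensorHom, Functor.LaxMonoidal.right_unitality])

/-- The action of `homog` on 2-cells. -/
def homogHom₂ {C D : CrossedCat.{w, v, u} G k} {F F' : Hom C D} (s : Hom₂ F F') :
    Monoidale.Hom₂ (homogHom F) (homogHom F') where
  t :=
    { as :=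
      { app := fun x =>
          { toNatTrans :=
            { app := fun X => ObjectProperty.homMk (s.t.app X.obj)
              naturality := fun X Y f => ObjectProperty.hom_ext _ (s.t.naturality f.hom) } }
        naturality := fun {x y} f => LinCat.hom₂_ext fun X => ObjectProperty.hom_ext _
          (s.φ f.as.el⁻¹ X.obj) } }
  tensor h X Y := ObjectProperty.hom_ext _ (NatTrans.IsMonoidal.tensor (τ := s.t) X.obj Y.obj)
  unit := ObjectProperty.hom_ext _ (NatTrans.IsMonoidal.unit (τ := s.t))

end CrossedCat

namespace CrossedCat

variable {G : Type u} [Group G] {k : Type w} [CommRing k]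

open Functor.LaxMonoidal

/-- The action of `homog` on 1-cells. -/
abbrev homogMor {C D : CrossedCat.{w, v, u} G k} (F : C ⟶ D) : C.homog ⟶ D.homog := homogHom F

/-- The unit constraint of `homogFunctor`, with identity components. -/
def homogMapId (C : CrossedCat.{w, v, u} G k) : homogMor (𝟙 C) ≅ 𝟙 C.homog :=
  Monoidale.isoMk (Pseudofunctor.StrongTrans.isoMk
    (fun x => LinCat.isoMk (NatIso.ofComponents
      (fun X => ObjectProperty.isoMk _ (Iso.refl X.obj))
      (fun {X Y} f => ObjectProperty.hom_ext _
        ((Category.comp_id f.hom).trans (Category.id_comp f.hom).symm))))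
    (fun {x y} f => LinCat.hom₂_ext fun X => ObjectProperty.hom_ext _ (by
      have e : (𝟙 ((C.φ f.as.el⁻¹).obj X.obj)) ≫ 𝟙 _ ≫ 𝟙 _ =
          ((Hom.id C).φIso f.as.el⁻¹).hom.app X.obj ≫ (C.φ f.as.el⁻¹).map (𝟙 X.obj) := by
        rw [Hom.id_φIso_app, CategoryTheory.Functor.map_id]
        exact Category.id_comp _
      exact e)))
    (fun {a b c} h X Y => ObjectProperty.hom_ext _ (by
      change 𝟙 _ ≫ 𝟙 _ = (𝟙 _ ⊗ₘ 𝟙 _) ≫ 𝟙 _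
      rw [id_tensorHom_id]))
    (ObjectProperty.hom_ext _ (by
      change 𝟙 _ ≫ 𝟙 _ = 𝟙 _
      rw [Category.comp_id]))

theorem homogMapComp_aux {C D E : CrossedCat.{w, v, u} G k} (F : C ⟶ D) (F' : D ⟶ E) (a : G)
    (X : C) :
    𝟙 ((Hom.F F').obj ((Hom.F F).obj ((C.φ a).obj X))) ≫
        𝟙 ((Hom.F F').obj ((Hom.F F).obj ((C.φ a).obj X))) ≫
          (Hom.F F').map ((Hom.φIso F a).hom.app X) ≫
            𝟙 ((Hom.F F').obj ((D.φ a).obj ((Hom.F F).obj X))) ≫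
              (Hom.φIso F' a).hom.app ((Hom.F F).obj X) ≫
                𝟙 ((E.φ a).obj ((Hom.F F').obj ((Hom.F F).obj X))) =
      ((Hom.comp F F').φIso a).hom.app X ≫
        (E.φ a).map (𝟙 ((Hom.F F').obj ((Hom.F F).obj X))) := by
  refine Eq.trans ?_ (congrArg₂ (fun r s => r ≫ s) (Hom.comp_φIso_app F F' a X)
    ((E.φ a).map_id ((Hom.F F').obj ((Hom.F F).obj X)))).symm
  simp only [Category.id_comp]
  have e := (Category.id_comp _).trans
    (Category.comp_id ((Hom.φIso F' a).hom.app ((Hom.F F).obj X)))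
  exact (congrArg (fun r => (Hom.F F').map ((Hom.φIso F a).hom.app X) ≫ r) e).trans
    (Category.comp_id ((Hom.F F').map ((Hom.φIso F a).hom.app X) ≫
      (Hom.φIso F' a).hom.app ((Hom.F F).obj X))).symm

/-- The composition constraint of `homogFunctor`, with identity components. -/
def homogMapComp {C D E : CrossedCat.{w, v, u} G k} (F : C ⟶ D) (F' : D ⟶ E) :
    homogMor (F ≫ F') ≅ homogMor F ≫ homogMor F' :=
  Monoidale.isoMk (Pseudofunctor.StrongTrans.isoMk
    (fun x => LinCat.isoMk (NatIso.ofComponents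
      (fun X => ObjectProperty.isoMk _ (Iso.refl ((Hom.F F').obj ((Hom.F F).obj X.obj))))
      (fun {X Y} f => ObjectProperty.hom_ext _
        ((Category.comp_id ((Hom.F F').map ((Hom.F F).map f.hom))).trans (Category.id_comp _).symm))))
    (fun {x y} f => LinCat.hom₂_ext fun X => ObjectProperty.hom_ext _ (by
      exact homogMapComp_aux F F' f.as.el⁻¹ X.obj)))
    (fun {a b c} h X Y => ObjectProperty.hom_ext _ (by
      change (μ (Hom.F F') _ _ ≫ (Hom.F F').map (μ (Hom.F F) X.obj Y.obj)) ≫ 𝟙 _ =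
        (𝟙 _ ⊗ₘ 𝟙 _) ≫ μ (Hom.F F') _ _ ≫ (Hom.F F').map (μ (Hom.F F) X.obj Y.obj)
      rw [id_tensorHom_id, Category.comp_id, Category.id_comp]))
    (ObjectProperty.hom_ext _ (by
      change (ε (Hom.F F') ≫ (Hom.F F').map (ε (Hom.F F))) ≫ 𝟙 _ = ε (Hom.F F') ≫ (Hom.F F').map (ε (Hom.F F))
      rw [Category.comp_id]))

/-- The pseudofunctor taking a `G`-crossed category to its monoidale of homogeneous objects. -/
def homogFunctor (G : Type u) [Group G] (k : Type w) [CommRing k] :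
    Pseudofunctor (CrossedCat.{w, v, u} G k) (Monoidale.{w, v, u} G k) where
  obj C := C.homog
  map F := homogMor F
  map₂ s := homogHom₂ s
  map₂_id F := rfl
  map₂_comp s t := rfl
  mapId C := homogMapId C
  mapComp F F' := homogMapComp F F'
  map₂_whisker_left F F' F'' s := Monoidale.hom₂_ext (Pseudofunctor.StrongTrans.homCategory.ext fun x =>
    LinCat.hom₂_ext fun X => ObjectProperty.hom_ext _ (by
      exact ((Category.id_comp _).trans (Category.comp_id (s.t.app ((Hom.F F).obj X.obj)))).symm))
  map₂_whisker_right s F := Monoidale.hom₂_ext (Pseudofunctor.StrongTrans.homCategory.ext fun x =>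
    LinCat.hom₂_ext fun X => ObjectProperty.hom_ext _ (by
      exact ((Category.id_comp _).trans
        (Category.comp_id ((Hom.F F).map (s.t.app X.obj)))).symm))
  map₂_associator F F' F'' := Monoidale.hom₂_ext (Pseudofunctor.StrongTrans.homCategory.ext fun x =>
    LinCat.hom₂_ext fun X => ObjectProperty.hom_ext _ (by
      change 𝟙 _ = 𝟙 _ ≫ (Hom.F F'').map (𝟙 ((Hom.F F').obj ((Hom.F F).obj X.obj))) ≫
        𝟙 _ ≫ 𝟙 _ ≫ 𝟙 _
      rw [CategoryTheory.Functor.map_id]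
      simp only [Category.comp_id]))
  map₂_left_unitor F := Monoidale.hom₂_ext (Pseudofunctor.StrongTrans.homCategory.ext fun x =>
    LinCat.hom₂_ext fun X => ObjectProperty.hom_ext _ (by
      change 𝟙 _ = 𝟙 _ ≫ (Hom.F F).map (𝟙 X.obj) ≫ 𝟙 _
      rw [CategoryTheory.Functor.map_id]
      simp only [Category.comp_id]))
  map₂_right_unitor F := Monoidale.hom₂_ext (Pseudofunctor.StrongTrans.homCategory.ext fun x =>
    LinCat.hom₂_ext fun X => ObjectProperty.hom_ext _ (by
      change 𝟙 _ = 𝟙 _ ≫ 𝟙 _ ≫ 𝟙 _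
      simp only [Category.comp_id]))

end CrossedCat

/-- The functors `J a : A a ⥤ C` exhibit `C` as the completion under finite direct sums of the
coproduct of the `k`-linear categories `A a`: the induced functor on the coproduct (in which
morphisms between objects of different summands are zero) is fully faithful, and the objects of `C`
are the finite direct sums of objects in its image. -/
structure IsSumCompletion {ι : Type u} {k : Type w} [CommRing k] {A : ι → LinCat.{w, v, u} k}
    {C : Type u} [Category.{v} C] [Preadditive C] [HasFiniteBiproducts C]
    (J : ∀ a, A a ⥤ C) : Prop where
  full (a : ι) : (J a).Full
  faithful (a : ι) : (J a).Faithful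
  hom_eq_zero {a b : ι} (h : a ≠ b) (X : A a) (Y : A b) (f : (J a).obj X ⟶ (J b).obj Y) : f = 0
  exists_iso (X : C) : ∃ (n : ℕ) (a : Fin n → ι) (Y : ∀ i, A (a i)),
    Nonempty (X ≅ ⨁ fun i => (J (a i)).obj (Y i))

namespace Monoidale

variable {G : Type u} [Group G] {k : Type w} [CommRing k]

/-- The components `M a` have finite direct sums. -/
def HasDirectSums (M : Monoidale.{w, v, u} G k) : Prop :=
  ∀ a : G, HasFiniteBiproducts (M.ps.at_ a)

/-- The morphism of monoidales `η : M ⟶ (C_a)_a` exhibits the `G`-crossed category `C` as the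
completion under finite direct sums of the coproduct of the `M a`. -/
def IsCompletion {M : Monoidale.{w, v, u} G k} {C : CrossedCat.{w, v, u} G k}
    (η : M ⟶ (CrossedCat.homogFunctor G k).obj C) : Prop :=
  IsSumCompletion (A := fun a : G => M.ps.at_ a) (C := C)
    fun a => Ps.app (Hom.F η) a ⋙ (C.deg a).ι

end Monoidale

end GCrossed

set_option linter.unusedVariables false

/-! A monoidale is a family of linear categories `M a` with products `M a ⊗ M b ⥤ M (a * b)` and an
action of each `g` from `M a` to `M (g * a * g⁻¹)`. A `G`-crossed category carries the same data,
assembled in one category with direct sums. The proof makes the passage from the pieces to the whole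
explicit and shows that it has the universal property of a completion; all five assertions follow
from that.

Construction (assertion 3). The coproduct `Tot` of the components, with zero morphisms between
different summands, is a monoidal category because degrees multiply. The actions of `a⁻¹` on all
components glue to a strong monoidal functor `Ps.cross a` on it. This gives `Monoidale.pre`, a
graded category with a crossing that may lack direct sums. Formal finite direct sums with matrices
as morphisms (`Sums`) supply them, and tensor product and crossing extend entrywise. A formal sum
carries an optional tag for its degree: the grading of a `G`-crossed category is disjoint, whereas
an empty sum would otherwise have every degree. The result is `Sums.incl_isCompletion`, which is
translated back to monoidales by `PreHom.toHom`.

Universal property (assertion 4). Let `J : E ⥤ C` be full, with each `X` a finite direct sum of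
objects in its image, so that `𝟙 X = ∑ p i ≫ s i` with `s i : J (Y i) ⟶ X`. For additive `T` the
maps `T s` with `s : J W ⟶ X` are then jointly epic. Hence a transformation given on `E` has at most
one extension to `C`, and the formula `∑ T (p i) ≫ t ≫ T' (s i)` provides one, natural because `J`
is full (`Generates.extend`). If `J` is also faithful, a functor `N` on `E` extends by choosing
direct sums in the target (`Realization.functor`). The same argument in two and three variables
extends monoidal constraints (`RestrictedMonoidal.core`), and coherence is checked on generators
only. Extension of transformations gives fullness and faithfulness of precomposition, extension of
functors gives essential surjectivity: this is `Monoidale.IsCompletion.isEquivalence`.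

Consequences. In a `G`-crossed category every object is a sum of homogeneous ones, so the identity
of `H C` is a completion (assertion 5). Applying the universal property to this identity and
removing a unitor gives the local equivalence (assertion 1). If the `M a` have direct sums, the
components `M a ⥤ C_a` of a completion are fully faithful, and essentially surjective because only
summands of degree `a` contribute to an object of degree `a`. A 1-cell of monoidales whose
components are equivalences is an equivalence (`Monoidale.Hom.equivalence`), its inverse having the
mates of the inverted constraints. Conversely direct sums pass through an equivalence (assertion 2
and the end of 4).

Degrees such as `a * b * c` and `a * (b * c)` are equal without being identical. The constraints of
the coproduct are therefore described for every choice of names of the degrees (`tensAssoc_hom`,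
`crossMulApp_hom`, `crossTensor_hom`). Coherence laws are proved by cancelling the comparison
isomorphisms `tens` and `toCross`, after which they become axioms of the monoidale. -/

namespace GCrossed

open CategoryTheory MonoidalCategory Limits

/-! ### The coproduct of a family of linear categories -/

noncomputable section Coproduct

variable {ι : Type u} {k : Type w} [CommRing k]

/-- The coproduct of a family of `k`-linear categories, in which morphisms between objects of
different summands are zero. -/
structure Tot (A : ι → LinCat.{w, v, u} k) where
  deg : ι
  obj : A deg

namespace Tot

variable {A : ι → LinCat.{w, v, u} k}

/-- A morphism of the coproduct: a morphism in the common summand, if there is one. -/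
def Hom (X Y : Tot A) : Type v :=
  ∀ h : PLift (X.deg = Y.deg), ((h.down ▸ X.obj : A Y.deg) ⟶ Y.obj)

instance (X Y : Tot A) : AddCommGroup (Hom X Y) := by
  unfold Hom; infer_instance

instance (X Y : Tot A) : Module k (Hom X Y) :=
  inferInstanceAs (Module k
    (∀ h : PLift (X.deg = Y.deg), ((h.down ▸ X.obj : A Y.deg) ⟶ Y.obj)))

/-- The morphism of the coproduct given by a morphism in one of the summands. -/
def ofHom {a : ι} {X Y : A a} (f : X ⟶ Y) : Hom (⟨a, X⟩ : Tot A) ⟨a, Y⟩ := fun _ => f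

theorem hom_eq_zero {X Y : Tot A} (h : X.deg ≠ Y.deg) (f : Hom X Y) : f = 0 :=
  funext fun h' => absurd h'.down h

/-- Either the two indices differ and the morphism vanishes, or they can be identified by
substitution. Identities in the coproduct thus split into a trivial zero case and a case inside one
summand in which no transport is left. -/
theorem hom_ind {P : ∀ X Y : Tot A, Hom X Y → Prop} (zero : ∀ X Y, P X Y 0)
    (of : ∀ (a : ι) (X Y : A a) (f : X ⟶ Y), P ⟨a, X⟩ ⟨a, Y⟩ (ofHom f)) (X Y : Tot A)
    (f : Hom X Y) : P X Y f := by
  obtain ⟨a, X⟩ := X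
  obtain ⟨b, Y⟩ := Y
  by_cases h : a = b
  · subst h
    exact of a X Y (f ⟨rfl⟩)
  · rw [hom_eq_zero h f]
    exact zero _ _

/-- In a composite, the treatment of the first factor has already placed the source of the second in
a summand, so only the target may still vary. -/
theorem hom_ind_source {a : ι} {X : A a} {P : ∀ Y : Tot A, Hom ⟨a, X⟩ Y → Prop}
    (zero : ∀ Y, P Y 0) (of : ∀ (Y : A a) (f : X ⟶ Y), P ⟨a, Y⟩ (ofHom f)) (Y : Tot A)
    (f : Hom ⟨a, X⟩ Y) : P Y f := by
  obtain ⟨b, Y⟩ := Y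
  by_cases h : a = b
  · subst h
    exact of Y (f ⟨rfl⟩)
  · rw [hom_eq_zero h f]
    exact zero _

/-- Composition in the coproduct, when the indices agree. -/
def compAux {a b c : ι} (h : a = b) (h' : b = c) (X : A a) (Y : A b) (Z : A c)
    (f : Hom ⟨a, X⟩ ⟨b, Y⟩) (g : Hom ⟨b, Y⟩ ⟨c, Z⟩) : Hom (⟨a, X⟩ : Tot A) ⟨c, Z⟩ := by
  subst h h'
  exact ofHom (f ⟨rfl⟩ ≫ g ⟨rfl⟩)

open scoped Classical in
/-- Composition in the coproduct. -/
def homComp {X Y Z : Tot A} (f : Hom X Y) (g : Hom Y Z) : Hom X Z :=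
  if h : X.deg = Y.deg ∧ Y.deg = Z.deg then
    compAux h.1 h.2 X.obj Y.obj Z.obj f g
  else 0

theorem homComp_ofHom {a : ι} {X Y Z : A a} (f : X ⟶ Y) (g : Y ⟶ Z) :
    homComp (ofHom f) (ofHom g) = ofHom (f ≫ g) :=
  dif_pos ⟨rfl, rfl⟩

theorem zero_homComp {X Y Z : Tot A} (g : Hom Y Z) : homComp (0 : Hom X Y) g = 0 := by
  by_cases h : X.deg = Y.deg ∧ Y.deg = Z.deg
  · obtain ⟨a, X⟩ := X
    obtain ⟨b, Y⟩ := Y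
    obtain ⟨c, Z⟩ := Z
    obtain ⟨h₁, h₂⟩ := h
    dsimp only at h₁ h₂
    subst h₁ h₂
    -- Once the indices coincide, `0` is `ofHom 0` and `g` is `ofHom (g ⟨rfl⟩)` by definition.
    refine (homComp_ofHom (0 : X ⟶ Y) (g ⟨rfl⟩)).trans ?_
    rw [zero_comp]
    rfl
  · exact dif_neg h

theorem homComp_zero {X Y Z : Tot A} (f : Hom X Y) : homComp f (0 : Hom Y Z) = 0 := by
  by_cases h : X.deg = Y.deg ∧ Y.deg = Z.deg
  · obtain ⟨a, X⟩ := X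
    obtain ⟨b, Y⟩ := Y
    obtain ⟨c, Z⟩ := Z
    obtain ⟨h₁, h₂⟩ := h
    dsimp only at h₁ h₂
    subst h₁ h₂
    refine (homComp_ofHom (f ⟨rfl⟩) (0 : Y ⟶ Z)).trans ?_
    rw [comp_zero]
    rfl
  · exact dif_neg h

/-- Two morphisms of the coproduct with the same source and target are both zero or both come from
the same summand. -/
theorem hom_ind₂ {P : ∀ X Y : Tot A, Hom X Y → Hom X Y → Prop} (zero : ∀ X Y, P X Y 0 0)
    (of : ∀ (a : ι) (X Y : A a) (f g : X ⟶ Y), P ⟨a, X⟩ ⟨a, Y⟩ (ofHom f) (ofHom g)) (X Y : Tot A)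
    (f g : Hom X Y) : P X Y f g := by
  obtain ⟨a, X⟩ := X
  obtain ⟨b, Y⟩ := Y
  by_cases h : a = b
  · subst h
    exact of a X Y (f ⟨rfl⟩) (g ⟨rfl⟩)
  · rw [hom_eq_zero h f, hom_eq_zero h g]
    exact zero _ _

instance : Category.{v} (Tot A) where
  Hom := Hom
  id X := ofHom (𝟙 X.obj)
  comp := homComp
  id_comp {X Y} f := by
    induction X, Y, f using hom_ind with
    | zero => exact homComp_zero _
    | of a X Y f => exact (homComp_ofHom _ _).trans (congrArg ofHom (Category.id_comp f))
  comp_id {X Y} f := by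
    induction X, Y, f using hom_ind with
    | zero => exact zero_homComp _
    | of a X Y f => exact (homComp_ofHom _ _).trans (congrArg ofHom (Category.comp_id f))
  assoc {X Y Z W} f g h := by
    induction X, Y, f using hom_ind with
    | zero => simp only [zero_homComp]
    | of a X Y f =>
      induction Z, g using hom_ind_source with
      | zero => simp only [homComp_zero, zero_homComp]
      | of Z g =>
        induction W, h using hom_ind_source with
        | zero => simp only [homComp_zero]
        | of W h => simp only [homComp_ofHom, Category.assoc]

/-- The inclusion of a summand, on morphisms. -/
def of {a : ι} {X Y : A a} (f : X ⟶ Y) : (⟨a, X⟩ : Tot A) ⟶ ⟨a, Y⟩ := ofHom f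

theorem of_id {a : ι} (X : A a) : (of (𝟙 X) : (⟨a, X⟩ : Tot A) ⟶ ⟨a, X⟩) = 𝟙 _ := rfl

theorem of_comp {a : ι} {X Y Z : A a} (f : X ⟶ Y) (g : Y ⟶ Z) : of (f ≫ g) = of f ≫ of g :=
  (homComp_ofHom f g).symm

theorem exists_of {a : ι} {X Y : A a} (f : (⟨a, X⟩ : Tot A) ⟶ ⟨a, Y⟩) : ∃ f', of f' = f :=
  ⟨f ⟨rfl⟩, rfl⟩

instance (X Y : Tot A) : AddCommGroup (X ⟶ Y) := inferInstanceAs (AddCommGroup (Hom X Y))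

instance (X Y : Tot A) : Module k (X ⟶ Y) := inferInstanceAs (Module k (Hom X Y))

theorem of_add {a : ι} {X Y : A a} (f g : X ⟶ Y) : of (f + g) = of f + of g := rfl

theorem of_smul {a : ι} {X Y : A a} (r : k) (f : X ⟶ Y) : of (r • f) = r • of f := rfl

theorem eq_zero {X Y : Tot A} (h : X.deg ≠ Y.deg) (f : X ⟶ Y) : f = 0 := hom_eq_zero h f

@[elab_as_elim]
theorem ind {P : ∀ X Y : Tot A, (X ⟶ Y) → Prop} (zero : ∀ X Y, P X Y 0)
    (of : ∀ (a : ι) (X Y : A a) (f : X ⟶ Y), P ⟨a, X⟩ ⟨a, Y⟩ (of f)) (X Y : Tot A)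
    (f : X ⟶ Y) : P X Y f := hom_ind zero of X Y f

@[elab_as_elim]
theorem ind_source {a : ι} {X : A a} {P : ∀ Y : Tot A, ((⟨a, X⟩ : Tot A) ⟶ Y) → Prop}
    (zero : ∀ Y, P Y 0) (of : ∀ (Y : A a) (f : X ⟶ Y), P ⟨a, Y⟩ (of f)) (Y : Tot A)
    (f : (⟨a, X⟩ : Tot A) ⟶ Y) : P Y f := hom_ind_source zero of Y f

@[elab_as_elim]
theorem ind₂ {P : ∀ X Y : Tot A, (X ⟶ Y) → (X ⟶ Y) → Prop} (zero : ∀ X Y, P X Y 0 0)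
    (of : ∀ (a : ι) (X Y : A a) (f g : X ⟶ Y), P ⟨a, X⟩ ⟨a, Y⟩ (of f) (of g)) (X Y : Tot A)
    (f g : X ⟶ Y) : P X Y f g := hom_ind₂ zero of X Y f g

theorem zero_comp' {X Y Z : Tot A} (g : Y ⟶ Z) : (0 : X ⟶ Y) ≫ g = 0 := zero_homComp g

theorem comp_zero' {X Y Z : Tot A} (f : X ⟶ Y) : f ≫ (0 : Y ⟶ Z) = 0 := homComp_zero f

instance : Preadditive (Tot A) where
  add_comp X Y Z f f' g := by
    induction X, Y, f, f' using ind₂ with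
    | zero => simp only [zero_comp', add_zero]
    | of a X Y f f' =>
      induction Z, g using ind_source with
      | zero => simp only [comp_zero', add_zero]
      | of Z g => rw [← of_add, ← of_comp, ← of_comp, ← of_comp, Preadditive.add_comp, of_add]
  comp_add X Y Z f g g' := by
    induction Y, Z, g, g' using ind₂ with
    | zero => simp only [comp_zero', add_zero]
    | of a Y Z g g' =>
      obtain ⟨b, X⟩ := X
      by_cases h : b = a
      · subst h
        obtain ⟨f, rfl⟩ := exists_of f
        rw [← of_add, ← of_comp, ← of_comp, ← of_comp, Preadditive.comp_add, of_add]
      · rw [eq_zero h f]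
        simp only [zero_comp', add_zero]

instance : Linear k (Tot A) where
  smul_comp X Y Z r f g := by
    induction X, Y, f using ind with
    | zero => simp only [smul_zero, zero_comp']
    | of a X Y f =>
      induction Z, g using ind_source with
      | zero => simp only [smul_zero, comp_zero']
      | of Z g => rw [← of_smul, ← of_comp, ← of_comp, Linear.smul_comp, of_smul]
  comp_smul X Y Z f r g := by
    induction X, Y, f using ind with
    | zero => simp only [smul_zero, zero_comp']
    | of a X Y f =>
      induction Z, g using ind_source with
      | zero => simp only [smul_zero, comp_zero']
      | of Z g => rw [← of_smul, ← of_comp, ← of_comp, Linear.comp_smul, of_smul]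

/-- The inclusion of a summand. -/
def incl (A : ι → LinCat.{w, v, u} k) (a : ι) : A a ⥤ Tot A where
  obj X := ⟨a, X⟩
  map f := of f
  map_id _ := rfl
  map_comp f g := of_comp f g

instance (a : ι) : (incl A a).Additive where

instance (a : ι) : (incl A a).Linear k where

section Lift

variable {C : Type*} [Category C] [Preadditive C] (K : ∀ a, A a ⥤ C)

/-- The action on morphisms of the functor out of the coproduct, when the indices agree. -/
def liftAux {a b : ι} (h : a = b) (X : A a) (Y : A b) (f : (⟨a, X⟩ : Tot A) ⟶ ⟨b, Y⟩) :
    (K a).obj X ⟶ (K b).obj Y := by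
  subst h
  exact (K a).map (f ⟨rfl⟩)

open scoped Classical in
/-- The action on morphisms of the functor out of the coproduct. -/
def liftMap {X Y : Tot A} (f : X ⟶ Y) : (K X.deg).obj X.obj ⟶ (K Y.deg).obj Y.obj :=
  if h : X.deg = Y.deg then liftAux K h X.obj Y.obj f else 0

theorem liftMap_of {a : ι} {X Y : A a} (f : X ⟶ Y) : liftMap K (of f) = (K a).map f :=
  dif_pos rfl

theorem liftMap_zero [∀ a, (K a).Additive] (X Y : Tot A) : liftMap K (0 : X ⟶ Y) = 0 := by
  obtain ⟨a, X⟩ := X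
  obtain ⟨b, Y⟩ := Y
  by_cases h : a = b
  · subst h
    exact (liftMap_of K (0 : X ⟶ Y)).trans ((K a).map_zero X Y)
  · exact dif_neg h

variable [∀ a, (K a).Additive]

/-- The functor out of the coproduct given by additive functors on the summands. -/
def lift : Tot A ⥤ C where
  obj X := (K X.deg).obj X.obj
  map f := liftMap K f
  map_id X := (liftMap_of K (𝟙 X.obj)).trans ((K X.deg).map_id X.obj)
  map_comp {X Y Z} f g := by
    induction X, Y, f using ind with
    | zero => simp only [zero_comp, liftMap_zero]
    | of a X Y f =>
      induction Z, g using ind_source with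
      | zero => simp only [comp_zero, liftMap_zero]
      | of Z g => rw [← of_comp, liftMap_of, liftMap_of, liftMap_of, Functor.map_comp]

@[simp]
theorem lift_map_of {a : ι} {X Y : A a} (f : X ⟶ Y) : (lift K).map (of f) = (K a).map f :=
  liftMap_of K f

instance : (lift K).Additive where
  map_add {X Y} f g := by
    induction X, Y, f, g using ind₂ with
    | zero X Y =>
      have h : (lift K).map (0 : X ⟶ Y) = 0 := liftMap_zero K X Y
      rw [add_zero, h, add_zero]
    | of a X Y f g =>
      rw [← of_add, lift_map_of, lift_map_of, lift_map_of, Functor.map_add]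
      rfl

instance lift_linear [Linear k C] [∀ a, (K a).Linear k] : (lift K).Linear k where
  map_smul {X Y} f r := by
    induction X, Y, f using ind with
    | zero => rw [smul_zero, Functor.map_zero, smul_zero]
    | of a X Y f =>
      rw [← of_smul, lift_map_of, lift_map_of, Functor.map_smul]
      rfl

theorem lift_faithful [∀ a, (K a).Faithful] : (lift K).Faithful where
  map_injective {X Y} f g h := by
    induction X, Y, f, g using ind₂ with
    | zero => rfl
    | of a X Y f g =>
      rw [lift_map_of, lift_map_of] at h
      rw [(K a).map_injective h]

/-- Inside one summand a preimage comes from fullness of `K a`. Between different summands `0` is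
the only candidate, and `hK` says that it suffices. -/
theorem lift_full [∀ a, (K a).Full]
    (hK : ∀ {a b : ι}, a ≠ b → ∀ (X : A a) (Y : A b) (f : (K a).obj X ⟶ (K b).obj Y), f = 0) :
    (lift K).Full where
  map_surjective {X Y} f := by
    obtain ⟨a, X⟩ := X
    obtain ⟨b, Y⟩ := Y
    by_cases h : a = b
    · subst h
      obtain ⟨g, hg⟩ := (K a).map_surjective f
      exact ⟨of g, (lift_map_of K g).trans hg⟩
    · exact ⟨0, (Functor.map_zero _ _ _).trans (hK h X Y f).symm⟩

end Lift

/-- A natural transformation from a functor out of the coproduct, from its components on the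
summands. -/
def natMk {C : Type*} [Category C] [Preadditive C] {F F' : Tot A ⥤ C} [F.Additive] [F'.Additive]
    (t : ∀ X, F.obj X ⟶ F'.obj X)
    (ht : ∀ {a : ι} {X Y : A a} (f : X ⟶ Y), F.map (of f) ≫ t ⟨a, Y⟩ = t ⟨a, X⟩ ≫ F'.map (of f)) :
    F ⟶ F' where
  app := t
  naturality X Y f := by
    induction X, Y, f using ind with
    | zero => simp only [Functor.map_zero, comp_zero, zero_comp]
    | of a X Y f => exact ht f

end Tot
end Coproduct

/-! ### The monoidal structure on the coproduct of the components of a monoidale -/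

namespace LinCat.Bilin

variable {k : Type w} [CommRing k] {A B C : LinCat.{w, v, u} k} (T : Bilin A B C)

theorem map_zero_left {X X' : A} {Y Y' : B} (g : Y ⟶ Y') : T.map (0 : X ⟶ X') g = 0 := by
  have h := T.map_add_left (0 : X ⟶ X') 0 g
  rwa [add_zero, left_eq_add] at h

theorem map_zero_right {X X' : A} {Y Y' : B} (f : X ⟶ X') : T.map f (0 : Y ⟶ Y') = 0 := by
  have h := T.map_add_right f (0 : Y ⟶ Y') 0
  rwa [add_zero, left_eq_add] at h

end LinCat.Bilin

namespace Monoidale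

variable {G : Type u} [Group G] {k : Type w} [CommRing k]

/-- The coproduct of the components of a monoidale. -/
abbrev Total (M : Monoidale.{w, v, u} G k) := Tot fun a : G => M.ps.at_ a

noncomputable section TotalMonoidal

namespace Total

variable {M : Monoidale.{w, v, u} G k}

/-- The tensor product of objects of the coproduct. -/
abbrev tensObj (X Y : M.Total) : M.Total := ⟨X.deg * Y.deg, (M.tensor rfl).obj X.obj Y.obj⟩

/-- The tensor product of morphisms of the coproduct, when the indices agree. -/
def tensHomAux {a a' b b' : G} (h : a = a') (h' : b = b') (X : M.ps.at_ a) (X' : M.ps.at_ a')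
    (Y : M.ps.at_ b) (Y' : M.ps.at_ b') (f : (⟨a, X⟩ : M.Total) ⟶ ⟨a', X'⟩)
    (g : (⟨b, Y⟩ : M.Total) ⟶ ⟨b', Y'⟩) : tensObj (M := M) ⟨a, X⟩ ⟨b, Y⟩ ⟶ tensObj ⟨a', X'⟩ ⟨b', Y'⟩ := by
  subst h h'
  exact Tot.of ((M.tensor rfl).map (f ⟨rfl⟩) (g ⟨rfl⟩))

open scoped Classical in
/-- The tensor product of morphisms of the coproduct. -/
def tensHom {X X' Y Y' : M.Total} (f : X ⟶ X') (g : Y ⟶ Y') : tensObj X Y ⟶ tensObj X' Y' :=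
  if h : X.deg = X'.deg ∧ Y.deg = Y'.deg then
    tensHomAux h.1 h.2 X.obj X'.obj Y.obj Y'.obj f g
  else 0

theorem tensHom_of {a b : G} {X X' : M.ps.at_ a} {Y Y' : M.ps.at_ b} (f : X ⟶ X') (g : Y ⟶ Y') :
    tensHom (M := M) (Tot.of f) (Tot.of g) = Tot.of ((M.tensor rfl).map f g) :=
  dif_pos ⟨rfl, rfl⟩

theorem zero_tensHom (X X' : M.Total) {Y Y' : M.Total} (g : Y ⟶ Y') :
    tensHom (0 : X ⟶ X') g = 0 := by
  obtain ⟨a, X⟩ := X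
  obtain ⟨a', X'⟩ := X'
  obtain ⟨b, Y⟩ := Y
  obtain ⟨b', Y'⟩ := Y'
  by_cases h : a = a' ∧ b = b'
  · obtain ⟨rfl, rfl⟩ := h
    refine (tensHom_of (0 : X ⟶ X') (g ⟨rfl⟩)).trans ?_
    rw [LinCat.Bilin.map_zero_left]
    rfl
  · exact dif_neg h

theorem tensHom_zero {X X' : M.Total} (f : X ⟶ X') (Y Y' : M.Total) :
    tensHom f (0 : Y ⟶ Y') = 0 := by
  obtain ⟨a, X⟩ := X
  obtain ⟨a', X'⟩ := X'
  obtain ⟨b, Y⟩ := Y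
  obtain ⟨b', Y'⟩ := Y'
  by_cases h : a = a' ∧ b = b'
  · obtain ⟨rfl, rfl⟩ := h
    refine (tensHom_of (f ⟨rfl⟩) (0 : Y ⟶ Y')).trans ?_
    rw [LinCat.Bilin.map_zero_right]
    rfl
  · exact dif_neg h

theorem tensHom_id (X Y : M.Total) : tensHom (𝟙 X) (𝟙 Y) = 𝟙 (tensObj X Y) :=
  (tensHom_of (𝟙 X.obj) (𝟙 Y.obj)).trans (congrArg Tot.of ((M.tensor rfl).map_id X.obj Y.obj))

theorem tensHom_comp {X X' X'' Y Y' Y'' : M.Total} (f : X ⟶ X') (f' : X' ⟶ X'') (g : Y ⟶ Y')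
    (g' : Y' ⟶ Y'') : tensHom (f ≫ f') (g ≫ g') = tensHom f g ≫ tensHom f' g' := by
  induction X, X', f using Tot.ind with
  | zero => simp only [zero_comp, zero_tensHom]
  | of a X X' f =>
    induction X'', f' using Tot.ind_source with
    | zero => simp only [comp_zero, zero_tensHom]
    | of X'' f' =>
      induction Y, Y', g using Tot.ind with
      | zero => simp only [zero_comp, tensHom_zero]
      | of b Y Y' g =>
        induction Y'', g' using Tot.ind_source with
        | zero => simp only [comp_zero, tensHom_zero]
        | of Y'' g' =>
          rw [← Tot.of_comp, ← Tot.of_comp, tensHom_of, tensHom_of, tensHom_of,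
            LinCat.Bilin.map_comp, Tot.of_comp]

theorem add_tensHom {X X' Y Y' : M.Total} (f f' : X ⟶ X') (g : Y ⟶ Y') :
    tensHom (f + f') g = tensHom f g + tensHom f' g := by
  induction X, X', f, f' using Tot.ind₂ with
  | zero => simp only [zero_tensHom, add_zero]
  | of a X X' f f' =>
    induction Y, Y', g using Tot.ind with
    | zero => simp only [tensHom_zero, add_zero]
    | of b Y Y' g =>
      rw [← Tot.of_add, tensHom_of, tensHom_of, tensHom_of, LinCat.Bilin.map_add_left]
      rfl

theorem tensHom_add {X X' Y Y' : M.Total} (f : X ⟶ X') (g g' : Y ⟶ Y') :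
    tensHom f (g + g') = tensHom f g + tensHom f g' := by
  induction Y, Y', g, g' using Tot.ind₂ with
  | zero => simp only [tensHom_zero, add_zero]
  | of b Y Y' g g' =>
    induction X, X', f using Tot.ind with
    | zero => simp only [zero_tensHom, add_zero]
    | of a X X' f =>
      rw [← Tot.of_add, tensHom_of, tensHom_of, tensHom_of, LinCat.Bilin.map_add_right]
      rfl

theorem smul_tensHom {X X' Y Y' : M.Total} (r : k) (f : X ⟶ X') (g : Y ⟶ Y') :
    tensHom (r • f) g = r • tensHom f g := by
  induction X, X', f using Tot.ind with
  | zero => simp only [smul_zero, zero_tensHom]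
  | of a X X' f =>
    induction Y, Y', g using Tot.ind with
    | zero => simp only [smul_zero, tensHom_zero]
    | of b Y Y' g =>
      rw [← Tot.of_smul, tensHom_of, tensHom_of, LinCat.Bilin.map_smul_left]
      rfl

theorem tensHom_smul {X X' Y Y' : M.Total} (r : k) (f : X ⟶ X') (g : Y ⟶ Y') :
    tensHom f (r • g) = r • tensHom f g := by
  induction X, X', f using Tot.ind with
  | zero => simp only [smul_zero, zero_tensHom]
  | of a X X' f =>
    induction Y, Y', g using Tot.ind with
    | zero => simp only [smul_zero, tensHom_zero]
    | of b Y Y' g =>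
      rw [← Tot.of_smul, tensHom_of, tensHom_of, LinCat.Bilin.map_smul_right]
      rfl

/-- One object lies over `c`, the other over the literal product `a * b`. Keeping `h` free allows
the axioms of a monoidale, which are stated for arbitrary names of the products, to be moved to the
coproduct. -/
theorem tens_eq {a b c : G} (h : a * b = c) (X : M.ps.at_ a) (Y : M.ps.at_ b) :
    (⟨c, (M.tensor h).obj X Y⟩ : M.Total) = tensObj ⟨a, X⟩ ⟨b, Y⟩ := by
  subst h; rfl

/-- The tensor product of homogeneous objects, computed in the component of the product of their
degrees. -/
def tens {a b c : G} (h : a * b = c) (X : M.ps.at_ a) (Y : M.ps.at_ b) :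
    (⟨c, (M.tensor h).obj X Y⟩ : M.Total) ≅ tensObj ⟨a, X⟩ ⟨b, Y⟩ := eqToIso (tens_eq h X Y)

theorem tens_rfl {a b : G} (X : M.ps.at_ a) (Y : M.ps.at_ b) : tens (M := M) (rfl : a * b = _) X Y = Iso.refl _ :=
  rfl

theorem tens_natural {a b c : G} (h : a * b = c) {X X' : M.ps.at_ a} {Y Y' : M.ps.at_ b}
    (f : X ⟶ X') (g : Y ⟶ Y') :
    Tot.of ((M.tensor h).map f g) ≫ (tens h X' Y').hom =
      (tens h X Y).hom ≫ tensHom (Tot.of f) (Tot.of g) := by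
  subst h
  rw [tensHom_of]
  exact (Category.comp_id _).trans (Category.id_comp _).symm

/-- The associativity constraint of the coproduct. -/
def tensAssoc (X Y Z : M.Total) : tensObj (tensObj X Y) Z ≅ tensObj X (tensObj Y Z) :=
  (Tot.incl _ _).mapIso (M.assoc rfl rfl rfl (mul_assoc _ _ _).symm X.obj Y.obj Z.obj) ≪≫
    tens (M := M) (mul_assoc _ _ _).symm X.obj ((M.tensor rfl).obj Y.obj Z.obj)

/-- A homogeneous object, regarded as an object of the coproduct. -/
abbrev tot {a : G} (X : M.ps.at_ a) : M.Total := ⟨a, X⟩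

/-- `tensAssoc` is defined from one choice of names for the degrees; this describes it for every
choice. After substitution, the only comparison that is not an identity is the one for `h₄`, and it
is the one contained in `tensAssoc`. -/
theorem tensAssoc_hom {a b c ab bc abc : G} (h₁ : a * b = ab) (h₂ : ab * c = abc) (h₃ : b * c = bc)
    (h₄ : a * bc = abc) (X : M.ps.at_ a) (Y : M.ps.at_ b) (Z : M.ps.at_ c) :
    Tot.of (M.assoc h₁ h₂ h₃ h₄ X Y Z).hom ≫ (tens h₄ X ((M.tensor h₃).obj Y Z)).hom ≫
        tensHom (𝟙 (tot X)) (tens h₃ Y Z).hom =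
      (tens h₂ ((M.tensor h₁).obj X Y) Z).hom ≫ tensHom (tens h₁ X Y).hom (𝟙 (tot Z)) ≫
        (tensAssoc (tot X) (tot Y) (tot Z)).hom := by
  subst h₁ h₂ h₃
  rw [tens_rfl, tens_rfl, tens_rfl]
  refine (congrArg (fun r => _ ≫ _ ≫ r) (tensHom_id _ _)).trans ?_
  refine Eq.trans ?_ (congrArg (fun r => _ ≫ r ≫ _) (tensHom_id _ _).symm)
  refine (congrArg (fun r => _ ≫ r) (Category.comp_id _)).trans ?_
  exact ((Category.id_comp _).trans (Category.id_comp _)).symm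

/-- The left unit constraint of the coproduct. -/
def tensLeft (X : M.Total) : tensObj (tot M.unit) X ≅ X :=
  (tens (one_mul _) M.unit X.obj).symm ≪≫ (Tot.incl _ _).mapIso (M.left (one_mul _) X.obj)

/-- The right unit constraint of the coproduct. -/
def tensRight (X : M.Total) : tensObj X (tot M.unit) ≅ X :=
  (tens (mul_one _) X.obj M.unit).symm ≪≫ (Tot.incl _ _).mapIso (M.right (mul_one _) X.obj)

theorem tensLeft_hom {a : G} (h : 1 * a = a) (X : M.ps.at_ a) :
    (tens h M.unit X).hom ≫ (tensLeft (tot X)).hom = Tot.of (M.left h X).hom :=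
  (tens h M.unit X).hom_inv_id_assoc _

theorem tensRight_hom {a : G} (h : a * 1 = a) (X : M.ps.at_ a) :
    (tens h X M.unit).hom ≫ (tensRight (tot X)).hom = Tot.of (M.right h X).hom :=
  (tens h X M.unit).hom_inv_id_assoc _

instance : MonoidalCategoryStruct M.Total where
  tensorObj := tensObj
  tensorHom := tensHom
  whiskerLeft X _ _ f := tensHom (𝟙 X) f
  whiskerRight f X := tensHom f (𝟙 X)
  tensorUnit := tot M.unit
  associator := tensAssoc
  leftUnitor := tensLeft
  rightUnitor := tensRight

theorem tensAssoc_natural {X X' Y Y' Z Z' : M.Total} (f : X ⟶ X') (g : Y ⟶ Y') (h : Z ⟶ Z') :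
    tensHom (tensHom f g) h ≫ (tensAssoc X' Y' Z').hom =
      (tensAssoc X Y Z).hom ≫ tensHom f (tensHom g h) := by
  induction X, X', f using Tot.ind with
  | zero => simp only [zero_tensHom, zero_comp, comp_zero]
  | of a X X' f =>
    induction Y, Y', g using Tot.ind with
    | zero => simp only [tensHom_zero, zero_tensHom, zero_comp, comp_zero]
    | of b Y Y' g =>
      induction Z, Z', h using Tot.ind with
      | zero => simp only [tensHom_zero, zero_comp, comp_zero]
      | of c Z Z' h =>
        rw [tensHom_of, tensHom_of]
        have e := congrArg (Tot.of (A := fun a => M.ps.at_ a)) (M.assoc_natural rfl rfl rfl (mul_assoc a b c).symm f g h)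
        rw [Tot.of_comp, Tot.of_comp] at e
        have e' := tens_natural (M := M) (mul_assoc a b c).symm f ((M.tensor rfl).map g h)
        refine ((reassoc_of% e) _).trans ?_
        exact (congrArg (fun r => _ ≫ r) (e'.trans
          (congrArg (fun r => _ ≫ r) (congrArg _ (tensHom_of g h).symm)))).trans
            (Category.assoc _ _ _).symm

/-- This and `tensAssoc_hom_right` are `tensAssoc_hom` without the comparisons that are identities.
They serve the two associators of the pentagon in which the degrees of the products agree only up to
reassociation. -/
theorem tensAssoc_hom_left {a b c ab : G} (h₁ : a * b = ab) (h₄ : a * (b * c) = ab * c)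
    (X : M.ps.at_ a) (Y : M.ps.at_ b) (Z : M.ps.at_ c) :
    Tot.of (M.assoc h₁ rfl rfl h₄ X Y Z).hom ≫ (tens h₄ X ((M.tensor rfl).obj Y Z)).hom =
      tensHom (tens h₁ X Y).hom (𝟙 (tot Z)) ≫ (tensAssoc (tot X) (tot Y) (tot Z)).hom := by
  subst h₁
  exact ((tensHom_id (M := M) (tensObj (tot X) (tot Y)) (tot Z) =≫ _).trans (Category.id_comp _)).symm

theorem tensAssoc_hom_right {a b c bc abc : G} (h₂ : a * b * c = abc) (h₃ : b * c = bc)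
    (h₄ : a * bc = abc) (X : M.ps.at_ a) (Y : M.ps.at_ b) (Z : M.ps.at_ c) :
    Tot.of (M.assoc rfl h₂ h₃ h₄ X Y Z).hom ≫ (tens h₄ X ((M.tensor h₃).obj Y Z)).hom ≫
        tensHom (𝟙 (tot X)) (tens h₃ Y Z).hom =
      (tens h₂ ((M.tensor rfl).obj X Y) Z).hom ≫ (tensAssoc (tot X) (tot Y) (tot Z)).hom := by
  subst h₂ h₃
  refine (congrArg (fun r => _ ≫ _ ≫ r) (tensHom_id _ _)).trans ?_
  refine (congrArg (fun r => _ ≫ r) (Category.comp_id _)).trans ?_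
  exact (Category.id_comp _).symm

theorem tensHom_comp_id {X X' X'' : M.Total} (f : X ⟶ X') (f' : X' ⟶ X'') (Y : M.Total) :
    tensHom f (𝟙 Y) ≫ tensHom f' (𝟙 Y) = tensHom (f ≫ f') (𝟙 Y) := by
  rw [← tensHom_comp, Category.comp_id]

theorem id_tensHom_comp {X X' X'' : M.Total} (f : X ⟶ X') (f' : X' ⟶ X'') (Y : M.Total) :
    tensHom (𝟙 Y) f ≫ tensHom (𝟙 Y) f' = tensHom (𝟙 Y) (f ≫ f') := by
  rw [← tensHom_comp, Category.comp_id]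

/-- In the component of degree `a * b * c * d` this is the pentagon of `M`. What remains is to slide
the comparisons `tens` past the associators, by naturality and by the two preceding descriptions of
`tensAssoc`. -/
theorem tens_pentagon (W X Y Z : M.Total) :
    tensHom (tensAssoc W X Y).hom (𝟙 Z) ≫ (tensAssoc W (tensObj X Y) Z).hom ≫
        tensHom (𝟙 W) (tensAssoc X Y Z).hom =
      (tensAssoc (tensObj W X) Y Z).hom ≫ (tensAssoc W X (tensObj Y Z)).hom := by
  obtain ⟨a, W⟩ := W
  obtain ⟨b, X⟩ := X
  obtain ⟨c, Y⟩ := Y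
  obtain ⟨d, Z⟩ := Z
  have h₅ : a * (b * c) = a * b * c := (mul_assoc a b c).symm
  have h₇ : b * (c * d) = b * c * d := (mul_assoc b c d).symm
  have h₉ : a * (b * c * d) = a * b * c * d := by simp only [mul_assoc]
  have h₁₀ : a * b * (c * d) = a * b * c * d := by simp only [mul_assoc]
  have e := congrArg Tot.of (M.pentagon rfl rfl rfl rfl h₅ rfl h₇ rfl h₉ h₁₀ W X Y Z)
  simp only [Tot.of_comp] at e
  have e₂ := tensAssoc_hom_left (M := M) h₅ h₉ W ((M.tensor rfl).obj X Y) Z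
  have e₅ := tensAssoc_hom_right (M := M) h₁₀ h₇ h₉ W X ((M.tensor rfl).obj Y Z)
  have n := tens_natural (M := M) h₉ (𝟙 W) (M.assoc rfl rfl rfl h₇ X Y Z).hom
  calc
    _ = tensHom (Tot.of (M.assoc rfl rfl rfl h₅ W X Y).hom) (𝟙 (tot Z)) ≫
          (tensHom (tens h₅ W ((M.tensor rfl).obj X Y)).hom (𝟙 (tot Z)) ≫
          (tensAssoc (tot W) (tot ((M.tensor rfl).obj X Y)) (tot Z)).hom) ≫
          (tensHom (𝟙 (tot W)) (Tot.of (M.assoc rfl rfl rfl h₇ X Y Z).hom) ≫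
            tensHom (𝟙 (tot W)) (tens h₇ X ((M.tensor rfl).obj Y Z)).hom) := by
        have i : tensHom (Tot.of (M.assoc rfl rfl rfl h₅ W X Y).hom) (𝟙 (tot Z)) ≫
            tensHom (tens h₅ W ((M.tensor rfl).obj X Y)).hom (𝟙 (tot Z)) =
              tensHom (tensAssoc (tot W) (tot X) (tot Y)).hom (𝟙 (tot Z)) := tensHom_comp_id _ _ _
        rw [id_tensHom_comp, Category.assoc, reassoc_of% i]
        rfl
    -- The comparisons now stand at the right end, and the bracket is the longer side of the
    -- pentagon of `M`.
    _ = (Tot.of ((M.tensor rfl).map (M.assoc rfl rfl rfl h₅ W X Y).hom (𝟙 Z)) ≫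
          Tot.of (M.assoc h₅ rfl rfl h₉ W ((M.tensor rfl).obj X Y) Z).hom ≫
          Tot.of ((M.tensor h₉).map (𝟙 W) (M.assoc rfl rfl rfl h₇ X Y Z).hom)) ≫
          (tens h₉ W _).hom ≫ tensHom (𝟙 (tot W)) (tens h₇ X ((M.tensor rfl).obj Y Z)).hom := by
        rw [← e₂, ← tensHom_of]
        simp only [Category.assoc]
        rw [reassoc_of% n]
        rfl
    _ = _ := by
        rw [e, Category.assoc, e₅]
        exact (Category.assoc _ _ _).symm

/-- The triangle of `M` is stated with `X ⊗ I` in degree `a`, whereas in the coproduct it lies over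
`a * 1`. Inserting `tens (mul_one a)` and its inverse moves between the two, and then the axiom of
`M` applies. -/
theorem tens_triangle (X Y : M.Total) :
    (tensAssoc X (tot M.unit) Y).hom ≫ tensHom (𝟙 X) (tensLeft Y).hom =
      tensHom (tensRight X).hom (𝟙 Y) := by
  obtain ⟨a, X⟩ := X
  obtain ⟨b, Y⟩ := Y
  have e := congrArg Tot.of (M.triangle (mul_one a) rfl (one_mul b) X Y)
  rw [Tot.of_comp] at e
  have e₁ := tensAssoc_hom (M := M) (mul_one a) rfl (one_mul b) rfl X M.unit Y
  have i : tensHom (tens (mul_one a) X M.unit).inv (𝟙 (tot Y)) ≫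
      tensHom (tens (mul_one a) X M.unit).hom (𝟙 (tot Y)) = 𝟙 _ := by
    rw [tensHom_comp_id, Iso.inv_hom_id, tensHom_id]
  calc
    _ = tensHom (tens (mul_one a) X M.unit).inv (𝟙 (tot Y)) ≫
        ((tens rfl ((M.tensor (mul_one a)).obj X M.unit) Y).hom ≫
          tensHom (tens (mul_one a) X M.unit).hom (𝟙 (tot Y)) ≫
          (tensAssoc (tot X) (tot M.unit) (tot Y)).hom) ≫
            tensHom (𝟙 (tot X)) (tensLeft (tot Y)).hom := by
        rw [tens_rfl]
        erw [Category.id_comp]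
        rw [Category.assoc, reassoc_of% i]
    _ = tensHom (tens (mul_one a) X M.unit).inv (𝟙 (tot Y)) ≫
        Tot.of (M.assoc (mul_one a) rfl (one_mul b) rfl X M.unit Y).hom ≫
          tensHom (𝟙 (tot X)) (Tot.of (M.left (one_mul b) Y).hom) := by
        rw [← e₁, tens_rfl]
        erw [Category.id_comp]
        rw [Category.assoc, id_tensHom_comp, tensLeft_hom]
    _ = tensHom (tens (mul_one a) X M.unit).inv (𝟙 (tot Y)) ≫
          tensHom (Tot.of (M.right (mul_one a) X).hom) (𝟙 (tot Y)) := by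
        congr 1
        rw [← Tot.of_id, ← Tot.of_id, tensHom_of, tensHom_of]
        exact e
    _ = _ := by
        rw [tensHom_comp_id]
        rfl

instance : MonoidalCategory M.Total :=
  MonoidalCategory.ofTensorHom
    (id_tensorHom_id := tensHom_id)
    (id_tensorHom := fun _ _ _ _ => rfl)
    (tensorHom_id := fun _ _ => rfl)
    (tensorHom_comp_tensorHom := fun f g f' g' => (tensHom_comp f f' g g').symm)
    (associator_naturality := tensAssoc_natural)
    (leftUnitor_naturality := fun {X Y} f => by
      induction X, Y, f using Tot.ind with
      | zero =>
        refine (congrArg (fun r => r ≫ _) (tensHom_zero _ _ _)).trans ?_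
        rw [zero_comp, comp_zero]
      | of a X Y f =>
        have e := congrArg Tot.of (M.left_natural (one_mul a) f)
        rw [Tot.of_comp, Tot.of_comp] at e
        have n := tens_natural (M := M) (one_mul a) (𝟙 M.unit) f
        rw [← cancel_epi (tens (one_mul a) M.unit X).hom]
        refine (((reassoc_of% n) _).symm.trans ?_).trans ((reassoc_of% tensLeft_hom (M := M)) _ _ _).symm
        exact (congrArg (fun r => _ ≫ r) (tensLeft_hom (one_mul a) Y)).trans e)
    (rightUnitor_naturality := fun {X Y} f => by
      induction X, Y, f using Tot.ind with
      | zero =>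
        refine (congrArg (fun r => r ≫ _) (zero_tensHom _ _ _)).trans ?_
        rw [zero_comp, comp_zero]
      | of a X Y f =>
        have e := congrArg Tot.of (M.right_natural (mul_one a) f)
        rw [Tot.of_comp, Tot.of_comp] at e
        have n := tens_natural (M := M) (mul_one a) f (𝟙 M.unit)
        rw [← cancel_epi (tens (mul_one a) X M.unit).hom]
        refine (((reassoc_of% n) _).symm.trans ?_).trans ((reassoc_of% tensRight_hom (M := M)) _ _ _).symm
        exact (congrArg (fun r => _ ≫ r) (tensRight_hom (mul_one a) Y)).trans e)
    (pentagon := tens_pentagon)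
    (triangle := tens_triangle)

instance : MonoidalPreadditive M.Total where
  whiskerLeft_zero := tensHom_zero _ _ _
  zero_whiskerRight := zero_tensHom _ _ _
  whiskerLeft_add := tensHom_add _
  add_whiskerRight f g := add_tensHom f g _

instance : MonoidalLinear k M.Total where
  whiskerLeft_smul _ _ _ r f := tensHom_smul r _ f
  smul_whiskerRight r _ _ f _ := smul_tensHom r f _

end Total

end TotalMonoidal
end Monoidale

/-! ### The crossing on the coproduct of the components of a pseudofunctor -/

namespace Ps

variable {G : Type u} [Group G] {k : Type w} [CommRing k] (S : Ps.{w, v, u} G k)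

theorem actOne_natural {a : G} (h : 1 * a = a * 1) {X Y : S.at_ a} (f : X ⟶ Y) :
    (S.act 1 h).map f ≫ (S.actOne h Y).hom = (S.actOne h X).hom ≫ f :=
  (S.mapId ⟨⟨a⟩⟩).hom.toNatTrans.naturality f

theorem actMul_natural (g g' : G) {a a' a'' : G} (h : g * a = a' * g) (h' : g' * a' = a'' * g')
    (h'' : g' * g * a = a'' * (g' * g)) {X Y : S.at_ a} (f : X ⟶ Y) :
    (S.act (g' * g) h'').map f ≫ (S.actMul g g' h h' h'' Y).hom =
      (S.actMul g g' h h' h'' X).hom ≫ (S.act g' h').map ((S.act g h).map f) :=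
  (S.mapComp (GAut.ofEl g h) (GAut.ofEl g' h')).hom.toNatTrans.naturality f

theorem actMul_inv_natural (g g' : G) {a a' a'' : G} (h : g * a = a' * g) (h' : g' * a' = a'' * g')
    (h'' : g' * g * a = a'' * (g' * g)) {X Y : S.at_ a} (f : X ⟶ Y) :
    (S.act g' h').map ((S.act g h).map f) ≫ (S.actMul g g' h h' h'' Y).inv =
      (S.actMul g g' h h' h'' X).inv ≫ (S.act (g' * g) h'').map f :=
  (S.mapComp (GAut.ofEl g h) (GAut.ofEl g' h')).inv.toNatTrans.naturality f

/-- The isomorphism between the actions of equal elements. -/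
def actEq {g g' : G} (e : g = g') {a b : G} (h : g * a = b * g) (h' : g' * a = b * g')
    (X : S.at_ a) : (S.act g h).obj X ≅ (S.act g' h').obj X :=
  eqToIso (by subst e; rfl)

/-- The 2-cells of a locally discrete bicategory are equalities, so `S` sends them to transports.
This turns the coherence axioms of the pseudofunctor into equations between morphisms of its values.
-/
theorem map₂_app {g g' : G} {a b : G} (h : g * a = b * g) (h' : g' * a = b * g')
    (t : GAut.ofEl g h ⟶ GAut.ofEl g' h') (e : g = g') (X : S.at_ a) :
    (S.map₂ t).toNatTrans.app X = (S.actEq e h h' X).hom := by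
  subst e
  obtain rfl : t = 𝟙 _ := Subsingleton.elim _ _
  rw [PrelaxFunctor.map₂_id]
  rfl

/-- The associativity axiom `map₂_associator` evaluated at `X`. Associators of `LinCat` have
identity components, so what is left is the cocycle condition, up to the transport between the two
bracketings of the product. -/
theorem actMul_assoc (g g' g'' : G) {a b c d : G} (h : g * a = b * g) (h' : g' * b = c * g')
    (h'' : g'' * c = d * g'') (h₁ : g' * g * a = c * (g' * g)) (h₂ : g'' * g' * b = d * (g'' * g'))
    (h₃ : g'' * (g' * g) * a = d * (g'' * (g' * g))) (h₄ : g'' * g' * g * a = d * (g'' * g' * g))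
    (X : S.at_ a) :
    (S.actMul (g' * g) g'' h₁ h'' h₃ X).hom ≫ (S.act g'' h'').map (S.actMul g g' h h' h₁ X).hom =
      (S.actEq (mul_assoc g'' g' g).symm h₃ h₄ X).hom ≫ (S.actMul g (g'' * g') h h₂ h₄ X).hom ≫
        (S.actMul g' g'' h' h'' h₂ ((S.act g h).obj X)).hom := by
  have e := congrArg (fun t => LinCat.Hom₂.toNatTrans t |>.app X)
    (S.map₂_associator (GAut.ofEl g h) (GAut.ofEl g' h') (GAut.ofEl g'' h''))
  have e' : (S.actEq (mul_assoc g'' g' g).symm h₃ h₄ X).hom =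
      (S.actMul (g' * g) g'' h₁ h'' h₃ X).hom ≫ (S.act g'' h'').map (S.actMul g g' h h' h₁ X).hom ≫
        𝟙 _ ≫ (S.actMul g' g'' h' h'' h₂ ((S.act g h).obj X)).inv ≫
          (S.actMul g (g'' * g') h h₂ h₄ X).inv :=
    (S.map₂_app h₃ h₄ _ (mul_assoc g'' g' g).symm X).symm.trans e
  rw [e', Category.id_comp]
  simp only [Category.assoc, Iso.inv_hom_id_assoc, Iso.inv_hom_id, Category.comp_id]

theorem actMul_assoc_inv (g g' g'' : G) {a b c d : G} (h : g * a = b * g) (h' : g' * b = c * g')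
    (h'' : g'' * c = d * g'') (h₁ : g' * g * a = c * (g' * g)) (h₂ : g'' * g' * b = d * (g'' * g'))
    (h₃ : g'' * (g' * g) * a = d * (g'' * (g' * g))) (h₄ : g'' * g' * g * a = d * (g'' * g' * g))
    (X : S.at_ a) :
    (S.act g'' h'').map (S.actMul g g' h h' h₁ X).inv ≫ (S.actMul (g' * g) g'' h₁ h'' h₃ X).inv ≫
        (S.actEq (mul_assoc g'' g' g).symm h₃ h₄ X).hom =
      (S.actMul g' g'' h' h'' h₂ ((S.act g h).obj X)).inv ≫
        (S.actMul g (g'' * g') h h₂ h₄ X).inv := by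
  have e := S.actMul_assoc g g' g'' h h' h'' h₁ h₂ h₃ h₄ X
  rw [← cancel_epi ((S.act g'' h'').map (S.actMul g g' h h' h₁ X).hom),
    ← cancel_epi (S.actMul (g' * g) g'' h₁ h'' h₃ X).hom, ← Functor.map_comp_assoc, Iso.hom_inv_id,
    CategoryTheory.Functor.map_id, Category.id_comp, reassoc_of% e, Iso.hom_inv_id_assoc,
    Iso.hom_inv_id_assoc, Iso.hom_inv_id, Category.comp_id]

theorem actMul_one (g : G) {a b : G} (h : g * a = b * g) (h₁ : 1 * a = a * 1)
    (h₂ : g * 1 * a = b * (g * 1)) (X : S.at_ a) :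
    (S.actMul 1 g h₁ h h₂ X).hom ≫ (S.act g h).map (S.actOne h₁ X).hom =
      (S.actEq (mul_one g) h₂ h X).hom := by
  have e := congrArg (fun t => LinCat.Hom₂.toNatTrans t |>.app X)
    (S.map₂_left_unitor (GAut.ofEl g h))
  have e' : (S.actEq (mul_one g) h₂ h X).hom = (S.actMul 1 g h₁ h h₂ X).hom ≫
      (S.act g h).map (S.actOne h₁ X).hom ≫ 𝟙 _ :=
    (S.map₂_app h₂ h _ (mul_one g) X).symm.trans e
  rw [e', Category.comp_id]

theorem actMul_one' (g : G) {a b : G} (h : g * a = b * g) (h₁ : 1 * b = b * 1)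
    (h₂ : 1 * g * a = b * (1 * g)) (X : S.at_ a) :
    (S.actMul g 1 h h₁ h₂ X).hom ≫ (S.actOne h₁ ((S.act g h).obj X)).hom =
      (S.actEq (one_mul g) h₂ h X).hom := by
  have e := congrArg (fun t => LinCat.Hom₂.toNatTrans t |>.app X)
    (S.map₂_right_unitor (GAut.ofEl g h))
  have e' : (S.actEq (one_mul g) h₂ h X).hom = (S.actMul g 1 h h₁ h₂ X).hom ≫
      (S.actOne h₁ ((S.act g h).obj X)).hom ≫ 𝟙 _ :=
    (S.map₂_app h₂ h _ (one_mul g) X).symm.trans e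
  rw [e', Category.comp_id]

/-- The coproduct of the components. -/
abbrev Total := Tot fun a : G => S.at_ a

noncomputable section Crossing

/-- This makes `a⁻¹` a morphism from `d` to `a⁻¹ * d * a` in `GAut`: the one along which the
crossing by `a` acts in degree `d`. -/
theorem conj_comm (a d : G) : a⁻¹ * d = a⁻¹ * d * a * a⁻¹ := by group

instance (a : G) {b c : G} (h : a * b = c * a) : (S.act a h).Additive := (S.map (GAut.ofEl a h)).additive

instance (a : G) {b c : G} (h : a * b = c * a) : (S.act a h).Linear k := (S.map (GAut.ofEl a h)).linear

/-- The functor on the coproduct of the components which is the action of `a⁻¹`. -/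
def cross (a : G) : S.Total ⥤ S.Total :=
  Tot.lift fun d => S.act a⁻¹ (conj_comm a d) ⋙ Tot.incl _ (a⁻¹ * d * a)

instance (a : G) : (S.cross a).Additive := by unfold cross; infer_instance

instance (a : G) : (S.cross a).Linear k := by unfold cross; infer_instance

/-- Both `g` and `d'` are free because composites of crossings lead to elements that equal `a⁻¹`,
and to degrees that equal `a⁻¹ * d * a`, only after a computation in the group. -/
theorem cross_eq {a g d d' : G} (hg : g = a⁻¹) (h : g * d = d' * g) (X : S.at_ d) :
    (⟨d', (S.act g h).obj X⟩ : S.Total) = (S.cross a).obj ⟨d, X⟩ := by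
  subst hg
  obtain rfl : d' = a⁻¹ * d * a := by rw [h]; group
  rfl

/-- The image of a homogeneous object under the crossing, computed by an action. -/
def toCross {a g d d' : G} (hg : g = a⁻¹) (h : g * d = d' * g) (X : S.at_ d) :
    (⟨d', (S.act g h).obj X⟩ : S.Total) ≅ (S.cross a).obj ⟨d, X⟩ := eqToIso (S.cross_eq hg h X)

theorem toCross_natural {a g d d' : G} (hg : g = a⁻¹) (h : g * d = d' * g) {X Y : S.at_ d}
    (f : X ⟶ Y) : (S.toCross hg h X).hom ≫ (S.cross a).map (Tot.of f) =
      Tot.of ((S.act g h).map f) ≫ (S.toCross hg h Y).hom := by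
  subst hg
  obtain rfl : d' = a⁻¹ * d * a := by rw [h]; group
  exact (Category.id_comp _).trans ((Tot.lift_map_of _ f).trans (Category.comp_id _).symm)

/-- Absorbs the transports left over by `actMul_assoc_inv`, `actMul_one` and `actMul_one'` into the
comparison with the crossing. -/
theorem toCross_actEq {a g g' d d' : G} (e : g = g') (hg : g = a⁻¹) (hg' : g' = a⁻¹)
    (h : g * d = d' * g) (h' : g' * d = d' * g') (X : S.at_ d) :
    Tot.of (S.actEq e h h' X).hom ≫ (S.toCross hg' h' X).hom = (S.toCross hg h X).hom := by
  subst e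
  exact Category.id_comp _

theorem one_comm (d : G) : 1 * d = d * 1 := (one_mul d).trans (mul_one d).symm

/-- The components of the unit constraint of the crossing. -/
def crossOneApp (X : S.Total) : X ≅ (S.cross 1).obj X :=
  (Tot.incl _ _).mapIso (S.actOne (one_comm _) X.obj).symm ≪≫
    S.toCross inv_one.symm (one_comm _) X.obj

theorem crossOneApp_hom {d : G} (h : 1 * d = d * 1) (X : S.at_ d) :
    (S.crossOneApp ⟨d, X⟩).hom = Tot.of (S.actOne h X).inv ≫ (S.toCross inv_one.symm h X).hom := rfl

theorem crossOneApp_natural {X Y : S.Total} (f : X ⟶ Y) :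
    f ≫ (S.crossOneApp Y).hom = (S.crossOneApp X).hom ≫ (S.cross 1).map f := by
  induction X, Y, f using Tot.ind with
  | zero => simp only [Functor.map_zero, zero_comp, comp_zero]
  | of d X Y f =>
    have e : f ≫ (S.actOne (one_comm _) Y).inv =
        (S.actOne (one_comm _) X).inv ≫ (S.act 1 _).map f := by
      rw [Iso.comp_inv_eq, Category.assoc, S.actOne_natural, Iso.inv_hom_id_assoc]
    rw [S.crossOneApp_hom (one_comm _), S.crossOneApp_hom (one_comm _), Category.assoc,
      toCross_natural, ← Category.assoc, ← Category.assoc, ← Tot.of_comp, ← Tot.of_comp, e]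

/-- The unit constraint of the crossing. -/
def crossOne : 𝟭 S.Total ≅ S.cross 1 :=
  NatIso.ofComponents S.crossOneApp S.crossOneApp_natural

theorem cross_mul_eq {a b c : G} (h : b * a = c) : a⁻¹ * b⁻¹ = c⁻¹ := by rw [← h]; group

theorem conj_conj_comm (a b d : G) :
    a⁻¹ * b⁻¹ * d = a⁻¹ * (b⁻¹ * d * b) * a * (a⁻¹ * b⁻¹) := by group

/-- The components of the composition constraint of the crossing. -/
def crossMulApp {a b c : G} (h : b * a = c) (X : S.Total) :
    (S.cross a).obj ((S.cross b).obj X) ≅ (S.cross c).obj X :=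
  ((S.cross a).mapIso (S.toCross (a := b) rfl (conj_comm b X.deg) X.obj)).symm ≪≫
    (S.toCross (a := a) rfl (conj_comm a _) ((S.act b⁻¹ (conj_comm b X.deg)).obj X.obj)).symm ≪≫
    (Tot.incl _ _).mapIso (S.actMul b⁻¹ a⁻¹ (conj_comm b X.deg) (conj_comm a _)
        (conj_conj_comm a b X.deg) X.obj).symm ≪≫
      S.toCross (cross_mul_eq h) (conj_conj_comm a b X.deg) X.obj

/-- The working description of the composition constraint: for any names of the group elements and
degrees, it is the inverse of `actMul` seen through the comparisons. After substitution, the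
comparisons on the left cancel those in the definition. -/
theorem crossMulApp_hom {a b c g g' d d' d'' : G} (h : b * a = c) (hg : g = b⁻¹) (hg' : g' = a⁻¹)
    (hg'' : g' * g = c⁻¹) (h₁ : g * d = d' * g) (h₂ : g' * d' = d'' * g')
    (h₃ : g' * g * d = d'' * (g' * g)) (X : S.at_ d) :
    (S.toCross hg' h₂ ((S.act g h₁).obj X)).hom ≫ (S.cross a).map (S.toCross hg h₁ X).hom ≫
        (S.crossMulApp h ⟨d, X⟩).hom =
      Tot.of (S.actMul g g' h₁ h₂ h₃ X).inv ≫ (S.toCross hg'' h₃ X).hom := by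
  subst hg hg'
  obtain rfl : d' = b⁻¹ * d * b := by rw [h₁]; group
  obtain rfl : d'' = a⁻¹ * (b⁻¹ * d * b) * a := by rw [h₂]; group
  change _ ≫ ((S.cross a).mapIso (S.toCross (a := b) rfl (conj_comm b d) X)).hom ≫
    ((S.cross a).mapIso (S.toCross (a := b) rfl (conj_comm b d) X)).inv ≫ _ ≫ _ = _
  rw [Iso.hom_inv_id_assoc]
  exact Iso.hom_inv_id_assoc _ _

theorem crossMulApp_natural {a b c : G} (h : b * a = c) {X Y : S.Total} (f : X ⟶ Y) :
    (S.cross a).map ((S.cross b).map f) ≫ (S.crossMulApp h Y).hom =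
      (S.crossMulApp h X).hom ≫ (S.cross c).map f := by
  induction X, Y, f using Tot.ind with
  | zero => simp only [Functor.map_zero, zero_comp, comp_zero]
  | of d X Y f =>
    have e := congrArg (Tot.of (A := fun a => S.at_ a))
      (S.actMul_inv_natural b⁻¹ a⁻¹ (conj_comm b d) (conj_comm a _) (conj_conj_comm a b d) f)
    rw [Tot.of_comp, Tot.of_comp] at e
    have e₁ := fun Z => S.crossMulApp_hom (d := d) h rfl rfl (cross_mul_eq h) (conj_comm b d) (conj_comm a _)
      (conj_conj_comm a b d) Z
    rw [← cancel_epi ((S.cross a).map (S.toCross (a := b) rfl (conj_comm b d) X).hom),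
      ← cancel_epi (S.toCross (a := a) rfl (conj_comm a _)
        ((S.act b⁻¹ (conj_comm b d)).obj X)).hom, reassoc_of% e₁, toCross_natural, ← reassoc_of% e,
      ← e₁, ← Functor.map_comp_assoc, toCross_natural, Functor.map_comp, Category.assoc,
      ← Category.assoc, toCross_natural, Category.assoc]

/-- The composition constraint of the crossing. -/
def crossMul {a b c : G} (h : b * a = c) : S.cross b ⋙ S.cross a ≅ S.cross c :=
  NatIso.ofComponents (S.crossMulApp h) (S.crossMulApp_natural h)

/-- Precomposing with three comparisons `toCross` replaces every constraint by an inverse `actMul`,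
and the identity becomes `actMul_assoc_inv` for `c⁻¹`, `b⁻¹`, `a⁻¹`. The two sides use different
bracketings of the triple product, which `toCross_actEq` reconciles. -/
theorem crossMulApp_assoc {a b c ab bc abc : G} (h₁ : b * a = ab) (h₂ : c * b = bc)
    (h₃ : c * ab = abc) (h₄ : bc * a = abc) (X : S.Total) :
    (S.cross a).map (S.crossMulApp h₂ X).hom ≫ (S.crossMulApp h₄ X).hom =
      (S.crossMulApp h₁ ((S.cross c).obj X)).hom ≫ (S.crossMulApp h₃ X).hom := by
  obtain ⟨d, X⟩ := X
  have k₁ : a⁻¹ * (b⁻¹ * c⁻¹) * d =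
      a⁻¹ * (b⁻¹ * (c⁻¹ * d * c) * b) * a * (a⁻¹ * (b⁻¹ * c⁻¹)) := by group
  have k₂ : a⁻¹ * b⁻¹ * c⁻¹ * d =
      a⁻¹ * (b⁻¹ * (c⁻¹ * d * c) * b) * a * (a⁻¹ * b⁻¹ * c⁻¹) := by group
  have m₁ : a⁻¹ * (b⁻¹ * c⁻¹) = abc⁻¹ := by rw [← h₃, ← h₁]; group
  have m₂ : a⁻¹ * b⁻¹ * c⁻¹ = abc⁻¹ := by rw [← h₃, ← h₁]; group
  have e₁ := S.crossMulApp_hom h₂ rfl rfl (cross_mul_eq h₂) (conj_comm c d) (conj_comm b _)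
    (conj_conj_comm b c d) X
  have e₂ := S.crossMulApp_hom h₄ (cross_mul_eq h₂) rfl m₁ (conj_conj_comm b c d)
    (conj_comm a _) k₁ X
  have e₃ := S.crossMulApp_hom h₁ rfl rfl (cross_mul_eq h₁) (conj_comm b _) (conj_comm a _)
    (conj_conj_comm a b _) ((S.act c⁻¹ (conj_comm c d)).obj X)
  have e₄ := S.crossMulApp_hom h₃ rfl (cross_mul_eq h₁) m₂ (conj_comm c d)
    (conj_conj_comm a b _) k₂ X
  have e₅ := congrArg (Tot.of (A := fun a => S.at_ a)) (S.actMul_assoc_inv c⁻¹ b⁻¹ a⁻¹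
    (conj_comm c d) (conj_comm b _) (conj_comm a _) (conj_conj_comm b c d)
    (conj_conj_comm a b _) k₁ k₂ X)
  simp only [Tot.of_comp] at e₅
  rw [← cancel_epi ((S.cross a).map ((S.cross b).map (S.toCross (a := c) rfl (conj_comm c d) X).hom)),
    ← cancel_epi ((S.cross a).map (S.toCross (a := b) rfl (conj_comm b _)
      ((S.act c⁻¹ (conj_comm c d)).obj X)).hom),
    ← cancel_epi (S.toCross (a := a) rfl (conj_comm a _)
      ((S.act b⁻¹ (conj_comm b _)).obj ((S.act c⁻¹ (conj_comm c d)).obj X))).hom]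
  rw [reassoc_of% S.crossMulApp_natural h₁, reassoc_of% e₃, e₄, ← Functor.map_comp_assoc,
    ← Functor.map_comp_assoc, Category.assoc, e₁, Functor.map_comp, Category.assoc,
    ← Category.assoc, toCross_natural, Category.assoc, e₂,
    ← S.toCross_actEq (mul_assoc _ _ _).symm m₁ m₂ k₁ k₂, reassoc_of% e₅]

theorem cross_map_crossOneApp {a : G} (h : 1 * a = a) (X : S.Total) :
    (S.cross a).map (S.crossOneApp X).hom ≫ (S.crossMulApp h X).hom = 𝟙 ((S.cross a).obj X) := by
  obtain ⟨d, X⟩ := X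
  have k₂ : a⁻¹ * 1 * d = a⁻¹ * d * a * (a⁻¹ * 1) := by group
  have e₁ := S.crossMulApp_hom h inv_one.symm rfl (mul_one _) (one_comm d) (conj_comm a d) k₂ X
  have e₂ := S.actMul_one a⁻¹ (conj_comm a d) (one_comm d) k₂ X
  rw [S.crossOneApp_hom (one_comm d), Functor.map_comp, Category.assoc,
    ← cancel_epi (S.toCross (a := a) rfl (conj_comm a _) X).hom, ← Category.assoc, toCross_natural,
    Category.assoc, e₁, ← S.toCross_actEq (mul_one a⁻¹) (mul_one a⁻¹) rfl k₂ (conj_comm a d), ← e₂,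
    ← Category.assoc, ← Category.assoc, ← Tot.of_comp, ← Tot.of_comp, Category.assoc,
    Iso.inv_hom_id_assoc, ← Functor.map_comp, Iso.inv_hom_id, CategoryTheory.Functor.map_id,
    Tot.of_id, Category.id_comp, Category.comp_id]

theorem crossOneApp_cross {a : G} (h : a * 1 = a) (X : S.Total) :
    (S.crossOneApp ((S.cross a).obj X)).hom ≫ (S.crossMulApp h X).hom = 𝟙 ((S.cross a).obj X) := by
  obtain ⟨d, X⟩ := X
  have k₂ : 1 * a⁻¹ * d = a⁻¹ * d * a * (1 * a⁻¹) := by group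
  have e₁ := S.crossMulApp_hom h rfl inv_one.symm (one_mul _) (conj_comm a d) (one_comm _) k₂ X
  have e₂ := S.actMul_one' a⁻¹ (conj_comm a d) (one_comm _) k₂ X
  rw [← cancel_epi (S.toCross (a := a) rfl (conj_comm a _) X).hom, reassoc_of% S.crossOneApp_natural,
    S.crossOneApp_hom (one_comm _), Category.assoc, e₁,
    ← S.toCross_actEq (one_mul a⁻¹) (one_mul a⁻¹) rfl k₂ (conj_comm a d), ← e₂,
    ← Category.assoc, ← Category.assoc, ← Tot.of_comp, ← Tot.of_comp, Category.assoc,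
    Iso.inv_hom_id_assoc, Iso.inv_hom_id,
    Tot.of_id, Category.id_comp, Category.comp_id]

end Crossing

end Ps

/-! ### The crossing is monoidal, and so are its constraints -/

namespace Monoidale

variable {G : Type u} [Group G] {k : Type w} [CommRing k]

noncomputable section TotalCrossing

namespace Total

variable {M : Monoidale.{w, v, u} G k}

open Ps

/-- The tensor product of homogeneous objects, as an isomorphism. -/
def tensI {a b c : G} (h : a * b = c) (X : M.ps.at_ a) (Y : M.ps.at_ b) :
    (tot ((M.tensor h).obj X Y)) ≅ tot X ⊗ tot Y := tens h X Y

theorem tensI_natural {a b c : G} (h : a * b = c) {X X' : M.ps.at_ a} {Y Y' : M.ps.at_ b}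
    (f : X ⟶ X') (g : Y ⟶ Y') :
    (tensI h X Y).hom ≫ (Tot.of f ⊗ₘ Tot.of g) =
      Tot.of ((M.tensor h).map f g) ≫ (tensI h X' Y').hom :=
  (tens_natural h f g).symm

theorem tensI_assoc {a b c ab bc abc : G} (h₁ : a * b = ab) (h₂ : ab * c = abc) (h₃ : b * c = bc)
    (h₄ : a * bc = abc) (X : M.ps.at_ a) (Y : M.ps.at_ b) (Z : M.ps.at_ c) :
    Tot.of (M.assoc h₁ h₂ h₃ h₄ X Y Z).hom ≫ (tensI h₄ X ((M.tensor h₃).obj Y Z)).hom ≫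
        (𝟙 (tot X) ⊗ₘ (tensI h₃ Y Z).hom) =
      (tensI h₂ ((M.tensor h₁).obj X Y) Z).hom ≫ ((tensI h₁ X Y).hom ⊗ₘ 𝟙 (tot Z)) ≫
        (α_ (tot X) (tot Y) (tot Z)).hom :=
  tensAssoc_hom h₁ h₂ h₃ h₄ X Y Z

theorem tensI_left {a : G} (h : 1 * a = a) (X : M.ps.at_ a) :
    (tensI h M.unit X).hom ≫ (λ_ (tot X)).hom = Tot.of (M.left h X).hom := tensLeft_hom h X

theorem tensI_right {a : G} (h : a * 1 = a) (X : M.ps.at_ a) :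
    (tensI h X M.unit).hom ≫ (ρ_ (tot X)).hom = Tot.of (M.right h X).hom := tensRight_hom h X

theorem conj_mul (a d e : G) : a⁻¹ * d * a * (a⁻¹ * e * a) = a⁻¹ * (d * e) * a := by group

/-- The compatibility of the crossing with tensor products. -/
def crossTensor (a : G) (X Y : M.Total) :
    (M.ps.cross a).obj (X ⊗ Y) ≅ (M.ps.cross a).obj X ⊗ (M.ps.cross a).obj Y :=
  ((M.ps.cross a).mapIso (tensI rfl X.obj Y.obj)).symm ≪≫
  (M.ps.toCross (a := a) rfl (conj_comm a (X.deg * Y.deg)) ((M.tensor rfl).obj X.obj Y.obj)).symm ≪≫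
    (Tot.incl _ _).mapIso (M.tensorAct a⁻¹ rfl (conj_mul a X.deg Y.deg) (conj_comm a X.deg)
      (conj_comm a Y.deg) (conj_comm a (X.deg * Y.deg)) X.obj Y.obj) ≪≫
    tensI (conj_mul a X.deg Y.deg) _ _ ≪≫
      (M.ps.toCross (a := a) rfl (conj_comm a X.deg) X.obj ⊗ᵢ
        M.ps.toCross (a := a) rfl (conj_comm a Y.deg) Y.obj)

/-- The analogue of `crossMulApp_hom`: whatever the names of the degrees, the constraint is
`tensorAct` seen through the comparisons. -/
theorem crossTensor_hom {a g d e c d' e' c' : G} (hg : g = a⁻¹) (h : d * e = c) (h' : d' * e' = c')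
    (ha : g * d = d' * g) (hb : g * e = e' * g) (hc : g * c = c' * g) (X : M.ps.at_ d)
    (Y : M.ps.at_ e) :
    (M.ps.toCross hg hc ((M.tensor h).obj X Y)).hom ≫ (M.ps.cross a).map (tensI h X Y).hom ≫
        (crossTensor a (tot X) (tot Y)).hom =
      Tot.of (M.tensorAct g h h' ha hb hc X Y).hom ≫ (tensI h' _ _).hom ≫
        ((M.ps.toCross hg ha X).hom ⊗ₘ (M.ps.toCross hg hb Y).hom) := by
  subst hg h
  obtain rfl : d' = a⁻¹ * d * a := by rw [ha]; group
  obtain rfl : e' = a⁻¹ * e * a := by rw [hb]; group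
  obtain rfl : c' = a⁻¹ * (d * e) * a := by rw [hc]; group
  change _ ≫ ((M.ps.cross a).mapIso (tensI rfl X Y)).hom ≫
    ((M.ps.cross a).mapIso (tensI rfl X Y)).inv ≫ _ ≫ _ ≫ _ ≫ _ = _
  rw [Iso.hom_inv_id_assoc]
  exact Iso.hom_inv_id_assoc _ _

theorem crossTensor_natural (a : G) {X X' Y Y' : M.Total} (f : X ⟶ X') (g : Y ⟶ Y') :
    (M.ps.cross a).map (f ⊗ₘ g) ≫ (crossTensor a X' Y').hom =
      (crossTensor a X Y).hom ≫ ((M.ps.cross a).map f ⊗ₘ (M.ps.cross a).map g) := by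
  induction X, X', f using Tot.ind with
  | zero =>
    rw [MonoidalPreadditive.zero_tensor, Functor.map_zero, Functor.map_zero,
      MonoidalPreadditive.zero_tensor, zero_comp, comp_zero]
  | of d X X' f =>
    induction Y, Y', g using Tot.ind with
    | zero =>
      rw [MonoidalPreadditive.tensor_zero, Functor.map_zero, Functor.map_zero,
        MonoidalPreadditive.tensor_zero, zero_comp, comp_zero]
    | of e Y Y' g =>
      have e₁ := fun X Y => crossTensor_hom (M := M) (d := d) (e := e) rfl rfl (conj_mul a d e)
        (conj_comm a d) (conj_comm a e) (conj_comm a (d * e)) X Y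
      have e₂ := congrArg (Tot.of (A := fun a => M.ps.at_ a))
        (M.tensorAct_natural a⁻¹ rfl (conj_mul a d e)
        (conj_comm a d) (conj_comm a e) (conj_comm a (d * e)) f g)
      rw [Tot.of_comp, Tot.of_comp] at e₂
      rw [← cancel_epi ((M.ps.cross a).map (tensI rfl X Y).hom),
        ← cancel_epi (M.ps.toCross (a := a) rfl (conj_comm a (d * e)) ((M.tensor rfl).obj X Y)).hom,
        reassoc_of% e₁, ← Functor.map_comp_assoc, tensI_natural, Functor.map_comp, Category.assoc,
        ← Category.assoc, toCross_natural, Category.assoc, e₁, tensorHom_comp_tensorHom,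
        toCross_natural, toCross_natural, reassoc_of% e₂, ← tensorHom_comp_tensorHom,
        ← Category.assoc (tensI _ _ _).hom, tensI_natural, Category.assoc]

theorem conj_one (a : G) : a⁻¹ * 1 = 1 * a⁻¹ := (mul_one _).trans (one_mul _).symm

/-- The compatibility of the crossing with the unit. -/
def crossUnit (a : G) : (M.ps.cross a).obj (𝟙_ M.Total) ≅ 𝟙_ M.Total :=
  (M.ps.toCross (a := a) rfl (conj_one a) M.unit).symm ≪≫
    (Tot.incl _ _).mapIso (M.unitAct a⁻¹ (conj_one a))

theorem crossUnit_hom {a g : G} (hg : g = a⁻¹) (h : g * 1 = 1 * g) :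
    (M.ps.toCross hg h M.unit).hom ≫ (crossUnit a).hom = Tot.of (M.unitAct g h).hom := by
  subst hg
  exact Iso.hom_inv_id_assoc _ _

/-- The axiom `assoc_act` for `a⁻¹`, surrounded by comparison isomorphisms. These are cancelled at
the source, and `tensI_assoc` identifies the associator at both ends. -/
theorem crossTensor_assoc (a : G) (X Y Z : M.Total) :
    (crossTensor a (X ⊗ Y) Z).hom ≫ ((crossTensor a X Y).hom ⊗ₘ 𝟙 ((M.ps.cross a).obj Z)) ≫
        (α_ _ _ _).hom =
      (M.ps.cross a).map (α_ X Y Z).hom ≫ (crossTensor a X (Y ⊗ Z)).hom ≫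
        (𝟙 ((M.ps.cross a).obj X) ⊗ₘ (crossTensor a Y Z).hom) := by
  obtain ⟨d, X⟩ := X
  obtain ⟨e, Y⟩ := Y
  obtain ⟨f, Z⟩ := Z
  change (crossTensor a (tot X ⊗ tot Y) (tot Z)).hom ≫
    ((crossTensor a (tot X) (tot Y)).hom ⊗ₘ 𝟙 ((M.ps.cross a).obj (tot Z))) ≫ (α_ _ _ _).hom =
      (M.ps.cross a).map (α_ (tot X) (tot Y) (tot Z)).hom ≫
        (crossTensor a (tot X) (tot Y ⊗ tot Z)).hom ≫
        (𝟙 ((M.ps.cross a).obj (tot X)) ⊗ₘ (crossTensor a (tot Y) (tot Z)).hom)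
  have h₄ : d * (e * f) = d * e * f := (mul_assoc _ _ _).symm
  have h₂' : a⁻¹ * (d * e) * a * (a⁻¹ * f * a) = a⁻¹ * (d * e * f) * a := by group
  have h₄' : a⁻¹ * d * a * (a⁻¹ * (e * f) * a) = a⁻¹ * (d * e * f) * a := by group
  have c₁ := crossTensor_hom (M := M) (a := a) rfl rfl (conj_mul a d e) (conj_comm a d)
    (conj_comm a e) (conj_comm a (d * e)) X Y
  have c₂ := crossTensor_hom (M := M) (a := a) rfl rfl h₂' (conj_comm a (d * e))
    (conj_comm a f) (conj_comm a (d * e * f)) ((M.tensor rfl).obj X Y) Z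
  have c₃ := crossTensor_hom (M := M) (a := a) rfl rfl (conj_mul a e f) (conj_comm a e)
    (conj_comm a f) (conj_comm a (e * f)) Y Z
  have c₄ := crossTensor_hom (M := M) (a := a) rfl h₄ h₄' (conj_comm a d)
    (conj_comm a (e * f)) (conj_comm a (d * e * f)) X ((M.tensor rfl).obj Y Z)
  have n₁ := crossTensor_natural a (tensI rfl X Y).hom (𝟙 (tot Z))
  have n₂ := crossTensor_natural a (𝟙 (tot X)) (tensI rfl Y Z).hom
  have e₀ := congrArg (M.ps.cross a).map (tensI_assoc (M := M) (a := d) rfl rfl rfl h₄ X Y Z)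
  have e₁ := congrArg (Tot.of (A := fun a => M.ps.at_ a)) (M.assoc_act a⁻¹ rfl rfl rfl h₄
    (conj_mul a d e) h₂' (conj_mul a e f) h₄' (conj_comm a d) (conj_comm a e) (conj_comm a f)
    (conj_comm a (d * e)) (conj_comm a (e * f)) (conj_comm a (d * e * f)) X Y Z)
  simp only [Tot.of_comp] at e₁
  simp only [Functor.map_comp] at e₀
  have t := toCross_natural (S := M.ps) (a := a) rfl (conj_comm a (d * e * f))
    (M.assoc rfl rfl rfl h₄ X Y Z).hom
  rw [CategoryTheory.Functor.map_id] at n₁ n₂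
  rw [← cancel_epi ((M.ps.cross a).map ((tensI rfl X Y).hom ⊗ₘ 𝟙 (tot Z))),
    ← cancel_epi ((M.ps.cross a).map (tensI rfl ((M.tensor rfl).obj X Y) Z).hom),
    ← cancel_epi (M.ps.toCross (a := a) rfl (conj_comm a (d * e * f))
      ((M.tensor rfl).obj ((M.tensor rfl).obj X Y) Z)).hom,
    ← reassoc_of% e₀, reassoc_of% t, reassoc_of% n₁, reassoc_of% n₂, reassoc_of% c₂,
    reassoc_of% c₄, tensorHom_comp_tensorHom_assoc, tensorHom_comp_tensorHom_assoc,
    tensorHom_comp_tensorHom, tensorHom_comp_tensorHom, Category.comp_id, Category.comp_id,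
    Category.comp_id, Category.comp_id, Category.assoc, c₁, c₃]
  -- The tensor of a composite with a single map is split into three layers, so that the innermost
  -- one can be absorbed by `tensI_natural` and the outermost one passes through the associator.
  -- `s₂` does the same on the other side.
  have s₁ : ((Tot.of (M.tensorAct a⁻¹ rfl (conj_mul a d e) (conj_comm a d) (conj_comm a e)
      (conj_comm a (d * e)) X Y).hom ≫ (tensI (conj_mul a d e) _ _).hom ≫
      ((M.ps.toCross (a := a) rfl (conj_comm a d) X).hom ⊗ₘ
        (M.ps.toCross (a := a) rfl (conj_comm a e) Y).hom)) ⊗ₘ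
      (M.ps.toCross (a := a) rfl (conj_comm a f) Z).hom) =
    (Tot.of (M.tensorAct a⁻¹ rfl (conj_mul a d e) (conj_comm a d) (conj_comm a e)
      (conj_comm a (d * e)) X Y).hom ⊗ₘ Tot.of (𝟙 _)) ≫
    ((tensI (conj_mul a d e) _ _).hom ⊗ₘ 𝟙 _) ≫
    (((M.ps.toCross (a := a) rfl (conj_comm a d) X).hom ⊗ₘ
        (M.ps.toCross (a := a) rfl (conj_comm a e) Y).hom) ⊗ₘ
      (M.ps.toCross (a := a) rfl (conj_comm a f) Z).hom) := by
    rw [Tot.of_id, tensorHom_comp_tensorHom, tensorHom_comp_tensorHom]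
    erw [Category.id_comp, Category.id_comp]
  have s₂ : ((M.ps.toCross (a := a) rfl (conj_comm a d) X).hom ⊗ₘ
      (Tot.of (M.tensorAct a⁻¹ rfl (conj_mul a e f) (conj_comm a e) (conj_comm a f)
      (conj_comm a (e * f)) Y Z).hom ≫ (tensI (conj_mul a e f) _ _).hom ≫
      ((M.ps.toCross (a := a) rfl (conj_comm a e) Y).hom ⊗ₘ
        (M.ps.toCross (a := a) rfl (conj_comm a f) Z).hom))) =
    (Tot.of (𝟙 _) ⊗ₘ Tot.of (M.tensorAct a⁻¹ rfl (conj_mul a e f) (conj_comm a e) (conj_comm a f)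
      (conj_comm a (e * f)) Y Z).hom) ≫
    (𝟙 _ ⊗ₘ (tensI (conj_mul a e f) _ _).hom) ≫
    ((M.ps.toCross (a := a) rfl (conj_comm a d) X).hom ⊗ₘ
      ((M.ps.toCross (a := a) rfl (conj_comm a e) Y).hom ⊗ₘ
      (M.ps.toCross (a := a) rfl (conj_comm a f) Z).hom)) := by
    rw [Tot.of_id, tensorHom_comp_tensorHom, tensorHom_comp_tensorHom]
    erw [Category.id_comp, Category.id_comp]
  rw [s₁, s₂, Category.assoc, Category.assoc, associator_naturality, reassoc_of% tensI_natural,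
    reassoc_of% tensI_natural, reassoc_of% e₁]
  have z := tensI_assoc (M := M) (conj_mul a d e) h₂' (conj_mul a e f) h₄'
    ((M.ps.act a⁻¹ (conj_comm a d)).obj X) ((M.ps.act a⁻¹ (conj_comm a e)).obj Y)
    ((M.ps.act a⁻¹ (conj_comm a f)).obj Z)
  rw [reassoc_of% z]

theorem crossTensor_left (a : G) (X : M.Total) :
    (M.ps.cross a).map (λ_ X).hom = (crossTensor a (𝟙_ _) X).hom ≫
      ((crossUnit a).hom ⊗ₘ 𝟙 _) ≫ (λ_ _).hom := by
  obtain ⟨d, X⟩ := X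
  have c := crossTensor_hom (M := M) (a := a) rfl (one_mul d) (one_mul (a⁻¹ * d * a)) (conj_one a)
    (conj_comm a d) (conj_comm a d) M.unit X
  have u := crossUnit_hom (M := M) (a := a) rfl (conj_one a)
  have e₁ := congrArg (Tot.of (A := fun a => M.ps.at_ a)) (M.left_act a⁻¹ (one_mul d)
    (one_mul (a⁻¹ * d * a)) (conj_one a) (conj_comm a d) X)
  rw [Tot.of_comp, Tot.of_comp, ← tensI_left, ← Category.assoc (Tot.of _) (tensI _ _ _).hom,
    ← tensI_natural, Category.assoc, Tot.of_id] at e₁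
  have e₃ := leftUnitor_naturality (M.ps.toCross (a := a) rfl (conj_comm a d) X).hom
  have t := toCross_natural (S := M.ps) (a := a) rfl (conj_comm a d) (M.left (one_mul d) X).hom
  rw [← tensI_left, e₁, Functor.map_comp] at t
  rw [← cancel_epi ((M.ps.cross a).map (tensI (one_mul d) M.unit X).hom),
    ← cancel_epi (M.ps.toCross (a := a) rfl (conj_comm a d) ((M.tensor (one_mul d)).obj M.unit X)).hom]
  refine t.trans ?_
  refine Eq.trans ?_ ((reassoc_of% c) _).symm
  simp only [Category.assoc]
  rw [tensorHom_comp_tensorHom_assoc]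
  erw [u]
  rw [Category.comp_id, ← e₃, ← id_tensorHom, tensorHom_comp_tensorHom_assoc, Category.id_comp]
  erw [Category.comp_id]

theorem crossTensor_right (a : G) (X : M.Total) :
    (M.ps.cross a).map (ρ_ X).hom = (crossTensor a X (𝟙_ _)).hom ≫
      (𝟙 _ ⊗ₘ (crossUnit a).hom) ≫ (ρ_ _).hom := by
  obtain ⟨d, X⟩ := X
  have c := crossTensor_hom (M := M) (a := a) rfl (mul_one d) (mul_one (a⁻¹ * d * a))
    (conj_comm a d) (conj_one a) (conj_comm a d) X M.unit
  have u := crossUnit_hom (M := M) (a := a) rfl (conj_one a)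
  have e₁ := congrArg (Tot.of (A := fun a => M.ps.at_ a)) (M.right_act a⁻¹ (mul_one d)
    (mul_one (a⁻¹ * d * a)) (conj_one a) (conj_comm a d) X)
  rw [Tot.of_comp, Tot.of_comp, ← tensI_right, ← Category.assoc (Tot.of _) (tensI _ _ _).hom,
    ← tensI_natural, Category.assoc, Tot.of_id] at e₁
  have e₃ := rightUnitor_naturality (M.ps.toCross (a := a) rfl (conj_comm a d) X).hom
  have t := toCross_natural (S := M.ps) (a := a) rfl (conj_comm a d) (M.right (mul_one d) X).hom
  rw [← tensI_right, e₁, Functor.map_comp] at t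
  rw [← cancel_epi ((M.ps.cross a).map (tensI (mul_one d) X M.unit).hom),
    ← cancel_epi (M.ps.toCross (a := a) rfl (conj_comm a d) ((M.tensor (mul_one d)).obj X M.unit)).hom]
  refine t.trans ?_
  refine Eq.trans ?_ ((reassoc_of% c) _).symm
  simp only [Category.assoc]
  rw [tensorHom_comp_tensorHom_assoc]
  erw [u]
  rw [Category.comp_id, ← e₃, ← tensorHom_id, tensorHom_comp_tensorHom_assoc, Category.id_comp]
  erw [Category.comp_id]

/-- The crossing is strong monoidal. -/
def crossCore (a : G) : (M.ps.cross a).CoreMonoidal :=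
  Functor.CoreMonoidal.mk' (crossUnit a).symm (fun X Y => (crossTensor a X Y).symm)
    (fun {X Y} f Z => by
      have e := crossTensor_natural a f (𝟙 Z)
      rw [CategoryTheory.Functor.map_id, tensorHom_id, tensorHom_id] at e
      exact e.symm)
    (fun {X Y} Z f => by
      have e := crossTensor_natural a (𝟙 Z) f
      rw [CategoryTheory.Functor.map_id, id_tensorHom, id_tensorHom] at e
      exact e.symm)
    (fun X Y Z => by
      have e := crossTensor_assoc a X Y Z
      rw [tensorHom_id, id_tensorHom] at e
      exact e)
    (fun X => by
      have e := crossTensor_left a X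
      rw [tensorHom_id] at e
      change _ = _ ≫ (crossTensor a _ X).hom ≫ (crossUnit a).hom ▷ _
      rw [← cancel_mono (λ_ ((M.ps.cross a).obj X)).hom, Iso.inv_hom_id, Category.assoc,
        Category.assoc, ← e, ← Functor.map_comp, Iso.inv_hom_id, CategoryTheory.Functor.map_id])
    (fun X => by
      have e := crossTensor_right a X
      rw [id_tensorHom] at e
      change _ = _ ≫ (crossTensor a X _).hom ≫ _ ◁ (crossUnit a).hom
      rw [← cancel_mono (ρ_ ((M.ps.cross a).obj X)).hom, Iso.inv_hom_id, Category.assoc,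
        Category.assoc, ← e, ← Functor.map_comp, Iso.inv_hom_id, CategoryTheory.Functor.map_id])

instance (a : G) : (M.ps.cross a).Monoidal := (crossCore a).toMonoidal

theorem crossOne_tensor (X Y : M.Total) :
    (M.ps.crossOneApp (X ⊗ Y)).hom ≫ (crossTensor 1 X Y).hom =
      ((M.ps.crossOneApp X).hom ⊗ₘ (M.ps.crossOneApp Y).hom) := by
  obtain ⟨d, X⟩ := X
  obtain ⟨e, Y⟩ := Y
  change (M.ps.crossOneApp (tot X ⊗ tot Y)).hom ≫ (crossTensor 1 (tot X) (tot Y)).hom =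
      ((M.ps.crossOneApp (tot X)).hom ⊗ₘ (M.ps.crossOneApp (tot Y)).hom)
  have c := crossTensor_hom (M := M) inv_one.symm rfl rfl (one_comm d) (one_comm e)
    (one_comm (d * e)) X Y
  have n := M.ps.crossOneApp_natural (tensI rfl X Y).hom
  have t := M.tensorAct_one rfl (one_comm d) (one_comm e) (one_comm (d * e)) X Y
  -- `crossOneApp` is built from the inverse of `actOne`, so the axiom `tensorAct_one` is solved for
  -- the inverses.
  have t' : (M.ps.actOne (one_comm (d * e)) ((M.tensor rfl).obj X Y)).inv ≫
      (M.tensorAct 1 rfl rfl (one_comm d) (one_comm e) (one_comm (d * e)) X Y).hom =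
      (M.tensor rfl).map (M.ps.actOne (one_comm d) X).inv (M.ps.actOne (one_comm e) Y).inv := by
    rw [Iso.inv_comp_eq, ← t, Category.assoc, ← (M.tensor rfl).map_comp, Iso.hom_inv_id,
      Iso.hom_inv_id, (M.tensor rfl).map_id, Category.comp_id]
  have t'' := congrArg (Tot.of (A := fun a => M.ps.at_ a)) t'
  rw [Tot.of_comp] at t''
  rw [← cancel_epi (tensI rfl X Y).hom, reassoc_of% n, M.ps.crossOneApp_hom (one_comm _),
    M.ps.crossOneApp_hom (one_comm _), M.ps.crossOneApp_hom (one_comm _), Category.assoc, c,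
    reassoc_of% t'', ← tensorHom_comp_tensorHom, reassoc_of% tensI_natural]

theorem crossOne_unit :
    (M.ps.crossOneApp (𝟙_ M.Total)).hom ≫ (crossUnit 1).hom = 𝟙 (𝟙_ M.Total) := by
  have e := M.ps.crossOneApp_hom (one_comm 1) M.unit
  have u := crossUnit_hom (M := M) inv_one.symm (one_comm 1)
  refine (e =≫ _).trans ?_
  rw [Category.assoc]
  erw [u]
  rw [M.unitAct_one, ← Tot.of_comp, Iso.inv_hom_id]
  rfl

theorem crossMul_unit {a b c : G} (h : b * a = c) :
    (M.ps.crossMulApp h (𝟙_ M.Total)).hom ≫ (crossUnit c).hom =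
      (M.ps.cross a).map (crossUnit b).hom ≫ (crossUnit a).hom := by
  have h'' : a⁻¹ * b⁻¹ * 1 = 1 * (a⁻¹ * b⁻¹) := (mul_one _).trans (one_mul _).symm
  have m := M.ps.crossMulApp_hom h rfl rfl (cross_mul_eq h) (conj_one b) (conj_one a) h'' M.unit
  have uc := crossUnit_hom (M := M) (cross_mul_eq h) h''
  have ua := crossUnit_hom (M := M) (a := a) rfl (conj_one a)
  have ub := congrArg (M.ps.cross a).map (crossUnit_hom (M := M) (a := b) rfl (conj_one b))
  have t := congrArg (Tot.of (A := fun a => M.ps.at_ a))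
    (M.unitAct_mul b⁻¹ a⁻¹ (conj_one b) (conj_one a) h'')
  rw [Tot.of_comp, Tot.of_comp] at t
  have n := toCross_natural (S := M.ps) (a := a) rfl (conj_one a) (M.unitAct b⁻¹ (conj_one b)).hom
  rw [Functor.map_comp] at ub
  rw [← cancel_epi ((M.ps.cross a).map (M.ps.toCross (a := b) rfl (conj_one b) M.unit).hom),
    ← cancel_epi (M.ps.toCross (a := a) rfl (conj_one a)
      ((M.ps.act b⁻¹ (conj_one b)).obj M.unit)).hom]
  refine ((reassoc_of% m) _).trans ?_
  refine Eq.trans ?_ (_ ≫= ((Category.assoc _ _ _).symm.trans (ub =≫ _))).symm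
  refine (congrArg (fun r => _ ≫ r) (uc.trans t)).trans ?_
  refine Eq.trans ?_ (((reassoc_of% n) (crossUnit a).hom).trans (_ ≫= ua)).symm
  rw [← Tot.of_comp, ← Tot.of_comp, ← Tot.of_comp, Iso.inv_hom_id_assoc, Tot.of_comp]

/-- Through the comparisons this is the axiom `tensorAct_mul` for `b⁻¹` followed by `a⁻¹`, with
`actMul` inverted (`t'`) because the composition constraint of the crossing is its inverse. -/
theorem crossMul_tensor {a b c : G} (h : b * a = c) (X Y : M.Total) :
    (M.ps.crossMulApp h (X ⊗ Y)).hom ≫ (crossTensor c X Y).hom =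
      (M.ps.cross a).map (crossTensor b X Y).hom ≫
        (crossTensor a ((M.ps.cross b).obj X) ((M.ps.cross b).obj Y)).hom ≫
          ((M.ps.crossMulApp h X).hom ⊗ₘ (M.ps.crossMulApp h Y).hom) := by
  obtain ⟨d, X⟩ := X
  obtain ⟨e, Y⟩ := Y
  change (M.ps.crossMulApp h (tot X ⊗ tot Y)).hom ≫ (crossTensor c (tot X) (tot Y)).hom =
      (M.ps.cross a).map (crossTensor b (tot X) (tot Y)).hom ≫
        (crossTensor a ((M.ps.cross b).obj (tot X)) ((M.ps.cross b).obj (tot Y))).hom ≫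
          ((M.ps.crossMulApp h (tot X)).hom ⊗ₘ (M.ps.crossMulApp h (tot Y)).hom)
  have h' : ∀ d, a⁻¹ * b⁻¹ * d = a⁻¹ * (b⁻¹ * d * b) * a * (a⁻¹ * b⁻¹) := conj_conj_comm a b
  have hh : a⁻¹ * (b⁻¹ * d * b) * a * (a⁻¹ * (b⁻¹ * e * b) * a) =
    a⁻¹ * (b⁻¹ * (d * e) * b) * a := by group
  have m := fun {d} (X : M.ps.at_ d) => M.ps.crossMulApp_hom h rfl rfl (cross_mul_eq h)
    (conj_comm b d) (conj_comm a _) (h' d) X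
  have c₀ := crossTensor_hom (M := M) (cross_mul_eq h) rfl hh (h' d) (h' e) (h' (d * e)) X Y
  have cb := congrArg (M.ps.cross a).map (crossTensor_hom (M := M) (a := b) rfl rfl
    (conj_mul b d e) (conj_comm b d) (conj_comm b e) (conj_comm b (d * e)) X Y)
  have ca := crossTensor_hom (M := M) (a := a) rfl (conj_mul b d e) hh
    (conj_comm a _) (conj_comm a _) (conj_comm a _)
    ((M.ps.act b⁻¹ (conj_comm b d)).obj X) ((M.ps.act b⁻¹ (conj_comm b e)).obj Y)
  have n := M.ps.crossMulApp_natural h (tensI rfl X Y).hom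
  have n₁ := crossTensor_natural a (M.ps.toCross (a := b) rfl (conj_comm b d) X).hom
    (M.ps.toCross (a := b) rfl (conj_comm b e) Y).hom
  have n₂ := toCross_natural (S := M.ps) (a := a) rfl (conj_comm a (b⁻¹ * (d * e) * b))
    (M.tensorAct b⁻¹ rfl (conj_mul b d e) (conj_comm b d) (conj_comm b e)
      (conj_comm b (d * e)) X Y).hom
  have t := M.tensorAct_mul b⁻¹ a⁻¹ rfl (conj_mul b d e) hh (conj_comm b d) (conj_comm b e)
    (conj_comm b (d * e)) (conj_comm a _) (conj_comm a _) (conj_comm a _) (h' d) (h' e) (h' (d * e)) X Y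
  have t' : (M.ps.actMul b⁻¹ a⁻¹ (conj_comm b (d * e)) (conj_comm a _) (h' (d * e))
      ((M.tensor rfl).obj X Y)).inv ≫
      (M.tensorAct (a⁻¹ * b⁻¹) rfl hh (h' d) (h' e) (h' (d * e)) X Y).hom =
      (M.ps.act a⁻¹ (conj_comm a _)).map (M.tensorAct b⁻¹ rfl (conj_mul b d e) (conj_comm b d)
        (conj_comm b e) (conj_comm b (d * e)) X Y).hom ≫
        (M.tensorAct a⁻¹ (conj_mul b d e) hh (conj_comm a _) (conj_comm a _) (conj_comm a _)
          ((M.ps.act b⁻¹ (conj_comm b d)).obj X) ((M.ps.act b⁻¹ (conj_comm b e)).obj Y)).hom ≫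
        (M.tensor hh).map
          (M.ps.actMul b⁻¹ a⁻¹ (conj_comm b d) (conj_comm a _) (h' d) X).inv
          (M.ps.actMul b⁻¹ a⁻¹ (conj_comm b e) (conj_comm a _) (h' e) Y).inv := by
    rw [Iso.inv_comp_eq, ← reassoc_of% t, ← (M.tensor hh).map_comp, Iso.hom_inv_id,
      Iso.hom_inv_id, (M.tensor hh).map_id, Category.comp_id]
  have t'' := congrArg (Tot.of (A := fun a => M.ps.at_ a)) t'
  simp only [Tot.of_comp] at t''
  simp only [Functor.map_comp] at cb
  rw [← cancel_epi ((M.ps.cross a).map ((M.ps.cross b).map (tensI rfl X Y).hom)),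
    ← cancel_epi ((M.ps.cross a).map (M.ps.toCross (a := b) rfl (conj_comm b (d * e))
      ((M.tensor rfl).obj X Y)).hom),
    ← cancel_epi (M.ps.toCross (a := a) rfl (conj_comm a _)
      ((M.ps.act b⁻¹ (conj_comm b (d * e))).obj ((M.tensor rfl).obj X Y))).hom,
    reassoc_of% cb, reassoc_of% n, reassoc_of% (m ((M.tensor rfl).obj X Y)), c₀, reassoc_of% n₁,
    reassoc_of% n₂, reassoc_of% ca, tensorHom_comp_tensorHom, tensorHom_comp_tensorHom,
    m, m, ← tensorHom_comp_tensorHom, reassoc_of% tensI_natural,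
    reassoc_of% t'']

-- Monoidality may be tested on the inverse constraints. Those are the natural ones here, since
-- `tensorAct` and `unitAct` point in the oplax direction.
open Functor.OplaxMonoidal in
theorem isMonoidal_of_delta {C D : Type*} [Category C] [Category D] [MonoidalCategory C]
    [MonoidalCategory D] {F F' : C ⥤ D} [F.Monoidal] [F'.Monoidal] (t : F ⟶ F')
    (h₁ : t.app (𝟙_ C) ≫ η F' = η F)
    (h₂ : ∀ X Y, t.app (X ⊗ Y) ≫ δ F' X Y = δ F X Y ≫ (t.app X ⊗ₘ t.app Y)) :
    NatTrans.IsMonoidal t where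
  unit := by
    rw [← cancel_mono (η F'), Category.assoc, h₁, Functor.Monoidal.ε_η, Functor.Monoidal.ε_η]
  tensor X Y := by
    rw [← cancel_mono (δ F' X Y), Category.assoc, Category.assoc, h₂, Functor.Monoidal.μ_δ,
      Functor.Monoidal.μ_δ_assoc, Category.comp_id]

instance : NatTrans.IsMonoidal (M.ps.crossOne).hom :=
  isMonoidal_of_delta _ crossOne_unit fun X Y =>
    (crossOne_tensor X Y).trans (Category.id_comp _).symm

instance {a b c : G} (h : b * a = c) : NatTrans.IsMonoidal (M.ps.crossMul h).hom :=
  isMonoidal_of_delta _ ((crossMul_unit h).trans (by rw [Functor.OplaxMonoidal.comp_η]; rfl))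
    fun X Y => (crossMul_tensor h X Y).trans (by
      rw [Functor.OplaxMonoidal.comp_δ, Category.assoc]; rfl)

end Total

end TotalCrossing
end Monoidale

/-! ### Extending functors and transformations along a generating functor -/

noncomputable section Density

set_option linter.unusedSectionVars false

variable {E C D : Type*} [Category E] [Category C] [Category D]
  [Preadditive C] [Preadditive D]

/-- A presentation of `X` as a retract of a finite direct sum of objects in the image of `J`. -/
structure Resolution (J : E ⥤ C) (X : C) where
  ι : Type
  [fintype : Fintype ι]
  Y : ι → E
  p (i : ι) : X ⟶ J.obj (Y i)
  s (i : ι) : J.obj (Y i) ⟶ X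
  total : ∑ i, p i ≫ s i = 𝟙 X

attribute [instance] Resolution.fintype

/-- Every object is a retract of a finite direct sum of objects in the image of `J`. -/
def Generates (J : E ⥤ C) : Prop := ∀ X, Nonempty (Resolution J X)

namespace Generates

variable {J : E ⥤ C} (hJ : Generates J)

/-- A chosen presentation. -/
def res (X : C) : Resolution J X := (hJ X).some

theorem total_map (T : C ⥤ D) [T.Additive] {X : C} (R : Resolution J X) :
    ∑ i, T.map (R.p i) ≫ T.map (R.s i) = 𝟙 (T.obj X) := by
  simp only [← Functor.map_comp]
  rw [← Functor.map_sum, R.total, CategoryTheory.Functor.map_id]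

/-- The identity of `T X` is a sum of maps factoring through some `T s`, so the maps `T s` are
jointly epic. This gives the uniqueness of extended transformations. -/
theorem hom_ext (hJ : Generates J) (T : C ⥤ D) [T.Additive] {X : C} {Z : D} {f g : T.obj X ⟶ Z}
    (h : ∀ (W : E) (s : J.obj W ⟶ X), T.map s ≫ f = T.map s ≫ g) : f = g := by
  rw [← Category.id_comp f, ← Category.id_comp g, ← total_map T (hJ.res X),
    Preadditive.sum_comp, Preadditive.sum_comp]
  refine Finset.sum_congr rfl fun i _ => ?_
  rw [Category.assoc, Category.assoc, h]

variable [J.Full] {T T' T'' : C ⥤ D} [T.Additive] [T'.Additive] [T''.Additive]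

/-- The value at `X` of the extension of a natural transformation. -/
def extendApp (t : J ⋙ T ⟶ J ⋙ T') (X : C) : T.obj X ⟶ T'.obj X :=
  ∑ i, T.map ((hJ.res X).p i) ≫ t.app ((hJ.res X).Y i) ≫ T'.map ((hJ.res X).s i)

/-- By fullness `s ≫ p i` is the image of a morphism of `E`, past which `t` may be moved; then the
sum collapses to the identity. The formula characterizes `extendApp` independently of the chosen
presentation. -/
theorem map_extendApp (t : J ⋙ T ⟶ J ⋙ T') {W : E} {X : C} (s : J.obj W ⟶ X) :
    T.map s ≫ hJ.extendApp t X = t.app W ≫ T'.map s := by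
  have key : ∀ i, T.map s ≫ T.map ((hJ.res X).p i) ≫ t.app ((hJ.res X).Y i) ≫
      T'.map ((hJ.res X).s i) =
      t.app W ≫ T'.map s ≫ T'.map ((hJ.res X).p i) ≫ T'.map ((hJ.res X).s i) := fun i => by
    obtain ⟨f, hf⟩ := J.map_surjective (s ≫ (hJ.res X).p i)
    have e := t.naturality f
    rw [Functor.comp_map, Functor.comp_map, hf] at e
    rw [← Functor.map_comp_assoc, reassoc_of% e, Functor.map_comp_assoc]
  rw [extendApp, Preadditive.comp_sum, Finset.sum_congr rfl fun i _ => key i,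
    ← Preadditive.comp_sum, ← Preadditive.comp_sum, total_map, Category.comp_id]

/-- A natural transformation between restrictions along a dense functor extends. -/
def extend (t : J ⋙ T ⟶ J ⋙ T') : T ⟶ T' where
  app := hJ.extendApp t
  naturality X X' f := by
    refine hJ.hom_ext T fun W s => ?_
    rw [← Functor.map_comp_assoc, map_extendApp, ← Category.assoc (T.map s), map_extendApp,
      Category.assoc, Functor.map_comp]

theorem map_extend (t : J ⋙ T ⟶ J ⋙ T') {W : E} {X : C} (s : J.obj W ⟶ X) :
    T.map s ≫ (hJ.extend t).app X = t.app W ≫ T'.map s :=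
  hJ.map_extendApp t s

theorem extend_app (t : J ⋙ T ⟶ J ⋙ T') (W : E) : (hJ.extend t).app (J.obj W) = t.app W := by
  have e := hJ.map_extend t (𝟙 (J.obj W))
  rw [CategoryTheory.Functor.map_id, CategoryTheory.Functor.map_id, Category.id_comp] at e
  exact e.trans (Category.comp_id (t.app W))

/-- A natural isomorphism between restrictions along a dense functor extends. -/
def extendIso (t : J ⋙ T ≅ J ⋙ T') : T ≅ T' where
  hom := hJ.extend t.hom
  inv := hJ.extend t.inv
  hom_inv_id := by
    ext X
    refine hJ.hom_ext T fun W s => ?_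
    rw [NatTrans.comp_app, ← Category.assoc, map_extend, Category.assoc, map_extend,
      Iso.hom_inv_id_app_assoc, NatTrans.id_app, Category.comp_id]
  inv_hom_id := by
    ext X
    refine hJ.hom_ext T' fun W s => ?_
    rw [NatTrans.comp_app, ← Category.assoc, map_extend, Category.assoc, map_extend,
      Iso.inv_hom_id_app_assoc, NatTrans.id_app, Category.comp_id]

end Generates

/-- Data exhibiting `obj` as the image of the presentation `R` of `X` under a functor `N`. -/
structure Realization {J : E ⥤ C} [J.Full] (N : E ⥤ D) {X : C} (R : Resolution J X) where
  obj : D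
  q (i : R.ι) : obj ⟶ N.obj (R.Y i)
  t (i : R.ι) : N.obj (R.Y i) ⟶ obj
  t_q (i j : R.ι) : t i ≫ q j = N.map (J.preimage (R.s i ≫ R.p j))
  total : ∑ i, q i ≫ t i = 𝟙 obj

namespace Realization

variable [Preadditive E] {J : E ⥤ C} [J.Full] [J.Faithful] [J.Additive] {N : E ⥤ D} [N.Additive]
  {R : ∀ X, Resolution J X} (L : ∀ X, Realization N (R X))

/-- The functor `N ∘ J⁻¹` on morphisms between objects in the image of `J`. -/
def im (J : E ⥤ C) [J.Full] (N : E ⥤ D) {Y Y' : E} (f : J.obj Y ⟶ J.obj Y') : N.obj Y ⟶ N.obj Y' :=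
  N.map (J.preimage f)

theorem im_comp {Y Y' Y'' : E} (f : J.obj Y ⟶ J.obj Y') (g : J.obj Y' ⟶ J.obj Y'') :
    im J N (f ≫ g) = im J N f ≫ im J N g := by
  rw [im, im, im, ← Functor.map_comp]
  congr 1
  exact J.map_injective (by simp)

theorem im_map {Y Y' : E} (f : Y ⟶ Y') : im J N (J.map f) = N.map f := by
  rw [im, Functor.preimage_map]

theorem im_id (Y : E) : im J N (𝟙 (J.obj Y)) = 𝟙 (N.obj Y) := by
  rw [← J.map_id, im_map, N.map_id]

theorem im_add {Y Y' : E} (f g : J.obj Y ⟶ J.obj Y') :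
    im J N (f + g) = im J N f + im J N g := by
  rw [im, im, im, ← Functor.map_add]
  congr 1
  exact J.map_injective (by simp)

theorem im_smul {k : Type*} [Ring k] [Linear k E] [Linear k C] [Linear k D] [J.Linear k]
    [N.Linear k] {Y Y' : E} (r : k) (f : J.obj Y ⟶ J.obj Y') : im J N (r • f) = r • im J N f := by
  rw [im, im, ← Functor.map_smul]
  congr 1
  exact J.map_injective (by simp)

/-- The map out of `N W` corresponding to a map out of `J W`. -/
def into {W : E} {X : C} (u : J.obj W ⟶ X) : N.obj W ⟶ (L X).obj :=
  ∑ j, im J N (u ≫ (R X).p j) ≫ (L X).t j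

/-- `into` prolongs the structure maps `t i` from the chosen `s i` to all maps `J W ⟶ X`; the
relation `t_q` is what makes this consistent. -/
theorem into_s (X : C) (i : (R X).ι) : into L ((R X).s i) = (L X).t i := by
  have e : ∀ j, im J N ((R X).s i ≫ (R X).p j) = (L X).t i ≫ (L X).q j :=
    fun j => ((L X).t_q i j).symm
  simp only [into, e, Category.assoc]
  rw [← Preadditive.comp_sum, (L X).total, Category.comp_id]

theorem im_into {W W' : E} {X : C} (f : J.obj W ⟶ J.obj W') (u : J.obj W' ⟶ X) :
    im J N f ≫ into L u = into L (f ≫ u) := by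
  simp only [into, Preadditive.comp_sum, Category.assoc, im_comp (f := f)]

theorem into_add {W : E} {X : C} (u u' : J.obj W ⟶ X) :
    into L (u + u') = into L u + into L u' := by
  simp only [into, Preadditive.add_comp, im_add, Finset.sum_add_distrib]

theorem into_smul {k : Type*} [Ring k] [Linear k E] [Linear k C] [Linear k D] [J.Linear k]
    [N.Linear k] {W : E} {X : C} (r : k) (u : J.obj W ⟶ X) :
    into L (r • u) = r • into L u := by
  simp only [into, Linear.smul_comp, im_smul, Finset.smul_sum]

theorem hom_ext {X : C} {Z : D} {f g : (L X).obj ⟶ Z}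
    (h : ∀ (W : E) (u : J.obj W ⟶ X), into L u ≫ f = into L u ≫ g) : f = g := by
  rw [← Category.id_comp f, ← Category.id_comp g, ← (L X).total,
    Preadditive.sum_comp, Preadditive.sum_comp]
  refine Finset.sum_congr rfl fun i _ => ?_
  rw [Category.assoc, Category.assoc, ← into_s, h]

/-- The map out of the realization determined by its values on the presentation. -/
def out {X : C} {Z : D} (h : ∀ i, N.obj ((R X).Y i) ⟶ Z) : (L X).obj ⟶ Z :=
  ∑ i, (L X).q i ≫ h i

/-- The universal property of the realization: an additive family indexed by the maps `J W ⟶ X`,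
compatible with precomposition, is induced by a map out of it, and `hom_ext` makes that map unique.
Additivity allows evaluation on `u = ∑ u ≫ p i ≫ s i`. -/
theorem into_out {X : C} {Z : D} (h : ∀ {W : E}, (J.obj W ⟶ X) → (N.obj W ⟶ Z))
    (h_add : ∀ {W : E} (u u' : J.obj W ⟶ X), h (u + u') = h u + h u')
    (h_im : ∀ {W W' : E} (f : J.obj W ⟶ J.obj W') (u : J.obj W' ⟶ X),
      h (f ≫ u) = im J N f ≫ h u) {W : E} (u : J.obj W ⟶ X) :
    into L u ≫ out L (fun i => h ((R X).s i)) = h u := by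
  have total : ∀ {W : E} (u : J.obj W ⟶ X), ∑ i, h (u ≫ (R X).p i ≫ (R X).s i) = h u := by
    intro W u
    have e := map_sum (AddMonoidHom.mk' h h_add) (fun i => u ≫ (R X).p i ≫ (R X).s i) Finset.univ
    rw [← Preadditive.comp_sum, (R X).total, Category.comp_id] at e
    exact e.symm
  -- By `t_q`, each `t j ≫ q i` is the image under `N` of the lift of `s j ≫ p i`, which `h` absorbs
  -- by compatibility with precomposition.
  have e : ∀ j, (L X).t j ≫ out L (fun i => h ((R X).s i)) = h ((R X).s j) := fun j => by
    have e' : ∀ i, (L X).t j ≫ (L X).q i ≫ h ((R X).s i) =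
        h ((R X).s j ≫ (R X).p i ≫ (R X).s i) := fun i => by
      rw [← Category.assoc, (L X).t_q, ← Category.assoc, h_im]; rfl
    rw [out, Preadditive.comp_sum, ← total]
    exact Finset.sum_congr rfl fun i _ => e' i
  rw [into, Preadditive.sum_comp, ← total]
  refine Finset.sum_congr rfl fun i _ => ?_
  rw [Category.assoc, e, ← h_im, Category.assoc]

/-- The extension of `N` on morphisms. -/
def homMap {X X' : C} (f : X ⟶ X') : (L X).obj ⟶ (L X').obj :=
  out L fun i => into L ((R X).s i ≫ f)

/-- This determines `homMap` by `hom_ext`, so that functoriality, additivity and linearity of the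
extension reduce to properties of composition in `C`. -/
theorem into_homMap {W : E} {X X' : C} (u : J.obj W ⟶ X) (f : X ⟶ X') :
    into L u ≫ homMap L f = into L (u ≫ f) :=
  into_out L (fun u => into L (u ≫ f))
    (fun u u' => by rw [Preadditive.add_comp, into_add])
    (fun g u => by rw [im_into, Category.assoc]) u

/-- The extension of `N` along `J`. -/
def functor : C ⥤ D where
  obj X := (L X).obj
  map f := homMap L f
  map_id X := hom_ext L fun W u => by
    rw [into_homMap, Category.comp_id, Category.comp_id]
  map_comp f g := hom_ext L fun W u => by
    rw [into_homMap, ← Category.assoc (into L u), into_homMap, into_homMap, Category.assoc]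

instance : (functor L).Additive where
  map_add {X Y f g} := hom_ext L fun W u => by
    change into L u ≫ homMap L (f + g) = into L u ≫ (homMap L f + homMap L g)
    rw [Preadditive.comp_add, into_homMap, into_homMap, into_homMap, Preadditive.comp_add, into_add]

theorem functor_linear {k : Type*} [Ring k] [Linear k E] [Linear k C] [Linear k D] [J.Linear k]
    [N.Linear k] : (functor L).Linear k where
  map_smul {X Y} f r := hom_ext L fun W u => by
    change into L u ≫ homMap L (r • f) = into L u ≫ (r • homMap L f)
    rw [Linear.comp_smul, into_homMap, into_homMap, Linear.comp_smul, into_smul]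

/-- The extension of `N` agrees with `N` on the image of `J`. -/
def objIso (W : E) : (L (J.obj W)).obj ≅ N.obj W where
  hom := out L fun i => im J N ((R (J.obj W)).s i)
  inv := into L (𝟙 (J.obj W))
  hom_inv_id := hom_ext L fun W' u => by
    rw [← Category.assoc, into_out L (fun u => im J N u) im_add im_comp u, im_into,
      Category.comp_id, Category.comp_id]
  inv_hom_id := (into_out L (fun u => im J N u) im_add im_comp _).trans (im_id W)

/-- The extension of `N` along `J` restricts to `N`. -/
def functorIso : J ⋙ functor L ≅ N :=
  (NatIso.ofComponents (fun W => (objIso L W).symm)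
    (fun {W W'} f => by
      change N.map f ≫ into L (𝟙 _) = into L (𝟙 _) ≫ homMap L (J.map f)
      rw [into_homMap, Category.id_comp, ← im_map (J := J) (N := N), im_into, Category.comp_id])).symm

end Realization

end Density

/-! ### Extending monoidal structures along a generating monoidal functor -/

noncomputable section DenseMonoidal

set_option linter.unusedSectionVars false

variable {E C D : Type*} [Category E] [Category C] [Category D]
  [Preadditive C] [Preadditive D] [MonoidalCategory E] [MonoidalCategory C] [MonoidalCategory D]
  [MonoidalPreadditive C] [MonoidalPreadditive D]

open Functor.OplaxMonoidal

/-- The tensor product of maps out of objects in the image of a monoidal functor `J`. -/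
def star (J : E ⥤ C) [J.Monoidal] {W W' : E} {X X' : C} (u : J.obj W ⟶ X) (u' : J.obj W' ⟶ X') :
    J.obj (W ⊗ W') ⟶ X ⊗ X' :=
  δ J W W' ≫ (u ⊗ₘ u')

section Star

variable {J : E ⥤ C} [J.Monoidal]

theorem star_comp {W W' : E} {X X' Y Y' : C} (u : J.obj W ⟶ X) (u' : J.obj W' ⟶ X') (f : X ⟶ Y)
    (f' : X' ⟶ Y') : star J u u' ≫ (f ⊗ₘ f') = star J (u ≫ f) (u' ≫ f') := by
  rw [star, star, Category.assoc, tensorHom_comp_tensorHom]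

theorem map_star {V V' W W' : E} {X X' : C} (f : V ⟶ W) (f' : V' ⟶ W') (u : J.obj W ⟶ X)
    (u' : J.obj W' ⟶ X') :
    J.map (f ⊗ₘ f') ≫ star J u u' = star J (J.map f ≫ u) (J.map f' ≫ u') := by
  rw [star, star, ← δ_natural_assoc, tensorHom_comp_tensorHom]

theorem star_assoc {W W' W'' : E} {X X' X'' : C} (u : J.obj W ⟶ X) (u' : J.obj W' ⟶ X')
    (u'' : J.obj W'' ⟶ X'') :
    star J (star J u u') u'' ≫ (α_ X X' X'').hom =
      J.map (α_ W W' W'').hom ≫ star J u (star J u' u'') := by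
  have e := Functor.OplaxMonoidal.associativity J W W' W''
  have e₁ : star J (star J u u') u'' = δ J (W ⊗ W') W'' ≫ (δ J W W' ⊗ₘ 𝟙 _) ≫
      ((u ⊗ₘ u') ⊗ₘ u'') := by
    rw [star, star, tensorHom_comp_tensorHom, Category.id_comp]
  have e₂ : star J u (star J u' u'') = δ J W (W' ⊗ W'') ≫ (𝟙 _ ⊗ₘ δ J W' W'') ≫
      (u ⊗ₘ (u' ⊗ₘ u'')) := by
    rw [star, star, tensorHom_comp_tensorHom, Category.id_comp]
  rw [e₁, e₂, Category.assoc, Category.assoc, associator_naturality, tensorHom_id, id_tensorHom,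
    reassoc_of% e]

/-- The map from the image of the unit object to the unit object. -/
def starUnit (J : E ⥤ C) [J.Monoidal] : J.obj (𝟙_ E) ⟶ 𝟙_ C := η J

theorem star_left {W : E} {X : C} (u : J.obj W ⟶ X) :
    star J (starUnit J) u ≫ (λ_ X).hom = J.map (λ_ W).hom ≫ u := by
  have e := Functor.OplaxMonoidal.left_unitality_hom J W
  rw [star, starUnit, Category.assoc, MonoidalCategory.tensorHom_def, Category.assoc, leftUnitor_naturality,
    reassoc_of% e]

theorem star_right {W : E} {X : C} (u : J.obj W ⟶ X) :
    star J u (starUnit J) ≫ (ρ_ X).hom = J.map (ρ_ W).hom ≫ u := by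
  have e := Functor.OplaxMonoidal.right_unitality_hom J W
  rw [star, starUnit, Category.assoc, MonoidalCategory.tensorHom_def', Category.assoc, rightUnitor_naturality,
    reassoc_of% e]

end Star

theorem sum_tensorHom_sum {ι ι' : Type*} [Fintype ι] [Fintype ι'] {X Y X' Y' : C}
    (f : ι → (X ⟶ Y)) (g : ι' → (X' ⟶ Y')) :
    ((∑ i, f i) ⊗ₘ (∑ j, g j)) = ∑ x : ι × ι', (f x.1 ⊗ₘ g x.2) := by
  rw [sum_tensor, Fintype.sum_prod_type]
  exact Finset.sum_congr rfl fun i _ => tensor_sum _ _ _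

section Ext

variable {J : E ⥤ C} (T T' T'' : C ⥤ D) [T.Additive] [T'.Additive] [T''.Additive]

theorem total_tensor (hJ : Generates J) {X X' : C} :
    ∑ x : (hJ.res X).ι × (hJ.res X').ι, (T.map ((hJ.res X).p x.1) ⊗ₘ T'.map ((hJ.res X').p x.2)) ≫
      (T.map ((hJ.res X).s x.1) ⊗ₘ T'.map ((hJ.res X').s x.2)) = 𝟙 (T.obj X ⊗ T'.obj X') := by
  simp only [tensorHom_comp_tensorHom]
  rw [← sum_tensorHom_sum (fun i => T.map ((hJ.res X).p i) ≫ T.map ((hJ.res X).s i))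
    (fun i => T'.map ((hJ.res X').p i) ≫ T'.map ((hJ.res X').s i)), Generates.total_map,
    Generates.total_map, id_tensorHom_id]

/-- Tensoring the decompositions of two identities decomposes the identity of the tensor product, so
a map in two variables is determined on pairs of generators. -/
theorem hom_ext_tensor (hJ : Generates J) {X X' : C} {Z : D} {f g : T.obj X ⊗ T'.obj X' ⟶ Z}
    (h : ∀ (W W' : E) (u : J.obj W ⟶ X) (u' : J.obj W' ⟶ X'),
      (T.map u ⊗ₘ T'.map u') ≫ f = (T.map u ⊗ₘ T'.map u') ≫ g) : f = g := by
  rw [← Category.id_comp f, ← Category.id_comp g, ← total_tensor T T' hJ,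
    Preadditive.sum_comp, Preadditive.sum_comp]
  refine Finset.sum_congr rfl fun i _ => ?_
  rw [Category.assoc, Category.assoc, h]

theorem hom_ext_tensor₃ (hJ : Generates J) {X X' X'' : C} {Z : D} {f g : (T.obj X ⊗ T'.obj X') ⊗ T''.obj X'' ⟶ Z}
    (h : ∀ (W W' W'' : E) (u : J.obj W ⟶ X) (u' : J.obj W' ⟶ X') (u'' : J.obj W'' ⟶ X''),
      ((T.map u ⊗ₘ T'.map u') ⊗ₘ T''.map u'') ≫ f =
        ((T.map u ⊗ₘ T'.map u') ⊗ₘ T''.map u'') ≫ g) : f = g := by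
  have e : 𝟙 ((T.obj X ⊗ T'.obj X') ⊗ T''.obj X'') = ((∑ x : (hJ.res X).ι × (hJ.res X').ι,
      (T.map ((hJ.res X).p x.1) ⊗ₘ T'.map ((hJ.res X').p x.2)) ≫
      (T.map ((hJ.res X).s x.1) ⊗ₘ T'.map ((hJ.res X').s x.2))) ⊗ₘ
      ∑ i, T''.map ((hJ.res X'').p i) ≫ T''.map ((hJ.res X'').s i)) := by
    rw [total_tensor, Generates.total_map, id_tensorHom_id]
  rw [sum_tensorHom_sum] at e
  rw [← Category.id_comp f, ← Category.id_comp g, e, Preadditive.sum_comp, Preadditive.sum_comp]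
  refine Finset.sum_congr rfl fun i _ => ?_
  rw [← tensorHom_comp_tensorHom, Category.assoc, Category.assoc, h]

/-- The product of two presentations exhibits `X ⊗ X'` as a retract of a sum of objects `J W ⊗ J
W'`. The constraint of `J` replaces these by `J (W ⊗ W')`, so that the test maps again start in the
image of `J`. -/
theorem hom_ext_star (hJ : Generates J) [J.Monoidal] {X X' : C} {Z : D} {f g : T.obj (X ⊗ X') ⟶ Z}
    (h : ∀ (W W' : E) (u : J.obj W ⟶ X) (u' : J.obj W' ⟶ X'),
      T.map (star J u u') ≫ f = T.map (star J u u') ≫ g) : f = g := by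
  have e := total_tensor (𝟭 C) (𝟭 C) hJ (X := X) (X' := X')
  dsimp only [Functor.id_obj, Functor.id_map] at e
  have e' : ∀ i j, ((hJ.res X).p i ⊗ₘ (hJ.res X').p j) ≫ ((hJ.res X).s i ⊗ₘ (hJ.res X').s j) =
      (((hJ.res X).p i ⊗ₘ (hJ.res X').p j) ≫ Functor.LaxMonoidal.μ J _ _) ≫
        star J ((hJ.res X).s i) ((hJ.res X').s j) := fun i j => by
    rw [star, Category.assoc, Functor.Monoidal.μ_δ_assoc]
  have e'' := congrArg T.map e
  rw [Functor.map_sum, T.map_id] at e''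
  rw [← Category.id_comp f, ← Category.id_comp g, ← e'', Preadditive.sum_comp,
    Preadditive.sum_comp]
  refine Finset.sum_congr rfl fun i _ => ?_
  rw [e', T.map_comp, Category.assoc, Category.assoc, h]

end Ext

/-- A strong monoidal structure on `J ⋙ F`, in terms of values of `F`. -/
structure RestrictedMonoidal (J : E ⥤ C) (F : C ⥤ D) where
  ε : 𝟙_ D ≅ F.obj (J.obj (𝟙_ E))
  μ (W W' : E) : F.obj (J.obj W) ⊗ F.obj (J.obj W') ≅ F.obj (J.obj (W ⊗ W'))
  μ_natural {V V' W W' : E} (f : V ⟶ W) (f' : V' ⟶ W') :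
    (F.map (J.map f) ⊗ₘ F.map (J.map f')) ≫ (μ W W').hom =
      (μ V V').hom ≫ F.map (J.map (f ⊗ₘ f'))
  assoc (W W' W'' : E) :
    ((μ W W').hom ⊗ₘ 𝟙 (F.obj (J.obj W''))) ≫ (μ (W ⊗ W') W'').hom ≫
        F.map (J.map (α_ W W' W'').hom) =
      (α_ _ _ _).hom ≫ (𝟙 (F.obj (J.obj W)) ⊗ₘ (μ W' W'').hom) ≫ (μ W (W' ⊗ W'')).hom
  left (W : E) : (λ_ (F.obj (J.obj W))).hom =
    (ε.hom ⊗ₘ 𝟙 (F.obj (J.obj W))) ≫ (μ (𝟙_ E) W).hom ≫ F.map (J.map (λ_ W).hom)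
  right (W : E) : (ρ_ (F.obj (J.obj W))).hom =
    (𝟙 (F.obj (J.obj W)) ⊗ₘ ε.hom) ≫ (μ W (𝟙_ E)).hom ≫ F.map (J.map (ρ_ W).hom)

namespace RestrictedMonoidal

variable {J : E ⥤ C} (hJ : Generates J) [J.Full] [J.Monoidal] {F : C ⥤ D} [F.Additive]
  (S : RestrictedMonoidal J F)

open Functor.LaxMonoidal (μ)

/-- The restricted structure of a strong monoidal structure transported along an isomorphism. -/
def ofIso (J : E ⥤ C) (F : C ⥤ D) {P : E ⥤ D} [P.Monoidal] (t : J ⋙ F ≅ P) :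
    RestrictedMonoidal J F :=
  letI := Functor.Monoidal.transport t.symm
  { ε := Functor.Monoidal.εIso (J ⋙ F)
    μ W W' := Functor.Monoidal.μIso (J ⋙ F) W W'
    μ_natural f f' := Functor.LaxMonoidal.μ_natural (J ⋙ F) f f'
    assoc W W' W'' := by
      rw [tensorHom_id, id_tensorHom]
      exact Functor.LaxMonoidal.associativity (J ⋙ F) W W' W''
    left W := by
      rw [tensorHom_id]
      exact Functor.LaxMonoidal.left_unitality (J ⋙ F) W
    right W := by
      rw [id_tensorHom]
      exact Functor.LaxMonoidal.right_unitality (J ⋙ F) W }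

theorem μ_star {V V' W W' : E} {X X' : C} (f : J.obj V ⟶ J.obj W) (f' : J.obj V' ⟶ J.obj W')
    (u : J.obj W ⟶ X) (u' : J.obj W' ⟶ X') :
    (F.map f ⊗ₘ F.map f') ≫ (S.μ W W').hom ≫ F.map (star J u u') =
      (S.μ V V').hom ≫ F.map (star J (f ≫ u) (f' ≫ u')) := by
  obtain ⟨f, rfl⟩ := J.map_surjective f
  obtain ⟨f', rfl⟩ := J.map_surjective f'
  rw [← Category.assoc, S.μ_natural, Category.assoc, ← Functor.map_comp, map_star]

/-- The components of the tensor constraint of the extension. -/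
def tensorHomApp (X X' : C) : F.obj X ⊗ F.obj X' ⟶ F.obj (X ⊗ X') :=
  ∑ x : (hJ.res X).ι × (hJ.res X').ι, (F.map ((hJ.res X).p x.1) ⊗ₘ F.map ((hJ.res X').p x.2)) ≫
    (S.μ _ _).hom ≫ F.map (star J ((hJ.res X).s x.1) ((hJ.res X').s x.2))

theorem sum_star {X X' : C} {W W' : E} (u : J.obj W ⟶ X) (u' : J.obj W' ⟶ X') :
    ∑ x : (hJ.res X).ι × (hJ.res X').ι, star J (u ≫ (hJ.res X).p x.1 ≫ (hJ.res X).s x.1)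
      (u' ≫ (hJ.res X').p x.2 ≫ (hJ.res X').s x.2) = star J u u' := by
  simp only [star]
  rw [← Preadditive.comp_sum, ← sum_tensorHom_sum
    (fun i => u ≫ (hJ.res X).p i ≫ (hJ.res X).s i) (fun i => u' ≫ (hJ.res X').p i ≫ (hJ.res X').s i),
    ← Preadditive.comp_sum, ← Preadditive.comp_sum, (hJ.res X).total, (hJ.res X').total,
    Category.comp_id, Category.comp_id]

/-- The two-variable analogue of `map_extendApp`: fullness (through `μ_star`) moves the given
constraint past `u ≫ p` and `u' ≫ p'`, and the double sum collapses. With `hom_ext_tensor` it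
characterizes the extended constraint. -/
theorem map_tensorHomApp {X X' : C} {W W' : E} (u : J.obj W ⟶ X) (u' : J.obj W' ⟶ X') :
    (F.map u ⊗ₘ F.map u') ≫ S.tensorHomApp hJ X X' = (S.μ W W').hom ≫ F.map (star J u u') := by
  rw [tensorHomApp, Preadditive.comp_sum, ← sum_star hJ u u', Functor.map_sum, Preadditive.comp_sum]
  refine Finset.sum_congr rfl fun x _ => ?_
  rw [tensorHom_comp_tensorHom_assoc, ← Functor.map_comp, ← Functor.map_comp, μ_star,
    Category.assoc, Category.assoc]

/-- The components of the inverse of the tensor constraint of the extension. -/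
def tensorInvApp (X X' : C) : F.obj (X ⊗ X') ⟶ F.obj X ⊗ F.obj X' :=
  ∑ x : (hJ.res X).ι × (hJ.res X').ι,
    F.map (((hJ.res X).p x.1 ⊗ₘ (hJ.res X').p x.2) ≫ Functor.LaxMonoidal.μ J _ _) ≫
    (S.μ _ _).inv ≫ (F.map ((hJ.res X).s x.1) ⊗ₘ F.map ((hJ.res X').s x.2))

theorem sum_map_tensorHom {X X' : C} {W W' : E} (u : J.obj W ⟶ X) (u' : J.obj W' ⟶ X') :
    ∑ x : (hJ.res X).ι × (hJ.res X').ι, (F.map (u ≫ (hJ.res X).p x.1 ≫ (hJ.res X).s x.1) ⊗ₘ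
      F.map (u' ≫ (hJ.res X').p x.2 ≫ (hJ.res X').s x.2)) = (F.map u ⊗ₘ F.map u') := by
  rw [← sum_tensorHom_sum (fun i => F.map (u ≫ (hJ.res X).p i ≫ (hJ.res X).s i))
    (fun i => F.map (u' ≫ (hJ.res X').p i ≫ (hJ.res X').s i)), ← Functor.map_sum,
    ← Functor.map_sum,
    ← Preadditive.comp_sum, ← Preadditive.comp_sum, (hJ.res X).total, (hJ.res X').total,
    Category.comp_id, Category.comp_id]

/-- The inverse is characterized in the same manner, tested against `star` since it starts at `F (X
⊗ X')`. The two formulas make both composites identities on generators. -/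
theorem map_tensorInvApp {X X' : C} {W W' : E} (u : J.obj W ⟶ X) (u' : J.obj W' ⟶ X') :
    F.map (star J u u') ≫ S.tensorInvApp hJ X X' = (S.μ W W').inv ≫ (F.map u ⊗ₘ F.map u') := by
  rw [tensorInvApp, Preadditive.comp_sum, ← sum_map_tensorHom hJ u u', Preadditive.comp_sum]
  refine Finset.sum_congr rfl fun x _ => ?_
  obtain ⟨f, hf⟩ := J.map_surjective (u ≫ (hJ.res X).p x.1)
  obtain ⟨f', hf'⟩ := J.map_surjective (u' ≫ (hJ.res X').p x.2)
  have e : star J u u' ≫ ((hJ.res X).p x.1 ⊗ₘ (hJ.res X').p x.2) ≫ Functor.LaxMonoidal.μ J _ _ =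
      J.map (f ⊗ₘ f') := by
    rw [star, Category.assoc, tensorHom_comp_tensorHom_assoc, ← hf, ← hf',
      Functor.LaxMonoidal.μ_natural, Functor.Monoidal.δ_μ_assoc]
  have e' : F.map (J.map (f ⊗ₘ f')) ≫ (S.μ _ _).inv =
      (S.μ _ _).inv ≫ (F.map (J.map f) ⊗ₘ F.map (J.map f')) := by
    rw [Iso.comp_inv_eq, Category.assoc, S.μ_natural, Iso.inv_hom_id_assoc]
  rw [← Functor.map_comp_assoc, e, reassoc_of% e', tensorHom_comp_tensorHom, ← Functor.map_comp,
    ← Functor.map_comp, hf, hf', Category.assoc, Category.assoc]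

/-- The tensor constraint of the extension. -/
def tensorApp (X X' : C) : F.obj X ⊗ F.obj X' ≅ F.obj (X ⊗ X') where
  hom := S.tensorHomApp hJ X X'
  inv := S.tensorInvApp hJ X X'
  hom_inv_id := hom_ext_tensor F F hJ fun W W' u u' => by
    rw [← Category.assoc, map_tensorHomApp, Category.assoc, map_tensorInvApp,
      Iso.hom_inv_id_assoc, Category.comp_id]
  inv_hom_id := hom_ext_star F hJ fun W W' u u' => by
    rw [← Category.assoc, map_tensorInvApp, Category.assoc, map_tensorHomApp,
      Iso.inv_hom_id_assoc, Category.comp_id]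

theorem map_tensorApp {X X' : C} {W W' : E} (u : J.obj W ⟶ X) (u' : J.obj W' ⟶ X') :
    (F.map u ⊗ₘ F.map u') ≫ (S.tensorApp hJ X X').hom = (S.μ W W').hom ≫ F.map (star J u u') :=
  S.map_tensorHomApp hJ u u'

theorem tensorApp_natural {X X' Y Y' : C} (f : X ⟶ Y) (f' : X' ⟶ Y') :
    (F.map f ⊗ₘ F.map f') ≫ (S.tensorApp hJ Y Y').hom =
      (S.tensorApp hJ X X').hom ≫ F.map (f ⊗ₘ f') :=
  hom_ext_tensor F F hJ fun W W' u u' => by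
    rw [tensorHom_comp_tensorHom_assoc, ← Functor.map_comp, ← Functor.map_comp, map_tensorApp,
      ← Category.assoc, map_tensorApp, Category.assoc, ← Functor.map_comp, star_comp]

/-- The strong monoidal structure of the extension. -/
def core : F.CoreMonoidal where
  εIso := S.ε ≪≫ F.mapIso (Functor.Monoidal.εIso J).symm
  μIso := S.tensorApp hJ
  μIso_hom_natural_left {X Y} f X' := by
    have e := S.tensorApp_natural hJ f (𝟙 X')
    rwa [CategoryTheory.Functor.map_id, tensorHom_id, tensorHom_id] at e
  μIso_hom_natural_right {X Y} X' f := by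
    have e := S.tensorApp_natural hJ (𝟙 X') f
    rwa [CategoryTheory.Functor.map_id, id_tensorHom, id_tensorHom] at e
  associativity X X' X'' := hom_ext_tensor₃ F F F hJ fun W W' W'' u u' u'' => by
    -- On generators the extended constraint becomes `S.μ` followed by `star`, and associativity
    -- follows from `S.assoc` and `star_assoc`.
    have e₁ : ((F.map u ⊗ₘ F.map u') ⊗ₘ F.map u'') ≫ (S.tensorApp hJ X X').hom ▷ F.obj X'' =
        ((S.μ W W').hom ⊗ₘ 𝟙 _) ≫ (F.map (star J u u') ⊗ₘ F.map u'') := by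
      rw [← tensorHom_id, tensorHom_comp_tensorHom, map_tensorApp, tensorHom_comp_tensorHom,
        Category.id_comp, Category.comp_id]
    have e₂ : (F.map u ⊗ₘ (F.map u' ⊗ₘ F.map u'')) ≫ F.obj X ◁ (S.tensorApp hJ X' X'').hom =
        (𝟙 _ ⊗ₘ (S.μ W' W'').hom) ≫ (F.map u ⊗ₘ F.map (star J u' u'')) := by
      rw [← id_tensorHom, tensorHom_comp_tensorHom, map_tensorApp, tensorHom_comp_tensorHom,
        Category.id_comp, Category.comp_id]
    rw [reassoc_of% e₁, ← Category.assoc (F.map _ ⊗ₘ F.map _), map_tensorApp, Category.assoc,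
      ← Functor.map_comp, star_assoc, Functor.map_comp, reassoc_of% S.assoc,
      associator_naturality_assoc, reassoc_of% e₂, map_tensorApp]
  left_unitality X := by
    rw [← cancel_epi (λ_ (F.obj X)).inv, Iso.inv_hom_id]
    refine hJ.hom_ext F fun W u => ?_
    have e₁ : 𝟙_ D ◁ F.map u ≫ (S.ε.hom ≫ F.map (starUnit J)) ▷ F.obj X =
        (S.ε.hom ⊗ₘ 𝟙 _) ≫ (F.map (starUnit J) ⊗ₘ F.map u) := by
      rw [← id_tensorHom, ← tensorHom_id, tensorHom_comp_tensorHom, tensorHom_comp_tensorHom,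
        Category.id_comp, Category.comp_id, Category.id_comp]
    rw [leftUnitor_inv_naturality_assoc]
    change _ = _ ≫ _ ≫ (S.ε.hom ≫ F.map (starUnit J)) ▷ F.obj X ≫ _
    rw [reassoc_of% e₁, ← Category.assoc (F.map _ ⊗ₘ F.map _), map_tensorApp, Category.assoc,
      ← Functor.map_comp, star_left, Functor.map_comp, ← reassoc_of% S.left, Iso.inv_hom_id_assoc,
      Category.comp_id]
  right_unitality X := by
    rw [← cancel_epi (ρ_ (F.obj X)).inv, Iso.inv_hom_id]
    refine hJ.hom_ext F fun W u => ?_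
    have e₁ : F.map u ▷ 𝟙_ D ≫ F.obj X ◁ (S.ε.hom ≫ F.map (starUnit J)) =
        (𝟙 _ ⊗ₘ S.ε.hom) ≫ (F.map u ⊗ₘ F.map (starUnit J)) := by
      rw [← id_tensorHom, ← tensorHom_id, tensorHom_comp_tensorHom, tensorHom_comp_tensorHom,
        Category.id_comp, Category.comp_id, Category.id_comp]
    rw [rightUnitor_inv_naturality_assoc]
    change _ = _ ≫ _ ≫ F.obj X ◁ (S.ε.hom ≫ F.map (starUnit J)) ≫ _
    rw [reassoc_of% e₁, ← Category.assoc (F.map _ ⊗ₘ F.map _), map_tensorApp, Category.assoc,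
      ← Functor.map_comp, star_right, Functor.map_comp, ← reassoc_of% S.right,
      Iso.inv_hom_id_assoc, Category.comp_id]

/-- The strong monoidal structure of the extension. -/
@[reducible]
def monoidal : F.Monoidal := (S.core hJ).toMonoidal

end RestrictedMonoidal

section Monoidal

variable {J : E ⥤ C} [J.Monoidal] {F F' : C ⥤ D} [F.Monoidal] [F'.Monoidal]

open Functor.LaxMonoidal

/-- By naturality, the constraint of any monoidal `F` on generators is expressed by that of `J ⋙ F`;
this is why monoidality of a transformation can be checked after restriction. -/
theorem map_μ_star {X X' : C} {W W' : E} (u : J.obj W ⟶ X) (u' : J.obj W' ⟶ X') :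
    (F.map u ⊗ₘ F.map u') ≫ μ F X X' =
      (μ F (J.obj W) (J.obj W') ≫ F.map (μ J W W')) ≫ F.map (star J u u') := by
  rw [Category.assoc, ← Functor.map_comp, star, Functor.Monoidal.μ_δ_assoc, μ_natural]

/-- A natural transformation is monoidal if its restriction is. -/
theorem isMonoidal_of_restrict (hJ : Generates J) [F.Additive] [F'.Additive] (t : F ⟶ F')
    (t' : J ⋙ F ⟶ J ⋙ F') [NatTrans.IsMonoidal t'] (h : ∀ W, t.app (J.obj W) = t'.app W) :
    NatTrans.IsMonoidal t where
  unit := by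
    have e₁ := NatTrans.IsMonoidal.unit (τ := t')
    rw [comp_ε, comp_ε, Category.assoc, ← h] at e₁
    have e := t.naturality (ε J)
    rw [← cancel_mono (F'.map (ε J)), Category.assoc, ← e]
    exact e₁
  tensor X X' := hom_ext_tensor F F hJ fun W W' u u' => by
    have h₂ := NatTrans.IsMonoidal.tensor (τ := t') W W'
    rw [comp_μ, comp_μ, Category.assoc, ← h, ← h, ← h] at h₂
    rw [← Category.assoc, map_μ_star, Category.assoc, Category.assoc, NatTrans.naturality]
    have h₃ := h₂ =≫ F'.map (star J u u')
    simp only [Category.assoc] at h₃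
    refine h₃.trans ?_
    rw [tensorHom_comp_tensorHom_assoc, NatTrans.naturality, NatTrans.naturality,
      ← tensorHom_comp_tensorHom_assoc, map_μ_star, Category.assoc]

/-- The structure of `T` was obtained by transporting that of `P` along `t`, so `t` respects it by
design. The verification consists in cancelling the unit and tensor constraints of `J` in the
composite structure of `J ⋙ T` against those in the construction. -/
theorem isMonoidal_ofIso {P : E ⥤ D} [P.Monoidal] (hJ : Generates J) [J.Full]
    {T : C ⥤ D} [T.Additive] (t : J ⋙ T ≅ P) :
    letI := (RestrictedMonoidal.ofIso J T t).monoidal hJ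
    NatTrans.IsMonoidal t.hom := by
  let _ := (RestrictedMonoidal.ofIso J T t).monoidal hJ
  let t' (W : E) : T.obj (J.obj W) ≅ P.obj W := t.app W
  constructor
  · rw [comp_ε]
    change (((ε P ≫ (t' _).inv) ≫ T.map (starUnit J)) ≫ T.map (ε J)) ≫ (t' _).hom = ε P
    have e : T.map (starUnit J) ≫ T.map (ε J) = 𝟙 _ := by
      rw [← Functor.map_comp, ← T.map_id]
      exact congrArg T.map (Functor.Monoidal.η_ε J)
    rw [Category.assoc, Category.assoc, reassoc_of% e, Category.assoc, Iso.inv_hom_id,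
      Category.comp_id]
  · intro W W'
    rw [comp_μ]
    have e := (RestrictedMonoidal.ofIso J T t).map_tensorApp hJ (𝟙 (J.obj W)) (𝟙 (J.obj W'))
    rw [CategoryTheory.Functor.map_id, CategoryTheory.Functor.map_id, id_tensorHom_id,
      Category.id_comp, star, id_tensorHom_id, Category.comp_id] at e
    have e' : T.map (Functor.OplaxMonoidal.δ J W W') ≫ T.map (μ J W W') = 𝟙 _ := by
      rw [← Functor.map_comp, Functor.Monoidal.δ_μ, CategoryTheory.Functor.map_id]
    change (((RestrictedMonoidal.ofIso J T t).tensorApp hJ (J.obj W) (J.obj W')).hom ≫ _) ≫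
      (t' _).hom = ((t' W).hom ⊗ₘ (t' W').hom) ≫ _
    rw [e, Category.assoc, Category.assoc, reassoc_of% e']
    change (((t' W).hom ⊗ₘ (t' W').hom) ≫ μ P W W' ≫ (t' (W ⊗ W')).inv) ≫ _ = _
    rw [Category.assoc, Category.assoc, Iso.inv_hom_id, Category.comp_id]

end Monoidal

end DenseMonoidal

/-! ### Graded categories with a crossing, and their completions -/

/-- A strictly `G`-graded `k`-linear monoidal category with a crossing, not assumed to have direct
sums. -/
structure Pre (G : Type u) [Group G] (k : Type w) [CommRing k] where
  carrier : Type u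
  [category : Category.{v} carrier]
  [preadditive : Preadditive carrier]
  [linear : Linear k carrier]
  [monoidal : MonoidalCategory carrier]
  [monoidalPreadditive : MonoidalPreadditive carrier]
  [monoidalLinear : MonoidalLinear k carrier]
  deg : carrier → G
  hom_eq_zero {X Y : carrier} : deg X ≠ deg Y → ∀ f : X ⟶ Y, f = 0
  deg_tensor (X Y : carrier) : deg (X ⊗ Y) = deg X * deg Y
  deg_unit : deg (𝟙_ carrier) = 1
  φ : G → carrier ⥤ carrier
  [φ_monoidal (a : G) : (φ a).Monoidal]
  [φ_additive (a : G) : (φ a).Additive]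
  [φ_linear (a : G) : (φ a).Linear k]
  φComp {a b c : G} (h : b * a = c) : φ b ⋙ φ a ≅ φ c
  [φComp_isMonoidal {a b c : G} (h : b * a = c) : NatTrans.IsMonoidal (φComp h).hom]
  φId : 𝟭 carrier ≅ φ 1
  [φId_isMonoidal : NatTrans.IsMonoidal φId.hom]
  φComp_assoc {a b c ab bc abc : G} (h₁ : b * a = ab) (h₂ : c * b = bc) (h₃ : c * ab = abc)
    (h₄ : bc * a = abc) (X : carrier) :
    (φ a).map ((φComp h₂).hom.app X) ≫ (φComp h₄).hom.app X =
      (φComp h₁).hom.app ((φ c).obj X) ≫ (φComp h₃).hom.app X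
  φ_map_φId {a : G} (h : 1 * a = a) (X : carrier) :
    (φ a).map (φId.hom.app X) ≫ (φComp h).hom.app X = 𝟙 ((φ a).obj X)
  φId_φ {a : G} (h : a * 1 = a) (X : carrier) :
    φId.hom.app ((φ a).obj X) ≫ (φComp h).hom.app X = 𝟙 ((φ a).obj X)
  deg_φ (a : G) (X : carrier) : deg ((φ a).obj X) = a⁻¹ * deg X * a

namespace Pre

variable {G : Type u} [Group G] {k : Type w} [CommRing k]

instance : CoeSort (Pre.{w, v, u} G k) (Type u) := ⟨carrier⟩

attribute [instance] category preadditive linear monoidal monoidalPreadditive monoidalLinear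
  φ_monoidal φ_additive φ_linear φComp_isMonoidal φId_isMonoidal

end Pre

noncomputable section PreHoms

variable {G : Type u} [Group G] {k : Type w} [CommRing k]

/-- The total category of a monoidale, with its grading and crossing. -/
def Monoidale.pre (M : Monoidale.{w, v, u} G k) : Pre.{w, v, u} G k where
  carrier := M.Total
  deg X := X.deg
  hom_eq_zero h f := Tot.eq_zero h f
  deg_tensor X Y := rfl
  deg_unit := rfl
  φ := M.ps.cross
  φ_monoidal := fun a => inferInstanceAs (M.ps.cross a).Monoidal
  φ_additive := fun a => inferInstanceAs (M.ps.cross a).Additive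
  φ_linear := fun a => inferInstanceAs ((M.ps.cross a).Linear k)
  φComp h := M.ps.crossMul h
  φComp_isMonoidal := fun h => inferInstanceAs (NatTrans.IsMonoidal (M.ps.crossMul h).hom)
  φId := M.ps.crossOne
  φId_isMonoidal := inferInstanceAs (NatTrans.IsMonoidal M.ps.crossOne.hom)
  φComp_assoc := M.ps.crossMulApp_assoc
  φ_map_φId := M.ps.cross_map_crossOneApp
  φId_φ := M.ps.crossOneApp_cross
  deg_φ a X := rfl

/-- A morphism from a graded category with a crossing to a `G`-crossed category. -/
structure PreHom (E : Pre.{w, v, u} G k) (C : CrossedCat.{w, v, u} G k) where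
  F : E ⥤ C
  [monoidal : F.Monoidal]
  [additive : F.Additive]
  [linear : F.Linear k]
  deg (X : E) : C.deg (E.deg X) (F.obj X)
  φIso (a : G) : E.φ a ⋙ F ≅ F ⋙ C.φ a
  [φIso_isMonoidal (a : G) : NatTrans.IsMonoidal (φIso a).hom]
  φIso_comp {a b c : G} (h : b * a = c) (X : E) :
    F.map ((E.φComp h).hom.app X) ≫ (φIso c).hom.app X =
      (φIso a).hom.app ((E.φ b).obj X) ≫ (C.φ a).map ((φIso b).hom.app X) ≫
        (C.φComp h).hom.app (F.obj X)
  φIso_id (X : E) :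
    F.map (E.φId.hom.app X) ≫ (φIso 1).hom.app X = C.φId.hom.app (F.obj X)

attribute [instance] PreHom.monoidal PreHom.additive PreHom.linear PreHom.φIso_isMonoidal

namespace PreHom

variable {E : Pre.{w, v, u} G k} {C D : CrossedCat.{w, v, u} G k}

/-- The morphism `J` exhibits `C` as a completion under finite direct sums. -/
structure IsCompletion (J : PreHom E C) : Prop where
  full : J.F.Full
  faithful : J.F.Faithful
  exists_iso (X : C) : ∃ (n : ℕ) (Y : Fin n → E), Nonempty (X ≅ ⨁ fun i => J.F.obj (Y i))

namespace IsCompletion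

variable {J : PreHom E C}

/-- The presentation is the given direct sum. If `X` has a degree, summands of other degrees are
discarded, which does not change the total because the maps from them to `X` vanish. Orthogonality
is kept in order to rebuild the same direct sum in another category. -/
theorem exists_resolution (hJ : J.IsCompletion) (X : C) : ∃ R : Resolution J.F X,
    (∀ i j, i ≠ j → R.s i ≫ R.p j = 0) ∧ (∀ i, R.s i ≫ R.p i = 𝟙 _) ∧
      ∀ a, C.deg a X → ∀ i, E.deg (R.Y i) = a := by
  obtain ⟨n, Y, ⟨e⟩⟩ := hJ.exists_iso X
  have total : ∑ i, (e.hom ≫ biproduct.π _ i) ≫ biproduct.ι (fun i => J.F.obj (Y i)) i ≫ e.inv = 𝟙 X := by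
    have h := biproduct.total (f := fun i => J.F.obj (Y i))
    have h' := e.hom ≫= (h =≫ e.inv)
    rw [Category.id_comp, Iso.hom_inv_id, Preadditive.sum_comp, Preadditive.comp_sum] at h'
    rw [← h']
    exact Finset.sum_congr rfl fun i _ => by simp only [Category.assoc]
  by_cases hX : ∃ a, C.deg a X
  · obtain ⟨a, ha⟩ := hX
    have zero : ∀ i, E.deg (Y i) ≠ a → (e.hom ≫ biproduct.π _ i) ≫
        biproduct.ι (fun i => J.F.obj (Y i)) i ≫ e.inv = 0 := fun i hi => by
      rw [C.hom_eq_zero hi (J.deg (Y i)) ha (biproduct.ι (fun i => J.F.obj (Y i)) i ≫ e.inv), comp_zero]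
    classical
    refine ⟨{ ι := { i : Fin n // E.deg (Y i) = a }
              Y := fun i => Y i
              p := fun i => e.hom ≫ biproduct.π _ i.1
              s := fun i => biproduct.ι (fun i => J.F.obj (Y i)) i.1 ≫ e.inv
              total := ?_ }, fun i j h => ?_, fun i => ?_, fun b hb i => ?_⟩
    · rw [← total]
      refine Fintype.sum_of_injective Subtype.val Subtype.val_injective _ _ (fun i hi => ?_)
        fun i => rfl
      exact zero i fun h => hi ⟨⟨i, h⟩, rfl⟩
    · have h' : i.1 ≠ j.1 := fun h' => h (Subtype.ext h')
      simp [biproduct.ι_π_ne _ h']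
    · simp
    · rw [i.2, C.deg_disjoint ha hb]
  · refine ⟨{ ι := Fin n
              Y := Y
              p := fun i => e.hom ≫ biproduct.π _ i
              s := fun i => biproduct.ι (fun i => J.F.obj (Y i)) i ≫ e.inv
              total := total }, fun i j h => ?_, fun i => ?_, fun b hb => (hX ⟨b, hb⟩).elim⟩
    · simp [biproduct.ι_π_ne _ h]
    · simp

theorem generates (hJ : J.IsCompletion) : Generates J.F := fun X => ⟨(hJ.exists_resolution X).choose⟩

/-- The direct sum in `D` of the images of the generators is a realization. The degrees in `D` are
not assumed closed under isomorphism, so for homogeneous `X` the sum has to be formed inside the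
subcategory of that degree. -/
theorem exists_realization (hJ : J.IsCompletion) [J.F.Full] [J.F.Faithful] (N : PreHom E D) (X : C) :
    ∃ (R : Resolution J.F X) (L : Realization N.F R), ∀ a, C.deg a X → D.deg a L.obj := by
  obtain ⟨R, h₁, h₂, h₃⟩ := hJ.exists_resolution X
  refine ⟨R, ?_⟩
  have key : ∀ (Z : D) (q : ∀ i, Z ⟶ N.F.obj (R.Y i)) (t : ∀ i, N.F.obj (R.Y i) ⟶ Z),
      (∀ i j, i ≠ j → t i ≫ q j = 0) → (∀ i, t i ≫ q i = 𝟙 _) → (∑ i, q i ≫ t i = 𝟙 Z) →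
        ∃ L : Realization N.F R, L.obj = Z := by
    intro Z q t h₁' h₂' h₃'
    refine ⟨⟨Z, q, t, fun i j => ?_, h₃'⟩, rfl⟩
    -- The composites `R.s i ≫ R.p j` are identities or zero, so their lifts along `J` are too,
    -- matching the relations between `t i` and `q j`.
    by_cases h : i = j
    · subst h
      rw [h₂', h₂, Functor.preimage_id, CategoryTheory.Functor.map_id]
    · rw [h₁' i j h, h₁ i j h]
      have e : J.F.preimage (0 : J.F.obj (R.Y i) ⟶ J.F.obj (R.Y j)) = 0 :=
        J.F.map_injective (by rw [Functor.map_preimage, Functor.map_zero])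
      rw [e, Functor.map_zero]
  by_cases hX : ∃ a, C.deg a X
  · obtain ⟨a, ha⟩ := hX
    -- All generators in the presentation have degree `a`, so their images in `D` have degree `a` as
    -- well.
    let Y' : R.ι → (D.deg a).FullSubcategory := fun i => ⟨N.F.obj (R.Y i), h₃ a ha i ▸ N.deg _⟩
    obtain ⟨L, hL⟩ := key (⨁ Y').obj (fun i => (biproduct.π Y' i).hom)
      (fun i => (biproduct.ι Y' i).hom)
      (fun i j h => congrArg (fun f => f.hom) (biproduct.ι_π_ne Y' h))
      (fun i => congrArg (fun f => f.hom) (biproduct.ι_π_self Y' i))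
      (by
        have e := congrArg (fun f => (D.deg a).ι.map f) (biproduct.total (f := Y'))
        rw [Functor.map_sum] at e
        exact e)
    refine ⟨L, fun b hb => ?_⟩
    rw [hL, ← C.deg_disjoint ha hb]
    exact (⨁ Y').property
  · obtain ⟨L, -⟩ := key (⨁ fun i => N.F.obj (R.Y i)) (fun i => biproduct.π _ i)
      (fun i => biproduct.ι (fun i => N.F.obj (R.Y i)) i) (fun i j h => biproduct.ι_π_ne _ h)
      (fun i => biproduct.ι_π_self _ i) biproduct.total
    exact ⟨L, fun b hb => (hX ⟨b, hb⟩).elim⟩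

end IsCompletion

end PreHom

end PreHoms

/-! ### Extending morphisms and 2-cells along a completion -/

noncomputable section Extension

set_option linter.unusedSectionVars false

/-- Naturality transports the comparison at `X` to the generators mapping to `X`, where `hom_ext`
decides. Coherence laws of the extensions are proved by writing both sides as natural
transformations and applying this. -/
theorem Generates.app_eq {E C D : Type*} [Category E] [Category C] [Category D]
    [Preadditive C] [Preadditive D] {J : E ⥤ C} (hJ : Generates J) {T T' : C ⥤ D} [T.Additive]
    (s t : T ⟶ T') (h : ∀ W, s.app (J.obj W) = t.app (J.obj W)) (X : C) : s.app X = t.app X :=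
  hJ.hom_ext T fun W u => by rw [s.naturality, t.naturality, h]

variable {G : Type u} [Group G] {k : Type w} [CommRing k]

namespace CrossedCat

variable (C : CrossedCat.{w, v, u} G k)

/-- The components of `φComp`. -/
def mulApp {a b c : G} (h : b * a = c) (X : C) : (C.φ a).obj ((C.φ b).obj X) ≅ (C.φ c).obj X :=
  (C.φComp h).app X

/-- The components of `φId`. -/
def oneApp (X : C) : X ≅ (C.φ 1).obj X := C.φId.app X

theorem mulApp_natural {a b c : G} (h : b * a = c) {X Y : C} (f : X ⟶ Y) :
    (C.φ a).map ((C.φ b).map f) ≫ (C.mulApp h Y).hom = (C.mulApp h X).hom ≫ (C.φ c).map f :=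
  (C.φComp h).hom.naturality f

theorem oneApp_natural {X Y : C} (f : X ⟶ Y) :
    f ≫ (C.oneApp Y).hom = (C.oneApp X).hom ≫ (C.φ 1).map f :=
  C.φId.hom.naturality f

variable {C} {D : CrossedCat.{w, v, u} G k}

/-- The components of `φIso`. -/
def Hom.φApp (F : Hom C D) (a : G) (X : C) : F.F.obj ((C.φ a).obj X) ≅ (D.φ a).obj (F.F.obj X) :=
  (F.φIso a).app X

end CrossedCat

namespace Pre

variable (E : Pre.{w, v, u} G k)

/-- The components of `φComp`. -/
def mulApp {a b c : G} (h : b * a = c) (X : E) : (E.φ a).obj ((E.φ b).obj X) ≅ (E.φ c).obj X :=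
  (E.φComp h).app X

/-- The components of `φId`. -/
def oneApp (X : E) : X ≅ (E.φ 1).obj X := E.φId.app X

end Pre

namespace PreHom

variable {E : Pre.{w, v, u} G k} {C D : CrossedCat.{w, v, u} G k} (J : PreHom E C)
  (N : PreHom E D)

/-- The components of `φIso`. -/
def φApp (a : G) (X : E) : J.F.obj ((E.φ a).obj X) ≅ (C.φ a).obj (J.F.obj X) :=
  (J.φIso a).app X

theorem φApp_mul {a b c : G} (h : b * a = c) (X : E) :
    J.F.map (E.mulApp h X).hom ≫ (J.φApp c X).hom =
      (J.φApp a ((E.φ b).obj X)).hom ≫ (C.φ a).map (J.φApp b X).hom ≫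
        (C.mulApp h (J.F.obj X)).hom :=
  J.φIso_comp h X

theorem φApp_one (X : E) :
    J.F.map (E.oneApp X).hom ≫ (J.φApp 1 X).hom = (C.oneApp (J.F.obj X)).hom :=
  J.φIso_id X

/-- A functor `C ⥤ D` whose restriction along `J` is isomorphic to `N`. -/
structure Ext where
  F : C ⥤ D
  [monoidal : F.Monoidal]
  [additive : F.Additive]
  [linear : F.Linear k]
  deg {a : G} {X : C} : C.deg a X → D.deg a (F.obj X)
  iso : J.F ⋙ F ≅ N.F
  [isMonoidal : NatTrans.IsMonoidal iso.hom]

attribute [instance] Ext.monoidal Ext.additive Ext.linear Ext.isMonoidal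

variable {J N}

/-- A realization is chosen for each object; `Realization.functor` makes the choices functorial.
Degrees are preserved since the realizations were chosen in the right degree, and the monoidal
structure is transported from `N`. -/
theorem IsCompletion.exists_ext (hJ : J.IsCompletion) : Nonempty (Ext J N) := by
  have := hJ.full
  have := hJ.faithful
  choose R L h using fun X => hJ.exists_realization N X
  let F := Realization.functor L
  let t : J.F ⋙ F ≅ N.F := Realization.functorIso L
  let _ : F.Monoidal := (RestrictedMonoidal.ofIso J.F F t).monoidal hJ.generates
  exact ⟨{ F := F
           linear := Realization.functor_linear L
           deg := fun {a X} hX => h X a hX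
           iso := t
           isMonoidal := isMonoidal_ofIso hJ.generates t }⟩

namespace Ext

variable (P : Ext J N)

/-- The isomorphism of a restricted functor with the given one. -/
def app (W : E) : P.F.obj (J.F.obj W) ≅ N.F.obj W := P.iso.app W

theorem app_natural {W W' : E} (f : W ⟶ W') :
    P.F.map (J.F.map f) ≫ (P.app W').hom = (P.app W).hom ≫ N.F.map f := P.iso.hom.naturality f

/-- The compatibility with the crossings, on generators. -/
def baseIso (a : G) : J.F ⋙ (C.φ a ⋙ P.F) ≅ J.F ⋙ (P.F ⋙ D.φ a) :=
  (Functor.associator _ _ _).symm ≪≫ Functor.isoWhiskerRight (J.φIso a).symm P.F ≪≫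
    Functor.associator _ _ _ ≪≫ Functor.isoWhiskerLeft (E.φ a) P.iso ≪≫ N.φIso a ≪≫
      Functor.isoWhiskerRight P.iso.symm (D.φ a) ≪≫ Functor.associator _ _ _

instance (a : G) : NatTrans.IsMonoidal (P.baseIso a).hom :=
  inferInstanceAs (NatTrans.IsMonoidal ((Functor.associator _ _ _).inv ≫
    Functor.whiskerRight (J.φIso a).inv P.F ≫ (Functor.associator _ _ _).hom ≫
      Functor.whiskerLeft (E.φ a) P.iso.hom ≫ (N.φIso a).hom ≫
        Functor.whiskerRight P.iso.inv (D.φ a) ≫ (Functor.associator _ _ _).hom))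

theorem baseIso_app (a : G) (W : E) :
    (P.baseIso a).hom.app W = P.F.map (J.φApp a W).inv ≫ (P.app ((E.φ a).obj W)).hom ≫
      (N.φApp a W).hom ≫ (D.φ a).map (P.app W).inv := by
  change 𝟙 _ ≫ P.F.map (J.φApp a W).inv ≫ 𝟙 _ ≫
      (P.app ((E.φ a).obj W)).hom ≫ (N.φApp a W).hom ≫ (D.φ a).map (P.app W).inv ≫ 𝟙 _ = _
  simp only [Category.id_comp, Category.comp_id]

variable (hJ : J.IsCompletion)

/-- The compatibility with the crossings. -/
def φIso (a : G) : C.φ a ⋙ P.F ≅ P.F ⋙ D.φ a :=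
  haveI := hJ.full
  hJ.generates.extendIso (P.baseIso a)

/-- The components of `φIso`. -/
def φApp (a : G) (X : C) : P.F.obj ((C.φ a).obj X) ≅ (D.φ a).obj (P.F.obj X) :=
  (P.φIso hJ a).app X

/-- The extended compatibility on generators, with all inverses moved to the other side. Together
with naturality it is all that the verification of `φApp_mul` and `φApp_one` uses. -/
theorem φApp_app (a : G) (W : E) :
    P.F.map (J.φApp a W).hom ≫ (P.φApp hJ a (J.F.obj W)).hom ≫ (D.φ a).map (P.app W).hom =
      (P.app ((E.φ a).obj W)).hom ≫ (N.φApp a W).hom := by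
  have := hJ.full
  have e : (P.φApp hJ a (J.F.obj W)).hom = P.F.map (J.φApp a W).inv ≫
      (P.app ((E.φ a).obj W)).hom ≫ (N.φApp a W).hom ≫ (D.φ a).map (P.app W).inv :=
    (hJ.generates.extend_app (P.baseIso a).hom W).trans (P.baseIso_app a W)
  rw [e, Category.assoc, Category.assoc, Category.assoc, ← Functor.map_comp, Iso.inv_hom_id,
    CategoryTheory.Functor.map_id, Category.comp_id, ← Functor.map_comp_assoc, Iso.hom_inv_id,
    CategoryTheory.Functor.map_id, Category.id_comp]

theorem φApp_natural (a : G) {X Y : C} (f : X ⟶ Y) :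
    P.F.map ((C.φ a).map f) ≫ (P.φApp hJ a Y).hom =
      (P.φApp hJ a X).hom ≫ (D.φ a).map (P.F.map f) :=
  (P.φIso hJ a).hom.naturality f

instance (a : G) : NatTrans.IsMonoidal (P.φIso hJ a).hom := by
  have := hJ.full
  exact isMonoidal_of_restrict hJ.generates _ (P.baseIso a).hom fun W =>
    hJ.generates.extend_app (P.baseIso a).hom W

/-- Both sides are natural in `X`, so it suffices to take `X = J W`. There the identity follows from
the corresponding laws of `J` and `N`. -/
theorem φApp_mul {a b c : G} (h : b * a = c) (X : C) :
    P.F.map (C.mulApp h X).hom ≫ (P.φApp hJ c X).hom =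
      (P.φApp hJ a ((C.φ b).obj X)).hom ≫ (D.φ a).map (P.φApp hJ b X).hom ≫
        (D.mulApp h (P.F.obj X)).hom := by
  let s : (C.φ b ⋙ C.φ a) ⋙ P.F ⟶ P.F ⋙ D.φ c :=
    Functor.whiskerRight (C.φComp h).hom P.F ≫ (P.φIso hJ c).hom
  let t : (C.φ b ⋙ C.φ a) ⋙ P.F ⟶ P.F ⋙ D.φ c :=
    { app := fun X => (P.φApp hJ a ((C.φ b).obj X)).hom ≫
        (D.φ a).map (P.φApp hJ b X).hom ≫ (D.mulApp h (P.F.obj X)).hom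
      naturality := fun X Y f => by
        have e₁ := P.φApp_natural hJ a ((C.φ b).map f)
        have e₂ := congrArg (D.φ a).map (P.φApp_natural hJ b f)
        rw [Functor.map_comp, Functor.map_comp] at e₂
        change P.F.map ((C.φ a).map ((C.φ b).map f)) ≫ _ = _ ≫ (D.φ c).map (P.F.map f)
        rw [reassoc_of% e₁, Category.assoc, Category.assoc, ← D.mulApp_natural, reassoc_of% e₂] }
  refine hJ.generates.app_eq s t (fun W => ?_) X
  change P.F.map (C.mulApp h (J.F.obj W)).hom ≫ (P.φApp hJ c (J.F.obj W)).hom =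
    (P.φApp hJ a ((C.φ b).obj (J.F.obj W))).hom ≫
      (D.φ a).map (P.φApp hJ b (J.F.obj W)).hom ≫ (D.mulApp h (P.F.obj (J.F.obj W))).hom
  have j := congrArg P.F.map (J.φApp_mul h W)
  have eb := congrArg (D.φ a).map (P.φApp_app hJ b W)
  simp only [Functor.map_comp] at j eb
  rw [← cancel_mono ((D.φ c).map (P.app W).hom),
    ← cancel_epi (P.F.map ((C.φ a).map (J.φApp b W).hom)),
    ← cancel_epi (P.F.map (J.φApp a ((E.φ b).obj W)).hom)]
  simp only [Category.assoc]
  rw [← reassoc_of% j, P.φApp_app, reassoc_of% P.app_natural, N.φApp_mul, ← D.mulApp_natural,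
    reassoc_of% P.φApp_natural hJ a (J.φApp b W).hom, reassoc_of% eb,
    reassoc_of% P.φApp_app hJ a ((E.φ b).obj W)]

theorem φApp_one (X : C) :
    P.F.map (C.oneApp X).hom ≫ (P.φApp hJ 1 X).hom = (D.oneApp (P.F.obj X)).hom := by
  refine hJ.generates.app_eq (Functor.whiskerRight C.φId.hom P.F ≫ (P.φIso hJ 1).hom)
    (Functor.whiskerLeft P.F D.φId.hom) (fun W => ?_) X
  change P.F.map (C.oneApp (J.F.obj W)).hom ≫ (P.φApp hJ 1 (J.F.obj W)).hom =
    (D.oneApp (P.F.obj (J.F.obj W))).hom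
  rw [← cancel_mono ((D.φ 1).map (P.app W).hom), Category.assoc, ← J.φApp_one, Functor.map_comp,
    Category.assoc, P.φApp_app, reassoc_of% P.app_natural, N.φApp_one, D.oneApp_natural]

/-- The extension as a morphism of `G`-crossed categories. -/
def hom : CrossedCat.Hom C D where
  F := P.F
  deg := P.deg
  φIso := P.φIso hJ
  φIso_comp h X := P.φApp_mul hJ h X
  φIso_id := P.φApp_one hJ

end Ext

/-- A transformation between restrictions along `J` of morphisms of `G`-crossed categories. -/
structure Restricted₂ (J : PreHom E C) (F F' : CrossedCat.Hom C D) where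
  t : J.F ⋙ F.F ⟶ J.F ⋙ F'.F
  [isMonoidal : NatTrans.IsMonoidal t]
  φ (a : G) (W : E) :
    t.app ((E.φ a).obj W) ≫ F'.F.map (J.φApp a W).hom ≫ (F'.φApp a (J.F.obj W)).hom =
      F.F.map (J.φApp a W).hom ≫ (F.φApp a (J.F.obj W)).hom ≫ (D.φ a).map (t.app W)

attribute [instance] Restricted₂.isMonoidal

/-- The extension of a transformation. -/
def Restricted₂.extend (hJ : J.IsCompletion) {F F' : CrossedCat.Hom C D} (s : Restricted₂ J F F') :
    CrossedCat.Hom₂ F F' :=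
  have := hJ.full
  { t := hJ.generates.extend s.t
    isMonoidal := isMonoidal_of_restrict hJ.generates _ s.t fun W => hJ.generates.extend_app s.t W
    φ := fun a X => by
      -- Both composites are natural transformations, hence it suffices to compare them on
      -- generators, where `s.φ` applies after cancelling the compatibility isomorphism of `J`.
      refine hJ.generates.app_eq (T := C.φ a ⋙ F.F) (T' := F'.F ⋙ D.φ a)
        (Functor.whiskerLeft (C.φ a) (hJ.generates.extend s.t) ≫ (F'.φIso a).hom)
        ((F.φIso a).hom ≫ Functor.whiskerRight (hJ.generates.extend s.t) (D.φ a)) (fun W => ?_) X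
      let t := hJ.generates.extend s.t
      change t.app ((C.φ a).obj (J.F.obj W)) ≫ (F'.φApp a (J.F.obj W)).hom =
        (F.φApp a (J.F.obj W)).hom ≫ (D.φ a).map (t.app (J.F.obj W))
      have e : ∀ W, t.app (J.F.obj W) = s.t.app W := fun W => hJ.generates.extend_app s.t W
      have e' := s.φ a W
      rw [← e, ← e] at e'
      rw [← cancel_epi (F.F.map (J.φApp a W).hom), ← e', ← Category.assoc, t.naturality,
        Category.assoc] }

theorem Restricted₂.extend_app (hJ : J.IsCompletion) {F F' : CrossedCat.Hom C D}
    (s : Restricted₂ J F F') (W : E) : (s.extend hJ).t.app (J.F.obj W) = s.t.app W :=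
  have := hJ.full
  hJ.generates.extend_app s.t W

theorem IsCompletion.hom₂_ext (hJ : J.IsCompletion) {F F' : CrossedCat.Hom C D}
    (s t : CrossedCat.Hom₂ F F') (h : ∀ W, s.t.app (J.F.obj W) = t.t.app (J.F.obj W)) : s = t :=
  CrossedCat.hom₂_ext (hJ.generates.app_eq s.t t.t h)

end PreHom

end Extension

/-! ### Formal finite direct sums and matrices -/

/-- Index shapes for finite direct sums, closed under products and finite sums. -/
inductive Shape : Type
  | unit : Shape
  | prod : Shape → Shape → Shape
  | sigma (n : ℕ) : (Fin n → Shape) → Shape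

namespace Shape

/-- The index set of a shape. -/
def El : Shape → Type
  | unit => Unit
  | prod c d => c.El × d.El
  | sigma n c => Σ i : Fin n, (c i).El

instance : ∀ c : Shape, Fintype c.El
  | unit => inferInstanceAs (Fintype Unit)
  | prod c d =>
    letI := instFintypeEl c
    letI := instFintypeEl d
    inferInstanceAs (Fintype (c.El × d.El))
  | sigma n c =>
    letI := fun i => instFintypeEl (c i)
    inferInstanceAs (Fintype (Σ i : Fin n, (c i).El))

end Shape

/-- A formal finite direct sum of objects of `E`, with a tag recording a degree which is common to
all summands. -/
structure Sums {G : Type u} [Group G] {k : Type w} [CommRing k] (E : Pre.{w, v, u} G k) where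
  shape : Shape
  fam : shape.El → E
  tag : Option G
  tag_spec (a : G) : tag = some a → ∀ i, E.deg (fam i) = a

noncomputable section SumsCategory

open Classical in
attribute [local instance] propDecidable

variable {G : Type u} [Group G] {k : Type w} [CommRing k] {E : Pre.{w, v, u} G k}

namespace Sums

/-- The index set of a formal direct sum. -/
abbrev El (X : Sums E) : Type := X.shape.El

/-- A matrix of morphisms. -/
def Hom (X Y : Sums E) : Type v := ∀ (i : X.El) (j : Y.El), X.fam i ⟶ Y.fam j

instance (X Y : Sums E) : AddCommGroup (Hom X Y) :=
  inferInstanceAs (AddCommGroup (∀ (i : X.El) (j : Y.El), X.fam i ⟶ Y.fam j))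

instance (X Y : Sums E) : Module k (Hom X Y) :=
  inferInstanceAs (Module k (∀ (i : X.El) (j : Y.El), X.fam i ⟶ Y.fam j))

/-- The identity matrix. -/
def idEnt (X : Sums E) (i j : X.El) : X.fam i ⟶ X.fam j :=
  if h : i = j then eqToHom (congrArg X.fam h) else 0

theorem idEnt_self (X : Sums E) (i : X.El) : X.idEnt i i = 𝟙 _ := by
  rw [idEnt, dif_pos rfl, eqToHom_refl]

theorem idEnt_ne (X : Sums E) {i j : X.El} (h : i ≠ j) : X.idEnt i j = 0 := dif_neg h

instance : CategoryStruct.{v} (Sums E) where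
  Hom := Hom
  id X := X.idEnt
  comp {_ Y _} f g := fun i k => ∑ j : Y.El, f i j ≫ g j k

/-- The entries of a matrix. -/
def ent {X Y : Sums E} (f : X ⟶ Y) (i : X.El) (j : Y.El) : X.fam i ⟶ Y.fam j := f i j

/-- The morphism with given entries. -/
def mk' {X Y : Sums E} (m : ∀ (i : X.El) (j : Y.El), X.fam i ⟶ Y.fam j) : X ⟶ Y := m

theorem hom_ext {X Y : Sums E} {f g : X ⟶ Y} (h : ∀ i j, ent f i j = ent g i j) : f = g :=
  funext fun i => funext fun j => h i j

theorem ent_comp {X Y Z : Sums E} (f : X ⟶ Y) (g : Y ⟶ Z) (i : X.El) (j : Z.El) :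
    ent (f ≫ g) i j = ∑ x : Y.El, ent f i x ≫ ent g x j := rfl

theorem ent_id (X : Sums E) (i j : X.El) : ent (𝟙 X) i j = X.idEnt i j := rfl

instance : Category.{v} (Sums E) where
  id_comp {X Y} f := hom_ext fun i j => by
    rw [ent_comp, Finset.sum_eq_single i (fun b _ hb => by rw [ent_id, idEnt_ne _ hb.symm, zero_comp])
      (by simp), ent_id, idEnt_self, Category.id_comp]
  comp_id {X Y} f := hom_ext fun i j => by
    rw [ent_comp, Finset.sum_eq_single j (fun b _ hb => by rw [ent_id, idEnt_ne _ hb, comp_zero])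
      (by simp), ent_id, idEnt_self, Category.comp_id]
  assoc f g h := hom_ext fun i j => by
    simp only [ent_comp, Preadditive.sum_comp, Preadditive.comp_sum, Category.assoc]
    exact Finset.sum_comm

instance (X Y : Sums E) : AddCommGroup (X ⟶ Y) := inferInstanceAs (AddCommGroup (Hom X Y))

instance (X Y : Sums E) : Module k (X ⟶ Y) := inferInstanceAs (Module k (Hom X Y))

theorem ent_add {X Y : Sums E} (f g : X ⟶ Y) (i : X.El) (j : Y.El) :
    ent (f + g) i j = ent f i j + ent g i j := rfl

theorem ent_zero {X Y : Sums E} (i : X.El) (j : Y.El) : ent (0 : X ⟶ Y) i j = 0 := rfl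

theorem ent_smul {X Y : Sums E} (r : k) (f : X ⟶ Y) (i : X.El) (j : Y.El) :
    ent (r • f) i j = r • ent f i j := rfl

instance : Preadditive (Sums E) where
  add_comp _ _ _ f f' g := hom_ext fun i j => by
    simp only [ent_comp, ent_add, Preadditive.add_comp, Finset.sum_add_distrib]
  comp_add _ _ _ f g g' := hom_ext fun i j => by
    simp only [ent_comp, ent_add, Preadditive.comp_add, Finset.sum_add_distrib]

instance : Linear k (Sums E) where
  smul_comp _ _ _ r f g := hom_ext fun i j => by
    simp only [ent_comp, ent_smul, Linear.smul_comp, Finset.smul_sum]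
  comp_smul _ _ _ f r g := hom_ext fun i j => by
    simp only [ent_comp, ent_smul, Linear.comp_smul, Finset.smul_sum]

/-- The monomial matrix with entries `f i` in position `(i, e i)`. -/
def mono {X Y : Sums E} (e : X.El → Y.El) (f : ∀ i, X.fam i ⟶ Y.fam (e i)) : X ⟶ Y :=
  mk' fun i j => f i ≫ Y.idEnt (e i) j

/-- The monomial matrix with entries `f j` in position `(e j, j)`. -/
def comono {X Y : Sums E} (e : Y.El → X.El) (f : ∀ j, X.fam (e j) ⟶ Y.fam j) : X ⟶ Y :=
  mk' fun i j => X.idEnt i (e j) ≫ f j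

theorem ent_mono {X Y : Sums E} (e : X.El → Y.El) (f : ∀ i, X.fam i ⟶ Y.fam (e i)) (i : X.El)
    (j : Y.El) : ent (mono e f) i j = f i ≫ Y.idEnt (e i) j := rfl

theorem ent_comono {X Y : Sums E} (e : Y.El → X.El) (f : ∀ j, X.fam (e j) ⟶ Y.fam j) (i : X.El)
    (j : Y.El) : ent (comono e f) i j = X.idEnt i (e j) ≫ f j := rfl

/-- A row of a monomial matrix is supported in one column, so the sum defining the composite has a
single term. Since the structural isomorphisms are monomial, this reduces matrix identities to
identities of entries. -/
theorem ent_mono_comp {X Y Z : Sums E} (e : X.El → Y.El) (f : ∀ i, X.fam i ⟶ Y.fam (e i))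
    (g : Y ⟶ Z) (i : X.El) (j : Z.El) : ent (mono e f ≫ g) i j = f i ≫ ent g (e i) j := by
  rw [ent_comp, Finset.sum_eq_single (e i)
    (fun b _ hb => by rw [ent_mono, idEnt_ne _ hb.symm, comp_zero, zero_comp]) (by simp),
    ent_mono, idEnt_self, Category.comp_id]

theorem ent_comp_comono {X Y Z : Sums E} (g : X ⟶ Y) (e : Z.El → Y.El)
    (f : ∀ j, Y.fam (e j) ⟶ Z.fam j) (i : X.El) (j : Z.El) :
    ent (g ≫ comono e f) i j = ent g i (e j) ≫ f j := by
  rw [ent_comp, Finset.sum_eq_single (e j)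
    (fun b _ hb => by rw [ent_comono, idEnt_ne _ hb, zero_comp, comp_zero]) (by simp),
    ent_comono, idEnt_self, Category.id_comp]

theorem ent_comp_mono {X Y Z : Sums E} (g : X ⟶ Y) (e : Y.El ≃ Z.El)
    (f : ∀ j, Y.fam j ⟶ Z.fam (e j)) (i : X.El) (j : Y.El) :
    ent (g ≫ mono e f) i (e j) = ent g i j ≫ f j := by
  rw [ent_comp, Finset.sum_eq_single j
    (fun b _ hb => by
      rw [ent_mono, idEnt_ne _ (fun h => hb (e.injective h)), comp_zero, comp_zero]) (by simp),
    ent_mono, idEnt_self, Category.comp_id]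

theorem hom_ext_equiv {X Y : Sums E} {κ : Type*} (e : κ ≃ Y.El) {f g : X ⟶ Y}
    (h : ∀ i j, ent f i (e j) = ent g i (e j)) : f = g :=
  hom_ext fun i j => by
    obtain ⟨j, rfl⟩ := e.surjective j
    exact h i j

theorem mono_id (X : Sums E) : mono (fun i => i) (fun i => 𝟙 (X.fam i)) = 𝟙 X :=
  hom_ext fun i j => by rw [ent_mono, Category.id_comp, ent_id]

theorem mono_comp_mono {X Y Z : Sums E} (e : X.El → Y.El) (f : ∀ i, X.fam i ⟶ Y.fam (e i))
    (e' : Y.El → Z.El) (f' : ∀ i, Y.fam i ⟶ Z.fam (e' i)) :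
    mono e f ≫ mono e' f' = mono (fun i => e' (e i)) (fun i => f i ≫ f' (e i)) :=
  hom_ext fun i j => by rw [ent_mono_comp, ent_mono, ent_mono, Category.assoc]

theorem mono_congr {X Y : Sums E} {e : X.El → Y.El} {f f' : ∀ i, X.fam i ⟶ Y.fam (e i)}
    (h : ∀ i, f i = f' i) : mono e f = mono e f' := by rw [funext h]

/-- Reduces the naturality of a monomial constraint to the naturality of its entries in `E`.
Bijectivity of `e'` ensures that the entries compared exhaust the matrix. -/
theorem mono_comm {X Y X' Y' : Sums E} (e : X.El → Y.El) (s : ∀ i, X.fam i ⟶ Y.fam (e i))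
    (e' : X'.El ≃ Y'.El) (s' : ∀ i, X'.fam i ⟶ Y'.fam (e' i)) (f : X ⟶ X') (g : Y ⟶ Y')
    (h : ∀ i j, ent f i j ≫ s' j = s i ≫ ent g (e i) (e' j)) :
    f ≫ mono e' s' = mono e s ≫ g :=
  hom_ext_equiv e' fun i j => by rw [ent_comp_mono, ent_mono_comp, h]

/-- The isomorphism given by a bijection of index sets and isomorphisms of summands. -/
def isoMono {X Y : Sums E} (e : X.El ≃ Y.El) (f : ∀ i, X.fam i ≅ Y.fam (e i)) : X ≅ Y where
  hom := mono e fun i => (f i).hom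
  inv := comono e fun i => (f i).inv
  hom_inv_id := hom_ext fun i j => by
    rw [ent_comp_comono, ent_mono, ent_id]
    by_cases h : i = j
    · subst h
      rw [idEnt_self, idEnt_self, Category.comp_id, Iso.hom_inv_id]
    · rw [idEnt_ne _ h, idEnt_ne _ fun h' => h (e.injective h'), comp_zero, zero_comp]
  inv_hom_id := hom_ext_equiv e fun i j => by
    rw [ent_comp_mono, ent_comono, ent_id, Category.assoc, Iso.inv_hom_id, Category.comp_id]

/-- If the inclusions are jointly epic, the sum can be tested after each of them, and then the
orthogonality relations leave one term. -/
theorem total_of_hom_ext {κ : Type*} [Fintype κ] {Z : κ → Sums E} (b : Bicone Z)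
    (h : ∀ g g' : b.pt ⟶ b.pt, (∀ x, b.ι x ≫ g = b.ι x ≫ g') → g = g') :
    ∑ x, b.π x ≫ b.ι x = 𝟙 b.pt := by
  refine h _ _ fun x => ?_
  rw [Category.comp_id, Preadditive.comp_sum, Finset.sum_eq_single x, bicone_ι_π_self_assoc]
  · intro y _ hy
    rw [bicone_ι_π_ne_assoc _ hy.symm, zero_comp]
  · simp

section Biproduct

variable {κ : Type*} [Fintype κ] {X : Sums E} {Z : κ → Sums E} (e : (Σ x, (Z x).El) ≃ X.El)
  (f : ∀ (x : κ) (i : (Z x).El), (Z x).fam i ≅ X.fam (e ⟨x, i⟩))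

/-- The bicone given by a partition of the summands of `X`. -/
def bicone : Bicone Z where
  pt := X
  ι x := mono (fun i => e ⟨x, i⟩) fun i => (f x i).hom
  π x := comono (fun i => e ⟨x, i⟩) fun i => (f x i).inv
  ι_π x y := by
    split_ifs with h
    · subst h
      refine hom_ext fun i j => ?_
      rw [ent_comp_comono, ent_mono]
      refine Eq.trans ?_ (ent_id _ i j).symm
      by_cases h : i = j
      · subst h
        rw [idEnt_self, idEnt_self, Category.comp_id, Iso.hom_inv_id]
      · rw [idEnt_ne _ h, idEnt_ne _ fun h' => h (eq_of_heq (Sigma.mk.inj (e.injective h')).2),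
          comp_zero, zero_comp]
    · refine hom_ext fun i j => ?_
      rw [ent_comp_comono, ent_mono,
        idEnt_ne _ fun h' => h (Sigma.mk.inj (e.injective h')).1, comp_zero, zero_comp, ent_zero]

theorem bicone_total : ∑ x, (bicone e f).π x ≫ (bicone e f).ι x = 𝟙 X :=
  total_of_hom_ext (bicone e f) fun (g g' : X ⟶ X) h => by
    refine hom_ext fun i j => ?_
    obtain ⟨⟨x, i⟩, rfl⟩ := e.surjective i
    have h' := congrArg (fun r => ent r i j) (h x)
    change ent (mono _ _ ≫ g) i j = ent (mono _ _ ≫ g') i j at h'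
    rw [ent_mono_comp, ent_mono_comp] at h'
    exact (cancel_epi _).1 h'

/-- The bicone given by a partition of the summands is a direct sum. -/
def biconeIsBilimit : (bicone e f).IsBilimit := isBilimitOfTotal _ (bicone_total e f)

end Biproduct

/-- The formal direct sum of a finite family of objects. -/
def sum {n : ℕ} (Z : Fin n → Sums E) (t : Option G) (ht : ∀ a, t = some a → ∀ x, (Z x).tag = some a) :
    Sums E where
  shape := .sigma n fun x => (Z x).shape
  fam := fun i => (Z i.1).fam i.2
  tag := t
  tag_spec := fun a h i => (Z i.1).tag_spec a (ht a h i.1) i.2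

/-- The canonical bicone on a formal direct sum. -/
def sumBicone {n : ℕ} (Z : Fin n → Sums E) (t : Option G)
    (ht : ∀ a, t = some a → ∀ x, (Z x).tag = some a) : Bicone Z :=
  bicone (X := sum Z t ht) (Equiv.refl _) fun x i => Iso.refl _

theorem sumBicone_total {n : ℕ} (Z : Fin n → Sums E) (t : Option G)
    (ht : ∀ a, t = some a → ∀ x, (Z x).tag = some a) :
    ∑ x, (sumBicone Z t ht).π x ≫ (sumBicone Z t ht).ι x = 𝟙 (sum Z t ht) :=
  bicone_total (X := sum Z t ht) (Equiv.refl _) fun x i => Iso.refl _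

instance : HasFiniteBiproducts (Sums E) where
  out n := ⟨fun Z => HasBiproduct.mk
    -- With no tag there is no condition on the degrees of the terms.
    ⟨sumBicone Z none (fun a h => by cases h), isBilimitOfTotal _ (sumBicone_total Z none _)⟩⟩

/-- The objects tagged with the degree `a`. -/
def IsDeg (a : G) : ObjectProperty (Sums E) := fun X => X.tag = some a

instance (a : G) : HasFiniteBiproducts (IsDeg (E := E) a).FullSubcategory where
  out n := ⟨fun Z =>
    have ht : ∀ b, some a = some b → ∀ x, (Z x).obj.tag = some b := fun b h x =>
      (Z x).property.trans h
    HasBiproduct.mk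
    { bicone :=
      -- The same sum, but tagged with `a`. For an empty family this yields a separate zero object
      -- in each degree.
      { pt := ⟨sum (fun x => (Z x).obj) (some a) ht, rfl⟩
        ι := fun x => ObjectProperty.homMk ((sumBicone _ _ ht).ι x)
        π := fun x => ObjectProperty.homMk ((sumBicone _ _ ht).π x)
        ι_π := fun x y => by
          have e := (sumBicone _ _ ht).ι_π x y
          refine ObjectProperty.hom_ext _ (e.trans ?_)
          split_ifs with h
          · subst h; rfl
          · rfl }
      isBilimit := isBilimitOfTotal _ (ObjectProperty.hom_ext _ (by
        refine Eq.trans ?_ (sumBicone_total _ _ ht)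
        refine (Functor.map_sum ((IsDeg (E := E) a).ι) _ _).trans ?_
        rfl)) }⟩

end Sums

end SumsCategory

/-! ### The tensor product of formal direct sums -/

noncomputable section SumsMonoidal

open Classical in
attribute [local instance] propDecidable

variable {G : Type u} [Group G] {k : Type w} [CommRing k] {E : Pre.{w, v, u} G k}

namespace Sums

/-- The tensor product of formal direct sums. -/
def tens (X Y : Sums E) : Sums E where
  shape := .prod X.shape Y.shape
  fam := fun i => X.fam i.1 ⊗ Y.fam i.2
  tag := Option.map₂ (· * ·) X.tag Y.tag
  tag_spec c h i := by
    obtain ⟨a, b, ha, hb, hc⟩ := Option.map₂_eq_some_iff.1 h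
    rw [E.deg_tensor, X.tag_spec a ha, Y.tag_spec b hb, hc]

/-- The tensor unit, as a formal direct sum with one summand. -/
def one : Sums E where
  shape := .unit
  fam := fun _ => 𝟙_ E
  tag := some 1
  tag_spec a h _ := by
    cases h
    exact E.deg_unit

/-- An index of a tensor product. -/
def pair {X Y : Sums E} (i : X.El) (j : Y.El) : (tens X Y).El := (i, j)

theorem pair_inj {X Y : Sums E} {i i' : X.El} {j j' : Y.El} :
    (pair i j : (tens X Y).El) = pair i' j' ↔ i = i' ∧ j = j' := Prod.mk_inj

/-- The tensor product of matrices. -/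
def tensHom {X X' Y Y' : Sums E} (f : X ⟶ X') (g : Y ⟶ Y') : tens X Y ⟶ tens X' Y' :=
  mk' fun p q => ent f p.1 q.1 ⊗ₘ ent g p.2 q.2

theorem ent_tensHom {X X' Y Y' : Sums E} (f : X ⟶ X') (g : Y ⟶ Y') (i : X.El) (j : Y.El)
    (i' : X'.El) (j' : Y'.El) :
    ent (tensHom f g) (pair i j) (pair i' j') = (ent f i i' ⊗ₘ ent g j j' :) := rfl

theorem tens_hom_ext {X Y Z W : Sums E} {f g : tens X Y ⟶ tens Z W}
    (h : ∀ i j i' j', ent f (pair i j) (pair i' j') = ent g (pair i j) (pair i' j')) : f = g :=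
  hom_ext fun p q => h p.1 p.2 q.1 q.2

theorem idEnt_tens {X Y : Sums E} (i i' : X.El) (j j' : Y.El) :
    (tens X Y).idEnt (pair i j) (pair i' j') = (X.idEnt i i' ⊗ₘ Y.idEnt j j' :) := by
  by_cases h : i = i'
  · subst h
    by_cases h : j = j'
    · subst h
      rw [idEnt_self, idEnt_self, idEnt_self, id_tensorHom_id]
      rfl
    · rw [idEnt_ne _ fun h' => h (pair_inj.1 h').2, idEnt_ne _ h, MonoidalPreadditive.tensor_zero]
      rfl
  · rw [idEnt_ne _ fun h' => h (pair_inj.1 h').1, idEnt_ne _ h, MonoidalPreadditive.zero_tensor]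
    rfl

theorem tensHom_id (X Y : Sums E) : tensHom (𝟙 X) (𝟙 Y) = 𝟙 (tens X Y) :=
  tens_hom_ext fun i j i' j' => (idEnt_tens i i' j j').symm

theorem tensHom_comp {X X' X'' Y Y' Y'' : Sums E} (f : X ⟶ X') (f' : X' ⟶ X'') (g : Y ⟶ Y')
    (g' : Y' ⟶ Y'') : tensHom (f ≫ f') (g ≫ g') = tensHom f g ≫ tensHom f' g' :=
  tens_hom_ext fun i j i'' j'' => by
    rw [ent_tensHom, ent_comp, ent_comp, sum_tensor]
    simp only [tensor_sum, ← tensorHom_comp_tensorHom]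
    refine (Fintype.sum_prod_type' (f := fun i' j' => (ent f i i' ⊗ₘ ent g j j') ≫
      (ent f' i' i'' ⊗ₘ ent g' j' j''))).symm.trans ?_
    rfl

theorem add_tensHom {X X' Y Y' : Sums E} (f f' : X ⟶ X') (g : Y ⟶ Y') :
    tensHom (f + f') g = tensHom f g + tensHom f' g :=
  tens_hom_ext fun i j i' j' => by
    rw [ent_tensHom, ent_add, MonoidalPreadditive.add_tensor]
    rfl

theorem tensHom_add {X X' Y Y' : Sums E} (f : X ⟶ X') (g g' : Y ⟶ Y') :
    tensHom f (g + g') = tensHom f g + tensHom f g' :=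
  tens_hom_ext fun i j i' j' => by
    rw [ent_tensHom, ent_add, MonoidalPreadditive.tensor_add]
    rfl

theorem zero_tensHom (X X' : Sums E) {Y Y' : Sums E} (g : Y ⟶ Y') :
    tensHom (0 : X ⟶ X') g = 0 :=
  tens_hom_ext fun i j i' j' => MonoidalPreadditive.zero_tensor _

theorem tensHom_zero {X X' : Sums E} (f : X ⟶ X') (Y Y' : Sums E) :
    tensHom f (0 : Y ⟶ Y') = 0 :=
  tens_hom_ext fun i j i' j' => MonoidalPreadditive.tensor_zero _

theorem smul_tensHom {X X' Y Y' : Sums E} (r : k) (f : X ⟶ X') (g : Y ⟶ Y') :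
    tensHom (r • f) g = r • tensHom f g :=
  tens_hom_ext fun i j i' j' => by
    rw [ent_tensHom, ent_smul, MonoidalCategory.tensorHom_def, MonoidalLinear.smul_whiskerRight, Linear.smul_comp,
      ← MonoidalCategory.tensorHom_def]
    rfl

theorem tensHom_smul {X X' Y Y' : Sums E} (r : k) (f : X ⟶ X') (g : Y ⟶ Y') :
    tensHom f (r • g) = r • tensHom f g :=
  tens_hom_ext fun i j i' j' => by
    rw [ent_tensHom, ent_smul, MonoidalCategory.tensorHom_def, MonoidalLinear.whiskerLeft_smul, Linear.comp_smul,
      ← MonoidalCategory.tensorHom_def]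
    rfl

/-- Monomial matrices are closed under tensor products as well as under composition, so every
coherence diagram of constraints is an equality of two monomial matrices. -/
theorem tensHom_mono {X X' Y Y' : Sums E} (e : X.El → X'.El) (f : ∀ i, X.fam i ⟶ X'.fam (e i))
    (e' : Y.El → Y'.El) (f' : ∀ j, Y.fam j ⟶ Y'.fam (e' j)) :
    tensHom (mono e f) (mono e' f') =
      mono (X := tens X Y) (Y := tens X' Y') (fun p => pair (e p.1) (e' p.2))
        (fun p => f p.1 ⊗ₘ f' p.2) :=
  tens_hom_ext fun i j i' j' => by
    rw [ent_tensHom, ent_mono, ent_mono]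
    refine (tensorHom_comp_tensorHom _ _ _ _).symm.trans ?_
    exact congrArg (fun r => (f i ⊗ₘ f' j) ≫ r) (idEnt_tens (e i) i' (e' j) j').symm

/-- The associativity constraint. -/
def tensAssoc (X Y Z : Sums E) : tens (tens X Y) Z ≅ tens X (tens Y Z) :=
  isoMono (X := tens (tens X Y) Z) (Y := tens X (tens Y Z))
    (Equiv.prodAssoc X.El Y.El Z.El) fun p => α_ (X.fam p.1.1) (Y.fam p.1.2) (Z.fam p.2)

/-- The left unit constraint. -/
def tensLeft (X : Sums E) : tens one X ≅ X :=
  isoMono (X := tens one X) (Y := X) (Equiv.punitProd X.El) fun p => λ_ (X.fam p.2)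

/-- The right unit constraint. -/
def tensRight (X : Sums E) : tens X one ≅ X :=
  isoMono (X := tens X one) (Y := X) (Equiv.prodPUnit X.El) fun p => ρ_ (X.fam p.1)

theorem tensAssoc_natural {X X' Y Y' Z Z' : Sums E} (f : X ⟶ X') (g : Y ⟶ Y') (h : Z ⟶ Z') :
    tensHom (tensHom f g) h ≫ (tensAssoc X' Y' Z').hom =
      (tensAssoc X Y Z).hom ≫ tensHom f (tensHom g h) :=
  mono_comm (X := tens (tens X Y) Z) (Y := tens X (tens Y Z)) (X' := tens (tens X' Y') Z')
    (Y' := tens X' (tens Y' Z')) _ _ (Equiv.prodAssoc X'.El Y'.El Z'.El) _ _ _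
    fun p q => associator_naturality _ _ _

theorem tensLeft_natural {X Y : Sums E} (f : X ⟶ Y) :
    tensHom (𝟙 one) f ≫ (tensLeft Y).hom = (tensLeft X).hom ≫ f :=
  mono_comm (X := tens one X) (X' := tens one Y) _ _ (Equiv.punitProd Y.El) _ _ _ fun p q => by
    have e : ent (𝟙 (one : Sums E)) p.1 q.1 = 𝟙 _ := idEnt_self _ _
    have e' : (ent (𝟙 (one : Sums E)) p.1 q.1 ⊗ₘ ent f p.2 q.2) ≫ (λ_ _).hom =
        (λ_ _).hom ≫ ent f p.2 q.2 := by
      rw [e]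
      exact (id_tensorHom (𝟙_ E) (ent f p.2 q.2) =≫ _).trans (leftUnitor_naturality _)
    exact e'

theorem tensRight_natural {X Y : Sums E} (f : X ⟶ Y) :
    tensHom f (𝟙 one) ≫ (tensRight Y).hom = (tensRight X).hom ≫ f :=
  mono_comm (X := tens X one) (X' := tens Y one) _ _ (Equiv.prodPUnit Y.El) _ _ _ fun p q => by
    have e : ent (𝟙 (one : Sums E)) p.2 q.2 = 𝟙 _ := idEnt_self _ _
    have e' : (ent f p.1 q.1 ⊗ₘ ent (𝟙 (one : Sums E)) p.2 q.2) ≫ (ρ_ _).hom =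
        (ρ_ _).hom ≫ ent f p.1 q.1 := by
      rw [e]
      exact (tensorHom_id (ent f p.1 q.1) (𝟙_ E) =≫ _).trans (rightUnitor_naturality _)
    exact e'

theorem tensHom_mono_id {X X' : Sums E} (e : X.El → X'.El) (f : ∀ i, X.fam i ⟶ X'.fam (e i))
    (Y : Sums E) :
    tensHom (mono e f) (𝟙 Y) =
      mono (X := tens X Y) (Y := tens X' Y) (fun p => pair (e p.1) p.2)
        (fun p => f p.1 ▷ Y.fam p.2) := by
  refine (congrArg (tensHom (mono e f)) (mono_id Y).symm).trans ((tensHom_mono _ _ _ _).trans ?_)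
  exact mono_congr fun p => tensorHom_id _ _

theorem tensHom_id_mono {X X' : Sums E} (Y : Sums E) (e : X.El → X'.El)
    (f : ∀ i, X.fam i ⟶ X'.fam (e i)) :
    tensHom (𝟙 Y) (mono e f) =
      mono (X := tens Y X) (Y := tens Y X') (fun p => pair p.1 (e p.2))
        (fun p => Y.fam p.1 ◁ f p.2) := by
  refine (congrArg (fun r => tensHom r (mono e f)) (mono_id Y).symm).trans
    ((tensHom_mono _ _ _ _).trans ?_)
  exact mono_congr fun p => id_tensorHom _ _

instance : MonoidalCategoryStruct (Sums E) where
  tensorObj := tens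
  tensorHom := tensHom
  whiskerLeft X _ _ f := tensHom (𝟙 X) f
  whiskerRight f X := tensHom f (𝟙 X)
  tensorUnit := one
  associator := tensAssoc
  leftUnitor := tensLeft
  rightUnitor := tensRight

/-- Both sides are monomial with definitionally equal maps of index sets, rebracketing of
quadruples, so the pentagon of `E` for each quadruple of summands suffices. -/
theorem tens_pentagon (W X Y Z : Sums E) :
    tensHom (tensAssoc W X Y).hom (𝟙 Z) ≫ (tensAssoc W (tens X Y) Z).hom ≫
        tensHom (𝟙 W) (tensAssoc X Y Z).hom =
      (tensAssoc (tens W X) Y Z).hom ≫ (tensAssoc W X (tens Y Z)).hom := by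
  refine (congrArg₂ (fun r s => r ≫ _ ≫ s) (tensHom_mono_id _ _ _)
    (tensHom_id_mono _ _ _)).trans ?_
  refine (congrArg (fun r => _ ≫ r) (mono_comp_mono _ _ _ _)).trans ?_
  refine ((mono_comp_mono _ _ _ _).trans ?_).trans (mono_comp_mono _ _ _ _).symm
  exact mono_congr fun p => MonoidalCategory.pentagon _ _ _ _

theorem tens_triangle (X Y : Sums E) :
    (tensAssoc X one Y).hom ≫ tensHom (𝟙 X) (tensLeft Y).hom =
      tensHom (tensRight X).hom (𝟙 Y) := by
  refine (congrArg (fun r => _ ≫ r) (tensHom_id_mono _ _ _)).trans ?_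
  refine ((mono_comp_mono _ _ _ _).trans ?_).trans (tensHom_mono_id _ _ _).symm
  exact mono_congr fun p => MonoidalCategory.triangle _ _

instance : MonoidalCategory (Sums E) :=
  MonoidalCategory.ofTensorHom
    (id_tensorHom_id := tensHom_id)
    (id_tensorHom := fun _ _ _ _ => rfl)
    (tensorHom_id := fun _ _ => rfl)
    (tensorHom_comp_tensorHom := fun f g f' g' => (tensHom_comp f f' g g').symm)
    (associator_naturality := tensAssoc_natural)
    (leftUnitor_naturality := tensLeft_natural)
    (rightUnitor_naturality := tensRight_natural)
    (pentagon := tens_pentagon)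
    (triangle := tens_triangle)

instance : MonoidalPreadditive (Sums E) where
  whiskerLeft_zero := tensHom_zero _ _ _
  zero_whiskerRight := zero_tensHom _ _ _
  whiskerLeft_add := tensHom_add _
  add_whiskerRight f g := add_tensHom f g _

instance : MonoidalLinear k (Sums E) where
  whiskerLeft_smul _ _ _ r f := tensHom_smul r _ f
  smul_whiskerRight r _ _ f _ := smul_tensHom r f _

end Sums

end SumsMonoidal

/-! ### The crossing on formal direct sums -/

noncomputable section SumsCrossing

open Classical in
attribute [local instance] propDecidable

variable {G : Type u} [Group G] {k : Type w} [CommRing k] {E : Pre.{w, v, u} G k}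

namespace Sums

/-- The crossing on formal direct sums. -/
def crossObj (a : G) (X : Sums E) : Sums E where
  shape := X.shape
  fam := fun i => (E.φ a).obj (X.fam i)
  tag := X.tag.map fun b => a⁻¹ * b * a
  tag_spec c h i := by
    obtain ⟨b, hb, hc⟩ := Option.map_eq_some_iff.1 h
    rw [E.deg_φ, X.tag_spec b hb, hc]

/-- The crossing on matrices. -/
def crossMap (a : G) {X Y : Sums E} (f : X ⟶ Y) : crossObj a X ⟶ crossObj a Y :=
  mk' fun i j => (E.φ a).map (ent f i j)

theorem ent_crossMap (a : G) {X Y : Sums E} (f : X ⟶ Y) (i : X.El) (j : Y.El) :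
    ent (crossMap a f) i j = (E.φ a).map (ent f i j) := rfl

/-- The functor `φ a` is additive, so it preserves the zeros of the identity matrix as well as the
identities on its diagonal. -/
theorem map_idEnt (a : G) (X : Sums E) (i j : X.El) :
    (E.φ a).map (X.idEnt i j) = (crossObj a X).idEnt i j := by
  by_cases h : i = j
  · subst h
    rw [idEnt_self, CategoryTheory.Functor.map_id]
    exact (idEnt_self (crossObj a X) i).symm
  · rw [idEnt_ne _ h, Functor.map_zero]
    exact (idEnt_ne (crossObj a X) h).symm

theorem cross_hom_ext {a : G} {X Y : Sums E} {f g : crossObj a X ⟶ crossObj a Y}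
    (h : ∀ (i : X.El) (j : Y.El), ent (X := crossObj a X) (Y := crossObj a Y) f i j =
      ent (X := crossObj a X) (Y := crossObj a Y) g i j) : f = g :=
  hom_ext h

theorem crossMap_mono (a : G) {X Y : Sums E} (e : X.El → Y.El) (f : ∀ i, X.fam i ⟶ Y.fam (e i)) :
    crossMap a (mono e f) =
      mono (X := crossObj a X) (Y := crossObj a Y) e fun i => (E.φ a).map (f i) :=
  cross_hom_ext fun i j => by
    refine (ent_crossMap a (mono e f) i j).trans ?_
    rw [ent_mono, Functor.map_comp]
    exact congrArg (fun r => (E.φ a).map (f i) ≫ r) (map_idEnt a Y (e i) j)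

theorem crossMap_comp (a : G) {X Y Z : Sums E} (f : X ⟶ Y) (g : Y ⟶ Z) :
    crossMap a (f ≫ g) = crossMap a f ≫ crossMap a g :=
  cross_hom_ext fun i j => by
    refine (ent_crossMap a (f ≫ g) i j).trans ?_
    rw [ent_comp, Functor.map_sum]
    refine Eq.trans ?_ (ent_comp _ _ _ _).symm
    exact Finset.sum_congr rfl fun x _ => Functor.map_comp _ _ _

/-- The crossing as a functor. -/
def cross (a : G) : Sums E ⥤ Sums E where
  obj := crossObj a
  map := crossMap a
  map_id X := hom_ext fun i j => map_idEnt a X i j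
  map_comp := crossMap_comp a

instance (a : G) : (cross (E := E) a).Additive where
  map_add {_ _ f g} := hom_ext fun i j => Functor.map_add (E.φ a)

instance (a : G) : (cross (E := E) a).Linear k where
  map_smul {_ _} f r := hom_ext fun i j => Functor.map_smul (E.φ a) r _

open Functor.LaxMonoidal Functor.OplaxMonoidal Functor.Monoidal

/-- The tensor constraint of the crossing. -/
def crossTens (a : G) (X Y : Sums E) : tens (crossObj a X) (crossObj a Y) ≅ crossObj a (tens X Y) :=
  isoMono (X := tens (crossObj a X) (crossObj a Y)) (Y := crossObj a (tens X Y))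
    (Equiv.refl _) fun p => μIso (E.φ a) (X.fam p.1) (Y.fam p.2)

/-- The unit constraint of the crossing. -/
def crossUnit (a : G) : one ≅ crossObj a (one : Sums E) :=
  isoMono (X := one) (Y := crossObj a one) (Equiv.refl _) fun p => εIso (E.φ a)

theorem crossTens_natural (a : G) {X X' Y Y' : Sums E} (f : X ⟶ X') (g : Y ⟶ Y') :
    tensHom (crossMap a f) (crossMap a g) ≫ (crossTens a X' Y').hom =
      (crossTens a X Y).hom ≫ crossMap a (tensHom f g) :=
  mono_comm (X := tens (crossObj a X) (crossObj a Y)) (Y := crossObj a (tens X Y))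
    (X' := tens (crossObj a X') (crossObj a Y')) (Y' := crossObj a (tens X' Y')) _ _
    (Equiv.refl _) _ _ _ fun p q => μ_natural (E.φ a) _ _

/-- All factors are monomial, so the law holds because it holds in `E` for each triple of summands.
The remaining laws of the crossing are reduced to `E` in the same way. -/
theorem crossTens_assoc (a : G) (X Y Z : Sums E) :
    tensHom (crossTens a X Y).hom (𝟙 (crossObj a Z)) ≫ (crossTens a (tens X Y) Z).hom ≫
        crossMap a (tensAssoc X Y Z).hom =
      (tensAssoc (crossObj a X) (crossObj a Y) (crossObj a Z)).hom ≫
        tensHom (𝟙 (crossObj a X)) (crossTens a Y Z).hom ≫ (crossTens a X (tens Y Z)).hom := by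
  refine (congrArg₂ (fun r s => r ≫ _ ≫ s) (tensHom_mono_id _ _ _) (crossMap_mono _ _ _)).trans ?_
  refine (congrArg (fun r => _ ≫ r) (mono_comp_mono _ _ _ _)).trans ?_
  refine (mono_comp_mono _ _ _ _).trans ?_
  refine Eq.trans ?_ (congrArg (fun r => _ ≫ r ≫ _) (tensHom_id_mono _ _ _)).symm
  refine Eq.trans ?_ (congrArg (fun r => _ ≫ r) (mono_comp_mono _ _ _ _)).symm
  refine Eq.trans ?_ (mono_comp_mono _ _ _ _).symm
  exact mono_congr fun p => Functor.LaxMonoidal.associativity (E.φ a) _ _ _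

theorem crossUnit_left (a : G) (X : Sums E) :
    (tensLeft (crossObj a X)).hom =
      tensHom (crossUnit a).hom (𝟙 (crossObj a X)) ≫ (crossTens a one X).hom ≫
        crossMap a (tensLeft X).hom := by
  refine Eq.trans ?_ (congrArg₂ (fun r s => r ≫ _ ≫ s) (tensHom_mono_id _ _ _)
    (crossMap_mono _ _ _)).symm
  refine Eq.trans ?_ (congrArg (fun r => _ ≫ r) (mono_comp_mono _ _ _ _)).symm
  refine Eq.trans ?_ (mono_comp_mono _ _ _ _).symm
  exact mono_congr fun p => Functor.LaxMonoidal.left_unitality (E.φ a) _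

theorem crossUnit_right (a : G) (X : Sums E) :
    (tensRight (crossObj a X)).hom =
      tensHom (𝟙 (crossObj a X)) (crossUnit a).hom ≫ (crossTens a X one).hom ≫
        crossMap a (tensRight X).hom := by
  refine Eq.trans ?_ (congrArg₂ (fun r s => r ≫ _ ≫ s) (tensHom_id_mono _ _ _)
    (crossMap_mono _ _ _)).symm
  refine Eq.trans ?_ (congrArg (fun r => _ ≫ r) (mono_comp_mono _ _ _ _)).symm
  refine Eq.trans ?_ (mono_comp_mono _ _ _ _).symm
  exact mono_congr fun p => Functor.LaxMonoidal.right_unitality (E.φ a) _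

/-- The crossing is strong monoidal. -/
def crossCore (a : G) : (cross (E := E) a).CoreMonoidal where
  εIso := crossUnit a
  μIso := crossTens a
  μIso_hom_natural_left {X Y} f Z := by
    have e := crossTens_natural a f (𝟙 Z)
    rw [show crossMap a (𝟙 Z) = 𝟙 _ from (cross a).map_id Z] at e
    exact e
  μIso_hom_natural_right {X Y} Z f := by
    have e := crossTens_natural a (𝟙 Z) f
    rw [show crossMap a (𝟙 Z) = 𝟙 _ from (cross a).map_id Z] at e
    exact e
  associativity := crossTens_assoc a
  left_unitality := crossUnit_left a
  right_unitality := crossUnit_right a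

instance (a : G) : (cross (E := E) a).Monoidal := (crossCore a).toMonoidal

/-- The composition constraint of the crossing. -/
def crossMulApp {a b c : G} (h : b * a = c) (X : Sums E) :
    crossObj a (crossObj b X) ≅ crossObj c X :=
  isoMono (X := crossObj a (crossObj b X)) (Y := crossObj c X) (Equiv.refl _)
    fun i => (E.φComp h).app (X.fam i)

/-- The unit constraint of the crossing. -/
def crossOneApp (X : Sums E) : X ≅ crossObj 1 X :=
  isoMono (X := X) (Y := crossObj 1 X) (Equiv.refl _) fun i => E.φId.app (X.fam i)

/-- The composition constraint of the crossing. -/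
def crossMul {a b c : G} (h : b * a = c) : cross (E := E) b ⋙ cross a ≅ cross c :=
  NatIso.ofComponents (crossMulApp h) fun {X Y} f =>
    mono_comm (X := crossObj a (crossObj b X)) (Y := crossObj c X)
      (X' := crossObj a (crossObj b Y)) (Y' := crossObj c Y) _ _ (Equiv.refl _) _ _ _
      fun p q => (E.φComp h).hom.naturality _

/-- The unit constraint of the crossing. -/
def crossOne : 𝟭 (Sums E) ≅ cross 1 :=
  NatIso.ofComponents crossOneApp fun {X Y} f =>
    mono_comm (X := X) (Y := crossObj 1 X) (X' := Y) (Y' := crossObj 1 Y) _ _ (Equiv.refl Y.El) _ f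
      (crossMap 1 f) fun p q => E.φId.hom.naturality _

theorem crossMul_tens {a b c : G} (h : b * a = c) (X Y : Sums E) :
    ((crossTens a (crossObj b X) (crossObj b Y)).hom ≫ crossMap a (crossTens b X Y).hom) ≫
        (crossMulApp h (tens X Y)).hom =
      tensHom (crossMulApp h X).hom (crossMulApp h Y).hom ≫ (crossTens c X Y).hom := by
  refine (congrArg (fun r => (_ ≫ r) ≫ _) (crossMap_mono _ _ _)).trans ?_
  refine (congrArg (fun r => r ≫ _) (mono_comp_mono _ _ _ _)).trans ?_
  refine (mono_comp_mono _ _ _ _).trans ?_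
  refine Eq.trans ?_ (congrArg (fun r => r ≫ _) (tensHom_mono _ _ _ _)).symm
  refine Eq.trans ?_ (mono_comp_mono _ _ _ _).symm
  exact mono_congr fun p => NatTrans.IsMonoidal.tensor (τ := (E.φComp h).hom) _ _

theorem crossMul_unit {a b c : G} (h : b * a = c) :
    ((crossUnit a).hom ≫ crossMap a (crossUnit b).hom) ≫ (crossMulApp h (one : Sums E)).hom =
      (crossUnit c).hom := by
  refine (congrArg (fun r => (_ ≫ r) ≫ _) (crossMap_mono _ _ _)).trans ?_
  refine (congrArg (fun r => r ≫ _) (mono_comp_mono _ _ _ _)).trans ?_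
  refine (mono_comp_mono _ _ _ _).trans ?_
  exact mono_congr fun p => NatTrans.IsMonoidal.unit (τ := (E.φComp h).hom)

theorem crossOne_tens (X Y : Sums E) :
    𝟙 (tens X Y) ≫ (crossOneApp (tens X Y)).hom =
      tensHom (crossOneApp X).hom (crossOneApp Y).hom ≫ (crossTens 1 X Y).hom := by
  refine (Category.id_comp _).trans ?_
  refine Eq.trans ?_ (congrArg (fun r => r ≫ _) (tensHom_mono _ _ _ _)).symm
  refine Eq.trans ?_ (mono_comp_mono _ _ _ _).symm
  exact mono_congr fun p => (Category.id_comp _).symm.trans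
    (NatTrans.IsMonoidal.tensor (τ := E.φId.hom) _ _)

theorem crossOne_unit : 𝟙 one ≫ (crossOneApp (one : Sums E)).hom = (crossUnit 1).hom := by
  refine (Category.id_comp _).trans ?_
  exact mono_congr fun p => (Category.id_comp _).symm.trans
    (NatTrans.IsMonoidal.unit (τ := E.φId.hom))

instance {a b c : G} (h : b * a = c) : NatTrans.IsMonoidal (crossMul (E := E) h).hom where
  unit := crossMul_unit h
  tensor := crossMul_tens h

instance : NatTrans.IsMonoidal (crossOne (E := E)).hom where
  unit := crossOne_unit
  tensor := crossOne_tens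

theorem crossMul_assoc {a b c ab bc abc : G} (h₁ : b * a = ab) (h₂ : c * b = bc) (h₃ : c * ab = abc)
    (h₄ : bc * a = abc) (X : Sums E) :
    crossMap a (crossMulApp h₂ X).hom ≫ (crossMulApp h₄ X).hom =
      (crossMulApp h₁ (crossObj c X)).hom ≫ (crossMulApp h₃ X).hom := by
  refine (congrArg (fun r => r ≫ _) (crossMap_mono _ _ _)).trans ?_
  refine ((mono_comp_mono _ _ _ _).trans ?_).trans (mono_comp_mono _ _ _ _).symm
  exact mono_congr fun p => E.φComp_assoc h₁ h₂ h₃ h₄ _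

theorem cross_map_crossOne {a : G} (h : 1 * a = a) (X : Sums E) :
    crossMap a (crossOneApp X).hom ≫ (crossMulApp h X).hom = 𝟙 (crossObj a X) := by
  refine (congrArg (fun r => r ≫ _) (crossMap_mono _ _ _)).trans ?_
  refine ((mono_comp_mono _ _ _ _).trans ?_).trans (mono_id _)
  exact mono_congr fun p => E.φ_map_φId h _

theorem crossOne_cross {a : G} (h : a * 1 = a) (X : Sums E) :
    (crossOneApp (crossObj a X)).hom ≫ (crossMulApp h X).hom = 𝟙 (crossObj a X) := by
  refine ((mono_comp_mono _ _ _ _).trans ?_).trans (mono_id _)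
  exact mono_congr fun p => E.φId_φ h _

/-- The crossing functors are equivalences. -/
def crossEquiv (a : G) : Sums E ≌ Sums E :=
  CategoryTheory.Equivalence.mk (cross a) (cross a⁻¹)
    -- The constraints of the crossing already exhibit `cross a⁻¹` as a quasi-inverse, which is why
    -- `Pre` does not require its functors to be equivalences.
    (crossOne ≪≫ (crossMul (mul_inv_cancel a)).symm)
    (crossMul (inv_mul_cancel a) ≪≫ crossOne.symm)

instance (a : G) : (cross (E := E) a).IsEquivalence := (crossEquiv a).isEquivalence_functor

end Sums

end SumsCrossing

/-! ### The completion as a `G`-crossed category -/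

noncomputable section SumsCrossed

open Classical in
attribute [local instance] propDecidable

variable {G : Type u} [Group G] {k : Type w} [CommRing k] {E : Pre.{w, v, u} G k}

namespace Sums

/-- The summands of degree `a`. -/
def part (X : Sums E) (a : G) : Sums E where
  -- No shape has `Fin n` itself as index set; a sum of `n` one-element shapes takes its place.
  shape := .sigma (Fintype.card { i : X.El // E.deg (X.fam i) = a }) fun _ => .unit
  fam := fun x => X.fam ((Fintype.equivFin { i : X.El // E.deg (X.fam i) = a }).symm x.1).1
  tag := some a
  tag_spec b h x := by
    cases h
    exact ((Fintype.equivFin { i : X.El // E.deg (X.fam i) = a }).symm x.1).2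

/-- The finite set of degrees of the summands. -/
def degs (X : Sums E) : Finset G := Finset.univ.image fun i : X.El => E.deg (X.fam i)

/-- The index in `X` of a summand of one of its homogeneous parts. -/
def partIndex (X : Sums E) (p : Σ a : X.degs, (X.part a).El) : X.El :=
  ((Fintype.equivFin { i : X.El // E.deg (X.fam i) = p.1 }).symm p.2.1).1

/-- Every index belongs to exactly one part, the one of the degree of its summand. -/
theorem partIndex_bijective (X : Sums E) : Function.Bijective X.partIndex := by
  constructor
  · rintro ⟨⟨a, ha⟩, ⟨x, ⟨⟩⟩⟩ ⟨⟨b, hb⟩, ⟨y, ⟨⟩⟩⟩ h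
    obtain rfl : a = b := by
      rw [← ((Fintype.equivFin { i : X.El // E.deg (X.fam i) = a }).symm x).2,
        ← ((Fintype.equivFin { i : X.El // E.deg (X.fam i) = b }).symm y).2]
      exact congrArg (fun i => E.deg (X.fam i)) h
    obtain rfl := (Fintype.equivFin { i : X.El // E.deg (X.fam i) = a }).symm.injective
      (Subtype.ext h)
    rfl
  · intro i
    refine ⟨⟨⟨E.deg (X.fam i), Finset.mem_image_of_mem _ (Finset.mem_univ i)⟩,
      ⟨Fintype.equivFin { j : X.El // E.deg (X.fam j) = E.deg (X.fam i) } ⟨i, rfl⟩, ()⟩⟩, ?_⟩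
    exact congrArg Subtype.val (Equiv.symm_apply_apply _ _)

/-- A formal direct sum is the direct sum of its homogeneous parts. -/
def partIso (X : Sums E) : X ≅ ⨁ fun a : X.degs => X.part a :=
  biproduct.uniqueUpToIso _ (biconeIsBilimit (Z := fun a : X.degs => X.part a)
    (Equiv.ofBijective X.partIndex X.partIndex_bijective) fun a i => Iso.refl _)

theorem eq_zero_of_isDeg {a b : G} {X Y : Sums E} (h : a ≠ b) (hX : IsDeg a X) (hY : IsDeg b Y)
    (f : X ⟶ Y) : f = 0 :=
  hom_ext fun i j => E.hom_eq_zero (by rwa [X.tag_spec a hX, Y.tag_spec b hY]) _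

/-- The completion under finite direct sums of a graded category with a crossing. -/
def crossedCat (E : Pre.{w, v, u} G k) : CrossedCat.{w, v, u} G k where
  carrier := Sums E
  deg := IsDeg
  -- The degree is read off from the tag and not from the summands, so even a formal sum without
  -- summands has at most one degree.
  deg_disjoint h h' := Option.some_injective _ (h.symm.trans h')
  deg_hasFiniteBiproducts := fun a => inferInstance
  exists_decomposition X := ⟨X.degs, fun a => X.part a, fun a => rfl, ⟨X.partIso⟩⟩
  deg_tensor {a b X Y} h h' := by
    change Option.map₂ (· * ·) X.tag Y.tag = _
    rw [show X.tag = _ from h, show Y.tag = _ from h']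
    rfl
  hom_eq_zero := eq_zero_of_isDeg
  deg_unit := rfl
  φ := cross
  φComp := crossMul
  φId := crossOne
  φComp_assoc := crossMul_assoc
  φ_map_φId := cross_map_crossOne
  φId_φ := crossOne_cross
  deg_φ a b X h := by
    change X.tag.map _ = _
    rw [show X.tag = _ from h]
    rfl

/-- The formal direct sum with one summand. -/
def singleObj (Z : E) : Sums E where
  shape := .unit
  fam := fun _ => Z
  tag := some (E.deg Z)
  tag_spec a h _ := Option.some_injective _ h

/-- A morphism, as a matrix. -/
def singleMap {Z W : E} (f : Z ⟶ W) : singleObj Z ⟶ singleObj W :=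
  mono (X := singleObj Z) (Y := singleObj W) (fun i => i) fun _ => f

theorem ent_singleMap {Z W : E} (f : Z ⟶ W) : ent (singleMap f) () () = f := by
  refine (ent_mono _ _ _ _).trans ?_
  exact (congrArg (fun r => f ≫ r) (idEnt_self (singleObj W) ())).trans (Category.comp_id f)

theorem singleMap_comp {Z W V : E} (f : Z ⟶ W) (g : W ⟶ V) :
    singleMap f ≫ singleMap g = singleMap (f ≫ g) :=
  mono_comp_mono (X := singleObj Z) (Y := singleObj W) (Z := singleObj V)
    (fun i => i) (fun _ => f) (fun i => i) fun _ => g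

/-- The inclusion of the given category into its completion. -/
def single : E ⥤ Sums E where
  obj := singleObj
  map := singleMap
  map_id Z := mono_id (singleObj Z)
  map_comp f g := (singleMap_comp f g).symm

theorem singleMap_eq {Z W : E} (g : singleObj Z ⟶ singleObj W) : singleMap (ent g () ()) = g :=
  hom_ext fun _ _ => ent_singleMap _

instance : (single (E := E)).Additive where
  map_add {Z W f g} := hom_ext fun _ _ => (ent_singleMap (f + g)).trans
    (congrArg₂ (· + ·) (ent_singleMap f) (ent_singleMap g)).symm

instance : (single (E := E)).Linear k where
  map_smul {Z W} f r := hom_ext fun _ _ => (ent_singleMap (r • f)).trans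
    (congrArg (r • ·) (ent_singleMap f)).symm

instance : (single (E := E)).Full where
  map_surjective g := ⟨_, singleMap_eq g⟩

instance : (single (E := E)).Faithful where
  map_injective {Z W f g} h := (ent_singleMap f).symm.trans
    ((congrArg (fun r : singleObj Z ⟶ singleObj W => ent r () ()) h).trans (ent_singleMap g))

/-- The tensor constraint of the inclusion. -/
def singleTens (Z W : E) : tens (singleObj Z) (singleObj W) ≅ singleObj (Z ⊗ W) :=
  isoMono (X := tens (singleObj Z) (singleObj W)) (Y := singleObj (Z ⊗ W)) (Equiv.punitProd Unit)
    fun _ => Iso.refl _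

/-- The unit constraint of the inclusion. -/
def singleUnit : one ≅ singleObj (𝟙_ E) :=
  isoMono (X := one) (Y := singleObj (𝟙_ E)) (Equiv.refl Unit) fun _ => Iso.refl _

theorem singleTens_natural {Z Z' W W' : E} (f : Z ⟶ Z') (g : W ⟶ W') :
    tensHom (singleMap f) (singleMap g) ≫ (singleTens Z' W').hom =
      (singleTens Z W).hom ≫ singleMap (f ⊗ₘ g) := by
  refine (tensHom_mono _ _ _ _ =≫ _).trans ?_
  refine ((mono_comp_mono _ _ _ _).trans ?_).trans (mono_comp_mono _ _ _ _).symm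
  exact mono_congr fun p => (Category.comp_id _).trans (Category.id_comp _).symm

/-- The inclusion is strong monoidal. -/
def singleCore : (single (E := E)).CoreMonoidal where
  εIso := singleUnit
  μIso := singleTens
  μIso_hom_natural_left {X Y} f Z := by
    have e := singleTens_natural f (𝟙 Z)
    rw [show singleMap (𝟙 Z) = 𝟙 _ from single.map_id Z, tensorHom_id] at e
    exact e
  μIso_hom_natural_right {X Y} Z f := by
    have e := singleTens_natural (𝟙 Z) f
    rw [show singleMap (𝟙 Z) = 𝟙 _ from single.map_id Z, id_tensorHom] at e
    exact e
  associativity X Y Z := by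
    refine (congrArg (fun r => r ≫ _) (tensHom_mono_id _ _ _)).trans ?_
    refine (congrArg (fun r => _ ≫ r) (mono_comp_mono _ _ _ _)).trans ?_
    refine (mono_comp_mono _ _ _ _).trans ?_
    refine Eq.trans ?_ (congrArg (fun r => _ ≫ r ≫ _) (tensHom_id_mono _ _ _)).symm
    refine Eq.trans ?_ (congrArg (fun r => _ ≫ r) (mono_comp_mono _ _ _ _)).symm
    refine Eq.trans ?_ (mono_comp_mono _ _ _ _).symm
    refine mono_congr fun p => ?_
    change 𝟙 (X ⊗ Y) ▷ Z ≫ 𝟙 _ ≫ (α_ X Y Z).hom = (α_ X Y Z).hom ≫ X ◁ 𝟙 (Y ⊗ Z) ≫ 𝟙 _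
    rw [id_whiskerRight, whiskerLeft_id, Category.id_comp, Category.id_comp, Category.id_comp,
      Category.comp_id]
  left_unitality X := by
    refine Eq.trans ?_ (congrArg (fun r => r ≫ _) (tensHom_mono_id _ _ _)).symm
    refine Eq.trans ?_ (congrArg (fun r => _ ≫ r) (mono_comp_mono _ _ _ _)).symm
    refine Eq.trans ?_ (mono_comp_mono _ _ _ _).symm
    refine mono_congr fun p => ?_
    change (λ_ X).hom = 𝟙 (𝟙_ E) ▷ X ≫ 𝟙 _ ≫ (λ_ X).hom
    rw [id_whiskerRight, Category.id_comp, Category.id_comp]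
  right_unitality X := by
    refine Eq.trans ?_ (congrArg (fun r => r ≫ _) (tensHom_id_mono _ _ _)).symm
    refine Eq.trans ?_ (congrArg (fun r => _ ≫ r) (mono_comp_mono _ _ _ _)).symm
    refine Eq.trans ?_ (mono_comp_mono _ _ _ _).symm
    refine mono_congr fun p => ?_
    change (ρ_ X).hom = X ◁ 𝟙 (𝟙_ E) ≫ 𝟙 _ ≫ (ρ_ X).hom
    rw [whiskerLeft_id, Category.id_comp, Category.id_comp]

instance : (single (E := E)).Monoidal := singleCore.toMonoidal

/-- Compatibility of the inclusion with the crossing. -/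
def singleCrossApp (a : G) (Z : E) : singleObj ((E.φ a).obj Z) ≅ crossObj a (singleObj Z) :=
  isoMono (X := singleObj ((E.φ a).obj Z)) (Y := crossObj a (singleObj Z)) (Equiv.refl Unit)
    fun _ => Iso.refl _

/-- Compatibility of the inclusion with the crossing. -/
def singleCross (a : G) : E.φ a ⋙ single ≅ single ⋙ cross a :=
  NatIso.ofComponents (singleCrossApp a) fun {Z W} f => by
    refine ((mono_comp_mono _ _ _ _).trans ?_).trans
      ((_ ≫= crossMap_mono _ _ _).trans (mono_comp_mono _ _ _ _)).symm
    exact mono_congr fun p => (Category.comp_id _).trans (Category.id_comp _).symm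

open Functor.LaxMonoidal in
theorem singleCross_unit (a : G) :
    (singleUnit.hom ≫ singleMap (ε (E.φ a))) ≫ (singleCrossApp a (𝟙_ E)).hom =
      (crossUnit a).hom ≫ crossMap a singleUnit.hom := by
  refine (congrArg (fun r => r ≫ _) (mono_comp_mono _ _ _ _)).trans ?_
  refine (mono_comp_mono _ _ _ _).trans ?_
  refine Eq.trans ?_ (congrArg (fun r => _ ≫ r) (crossMap_mono _ _ _)).symm
  refine Eq.trans ?_ (mono_comp_mono _ _ _ _).symm
  refine mono_congr fun p => ?_
  change (𝟙 (𝟙_ E) ≫ ε (E.φ a)) ≫ 𝟙 _ = ε (E.φ a) ≫ (E.φ a).map (𝟙 (𝟙_ E))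
  rw [CategoryTheory.Functor.map_id, Category.id_comp]

open Functor.LaxMonoidal in
theorem singleCross_tens (a : G) (X Y : E) :
    ((singleTens ((E.φ a).obj X) ((E.φ a).obj Y)).hom ≫ singleMap (μ (E.φ a) X Y)) ≫
        (singleCrossApp a (X ⊗ Y)).hom =
      tensHom (singleCrossApp a X).hom (singleCrossApp a Y).hom ≫
        (crossTens a (singleObj X) (singleObj Y)).hom ≫ crossMap a (singleTens X Y).hom := by
  refine (congrArg (fun r => r ≫ _) (mono_comp_mono _ _ _ _)).trans ?_
  refine (mono_comp_mono _ _ _ _).trans ?_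
  refine Eq.trans ?_ (congrArg₂ (fun r s => r ≫ _ ≫ s) (tensHom_mono _ _ _ _)
    (crossMap_mono _ _ _)).symm
  refine Eq.trans ?_ (congrArg (fun r => _ ≫ r) (mono_comp_mono _ _ _ _)).symm
  refine Eq.trans ?_ (mono_comp_mono _ _ _ _).symm
  refine mono_congr fun p => ?_
  change (𝟙 ((E.φ a).obj X ⊗ (E.φ a).obj Y) ≫ μ (E.φ a) X Y) ≫ 𝟙 _ =
    (𝟙 ((E.φ a).obj X) ⊗ₘ 𝟙 ((E.φ a).obj Y)) ≫ μ (E.φ a) X Y ≫ (E.φ a).map (𝟙 (X ⊗ Y))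
  rw [CategoryTheory.Functor.map_id, id_tensorHom_id, Category.assoc]

theorem singleCross_isMonoidal (a : G) : NatTrans.IsMonoidal (singleCross (E := E) a).hom :=
  ⟨singleCross_unit a, singleCross_tens a⟩

/-- The inclusion into the completion, as a morphism. -/
def incl (E : Pre.{w, v, u} G k) : PreHom E (crossedCat E) where
  F := single
  monoidal := singleCore.toMonoidal
  additive := inferInstanceAs (single (E := E)).Additive
  linear := inferInstanceAs ((single (E := E)).Linear k)
  deg X := rfl
  φIso := singleCross
  φIso_isMonoidal := singleCross_isMonoidal
  φIso_comp h X := by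
    refine ((mono_comp_mono _ _ _ _).trans ?_).trans ((_ ≫= ((crossMap_mono _ _ _ =≫ _).trans
      (mono_comp_mono _ _ _ _))).trans (mono_comp_mono _ _ _ _)).symm
    refine mono_congr fun p => (Category.comp_id _).trans (Eq.symm ?_)
    refine (Category.id_comp _).trans ?_
    exact (congrArg (fun r => r ≫ _) (CategoryTheory.Functor.map_id _ _)).trans (Category.id_comp _)
  φIso_id X := by
    refine (mono_comp_mono _ _ _ _).trans ?_
    exact mono_congr fun p => Category.comp_id _

theorem incl_isCompletion (E : Pre.{w, v, u} G k) : (incl E).IsCompletion where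
  full := inferInstanceAs (single (E := E)).Full
  faithful := inferInstanceAs (single (E := E)).Faithful
  exists_iso X := by
    let s := (Fintype.equivFin X.El).symm
    -- A formal sum is the direct sum of its entries taken as one-term sums; the fibres are
    -- one-point sets, so the index set is just enumerated.
    let e : (Σ x : Fin (Fintype.card X.El), (singleObj (X.fam (s x))).El) ≃ X.El :=
      (Equiv.sigmaUnique _ fun _ => Unit).trans s
    exact ⟨_, fun x => X.fam (s x), ⟨biproduct.uniqueUpToIso _ (biconeIsBilimit
      (Z := fun x => singleObj (X.fam (s x))) e fun x i => Iso.refl _)⟩⟩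

end Sums

end SumsCrossed

open scoped CategoryTheory.Pseudofunctor.StrongTrans

/-! ### Pseudonatural transformations and modifications on components -/

noncomputable section Elementwise

variable {G : Type u} [Group G] {k : Type w} [CommRing k]

namespace Ps

variable {S T : Ps.{w, v, u} G k}

/-- The axioms of a pseudonatural transformation involve associators and unitors of `LinCat`, whose
components are identities. Here and in `appAct_mul` they are removed, and the constraint is turned
round by passing to inverses. -/
theorem appAct_one (F : S ⟶ T) {a : G} (h : 1 * a = a * 1) (X : S.at_ a) :
    (appAct F 1 h X).hom ≫ (app F a).map (S.actOne h X).hom =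
      (T.actOne h ((app F a).obj X)).hom := by
  have e := congrArg (fun t => LinCat.Hom₂.toNatTrans t |>.app X)
    (Pseudofunctor.StrongTrans.naturality_id F ⟨⟨a⟩⟩)
  change (appAct F 1 h X).inv ≫ (T.actOne h ((app F a).obj X)).hom =
    (app F a).map (S.actOne h X).hom ≫ 𝟙 _ ≫ 𝟙 _ at e
  rw [Category.comp_id, Iso.inv_comp_eq] at e
  exact (e.trans (congrArg (fun r => _ ≫ r) (Category.comp_id _))).symm

theorem appAct_mul (F : S ⟶ T) (g g' : G) {a a' a'' : G} (h : g * a = a' * g)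
    (h' : g' * a' = a'' * g') (h'' : g' * g * a = a'' * (g' * g)) (X : S.at_ a) :
    (appAct F (g' * g) h'' X).hom ≫ (app F a'').map (S.actMul g g' h h' h'' X).hom =
      (T.actMul g g' h h' h'' ((app F a).obj X)).hom ≫ (T.act g' h').map (appAct F g h X).hom ≫
        (appAct F g' h' ((S.act g h).obj X)).hom := by
  have e := congrArg (fun t => LinCat.Hom₂.toNatTrans t |>.app X)
    (Pseudofunctor.StrongTrans.naturality_comp F (GAut.ofEl g h) (GAut.ofEl g' h'))
  change (appAct F (g' * g) h'' X).inv ≫ (T.actMul g g' h h' h'' ((app F a).obj X)).hom =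
    (app F a'').map (S.actMul g g' h h' h'' X).hom ≫ 𝟙 _ ≫
      (appAct F g' h' ((S.act g h).obj X)).inv ≫ 𝟙 _ ≫ (T.act g' h').map (appAct F g h X).inv ≫
        𝟙 _ at e
  simp only [Category.id_comp] at e
  have e' : (appAct F (g' * g) h'' X).inv ≫ (T.actMul g g' h h' h'' ((app F a).obj X)).hom =
    (app F a'').map (S.actMul g g' h h' h'' X).hom ≫
      (appAct F g' h' ((S.act g h).obj X)).inv ≫ (T.act g' h').map (appAct F g h X).inv :=
    e.trans (congrArg (fun r => _ ≫ _ ≫ r) (Category.comp_id _))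
  rw [Iso.inv_comp_eq] at e'
  rw [e']
  simp only [Category.assoc]
  rw [← Functor.map_comp_assoc, Iso.inv_hom_id, CategoryTheory.Functor.map_id, Category.id_comp,
    Iso.inv_hom_id, Category.comp_id]

theorem app₂_act {F F' : S ⟶ T} (t : F ⟶ F') (g : G) {a a' : G} (h : g * a = a' * g)
    (X : S.at_ a) :
    (T.act g h).map (app₂ t X) ≫ (appAct F' g h X).hom =
      (appAct F g h X).hom ≫ app₂ t ((S.act g h).obj X) := by
  have e := congrArg (fun t => LinCat.Hom₂.toNatTrans t |>.app X)
    (t.as.naturality (GAut.ofEl g h))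
  change app₂ t ((S.act g h).obj X) ≫ (appAct F' g h X).inv =
    (appAct F g h X).inv ≫ (T.act g h).map (app₂ t X) at e
  rw [← cancel_epi (appAct F g h X).inv, ← reassoc_of% e, Iso.inv_hom_id, Category.comp_id,
    Iso.inv_hom_id_assoc]

theorem app₂_natural {F F' : S ⟶ T} (t : F ⟶ F') {a : G} {X Y : S.at_ a} (f : X ⟶ Y) :
    (app F a).map f ≫ app₂ t Y = app₂ t X ≫ (app F' a).map f :=
  (t.as.app ⟨⟨a⟩⟩).toNatTrans.naturality f

variable (S T) in
/-- A pseudonatural transformation, described by its components on objects. -/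
structure HomData where
  fn (a : G) : S.at_ a ⟶ T.at_ a
  act (g : G) {a a' : G} (h : g * a = a' * g) (X : S.at_ a) :
    (T.act g h).obj ((fn a).toFunctor.obj X) ≅ (fn a').toFunctor.obj ((S.act g h).obj X)
  natural (g : G) {a a' : G} (h : g * a = a' * g) {X Y : S.at_ a} (f : X ⟶ Y) :
    (act g h X).hom ≫ (fn a').toFunctor.map ((S.act g h).map f) =
      (T.act g h).map ((fn a).toFunctor.map f) ≫ (act g h Y).hom
  one {a : G} (h : 1 * a = a * 1) (X : S.at_ a) :
    (act 1 h X).hom ≫ (fn a).toFunctor.map (S.actOne h X).hom =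
      (T.actOne h ((fn a).toFunctor.obj X)).hom
  mul (g g' : G) {a a' a'' : G} (h : g * a = a' * g) (h' : g' * a' = a'' * g')
    (h'' : g' * g * a = a'' * (g' * g)) (X : S.at_ a) :
    (act (g' * g) h'' X).hom ≫ (fn a'').toFunctor.map (S.actMul g g' h h' h'' X).hom =
      (T.actMul g g' h h' h'' ((fn a).toFunctor.obj X)).hom ≫ (T.act g' h').map (act g h X).hom ≫
        (act g' h' ((S.act g h).obj X)).hom

namespace HomData

variable (D : HomData S T)

/-- The identities on the right are the components of unitors in the axiom `naturality_id`, kept so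
that this statement matches it definitionally; `mul_inv` does the same for `naturality_comp`. -/
theorem one_inv {a : G} (h : 1 * a = a * 1) (X : S.at_ a) :
    (D.act 1 h X).inv ≫ (T.actOne h ((D.fn a).toFunctor.obj X)).hom =
      (D.fn a).toFunctor.map (S.actOne h X).hom ≫ 𝟙 _ ≫ 𝟙 _ := by
  rw [← D.one, Iso.inv_hom_id_assoc, Category.comp_id, Category.comp_id]

theorem mul_inv (g g' : G) {a a' a'' : G} (h : g * a = a' * g) (h' : g' * a' = a'' * g')
    (h'' : g' * g * a = a'' * (g' * g)) (X : S.at_ a) :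
    (D.act (g' * g) h'' X).inv ≫ (T.actMul g g' h h' h'' ((D.fn a).toFunctor.obj X)).hom =
      (D.fn a'').toFunctor.map (S.actMul g g' h h' h'' X).hom ≫ 𝟙 _ ≫
        (D.act g' h' ((S.act g h).obj X)).inv ≫ 𝟙 _ ≫ (T.act g' h').map (D.act g h X).inv ≫
          𝟙 _ := by
  simp only [Category.id_comp, Category.comp_id]
  rw [Iso.inv_comp_eq, reassoc_of% D.mul, Iso.hom_inv_id_assoc, ← Functor.map_comp, Iso.hom_inv_id,
    CategoryTheory.Functor.map_id, Category.comp_id]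

/-- The pseudonaturality constraint. -/
def nat (g : G) {a a' : G} (h : g * a = a' * g) :
    S.map (GAut.ofEl g h) ≫ D.fn a' ≅ D.fn a ≫ T.map (GAut.ofEl g h) :=
  LinCat.isoMk (NatIso.ofComponents (fun X => (D.act g h X).symm) fun {X Y} f => by
    have e := D.natural g h f
    have e' : (D.fn a').toFunctor.map ((S.act g h).map f) ≫ (D.act g h Y).inv =
      (D.act g h X).inv ≫ (T.act g h).map ((D.fn a).toFunctor.map f) := by
      rw [Iso.comp_inv_eq, Category.assoc, ← e, Iso.inv_hom_id_assoc]
    exact e')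

/-- The pseudonatural transformation. -/
def hom : S ⟶ T where
  app x := D.fn x.as.el
  naturality f := D.nat f.as.el f.as.comm
  naturality_naturality t := CrossedCat.naturality_aux (fun x => D.fn x.as.el)
    (fun f => D.nat f.as.el f.as.comm) t
  naturality_id x := LinCat.hom₂_ext fun X => D.one_inv _ X
  naturality_comp f g := LinCat.hom₂_ext fun X =>
    D.mul_inv f.as.el g.as.el f.as.comm g.as.comm _ X

end HomData

/-- An invertible modification, from its components on objects. -/
def isoMk {F F' : S ⟶ T} (e : ∀ {a : G} (X : S.at_ a), (app F a).obj X ≅ (app F' a).obj X)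
    (natural : ∀ {a : G} {X Y : S.at_ a} (f : X ⟶ Y),
      (app F a).map f ≫ (e Y).hom = (e X).hom ≫ (app F' a).map f)
    (act : ∀ (g : G) {a a' : G} (h : g * a = a' * g) (X : S.at_ a),
      (T.act g h).map (e X).hom ≫ (appAct F' g h X).hom =
        (appAct F g h X).hom ≫ (e ((S.act g h).obj X)).hom) : F ≅ F' :=
  Pseudofunctor.StrongTrans.isoMk
    (fun x => LinCat.isoMk (NatIso.ofComponents (fun X => e (a := x.as.el) X) natural))
    fun {x y} f => LinCat.hom₂_ext fun X => by
      have h := act f.as.el f.as.comm X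
      have h' : (e ((S.act f.as.el f.as.comm).obj X)).hom ≫
          (appAct F' f.as.el f.as.comm X).inv =
        (appAct F f.as.el f.as.comm X).inv ≫ (T.act f.as.el f.as.comm).map (e X).hom := by
        rw [Iso.comp_inv_eq, Category.assoc, h, Iso.inv_hom_id_assoc]
      exact h'

end Ps

end Elementwise

open scoped CategoryTheory.Pseudofunctor.StrongTrans

/-! ### From a 1-cell into `H C` to a monoidal functor on the coproduct -/

noncomputable section HomToHomog

variable {G : Type u} [Group G] {k : Type w} [CommRing k]

namespace Monoidale.Hom

open Functor.LaxMonoidal Functor.OplaxMonoidal Functor.Monoidal Monoidale.Total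

variable {M : Monoidale.{w, v, u} G k} {C : CrossedCat.{w, v, u} G k} (η : Hom M C.homog)

/-- The restriction to a component, as a functor to the ambient category. -/
def comp_ι (a : G) : M.ps.at_ a ⥤ C := Ps.app η.F a ⋙ (C.deg a).ι

instance (a : G) : (η.comp_ι a).Additive where
  map_add {X Y f g} := congrArg (fun r : (Ps.app η.F a).obj X ⟶ (Ps.app η.F a).obj Y =>
    (C.deg a).ι.map r) (Functor.map_add (Ps.app η.F a) (f := f) (g := g))

instance (a : G) : (η.comp_ι a).Linear k where
  map_smul {X Y} f r := congrArg (fun r : (Ps.app η.F a).obj X ⟶ (Ps.app η.F a).obj Y =>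
    (C.deg a).ι.map r) (Functor.map_smul (Ps.app η.F a) r f)

/-- The induced functor on the coproduct of the components. -/
def total : M.Total ⥤ C := Tot.lift η.comp_ι

instance : η.total.Additive := inferInstanceAs (Tot.lift η.comp_ι).Additive

instance : η.total.Linear k := inferInstanceAs ((Tot.lift η.comp_ι).Linear k)

theorem total_map_of {a : G} {X Y : M.ps.at_ a} (f : X ⟶ Y) :
    η.total.map (Tot.of f) = (η.comp_ι a).map f := Tot.lift_map_of _ f

theorem comp_ι_deg {a : G} (X : M.ps.at_ a) : C.deg a ((η.comp_ι a).obj X) :=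
  ((Ps.app η.F a).obj X : (C.deg a).FullSubcategory).property

/-- The tensor constraint. -/
def ten {a b c : G} (h : a * b = c) (X : M.ps.at_ a) (Y : M.ps.at_ b) :
    η.total.obj (tot X) ⊗ η.total.obj (tot Y) ≅ η.total.obj (tot ((M.tensor h).obj X Y)) :=
  (C.deg c).ι.mapIso (η.tensorIso h X Y)

/-- The unit constraint. -/
def uni : 𝟙_ C ≅ η.total.obj (tot M.unit) := (C.deg 1).ι.mapIso η.unitIso

/-- The constraint for the action. -/
def ac (g : G) {a a' : G} (h : g * a = a' * g) (X : M.ps.at_ a) :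
    (C.φ g⁻¹).obj (η.total.obj (tot X)) ≅ η.total.obj (tot ((M.ps.act g h).obj X)) :=
  (C.deg a').ι.mapIso (Ps.appAct η.F g h X)

theorem ten_natural {a b c : G} (h : a * b = c) {X X' : M.ps.at_ a} {Y Y' : M.ps.at_ b}
    (x : X ⟶ X') (y : Y ⟶ Y') :
    (η.total.map (Tot.of x) ⊗ₘ η.total.map (Tot.of y)) ≫ (η.ten h X' Y').hom =
      (η.ten h X Y).hom ≫ η.total.map (Tot.of ((M.tensor h).map x y)) := by
  simp only [total_map_of]
  exact congrArg (fun r => (C.deg c).ι.map r) (η.tensorIso_natural h x y)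

theorem ac_natural (g : G) {a a' : G} (h : g * a = a' * g) {X X' : M.ps.at_ a} (x : X ⟶ X') :
    (C.φ g⁻¹).map (η.total.map (Tot.of x)) ≫ (η.ac g h X').hom =
      (η.ac g h X).hom ≫ η.total.map (Tot.of ((M.ps.act g h).map x)) := by
  simp only [total_map_of]
  exact congrArg (fun r => (C.deg a').ι.map r) (Ps.appAct_natural η.F g h x).symm

theorem ten_act (g : G) {a b c a' b' c' : G} (h : a * b = c) (h' : a' * b' = c')
    (ha : g * a = a' * g) (hb : g * b = b' * g) (hc : g * c = c' * g)
    (X : M.ps.at_ a) (Y : M.ps.at_ b) :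
    (C.φ g⁻¹).map (η.ten h X Y).hom ≫ (η.ac g hc ((M.tensor h).obj X Y)).hom ≫
        η.total.map (Tot.of (M.tensorAct g h h' ha hb hc X Y).hom) =
      δ (C.φ g⁻¹) (η.total.obj (tot X)) (η.total.obj (tot Y)) ≫
        ((η.ac g ha X).hom ⊗ₘ (η.ac g hb Y).hom) ≫
          (η.ten h' ((M.ps.act g ha).obj X) ((M.ps.act g hb).obj Y)).hom := by
  simp only [total_map_of]
  exact congrArg (fun r => (C.deg c').ι.map r) (η.tensorIso_act g h h' ha hb hc X Y)

theorem uni_act (g : G) (h : g * 1 = 1 * g) :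
    (C.φ g⁻¹).map η.uni.hom ≫ (η.ac g h M.unit).hom ≫ η.total.map (Tot.of (M.unitAct g h).hom) =
      Functor.OplaxMonoidal.η (C.φ g⁻¹) ≫ η.uni.hom := by
  simp only [total_map_of]
  exact congrArg (fun r => (C.deg 1).ι.map r) (η.unitIso_act g h)

theorem ten_assoc {a b c ab bc abc : G} (h₁ : a * b = ab) (h₂ : ab * c = abc) (h₃ : b * c = bc)
    (h₄ : a * bc = abc) (X : M.ps.at_ a) (Y : M.ps.at_ b) (Z : M.ps.at_ c) :
    ((η.ten h₁ X Y).hom ⊗ₘ 𝟙 (η.total.obj (tot Z))) ≫ (η.ten h₂ ((M.tensor h₁).obj X Y) Z).hom ≫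
        η.total.map (Tot.of (M.assoc h₁ h₂ h₃ h₄ X Y Z).hom) =
      (α_ (η.total.obj (tot X)) (η.total.obj (tot Y)) (η.total.obj (tot Z))).hom ≫
        (𝟙 (η.total.obj (tot X)) ⊗ₘ (η.ten h₃ Y Z).hom) ≫
          (η.ten h₄ X ((M.tensor h₃).obj Y Z)).hom := by
  simp only [total_map_of]
  exact congrArg (fun r => (C.deg abc).ι.map r) (η.assoc h₁ h₂ h₃ h₄ X Y Z)

theorem ten_left {a : G} (h : 1 * a = a) (X : M.ps.at_ a) :
    (λ_ (η.total.obj (tot X))).hom = (η.uni.hom ⊗ₘ 𝟙 (η.total.obj (tot X))) ≫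
      (η.ten h M.unit X).hom ≫ η.total.map (Tot.of (M.left h X).hom) := by
  simp only [total_map_of]
  exact congrArg (fun r => (C.deg a).ι.map r) (η.left h X)

theorem ten_right {a : G} (h : a * 1 = a) (X : M.ps.at_ a) :
    (ρ_ (η.total.obj (tot X))).hom = (𝟙 (η.total.obj (tot X)) ⊗ₘ η.uni.hom) ≫
      (η.ten h X M.unit).hom ≫ η.total.map (Tot.of (M.right h X).hom) := by
  simp only [total_map_of]
  exact congrArg (fun r => (C.deg a).ι.map r) (η.right h X)

/-- The neutral element acts on homogeneous parts as `φ` of `1⁻¹`, which is not literally `1`; hence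
`φId'` in place of `φId`. -/
theorem ac_one {a : G} (h : 1 * a = a * 1) (X : M.ps.at_ a) :
    (η.ac 1 h X).hom ≫ η.total.map (Tot.of (M.ps.actOne h X).hom) =
      (C.φId' inv_one).inv.app (η.total.obj (tot X)) := by
  simp only [total_map_of]
  exact congrArg (fun r => (C.deg a).ι.map r) (Ps.appAct_one η.F h X)

theorem ac_mul (g g' : G) {a a' a'' : G} (h : g * a = a' * g)
    (h' : g' * a' = a'' * g') (h'' : g' * g * a = a'' * (g' * g)) (X : M.ps.at_ a) :
    (η.ac (g' * g) h'' X).hom ≫ η.total.map (Tot.of (M.ps.actMul g g' h h' h'' X).hom) =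
      (C.mulApp (mul_inv_rev g' g).symm (η.total.obj (tot X))).inv ≫
        (C.φ g'⁻¹).map (η.ac g h X).hom ≫ (η.ac g' h' ((M.ps.act g h).obj X)).hom := by
  simp only [total_map_of]
  exact congrArg (fun r => (C.deg a'').ι.map r) (Ps.appAct_mul η.F g g' h h' h'' X)

/-- The constraint for the action, in terms of the inverse. -/
def actI {e g : G} (hg : g⁻¹ = e) {a a' : G} (h : g * a = a' * g) (X : M.ps.at_ a) :
    (C.φ e).obj (η.total.obj (tot X)) ≅ η.total.obj (tot ((M.ps.act g h).obj X)) :=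
  eqToIso (by rw [hg]) ≪≫ η.ac g h X

theorem actI_rfl (g : G) {a a' : G} (h : g * a = a' * g) (X : M.ps.at_ a) :
    η.actI rfl h X = η.ac g h X := Iso.ext (Category.id_comp _)

theorem actI_natural {e g : G} (hg : g⁻¹ = e) {a a' : G} (h : g * a = a' * g)
    {X X' : M.ps.at_ a} (x : X ⟶ X') :
    (C.φ e).map (η.total.map (Tot.of x)) ≫ (η.actI hg h X').hom =
      (η.actI hg h X).hom ≫ η.total.map (Tot.of ((M.ps.act g h).map x)) := by
  subst hg
  rw [actI_rfl, actI_rfl, ac_natural]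

theorem ten_actI {e g : G} (hg : g⁻¹ = e) {a b c a' b' c' : G} (h : a * b = c) (h' : a' * b' = c')
    (ha : g * a = a' * g) (hb : g * b = b' * g) (hc : g * c = c' * g)
    (X : M.ps.at_ a) (Y : M.ps.at_ b) :
    (C.φ e).map (η.ten h X Y).hom ≫ (η.actI hg hc ((M.tensor h).obj X Y)).hom ≫
        η.total.map (Tot.of (M.tensorAct g h h' ha hb hc X Y).hom) =
      δ (C.φ e) (η.total.obj (tot X)) (η.total.obj (tot Y)) ≫
        ((η.actI hg ha X).hom ⊗ₘ (η.actI hg hb Y).hom) ≫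
          (η.ten h' ((M.ps.act g ha).obj X) ((M.ps.act g hb).obj Y)).hom := by
  subst hg
  rw [actI_rfl, actI_rfl, actI_rfl, ten_act]

theorem uni_actI {e g : G} (hg : g⁻¹ = e) (h : g * 1 = 1 * g) :
    (C.φ e).map η.uni.hom ≫ (η.actI hg h M.unit).hom ≫ η.total.map (Tot.of (M.unitAct g h).hom) =
      Functor.OplaxMonoidal.η (C.φ e) ≫ η.uni.hom := by
  subst hg
  rw [actI_rfl, uni_act]

theorem actI_one' {e : G} (hg : (1 : G)⁻¹ = e) (he : e = 1) {a : G} (h : 1 * a = a * 1)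
    (X : M.ps.at_ a) :
    (η.actI hg h X).hom ≫ η.total.map (Tot.of (M.ps.actOne h X).hom) =
      (C.φId' he).inv.app (η.total.obj (tot X)) := by
  subst hg
  rw [actI_rfl, ac_one]

theorem actI_one {a : G} (h : 1 * a = a * 1) (X : M.ps.at_ a) :
    (η.actI inv_one h X).hom ≫ η.total.map (Tot.of (M.ps.actOne h X).hom) =
      (C.oneApp (η.total.obj (tot X))).inv :=
  (η.actI_one' inv_one rfl h X).trans (Category.id_comp _)

/-- The inverses are given names because the crossing by `a` is the action of `a⁻¹`, and `(a⁻¹)⁻¹`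
has to be replaced by `a`. -/
theorem actI_mul {b c e g g' : G} (hg : g⁻¹ = b) (hg' : g'⁻¹ = c) (hg'' : (g' * g)⁻¹ = e)
    (he : b * c = e) {a a' a'' : G} (h : g * a = a' * g)
    (h' : g' * a' = a'' * g') (h'' : g' * g * a = a'' * (g' * g)) (X : M.ps.at_ a) :
    (η.actI hg'' h'' X).hom ≫ η.total.map (Tot.of (M.ps.actMul g g' h h' h'' X).hom) =
      (C.mulApp he (η.total.obj (tot X))).inv ≫
        (C.φ c).map (η.actI hg h X).hom ≫ (η.actI hg' h' ((M.ps.act g h).obj X)).hom := by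
  subst hg hg' hg''
  rw [actI_rfl, actI_rfl, actI_rfl, ac_mul]

/-- The tensor constraint of the induced functor. -/
def tenI (X Y : M.Total) : η.total.obj X ⊗ η.total.obj Y ≅ η.total.obj (X ⊗ Y) :=
  η.ten rfl X.obj Y.obj

/-- Composed with the comparison, the constraint no longer depends on the name of the product
degree, so it becomes a constraint for the functor on the coproduct. -/
theorem ten_tensI {a b c : G} (h : a * b = c) (X : M.ps.at_ a) (Y : M.ps.at_ b) :
    (η.ten h X Y).hom ≫ η.total.map (tensI h X Y).hom = (η.tenI (tot X) (tot Y)).hom := by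
  subst h
  exact (congrArg (fun r => (η.ten rfl X Y).hom ≫ r) (η.total.map_id (tot X ⊗ tot Y))).trans
    (Category.comp_id (η.ten rfl X Y).hom)

theorem tenI_natural {X X' Y Y' : M.Total} (f : X ⟶ X') (g : Y ⟶ Y') :
    (η.total.map f ⊗ₘ η.total.map g) ≫ (η.tenI X' Y').hom =
      (η.tenI X Y).hom ≫ η.total.map (f ⊗ₘ g) := by
  induction X, X', f using Tot.ind with
  | zero =>
    rw [MonoidalPreadditive.zero_tensor, Functor.map_zero, Functor.map_zero,
      MonoidalPreadditive.zero_tensor, zero_comp, comp_zero]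
  | of d X X' f =>
    induction Y, Y', g using Tot.ind with
    | zero =>
      rw [MonoidalPreadditive.tensor_zero, Functor.map_zero, Functor.map_zero,
        MonoidalPreadditive.tensor_zero, zero_comp, comp_zero]
    | of e Y Y' g =>
      rw [← η.ten_tensI rfl X' Y', ← η.ten_tensI rfl X Y, reassoc_of% η.ten_natural,
        Category.assoc, ← Functor.map_comp, ← Functor.map_comp, tensI_natural]

/-- The induced functor on the coproduct is strong monoidal. -/
def totalCore : η.total.CoreMonoidal where
  εIso := η.uni
  μIso := η.tenI
  μIso_hom_natural_left f Z := by
    have e := η.tenI_natural f (𝟙 Z)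
    rwa [CategoryTheory.Functor.map_id, tensorHom_id, tensorHom_id] at e
  μIso_hom_natural_right Z f := by
    have e := η.tenI_natural (𝟙 Z) f
    rwa [CategoryTheory.Functor.map_id, id_tensorHom, id_tensorHom] at e
  associativity X Y Z := by
    obtain ⟨a, X⟩ := X
    obtain ⟨b, Y⟩ := Y
    obtain ⟨c, Z⟩ := Z
    have h₄ : a * (b * c) = a * b * c := (mul_assoc _ _ _).symm
    have e := η.ten_assoc rfl rfl rfl h₄ X Y Z
    have e' := η.ten_tensI h₄ X ((M.tensor rfl).obj Y Z)
    -- The associator of the coproduct is by definition that of `M` followed by a comparison, and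
    -- the comparison turns `ten h₄` into `tenI`.
    have e'' : η.total.map (α_ (tot X) (tot Y) (tot Z)).hom =
        η.total.map (Tot.of (M.assoc rfl rfl rfl h₄ X Y Z).hom) ≫
          η.total.map (tensI h₄ X ((M.tensor rfl).obj Y Z)).hom := by
      rw [← Functor.map_comp]
      rfl
    rw [tensorHom_id, id_tensorHom] at e
    refine (congrArg (fun r => _ ≫ _ ≫ r) e'').trans ?_
    refine Eq.trans ?_ (congrArg (fun r => _ ≫ _ ≫ r) e')
    have e₂ := e =≫ η.total.map (tensI h₄ X ((M.tensor rfl).obj Y Z)).hom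
    simp only [Category.assoc] at e₂
    exact e₂
  left_unitality X := by
    obtain ⟨a, X⟩ := X
    have e' : η.total.map (λ_ (tot X)).hom = η.total.map (tensI (one_mul a) M.unit X).inv ≫
        η.total.map (Tot.of (M.left (one_mul a) X).hom) := by
      rw [← Functor.map_comp]
      rfl
    have e := η.ten_left (one_mul a) X
    rw [tensorHom_id] at e
    have e₂ := η.ten_tensI (one_mul a) M.unit X
    refine e.trans (congrArg (fun r => _ ≫ r) ?_)
    refine Eq.trans ?_ (congrArg₂ (fun r s => r ≫ s) e₂ e'.symm)
    rw [Category.assoc, ← Functor.map_comp_assoc, Iso.hom_inv_id, CategoryTheory.Functor.map_id,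
      Category.id_comp]
  right_unitality X := by
    obtain ⟨a, X⟩ := X
    have e' : η.total.map (ρ_ (tot X)).hom = η.total.map (tensI (mul_one a) X M.unit).inv ≫
        η.total.map (Tot.of (M.right (mul_one a) X).hom) := by
      rw [← Functor.map_comp]
      rfl
    have e := η.ten_right (mul_one a) X
    rw [id_tensorHom] at e
    have e₂ := η.ten_tensI (mul_one a) X M.unit
    refine e.trans (congrArg (fun r => _ ≫ r) ?_)
    refine Eq.trans ?_ (congrArg₂ (fun r s => r ≫ s) e₂ e'.symm)
    rw [Category.assoc, ← Functor.map_comp_assoc, Iso.hom_inv_id, CategoryTheory.Functor.map_id,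
      Category.id_comp]

instance : η.total.Monoidal := η.totalCore.toMonoidal

end Monoidale.Hom

end HomToHomog

open scoped CategoryTheory.Pseudofunctor.StrongTrans

/-! ### Compatibility of the induced functor with the crossings -/

noncomputable section HomToPre

variable {G : Type u} [Group G] {k : Type w} [CommRing k]

namespace Monoidale.Hom

open Functor.LaxMonoidal Functor.OplaxMonoidal Functor.Monoidal Monoidale.Total Ps

variable {M : Monoidale.{w, v, u} G k} {C : CrossedCat.{w, v, u} G k} (η : Hom M C.homog)

theorem total_map_tensI_δ {a b c : G} (h : a * b = c) (X : M.ps.at_ a) (Y : M.ps.at_ b) :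
    η.total.map (tensI h X Y).hom ≫ δ η.total (tot X) (tot Y) = (η.ten h X Y).inv := by
  rw [← cancel_epi (η.ten h X Y).hom, ← Category.assoc, ten_tensI, Iso.hom_inv_id]
  exact (η.tenI (tot X) (tot Y)).hom_inv_id

theorem uni_η : Functor.OplaxMonoidal.η η.total = η.uni.inv := rfl

/-- The compatibility with the crossings. -/
def crossApp (a : G) (X : M.Total) :
    η.total.obj ((M.ps.cross a).obj X) ≅ (C.φ a).obj (η.total.obj X) :=
  (η.actI (inv_inv a) (conj_comm a X.deg) X.obj).symm

/-- Describes `crossApp` through any presentation of the crossing by an action. With it, the axioms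
of the 1-cell imply those of a morphism of graded categories with a crossing. -/
theorem toCross_crossApp {a g d d' : G} (hg : g = a⁻¹) (hg' : g⁻¹ = a) (h : g * d = d' * g)
    (X : M.ps.at_ d) :
    η.total.map (M.ps.toCross hg h X).hom ≫ (η.crossApp a (tot X)).hom =
      (η.actI hg' h X).inv := by
  subst hg
  obtain rfl : d' = a⁻¹ * d * a := by rw [h]; group
  exact (congrArg (fun r => r ≫ _) (η.total.map_id _)).trans (Category.id_comp _)

theorem crossApp_natural (a : G) {X Y : M.Total} (f : X ⟶ Y) :
    η.total.map ((M.ps.cross a).map f) ≫ (η.crossApp a Y).hom =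
      (η.crossApp a X).hom ≫ (C.φ a).map (η.total.map f) := by
  induction X, Y, f using Tot.ind with
  | zero => simp only [Functor.map_zero, zero_comp, comp_zero]
  | of d X Y f =>
    have e := η.actI_natural (inv_inv a) (conj_comm a d) f
    rw [← cancel_epi (η.total.map (M.ps.toCross (a := a) rfl (conj_comm a d) X).hom),
      ← Functor.map_comp_assoc, toCross_natural, Functor.map_comp, Category.assoc,
      η.toCross_crossApp rfl (inv_inv a), reassoc_of% η.toCross_crossApp rfl (inv_inv a),
      Iso.comp_inv_eq, Category.assoc, e, Iso.inv_hom_id_assoc]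

/-- The compatibility with the crossings. -/
def crossIso (a : G) : M.ps.cross a ⋙ η.total ≅ η.total ⋙ C.φ a :=
  NatIso.ofComponents (η.crossApp a) (η.crossApp_natural a)

/-- This is `ten_actI`, the compatibility of the 1-cell with `tensorAct`, solved for the inverse
tensor constraint. It is stated in the oplax form required by `isMonoidal_of_delta`. -/
theorem crossApp_tensor (a : G) (X Y : M.Total) :
    (η.crossApp a (X ⊗ Y)).hom ≫ (C.φ a).map (δ η.total X Y) ≫
        δ (C.φ a) (η.total.obj X) (η.total.obj Y) =
      η.total.map (crossTensor a X Y).hom ≫ δ η.total ((M.ps.cross a).obj X) ((M.ps.cross a).obj Y) ≫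
        ((η.crossApp a X).hom ⊗ₘ (η.crossApp a Y).hom) := by
  obtain ⟨d, X⟩ := X
  obtain ⟨e, Y⟩ := Y
  change (η.crossApp a (tot X ⊗ tot Y)).hom ≫ (C.φ a).map (δ η.total (tot X) (tot Y)) ≫
        δ (C.φ a) (η.total.obj (tot X)) (η.total.obj (tot Y)) =
      η.total.map (crossTensor a (tot X) (tot Y)).hom ≫
        δ η.total ((M.ps.cross a).obj (tot X)) ((M.ps.cross a).obj (tot Y)) ≫
        ((η.crossApp a (tot X)).hom ⊗ₘ (η.crossApp a (tot Y)).hom)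
  have c := congrArg η.total.map (crossTensor_hom (M := M) (a := a) rfl rfl (conj_mul a d e)
    (conj_comm a d) (conj_comm a e) (conj_comm a (d * e)) X Y)
  simp only [Functor.map_comp] at c
  have t := η.ten_actI (inv_inv a) rfl (conj_mul a d e) (conj_comm a d) (conj_comm a e)
    (conj_comm a (d * e)) X Y
  have n := δ_natural η.total (M.ps.toCross (a := a) rfl (conj_comm a d) X).hom
    (M.ps.toCross (a := a) rfl (conj_comm a e) Y).hom
  have p := η.toCross_crossApp (a := a) rfl (inv_inv a) (conj_comm a (d * e))
    ((M.tensor rfl).obj X Y)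
  have q := congrArg (C.φ a).map (η.total_map_tensI_δ rfl X Y)
  rw [Functor.map_comp] at q
  rw [← cancel_epi (η.total.map ((M.ps.cross a).map (tensI rfl X Y).hom)),
    ← cancel_epi (η.total.map (M.ps.toCross (a := a) rfl (conj_comm a (d * e))
      ((M.tensor rfl).obj X Y)).hom), reassoc_of% η.crossApp_natural, reassoc_of% p,
      reassoc_of% q, reassoc_of% c, ← reassoc_of% n, tensorHom_comp_tensorHom,
      η.toCross_crossApp rfl (inv_inv a), η.toCross_crossApp rfl (inv_inv a),
      ← Category.assoc (η.total.map (tensI _ _ _).hom), total_map_tensI_δ]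
  -- Composing with the inverses of the last two factors isolates `δ` of `φ a` on the right.
  have t' := t =≫ ((η.ten (conj_mul a d e) _ _).inv ≫
    ((η.actI (inv_inv a) (conj_comm a d) X).inv ⊗ₘ (η.actI (inv_inv a) (conj_comm a e) Y).inv))
  simp only [Category.assoc, Iso.hom_inv_id_assoc, tensorHom_comp_tensorHom, Iso.hom_inv_id] at t'
  rw [id_tensorHom_id, Category.comp_id] at t'
  rw [Iso.inv_comp_eq, ← t', ← Functor.map_comp_assoc, Iso.inv_hom_id,
    CategoryTheory.Functor.map_id, Category.id_comp]

theorem crossApp_unit (a : G) :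
    (η.crossApp a (𝟙_ M.Total)).hom ≫ (C.φ a).map (Functor.OplaxMonoidal.η η.total) ≫
        Functor.OplaxMonoidal.η (C.φ a) =
      η.total.map (Total.crossUnit a).hom ≫ Functor.OplaxMonoidal.η η.total := by
  have c := congrArg η.total.map (crossUnit_hom (M := M) (a := a) rfl (conj_one a))
  rw [Functor.map_comp] at c
  have t := η.uni_actI (inv_inv a) (conj_one a)
  have p := η.toCross_crossApp (a := a) rfl (inv_inv a) (conj_one a) M.unit
  have q : (C.φ a).map η.uni.inv ≫ Functor.OplaxMonoidal.η (C.φ a) =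
      (η.actI (inv_inv a) (conj_one a) M.unit).hom ≫
        η.total.map (Tot.of (M.unitAct a⁻¹ (conj_one a)).hom) ≫ η.uni.inv := by
    rw [← cancel_epi ((C.φ a).map η.uni.hom), ← Functor.map_comp_assoc, Iso.hom_inv_id,
      CategoryTheory.Functor.map_id, Category.id_comp, ← Category.assoc, ← Category.assoc,
      Category.assoc ((C.φ a).map η.uni.hom), t, Category.assoc, Iso.hom_inv_id, Category.comp_id]
  rw [uni_η, ← cancel_epi (η.total.map (M.ps.toCross (a := a) rfl (conj_one a) M.unit).hom)]
  refine ((reassoc_of% p) _).trans ?_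
  refine Eq.trans ?_ ((reassoc_of% c) _).symm
  rw [q, Iso.inv_hom_id_assoc]

instance crossIso_isMonoidal (a : G) : NatTrans.IsMonoidal (η.crossIso a).hom :=
  isMonoidal_of_delta _
    (((congrArg (fun r => (η.crossApp a (𝟙_ M.Total)).hom ≫ r)
      (Functor.OplaxMonoidal.comp_η η.total (C.φ a))).trans (η.crossApp_unit a)).trans
        (Functor.OplaxMonoidal.comp_η (M.ps.cross a) η.total).symm)
    fun X Y => ((congrArg (fun r => (η.crossApp a (X ⊗ Y)).hom ≫ r)
      (Functor.OplaxMonoidal.comp_δ η.total (C.φ a) X Y)).trans (η.crossApp_tensor a X Y)).trans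
        ((Category.assoc _ _ _).symm.trans (congrArg (fun r => r ≫ _)
          (Functor.OplaxMonoidal.comp_δ (M.ps.cross a) η.total X Y).symm))

theorem crossApp_one (X : M.Total) :
    η.total.map (M.ps.crossOneApp X).hom ≫ (η.crossApp 1 X).hom =
      (C.oneApp (η.total.obj X)).hom := by
  obtain ⟨d, X⟩ := X
  have e : η.actI inv_one (one_comm d) X ≪≫
      η.total.mapIso ((Tot.incl (fun a => M.ps.at_ a) d).mapIso (M.ps.actOne (one_comm d) X)) =
        (C.oneApp (η.total.obj (tot X))).symm := Iso.ext (η.actI_one (one_comm d) X)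
  have p := η.toCross_crossApp (a := 1) inv_one.symm inv_one (one_comm d) X
  rw [M.ps.crossOneApp_hom (one_comm d), Functor.map_comp, Category.assoc, p]
  exact congrArg Iso.inv e

theorem crossApp_mul {a b c : G} (h : b * a = c) (X : M.Total) :
    η.total.map (M.ps.crossMulApp h X).hom ≫ (η.crossApp c X).hom =
      (η.crossApp a ((M.ps.cross b).obj X)).hom ≫ (C.φ a).map (η.crossApp b X).hom ≫
        (C.mulApp h (η.total.obj X)).hom := by
  obtain ⟨d, X⟩ := X
  have e := congrArg η.total.map (M.ps.crossMulApp_hom h rfl rfl (cross_mul_eq h) (conj_comm b d)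
    (conj_comm a _) (conj_conj_comm a b d) X)
  simp only [Functor.map_comp] at e
  have hc : (a⁻¹ * b⁻¹)⁻¹ = c := by rw [← h]; group
  have m := η.actI_mul (inv_inv b) (inv_inv a) hc h (conj_comm b d) (conj_comm a _)
    (conj_conj_comm a b d) X
  have p := η.toCross_crossApp (cross_mul_eq h) hc (conj_conj_comm a b d) X
  have p₁ := congrArg (C.φ a).map (η.toCross_crossApp (a := b) rfl (inv_inv b) (conj_comm b d) X)
  have p₂ := η.toCross_crossApp (a := a) rfl (inv_inv a) (conj_comm a _)
    ((M.ps.act b⁻¹ (conj_comm b d)).obj X)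
  rw [Functor.map_comp] at p₁
  rw [← cancel_epi (η.total.map ((M.ps.cross a).map (M.ps.toCross (a := b) rfl (conj_comm b d) X).hom)),
    ← cancel_epi (η.total.map (M.ps.toCross (a := a) rfl (conj_comm a _)
      ((M.ps.act b⁻¹ (conj_comm b d)).obj X)).hom), reassoc_of% e, p,
      reassoc_of% η.crossApp_natural a (M.ps.toCross (a := b) rfl (conj_comm b d) X).hom,
      reassoc_of% p₂, reassoc_of% p₁]
  -- `crossApp` is the inverse of `actI`, so `m` is read as an equality of isomorphisms and its
  -- inverse is taken.
  have m' : η.actI hc (conj_conj_comm a b d) X ≪≫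
      η.total.mapIso ((Tot.incl (fun a => M.ps.at_ a) _).mapIso
        (M.ps.actMul b⁻¹ a⁻¹ (conj_comm b d) (conj_comm a _) (conj_conj_comm a b d) X)) =
      (C.mulApp h (η.total.obj (tot X))).symm ≪≫
        (C.φ a).mapIso (η.actI (inv_inv b) (conj_comm b d) X) ≪≫
          η.actI (inv_inv a) (conj_comm a _) ((M.ps.act b⁻¹ (conj_comm b d)).obj X) := Iso.ext m
  have m'' := congrArg Iso.inv m'
  simp only [Iso.trans_inv, Category.assoc] at m''
  exact m''

/-- A morphism to a monoidale of homogeneous objects, as a functor on the coproduct of the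
components. -/
def toPre : PreHom M.pre C where
  F := η.total
  monoidal := η.totalCore.toMonoidal
  additive := inferInstanceAs η.total.Additive
  linear := inferInstanceAs (η.total.Linear k)
  deg X := η.comp_ι_deg X.obj
  φIso := η.crossIso
  φIso_isMonoidal := fun a => η.crossIso_isMonoidal a
  φIso_comp := η.crossApp_mul
  φIso_id := η.crossApp_one

/-- Full faithfulness on the coproduct is full faithfulness on each component together with the
vanishing of morphisms between different components. -/
theorem toPre_isCompletion (hη : IsCompletion (C := C) η) : η.toPre.IsCompletion where
  full :=
    have : ∀ a, (η.comp_ι a).Full := hη.full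
    Tot.lift_full η.comp_ι hη.hom_eq_zero
  faithful :=
    have : ∀ a, (η.comp_ι a).Faithful := hη.faithful
    Tot.lift_faithful η.comp_ι
  exists_iso X := by
    obtain ⟨n, a, Y, h⟩ := hη.exists_iso X
    exact ⟨n, fun i => ⟨a i, Y i⟩, h⟩

end Monoidale.Hom

end HomToPre

open scoped CategoryTheory.Pseudofunctor.StrongTrans

/-! ### From a functor on the coproduct back to a 1-cell into `H C` -/

noncomputable section PreToHom

variable {G : Type u} [Group G] {k : Type w} [CommRing k]

instance Tot.of_isIso {ι : Type u} {A : ι → LinCat.{w, v, u} k} {i : ι} {X Y : A i} (f : X ⟶ Y)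
    [IsIso f] : IsIso (Tot.of (A := fun a => A a) f) :=
  inferInstanceAs (IsIso ((Tot.incl (fun a => A a) i).map f))

instance Tot.incl_full {ι : Type u} (A : ι → LinCat.{w, v, u} k) (i : ι) : (Tot.incl A i).Full where
  map_surjective {X Y} f := ⟨(show Tot.Hom (⟨i, X⟩ : Tot A) ⟨i, Y⟩ from f) ⟨rfl⟩, rfl⟩

instance Tot.incl_faithful {ι : Type u} (A : ι → LinCat.{w, v, u} k) (i : ι) :
    (Tot.incl A i).Faithful where
  map_injective {X Y f g} h := congrFun (show Tot.ofHom f = Tot.ofHom g from h) ⟨rfl⟩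

namespace PreHom

open Functor.LaxMonoidal Functor.OplaxMonoidal Functor.Monoidal Monoidale.Total Ps

variable {M : Monoidale.{w, v, u} G k} {C : CrossedCat.{w, v, u} G k} (N : PreHom M.pre C)

/-- The underlying functor, on the coproduct of the components. -/
def total : M.Total ⥤ C := N.F

instance : N.total.Monoidal := N.monoidal

instance : N.total.Additive := N.additive

instance : N.total.Linear k := N.linear

/-- The inverse of the compatibility with the crossings. -/
def totalApp (a : G) (X : M.Total) :
    (C.φ a).obj (N.total.obj X) ≅ N.total.obj ((M.ps.cross a).obj X) := (N.φApp a X).symm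

theorem totalApp_natural (a : G) {X Y : M.Total} (f : X ⟶ Y) :
    (C.φ a).map (N.total.map f) ≫ (N.totalApp a Y).hom =
      (N.totalApp a X).hom ≫ N.total.map ((M.ps.cross a).map f) :=
  (N.φIso a).inv.naturality f

theorem totalApp_mul {a b c : G} (h : b * a = c) (X : M.Total) :
    (C.φ a).map (N.totalApp b X).hom ≫ (N.totalApp a ((M.ps.cross b).obj X)).hom ≫
        N.total.map (M.ps.crossMulApp h X).hom =
      (C.mulApp h (N.total.obj X)).hom ≫ (N.totalApp c X).hom := by
  have e : N.total.map (M.ps.crossMulApp h X).hom ≫ (N.totalApp c X).inv =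
      (N.totalApp a ((M.ps.cross b).obj X)).inv ≫ (C.φ a).map (N.totalApp b X).inv ≫
        (C.mulApp h (N.total.obj X)).hom := N.φApp_mul h X
  rw [← Iso.comp_inv_eq]
  simp only [Category.assoc]
  rw [e, Iso.hom_inv_id_assoc, ← Functor.map_comp_assoc, Iso.hom_inv_id,
    CategoryTheory.Functor.map_id, Category.id_comp]

theorem totalApp_one (X : M.Total) :
    (C.oneApp (N.total.obj X)).hom ≫ (N.totalApp 1 X).hom =
      N.total.map (M.ps.crossOneApp X).hom := by
  rw [← Iso.eq_comp_inv]
  exact (N.φApp_one X).symm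

/-- Monoidality of the inverse of `φIso`, with the tensor constraint of `φ a` moved to the other
side as `δ`: the shape of the axiom `tensorIso_act`. -/
theorem totalApp_tensor (a : G) (X Y : M.Total) :
    (C.φ a).map (μ N.total X Y) ≫ (N.totalApp a (X ⊗ Y)).hom ≫
        N.total.map (crossTensor a X Y).hom =
      δ (C.φ a) (N.total.obj X) (N.total.obj Y) ≫
        ((N.totalApp a X).hom ⊗ₘ (N.totalApp a Y).hom) ≫
          μ N.total ((M.ps.cross a).obj X) ((M.ps.cross a).obj Y) := by
  have e : (μ (C.φ a) (N.total.obj X) (N.total.obj Y) ≫ (C.φ a).map (μ N.total X Y)) ≫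
      (N.totalApp a (X ⊗ Y)).hom = ((N.totalApp a X).hom ⊗ₘ (N.totalApp a Y).hom) ≫
        μ N.total ((M.ps.cross a).obj X) ((M.ps.cross a).obj Y) ≫
          N.total.map (crossTensor a X Y).inv := by
    exact ((congrArg (fun r => r ≫ (N.φIso a).inv.app (X ⊗ Y))
      (comp_μ N.F (C.φ a) X Y)).symm.trans
        (NatTrans.IsMonoidal.tensor (τ := (N.φIso a).inv) X Y)).trans
          (congrArg (fun r => ((N.φIso a).inv.app X ⊗ₘ (N.φIso a).inv.app Y) ≫ r)
            (comp_μ (M.ps.cross a) N.total X Y))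
  rw [← cancel_epi (μ (C.φ a) (N.total.obj X) (N.total.obj Y)), μ_δ_assoc, ← Category.assoc,
    ← Category.assoc, e, Category.assoc, Category.assoc, ← Functor.map_comp, Iso.inv_hom_id, CategoryTheory.Functor.map_id,
    Category.comp_id]

theorem totalApp_unit (a : G) :
    (C.φ a).map (ε N.total) ≫ (N.totalApp a (𝟙_ M.Total)).hom ≫
        N.total.map (crossUnit a).hom = η (C.φ a) ≫ ε N.total := by
  have e : (ε (C.φ a) ≫ (C.φ a).map (ε N.total)) ≫ (N.totalApp a (𝟙_ M.Total)).hom =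
      ε N.total ≫ N.total.map (crossUnit a).inv := by
    have e := NatTrans.IsMonoidal.unit (τ := (N.φIso a).inv)
    rw [comp_ε, comp_ε] at e
    exact e
  rw [← cancel_epi (ε (C.φ a)), ← Category.assoc, ← Category.assoc, e, ε_η_assoc, Category.assoc,
    ← Functor.map_comp, Iso.inv_hom_id, CategoryTheory.Functor.map_id, Category.comp_id]

/-- The constraint for the action. -/
def actC {g e : G} (hg : g = e⁻¹) {a a' : G} (h : g * a = a' * g) (X : M.ps.at_ a) :
    (C.φ e).obj (N.total.obj (tot X)) ≅ N.total.obj (tot ((M.ps.act g h).obj X)) :=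
  N.totalApp e (tot X) ≪≫ N.total.mapIso (M.ps.toCross hg h X).symm

/-- The identities for `actC` are obtained by composing with the comparison, which removes it from
the definition and leaves identities for the crossing on the coproduct. -/
theorem actC_toCross {g e : G} (hg : g = e⁻¹) {a a' : G} (h : g * a = a' * g) (X : M.ps.at_ a) :
    (N.actC hg h X).hom ≫ N.total.map (M.ps.toCross hg h X).hom = (N.totalApp e (tot X)).hom := by
  change ((N.totalApp e (tot X)).hom ≫ N.total.map (M.ps.toCross hg h X).inv) ≫ _ = _
  rw [Category.assoc, ← Functor.map_comp, Iso.inv_hom_id, CategoryTheory.Functor.map_id,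
    Category.comp_id]

theorem actC_natural {g e : G} (hg : g = e⁻¹) {a a' : G} (h : g * a = a' * g) {X Y : M.ps.at_ a}
    (f : X ⟶ Y) :
    (N.actC hg h X).hom ≫ N.total.map (Tot.of ((M.ps.act g h).map f)) =
      (C.φ e).map (N.total.map (Tot.of f)) ≫ (N.actC hg h Y).hom := by
  rw [← cancel_mono (N.total.map (M.ps.toCross hg h Y).hom), Category.assoc, Category.assoc,
    actC_toCross, totalApp_natural, ← Functor.map_comp, ← toCross_natural, Functor.map_comp,
    reassoc_of% N.actC_toCross]

theorem actC_one {e : G} (hg : 1 = e⁻¹) (he : e = 1) {a : G} (h : 1 * a = a * 1) (X : M.ps.at_ a) :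
    (N.actC hg h X).hom ≫ N.total.map (Tot.of (M.ps.actOne h X).hom) =
      (C.φId' he).inv.app (N.total.obj (tot X)) := by
  subst he
  have e₁ := N.totalApp_one (tot X)
  have e₂ := M.ps.crossOneApp_hom h X
  have e₃ : (C.φId' rfl).inv.app (N.total.obj (tot X)) = (C.oneApp (N.total.obj (tot X))).inv :=
    Category.id_comp _
  refine Eq.trans ?_ e₃.symm
  rw [← cancel_epi (C.oneApp (N.total.obj (tot X))).hom, Iso.hom_inv_id, ← cancel_mono (N.total.map (Tot.of (M.ps.actOne h X).inv)),
    ← cancel_mono (N.total.map (M.ps.toCross hg h X).hom)]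
  simp only [Category.assoc]
  rw [← Functor.map_comp_assoc N.total (Tot.of _), ← Tot.of_comp, Iso.hom_inv_id, Tot.of_id,
    CategoryTheory.Functor.map_id, Category.id_comp, actC_toCross, Category.id_comp, e₁, e₂,
    Functor.map_comp]

theorem actC_mul {g g' e e' e'' : G} (hg : g = e⁻¹) (hg' : g' = e'⁻¹) (hg'' : g' * g = e''⁻¹)
    (he : e * e' = e'') {a a' a'' : G} (h : g * a = a' * g) (h' : g' * a' = a'' * g')
    (h'' : g' * g * a = a'' * (g' * g)) (X : M.ps.at_ a) :
    (N.actC hg'' h'' X).hom ≫ N.total.map (Tot.of (M.ps.actMul g g' h h' h'' X).hom) =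
      (C.mulApp he (N.total.obj (tot X))).inv ≫ (C.φ e').map (N.actC hg h X).hom ≫
        (N.actC hg' h' ((M.ps.act g h).obj X)).hom := by
  have e₁ := N.totalApp_mul he (tot X)
  have e₂ := M.ps.crossMulApp_hom he hg hg' hg'' h h' h'' X
  have e₃ := congrArg (C.φ e').map (N.actC_toCross hg h X)
  rw [Functor.map_comp] at e₃
  rw [Iso.eq_inv_comp, ← cancel_mono (N.total.map (Tot.of (M.ps.actMul g g' h h' h'' X).inv)),
    ← cancel_mono (N.total.map (M.ps.toCross hg'' h'' X).hom)]
  simp only [Category.assoc]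
  rw [← Functor.map_comp_assoc N.total (Tot.of _), ← Tot.of_comp, Iso.hom_inv_id, Tot.of_id,
    CategoryTheory.Functor.map_id, Category.id_comp, actC_toCross, ← e₁,
    ← Functor.map_comp, ← e₂, Functor.map_comp, Functor.map_comp, reassoc_of% N.actC_toCross hg',
    ← reassoc_of% N.totalApp_natural, reassoc_of% e₃]

/-- The tensor constraint. -/
def tenC {a b c : G} (h : a * b = c) (X : M.ps.at_ a) (Y : M.ps.at_ b) :
    N.total.obj (tot X) ⊗ N.total.obj (tot Y) ≅ N.total.obj (tot ((M.tensor h).obj X Y)) :=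
  μIso N.total (tot X) (tot Y) ≪≫ N.total.mapIso (tensI h X Y).symm

theorem tenC_tensI {a b c : G} (h : a * b = c) (X : M.ps.at_ a) (Y : M.ps.at_ b) :
    (N.tenC h X Y).hom ≫ N.total.map (tensI h X Y).hom = μ N.total (tot X) (tot Y) := by
  change (μ N.total (tot X) (tot Y) ≫ N.total.map (tensI h X Y).inv) ≫ _ = _
  rw [Category.assoc, ← Functor.map_comp, Iso.inv_hom_id, CategoryTheory.Functor.map_id,
    Category.comp_id]

theorem tenC_natural {a b c : G} (h : a * b = c) {X X' : M.ps.at_ a} {Y Y' : M.ps.at_ b}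
    (x : X ⟶ X') (y : Y ⟶ Y') :
    (N.total.map (Tot.of x) ⊗ₘ N.total.map (Tot.of y)) ≫ (N.tenC h X' Y').hom =
      (N.tenC h X Y).hom ≫ N.total.map (Tot.of ((M.tensor h).map x y)) := by
  rw [← cancel_mono (N.total.map (tensI h X' Y').hom), Category.assoc, Category.assoc,
    tenC_tensI, ← Functor.map_comp, ← tensI_natural, Functor.map_comp, reassoc_of% N.tenC_tensI,
    μ_natural]

/-- After composing with the comparisons at the target, `crossTensor_hom` converts `tensorAct` into
the monoidal constraint of the crossing, and the claim becomes `totalApp_tensor`. -/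
theorem tenC_act {g e : G} (hg : g = e⁻¹) {a b c a' b' c' : G} (h : a * b = c) (h' : a' * b' = c')
    (ha : g * a = a' * g) (hb : g * b = b' * g) (hc : g * c = c' * g)
    (X : M.ps.at_ a) (Y : M.ps.at_ b) :
    (C.φ e).map (N.tenC h X Y).hom ≫ (N.actC hg hc ((M.tensor h).obj X Y)).hom ≫
        N.total.map (Tot.of (M.tensorAct g h h' ha hb hc X Y).hom) =
      δ (C.φ e) (N.total.obj (tot X)) (N.total.obj (tot Y)) ≫
        ((N.actC hg ha X).hom ⊗ₘ (N.actC hg hb Y).hom) ≫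
          (N.tenC h' ((M.ps.act g ha).obj X) ((M.ps.act g hb).obj Y)).hom := by
  have c := crossTensor_hom (M := M) hg h h' ha hb hc X Y
  have m := N.totalApp_tensor e (tot X) (tot Y)
  have t := congrArg (C.φ e).map (N.tenC_tensI h X Y)
  rw [Functor.map_comp] at t
  rw [← cancel_mono (N.total.map (tensI h' ((M.ps.act g ha).obj X) ((M.ps.act g hb).obj Y)).hom),
    ← cancel_mono (N.total.map ((M.ps.toCross hg ha X).hom ⊗ₘ (M.ps.toCross hg hb Y).hom))]
  simp only [Category.assoc]
  rw [reassoc_of% N.tenC_tensI h', ← Functor.map_comp, ← Functor.map_comp, ← c, Functor.map_comp,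
    Functor.map_comp, reassoc_of% N.actC_toCross, ← reassoc_of% N.totalApp_natural,
    reassoc_of% t, m, ← μ_natural, tensorHom_comp_tensorHom_assoc, actC_toCross, actC_toCross]

theorem uniC_act {g e : G} (hg : g = e⁻¹) (h : g * 1 = 1 * g) :
    (C.φ e).map (ε N.total) ≫ (N.actC hg h M.unit).hom ≫
        N.total.map (Tot.of (M.unitAct g h).hom) = η (C.φ e) ≫ ε N.total := by
  rw [← crossUnit_hom hg h, Functor.map_comp, reassoc_of% N.actC_toCross]
  exact N.totalApp_unit e

theorem tenC_assoc {a b c ab bc abc : G} (h₁ : a * b = ab) (h₂ : ab * c = abc) (h₃ : b * c = bc)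
    (h₄ : a * bc = abc) (X : M.ps.at_ a) (Y : M.ps.at_ b) (Z : M.ps.at_ c) :
    ((N.tenC h₁ X Y).hom ⊗ₘ 𝟙 (N.total.obj (tot Z))) ≫ (N.tenC h₂ ((M.tensor h₁).obj X Y) Z).hom ≫
        N.total.map (Tot.of (M.assoc h₁ h₂ h₃ h₄ X Y Z).hom) =
      (α_ (N.total.obj (tot X)) (N.total.obj (tot Y)) (N.total.obj (tot Z))).hom ≫
        (𝟙 (N.total.obj (tot X)) ⊗ₘ (N.tenC h₃ Y Z).hom) ≫
          (N.tenC h₄ X ((M.tensor h₃).obj Y Z)).hom := by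
  have e := congrArg N.total.map (tensI_assoc h₁ h₂ h₃ h₄ X Y Z)
  have l := μ_natural N.total (tensI h₁ X Y).hom (𝟙 (tot Z))
  have r := μ_natural N.total (𝟙 (tot X)) (tensI h₃ Y Z).hom
  have m := Functor.LaxMonoidal.associativity N.total (tot X) (tot Y) (tot Z)
  simp only [Functor.map_comp, CategoryTheory.Functor.map_id] at e l r
  rw [← tensorHom_id, ← id_tensorHom] at m
  rw [← cancel_mono (N.total.map (tensI h₄ X ((M.tensor h₃).obj Y Z)).hom),
    ← cancel_mono (N.total.map (𝟙 (tot X) ⊗ₘ (tensI h₃ Y Z).hom))]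
  simp only [Category.assoc]
  rw [e, reassoc_of% N.tenC_tensI h₂, reassoc_of% N.tenC_tensI h₄, ← reassoc_of% l,
    ← r, tensorHom_comp_tensorHom_assoc, tensorHom_comp_tensorHom_assoc, tenC_tensI, tenC_tensI,
    Category.comp_id, Category.comp_id, m]

theorem tenC_left {a : G} (h : 1 * a = a) (X : M.ps.at_ a) :
    (λ_ (N.total.obj (tot X))).hom = (ε N.total ⊗ₘ 𝟙 (N.total.obj (tot X))) ≫
      (N.tenC h M.unit X).hom ≫ N.total.map (Tot.of (M.left h X).hom) := by
  rw [← tensI_left, Functor.map_comp, reassoc_of% N.tenC_tensI, tensorHom_id]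
  exact Functor.LaxMonoidal.left_unitality N.total (tot X)

theorem tenC_right {a : G} (h : a * 1 = a) (X : M.ps.at_ a) :
    (ρ_ (N.total.obj (tot X))).hom = (𝟙 (N.total.obj (tot X)) ⊗ₘ ε N.total) ≫
      (N.tenC h X M.unit).hom ≫ N.total.map (Tot.of (M.right h X).hom) := by
  rw [← tensI_right, Functor.map_comp, reassoc_of% N.tenC_tensI, id_tensorHom]
  exact Functor.LaxMonoidal.right_unitality N.total (tot X)

/-- The components. -/
def homogApp (a : G) : M.ps.at_ a ⟶ C.homogCat a where
  toFunctor := (C.deg a).lift (Tot.incl (fun a => M.ps.at_ a) a ⋙ N.total) fun X => N.deg (tot X)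
  additive := ⟨fun {X Y f g} => ObjectProperty.hom_ext _
    ((Tot.incl (fun a => M.ps.at_ a) a ⋙ N.total).map_add (f := f) (g := g))⟩
  linear := ⟨fun {X Y} f r => ObjectProperty.hom_ext _
    ((Tot.incl (fun a => M.ps.at_ a) a ⋙ N.total).map_smul r f)⟩

/-- The pseudonatural transformation to the homogeneous parts. -/
def homData : HomData M.ps C.homogPs where
  fn := N.homogApp
  act g a a' h X := ObjectProperty.isoMk _ (N.actC (inv_inv g).symm h X)
  natural g a a' h X Y f := ObjectProperty.hom_ext _ (N.actC_natural (inv_inv g).symm h f)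
  one h X := ObjectProperty.hom_ext _ (N.actC_one (inv_inv 1).symm inv_one h X)
  mul g g' a a' a'' h h' h'' X := ObjectProperty.hom_ext _
    (N.actC_mul (inv_inv g).symm (inv_inv g').symm (inv_inv (g' * g)).symm
      (mul_inv_rev g' g).symm h h' h'' X)

/-- The morphism to the monoidale of homogeneous objects. -/
def toHom : Monoidale.Hom M C.homog where
  F := N.homData.hom
  tensorIso h X Y := ObjectProperty.isoMk _ (N.tenC h X Y)
  tensorIso_natural h _ _ _ _ x y := ObjectProperty.hom_ext _ (N.tenC_natural h x y)
  tensorIso_act g _ _ _ _ _ _ h h' ha hb hc X Y :=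
    ObjectProperty.hom_ext _ (N.tenC_act (inv_inv g).symm h h' ha hb hc X Y)
  unitIso := ObjectProperty.isoMk _ (εIso N.total)
  unitIso_act g h := ObjectProperty.hom_ext _ (N.uniC_act (inv_inv g).symm h)
  assoc h₁ h₂ h₃ h₄ X Y Z := ObjectProperty.hom_ext _ (N.tenC_assoc h₁ h₂ h₃ h₄ X Y Z)
  left h X := ObjectProperty.hom_ext _ (N.tenC_left h X)
  right h X := ObjectProperty.hom_ext _ (N.tenC_right h X)

theorem IsCompletion.toHom (hN : N.IsCompletion) : Monoidale.IsCompletion (C := C) N.toHom :=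
  have : N.total.Full := hN.full
  have : N.total.Faithful := hN.faithful
  { full := fun a => inferInstanceAs (Tot.incl (fun a => M.ps.at_ a) a ⋙ N.total).Full
    faithful := fun a => inferInstanceAs (Tot.incl (fun a => M.ps.at_ a) a ⋙ N.total).Faithful
    hom_eq_zero := fun h X Y f => C.hom_eq_zero h (N.deg (tot X)) (N.deg (tot Y)) f
    exists_iso := fun X => by
      obtain ⟨n, Y, h⟩ := hN.exists_iso X
      exact ⟨n, fun i => Tot.deg (Y i), fun i => Tot.obj (Y i), h⟩ }

end PreHom

/-- Every monoidale has a completion. -/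
theorem Monoidale.exists_isCompletion (M : Monoidale.{w, v, u} G k) :
    ∃ (C : CrossedCat.{w, v, u} G k) (η : M ⟶ (CrossedCat.homogFunctor G k).obj C),
      IsCompletion η :=
  ⟨Sums.crossedCat M.pre, (Sums.incl M.pre).toHom,
    PreHom.IsCompletion.toHom _ (Sums.incl_isCompletion M.pre)⟩

end PreToHom

open scoped CategoryTheory.Pseudofunctor.StrongTrans

/-! ### Precomposition with a completion -/

noncomputable section Precomposition

variable {G : Type u} [Group G] {k : Type w} [CommRing k]

namespace Monoidale.Hom

open Functor.LaxMonoidal Functor.OplaxMonoidal Functor.Monoidal Monoidale.Total Ps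

variable {M : Monoidale.{w, v, u} G k} {C D : CrossedCat.{w, v, u} G k} (η : Hom M C.homog)

/-- The composite of a morphism to a monoidale of homogeneous objects with the morphism induced by a
morphism of `G`-crossed categories. -/
abbrev compHomog (F : CrossedCat.Hom C D) : Hom M D.homog := Hom.comp η (CrossedCat.homogHom F)

section Full

variable {η} {F F' : CrossedCat.Hom C D} (r : Hom₂ (η.compHomog F) (η.compHomog F'))

/-- The components of a 2-cell. -/
def appC {a : G} (X : M.ps.at_ a) :
    F.F.obj (η.total.obj (tot X)) ⟶ F'.F.obj (η.total.obj (tot X)) :=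
  (D.deg a).ι.map (app₂ r.t X)

theorem appC_natural {a : G} {X Y : M.ps.at_ a} (f : X ⟶ Y) :
    F.F.map (η.total.map (Tot.of f)) ≫ appC r Y = appC r X ≫ F'.F.map (η.total.map (Tot.of f)) := by
  simp only [total_map_of]
  exact congrArg (fun r => (D.deg a).ι.map r) (app₂_natural r.t f)

/-- The modification axiom of `r`, in which the constraints of the two composites are expanded by
`appAct_comp` and read in the ambient category. -/
theorem appC_act {e g : G} (hg : g⁻¹ = e) {a a' : G} (h : g * a = a' * g) (X : M.ps.at_ a) :
    (D.φ e).map (appC r X) ≫ (F'.φApp e (η.total.obj (tot X))).inv ≫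
        F'.F.map (η.actI hg h X).hom =
      (F.φApp e (η.total.obj (tot X))).inv ≫ F.F.map (η.actI hg h X).hom ≫
        appC r ((M.ps.act g h).obj X) := by
  subst hg
  have e := app₂_act r.t g h X
  have e₁ := appAct_comp η.F (CrossedCat.homogTrans F) g h X
  have e₂ := appAct_comp η.F (CrossedCat.homogTrans F') g h X
  have e₃ := ((congrArg (fun s => (D.homogPs.act g h).map (app₂ r.t X) ≫ s) e₂).symm.trans e).trans
    (congrArg (fun s => s ≫ app₂ r.t ((M.ps.act g h).obj X)) e₁)
  have e₄ := congrArg (fun r => (D.deg a').ι.map r) e₃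
  rw [actI_rfl, ← Category.assoc (F.φApp _ _).inv]
  exact e₄

/-- The same condition with the constraints inverted, as demanded by `PreHom.Restricted₂`, since
`crossApp` is the inverse of `actI`. -/
theorem appC_act_inv {e g : G} (hg : g⁻¹ = e) {a a' : G} (h : g * a = a' * g) (X : M.ps.at_ a) :
    appC r ((M.ps.act g h).obj X) ≫ F'.F.map (η.actI hg h X).inv ≫
        (F'.φApp e (η.total.obj (tot X))).hom =
      F.F.map (η.actI hg h X).inv ≫ (F.φApp e (η.total.obj (tot X))).hom ≫
        (D.φ e).map (appC r X) := by
  rw [← cancel_epi (F.F.map (η.actI hg h X).hom), ← cancel_epi (F.φApp e (η.total.obj (tot X))).inv,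
    ← reassoc_of% appC_act r hg h X, ← Functor.map_comp_assoc, Iso.hom_inv_id,
    CategoryTheory.Functor.map_id, Category.id_comp, Iso.inv_hom_id, Category.comp_id,
    ← Functor.map_comp_assoc, Iso.hom_inv_id, CategoryTheory.Functor.map_id, Category.id_comp,
    Iso.inv_hom_id_assoc]

theorem appC_tensor {a b c : G} (h : a * b = c) (X : M.ps.at_ a) (Y : M.ps.at_ b) :
    (μ F.F (η.total.obj (tot X)) (η.total.obj (tot Y)) ≫ F.F.map (η.ten h X Y).hom) ≫
        appC r ((M.tensor h).obj X Y) =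
      (appC r X ⊗ₘ appC r Y) ≫
        μ F'.F (η.total.obj (tot X)) (η.total.obj (tot Y)) ≫ F'.F.map (η.ten h X Y).hom :=
  congrArg (fun r => (D.deg c).ι.map r) (r.tensor h X Y)

theorem appC_unit :
    (ε F.F ≫ F.F.map η.uni.hom) ≫ appC r M.unit = ε F'.F ≫ F'.F.map η.uni.hom :=
  congrArg (fun r => (D.deg 1).ι.map r) r.unit

/-- The transformation on the coproduct. -/
def natC : η.total ⋙ F.F ⟶ η.total ⋙ F'.F :=
  Tot.natMk (fun X => appC r X.obj) fun f => appC_natural r f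

instance natC_isMonoidal : NatTrans.IsMonoidal (natC r) where
  unit := by
    rw [comp_ε, comp_ε]
    exact appC_unit r
  tensor X Y := by
    rw [comp_μ, comp_μ]
    exact appC_tensor r rfl X.obj Y.obj

/-- The transformation of functors on the coproduct given by a 2-cell. -/
def restricted₂ : PreHom.Restricted₂ η.toPre F F' where
  t := natC r
  isMonoidal := natC_isMonoidal r
  φ a W := by
    obtain ⟨d, X⟩ := W
    exact appC_act_inv r (inv_inv a) (conj_comm a d) X

end Full

section Surjective

variable {η} {N : Hom M D.homog} (hJ : η.toPre.IsCompletion) (P : PreHom.Ext η.toPre N.toPre)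

/-- The components of the comparison isomorphism. -/
def extApp {a : G} (X : M.ps.at_ a) : P.F.obj (η.total.obj (tot X)) ≅ N.total.obj (tot X) :=
  P.app (tot X)

/-- The components of the comparison isomorphism, on the coproduct. -/
def extTot (X : M.Total) : P.F.obj (η.total.obj X) ≅ N.total.obj X := P.app X

theorem extApp_natural {a : G} {X Y : M.ps.at_ a} (f : X ⟶ Y) :
    P.F.map (η.total.map (Tot.of f)) ≫ (extApp P Y).hom =
      (extApp P X).hom ≫ N.total.map (Tot.of f) := P.app_natural (Tot.of f)

/-- The extension is compatible with the crossing by `g⁻¹` on the coproduct (`φApp_app`).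
Restricting along the comparison `toCross` turns the crossing into the action of `g`, for both `η`
and `N`. -/
theorem extApp_act (g : G) {a a' : G} (h : g * a = a' * g) (X : M.ps.at_ a) :
    (D.φ g⁻¹).map (extApp P X).hom ≫ (N.ac g h X).hom =
      ((P.φApp hJ g⁻¹ (η.total.obj (tot X))).inv ≫ P.F.map (η.ac g h X).hom) ≫
        (extApp P ((M.ps.act g h).obj X)).hom := by
  have e : P.F.map (η.crossApp g⁻¹ (tot X)).hom ≫ (P.φApp hJ g⁻¹ (η.total.obj (tot X))).hom ≫
        (D.φ g⁻¹).map (extApp P X).hom =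
      (extTot P ((M.ps.cross g⁻¹).obj (tot X))).hom ≫ (N.crossApp g⁻¹ (tot X)).hom :=
    P.φApp_app hJ g⁻¹ (tot X)
  have n : P.F.map (η.total.map (M.ps.toCross (inv_inv g).symm h X).hom) ≫
        (extTot P ((M.ps.cross g⁻¹).obj (tot X))).hom =
      (extApp P ((M.ps.act g h).obj X)).hom ≫
        N.total.map (M.ps.toCross (inv_inv g).symm h X).hom :=
    P.app_natural (M.ps.toCross (inv_inv g).symm h X).hom
  have p := congrArg P.F.map (η.toCross_crossApp (inv_inv g).symm rfl h X)
  have q := N.toCross_crossApp (inv_inv g).symm rfl h X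
  rw [Functor.map_comp, actI_rfl] at p
  rw [actI_rfl] at q
  have e' := P.F.map (η.total.map (M.ps.toCross (inv_inv g).symm h X).hom) ≫= e
  rw [reassoc_of% p, reassoc_of% n, q] at e'
  rw [← cancel_epi (P.φApp hJ g⁻¹ (η.total.obj (tot X))).hom,
    ← cancel_epi (P.F.map (η.ac g h X).inv)]
  simp only [Category.assoc]
  rw [reassoc_of% e', Iso.inv_hom_id, Category.comp_id, Iso.hom_inv_id_assoc,
    ← Functor.map_comp_assoc, Iso.inv_hom_id, CategoryTheory.Functor.map_id, Category.id_comp]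

theorem extApp_tensor {a b c : G} (h : a * b = c) (X : M.ps.at_ a) (Y : M.ps.at_ b) :
    (μ P.F (η.total.obj (tot X)) (η.total.obj (tot Y)) ≫ P.F.map (η.ten h X Y).hom) ≫
        (extApp P ((M.tensor h).obj X Y)).hom =
      ((extApp P X).hom ⊗ₘ (extApp P Y).hom) ≫ (N.ten h X Y).hom := by
  subst h
  exact ((congrArg (fun r => r ≫ (extApp P ((M.tensor rfl).obj X Y)).hom)
      (comp_μ η.total P.F (tot X) (tot Y))).symm.trans
        (NatTrans.IsMonoidal.tensor (τ := P.iso.hom) (tot X) (tot Y)))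

theorem extApp_unit :
    (ε P.F ≫ P.F.map η.uni.hom) ≫ (extApp P M.unit).hom = N.uni.hom :=
  (congrArg (fun r => r ≫ (extApp P M.unit).hom) (comp_ε η.total P.F)).symm.trans
    (NatTrans.IsMonoidal.unit (τ := P.iso.hom))

/-- The comparison isomorphism. -/
def extIso : (show M ⟶ D.homog from η.compHomog (P.hom hJ)) ≅ (show M ⟶ D.homog from N) :=
  Monoidale.isoMk
    (Ps.isoMk (S := M.ps) (T := D.homogPs) (F := (η.compHomog (P.hom hJ)).F) (F' := N.F)
      (fun X => ObjectProperty.isoMk _ (extApp P X))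
      (fun {a X Y} f => ObjectProperty.hom_ext _ (by
        have e := extApp_natural P f
        rw [total_map_of, total_map_of] at e
        exact e))
      (fun g a a' h X => by
        refine ObjectProperty.hom_ext _ ((extApp_act hJ P g h X).trans ?_)
        have e₁ := appAct_comp η.F (CrossedCat.homogTrans (P.hom hJ)) g h X
        exact (congrArg (fun r => (D.deg a').ι.map r ≫ (extApp P ((M.ps.act g h).obj X)).hom) e₁).symm))
    (fun h X Y => ObjectProperty.hom_ext _ (extApp_tensor P h X Y))
    (ObjectProperty.hom_ext _ (extApp_unit P))

end Surjective

end Monoidale.Hom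

open Monoidale in
/-- Precomposition with a completion is an equivalence. -/
theorem Monoidale.IsCompletion.isEquivalence {M : Monoidale.{w, v, u} G k}
    {C : CrossedCat.{w, v, u} G k} {η : M ⟶ (CrossedCat.homogFunctor G k).obj C}
    (hη : Monoidale.IsCompletion η) (D : CrossedCat.{w, v, u} G k) :
    ((CrossedCat.homogFunctor G k).mapFunctor C D ⋙
      Bicategory.precomp ((CrossedCat.homogFunctor G k).obj D) η).IsEquivalence :=
  have hJ := Monoidale.Hom.toPre_isCompletion (M := M) (C := C) η hη
  -- A 2-cell is determined by its values on the generators, and these are the components of its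
  -- image.
  { faithful := ⟨fun {F F' s t} h => hJ.hom₂_ext s t fun W =>
      congrArg (fun r : Monoidale.Hom₂ (Monoidale.Hom.compHomog (M := M) (C := C) η F)
        (Monoidale.Hom.compHomog (M := M) (C := C) η F') => Monoidale.Hom.appC r (Tot.obj W)) h⟩
    full := ⟨fun {F F'} r => ⟨(Monoidale.Hom.restricted₂ (η := η) (F := F) (F' := F') r).extend hJ,
      Monoidale.hom₂_ext (Pseudofunctor.StrongTrans.homCategory.ext fun x =>
        LinCat.hom₂_ext fun X => ObjectProperty.hom_ext _
          (PreHom.Restricted₂.extend_app hJ (Monoidale.Hom.restricted₂ (η := η) (F := F) (F' := F') r)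
            (Monoidale.Total.tot X)))⟩⟩
    -- The functor on the coproduct induced by `N` is extended along `η`; the comparison on
    -- generators is compatible with all constraints, hence an invertible 2-cell.
    essSurj := ⟨fun N => by
      obtain ⟨P⟩ := hJ.exists_ext (N := Monoidale.Hom.toPre N)
      exact ⟨P.hom hJ, ⟨Monoidale.Hom.extIso hJ P⟩⟩⟩ }

end Precomposition

open scoped CategoryTheory.Pseudofunctor.StrongTrans

/-! ### 1-cells whose components are equivalences -/

noncomputable section ComponentwiseEquivalence

variable {G : Type u} [Group G] {k : Type w} [CommRing k]

namespace Ps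

variable {S T : Ps.{w, v, u} G k} (F : S ⟶ T)

/-- The constraints of the inverse 1-cell are built from the inverses of those of the given one, so
the axioms are needed in inverted form, here and in the lemmas up to `right_inv`. -/
theorem appAct_inv_natural (g : G) {a a' : G} (h : g * a = a' * g) {X Y : S.at_ a} (f : X ⟶ Y) :
    (app F a').map ((S.act g h).map f) ≫ (appAct F g h Y).inv =
      (appAct F g h X).inv ≫ (T.act g h).map ((app F a).map f) := by
  rw [Iso.comp_inv_eq, Category.assoc, ← appAct_natural, Iso.inv_hom_id_assoc]

theorem appAct_inv_one {a : G} (h : 1 * a = a * 1) (X : S.at_ a) :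
    (appAct F 1 h X).inv ≫ (T.actOne h ((app F a).obj X)).hom =
      (app F a).map (S.actOne h X).hom := by
  rw [← appAct_one, Iso.inv_hom_id_assoc]

theorem appAct_inv_mul (g g' : G) {a a' a'' : G} (h : g * a = a' * g)
    (h' : g' * a' = a'' * g') (h'' : g' * g * a = a'' * (g' * g)) (X : S.at_ a) :
    (appAct F (g' * g) h'' X).inv ≫ (T.actMul g g' h h' h'' ((app F a).obj X)).hom =
      (app F a'').map (S.actMul g g' h h' h'' X).hom ≫
        (appAct F g' h' ((S.act g h).obj X)).inv ≫ (T.act g' h').map (appAct F g h X).inv := by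
  rw [Iso.inv_comp_eq, reassoc_of% appAct_mul, Iso.hom_inv_id_assoc, ← Functor.map_comp,
    Iso.hom_inv_id, CategoryTheory.Functor.map_id, Category.comp_id]

end Ps

namespace Monoidale.Hom

open Ps

variable {M N : Monoidale.{w, v, u} G k} (η : Hom M N)

theorem tensorIso_inv_natural {a b c : G} (h : a * b = c) {X X' : M.ps.at_ a} {Y Y' : M.ps.at_ b}
    (x : X ⟶ X') (y : Y ⟶ Y') :
    (app η.F c).map ((M.tensor h).map x y) ≫ (η.tensorIso h X' Y').inv =
      (η.tensorIso h X Y).inv ≫ (N.tensor h).map ((app η.F a).map x) ((app η.F b).map y) := by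
  rw [Iso.comp_inv_eq, Category.assoc, η.tensorIso_natural, Iso.inv_hom_id_assoc]

theorem tensorIso_inv_act (g : G) {a b c a' b' c' : G} (h : a * b = c) (h' : a' * b' = c')
    (ha : g * a = a' * g) (hb : g * b = b' * g) (hc : g * c = c' * g)
    (X : M.ps.at_ a) (Y : M.ps.at_ b) :
    (appAct η.F g hc ((M.tensor h).obj X Y)).inv ≫ (N.ps.act g hc).map (η.tensorIso h X Y).inv ≫
        (N.tensorAct g h h' ha hb hc ((app η.F a).obj X) ((app η.F b).obj Y)).hom =
      (app η.F c').map (M.tensorAct g h h' ha hb hc X Y).hom ≫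
        (η.tensorIso h' ((M.ps.act g ha).obj X) ((M.ps.act g hb).obj Y)).inv ≫
          (N.tensor h').map (appAct η.F g ha X).inv (appAct η.F g hb Y).inv := by
  have e : (N.tensor h').map (appAct η.F g ha X).hom (appAct η.F g hb Y).hom ≫
      (N.tensor h').map (appAct η.F g ha X).inv (appAct η.F g hb Y).inv = 𝟙 _ :=
    ((N.tensor h').mapIso (appAct η.F g ha X) (appAct η.F g hb Y)).hom_inv_id
  rw [Iso.inv_comp_eq, ← cancel_epi ((N.ps.act g hc).map (η.tensorIso h X Y).hom),
    ← Functor.map_comp_assoc, Iso.hom_inv_id, CategoryTheory.Functor.map_id, Category.id_comp,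
    reassoc_of% η.tensorIso_act g h h' ha hb hc X Y, Iso.hom_inv_id_assoc, e, Category.comp_id]

theorem unitIso_inv_act (g : G) (h : g * 1 = 1 * g) :
    (appAct η.F g h M.unit).inv ≫ (N.ps.act g h).map η.unitIso.inv ≫ (N.unitAct g h).hom =
      (app η.F 1).map (M.unitAct g h).hom ≫ η.unitIso.inv := by
  rw [Iso.inv_comp_eq, ← cancel_epi ((N.ps.act g h).map η.unitIso.hom),
    ← Functor.map_comp_assoc, Iso.hom_inv_id, CategoryTheory.Functor.map_id, Category.id_comp,
    reassoc_of% η.unitIso_act g h, Iso.hom_inv_id, Category.comp_id]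

theorem assoc_inv {a b c ab bc abc : G} (h₁ : a * b = ab) (h₂ : ab * c = abc) (h₃ : b * c = bc)
    (h₄ : a * bc = abc) (X : M.ps.at_ a) (Y : M.ps.at_ b) (Z : M.ps.at_ c) :
    (η.tensorIso h₂ ((M.tensor h₁).obj X Y) Z).inv ≫
        (N.tensor h₂).map (η.tensorIso h₁ X Y).inv (𝟙 ((app η.F c).obj Z)) ≫
          (N.assoc h₁ h₂ h₃ h₄ ((app η.F a).obj X) ((app η.F b).obj Y) ((app η.F c).obj Z)).hom =
      (app η.F abc).map (M.assoc h₁ h₂ h₃ h₄ X Y Z).hom ≫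
        (η.tensorIso h₄ X ((M.tensor h₃).obj Y Z)).inv ≫
          (N.tensor h₄).map (𝟙 ((app η.F a).obj X)) (η.tensorIso h₃ Y Z).inv := by
  have e₁ : (N.tensor h₂).map (η.tensorIso h₁ X Y).hom (𝟙 ((app η.F c).obj Z)) ≫
      (N.tensor h₂).map (η.tensorIso h₁ X Y).inv (𝟙 ((app η.F c).obj Z)) = 𝟙 _ :=
    ((N.tensor h₂).mapIso (η.tensorIso h₁ X Y) (Iso.refl ((app η.F c).obj Z))).hom_inv_id
  have e₂ : (N.tensor h₄).map (𝟙 ((app η.F a).obj X)) (η.tensorIso h₃ Y Z).hom ≫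
      (N.tensor h₄).map (𝟙 ((app η.F a).obj X)) (η.tensorIso h₃ Y Z).inv = 𝟙 _ :=
    ((N.tensor h₄).mapIso (Iso.refl ((app η.F a).obj X)) (η.tensorIso h₃ Y Z)).hom_inv_id
  have : Epi ((N.tensor h₂).map (η.tensorIso h₁ X Y).hom (𝟙 ((app η.F c).obj Z))) :=
    inferInstanceAs (Epi ((N.tensor h₂).mapIso (η.tensorIso h₁ X Y)
      (Iso.refl ((app η.F c).obj Z))).hom)
  rw [Iso.inv_comp_eq, ← cancel_epi ((N.tensor h₂).map (η.tensorIso h₁ X Y).hom (𝟙 _)),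
    reassoc_of% e₁, reassoc_of% η.assoc h₁ h₂ h₃ h₄ X Y Z, Iso.hom_inv_id_assoc, e₂,
    Category.comp_id]

theorem left_inv {a : G} (h : 1 * a = a) (X : M.ps.at_ a) :
    (η.tensorIso h M.unit X).inv ≫ (N.tensor h).map η.unitIso.inv (𝟙 ((app η.F a).obj X)) ≫
      (N.left h ((app η.F a).obj X)).hom = (app η.F a).map (M.left h X).hom := by
  have e : (N.tensor h).map η.unitIso.inv (𝟙 ((app η.F a).obj X)) ≫
      (N.tensor h).map η.unitIso.hom (𝟙 ((app η.F a).obj X)) = 𝟙 _ :=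
    ((N.tensor h).mapIso η.unitIso (Iso.refl ((app η.F a).obj X))).inv_hom_id
  rw [η.left, reassoc_of% e, Iso.inv_hom_id_assoc]

theorem right_inv {a : G} (h : a * 1 = a) (X : M.ps.at_ a) :
    (η.tensorIso h X M.unit).inv ≫ (N.tensor h).map (𝟙 ((app η.F a).obj X)) η.unitIso.inv ≫
      (N.right h ((app η.F a).obj X)).hom = (app η.F a).map (M.right h X).hom := by
  have e : (N.tensor h).map (𝟙 ((app η.F a).obj X)) η.unitIso.inv ≫
      (N.tensor h).map (𝟙 ((app η.F a).obj X)) η.unitIso.hom = 𝟙 _ :=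
    ((N.tensor h).mapIso (Iso.refl ((app η.F a).obj X)) η.unitIso).inv_hom_id
  rw [η.right, reassoc_of% e, Iso.inv_hom_id_assoc]

variable [hη : ∀ a, (app η.F a).IsEquivalence]

/-- An inverse of the component at `a`. -/
def invApp (a : G) : N.ps.at_ a ⥤ M.ps.at_ a := (app η.F a).inv

/-- The counit of the adjoint equivalence of the component at `a`. -/
def counitApp {a : G} (X : N.ps.at_ a) : (app η.F a).obj ((η.invApp a).obj X) ≅ X :=
  (app η.F a).asEquivalence.counitIso.app X

theorem counitApp_natural {a : G} {X Y : N.ps.at_ a} (f : X ⟶ Y) :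
    (app η.F a).map ((η.invApp a).map f) ≫ (η.counitApp Y).hom = (η.counitApp X).hom ≫ f :=
  (app η.F a).asEquivalence.counitIso.hom.naturality f

-- A map into the inverse is determined by its transpose. Combined with `map_invAct`,
-- `map_invTensor` and `map_invUnit`, this reduces each axiom for the inverse to the inverted axiom
-- of `η` and naturality of the counit.
variable {η} in
theorem invApp_ext {a : G} {X : M.ps.at_ a} {Y : N.ps.at_ a} {f f' : X ⟶ (η.invApp a).obj Y}
    (h : (app η.F a).map f ≫ (η.counitApp Y).hom = (app η.F a).map f' ≫ (η.counitApp Y).hom) :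
    f = f' :=
  (app η.F a).map_injective ((cancel_mono _).1 h)

/-- The isomorphism corresponding to an isomorphism under the adjunction. -/
def invIso {a : G} {X : M.ps.at_ a} {Y : N.ps.at_ a} (e : (app η.F a).obj X ≅ Y) :
    X ≅ (η.invApp a).obj Y :=
  (app η.F a).preimageIso (e ≪≫ (η.counitApp Y).symm)

theorem map_invIso {a : G} {X : M.ps.at_ a} {Y : N.ps.at_ a} (e : (app η.F a).obj X ≅ Y) :
    (app η.F a).map (η.invIso e).hom ≫ (η.counitApp Y).hom = e.hom := by
  have h : (app η.F a).map (η.invIso e).hom = e.hom ≫ (η.counitApp Y).inv :=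
    (app η.F a).map_preimage _
  rw [h, Category.assoc, Iso.inv_hom_id, Category.comp_id]

instance (a : G) : (η.invApp a).Additive where
  map_add {X Y f g} := invApp_ext (by
    rw [counitApp_natural, Functor.map_add, Preadditive.add_comp, Preadditive.comp_add,
      counitApp_natural, counitApp_natural])

instance (a : G) : (η.invApp a).Linear k where
  map_smul {X Y} f r := invApp_ext (by
    rw [counitApp_natural, Functor.map_smul, Linear.smul_comp, Linear.comp_smul,
      counitApp_natural])

/-- The action constraint of the inverse. -/
def invAct (g : G) {a a' : G} (h : g * a = a' * g) (X : N.ps.at_ a) :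
    (M.ps.act g h).obj ((η.invApp a).obj X) ≅ (η.invApp a').obj ((N.ps.act g h).obj X) :=
  η.invIso ((appAct η.F g h ((η.invApp a).obj X)).symm ≪≫ (N.ps.act g h).mapIso (η.counitApp X))

theorem map_invAct (g : G) {a a' : G} (h : g * a = a' * g) (X : N.ps.at_ a) :
    (app η.F a').map (η.invAct g h X).hom ≫ (η.counitApp ((N.ps.act g h).obj X)).hom =
      (appAct η.F g h ((η.invApp a).obj X)).inv ≫ (N.ps.act g h).map (η.counitApp X).hom :=
  η.map_invIso _

/-- The tensor constraint of the inverse. -/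
def invTensor {a b c : G} (h : a * b = c) (X : N.ps.at_ a) (Y : N.ps.at_ b) :
    (M.tensor h).obj ((η.invApp a).obj X) ((η.invApp b).obj Y) ≅
      (η.invApp c).obj ((N.tensor h).obj X Y) :=
  η.invIso ((η.tensorIso h ((η.invApp a).obj X) ((η.invApp b).obj Y)).symm ≪≫
    (N.tensor h).mapIso (η.counitApp X) (η.counitApp Y))

theorem map_invTensor {a b c : G} (h : a * b = c) (X : N.ps.at_ a) (Y : N.ps.at_ b) :
    (app η.F c).map (η.invTensor h X Y).hom ≫ (η.counitApp ((N.tensor h).obj X Y)).hom =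
      (η.tensorIso h ((η.invApp a).obj X) ((η.invApp b).obj Y)).inv ≫
        (N.tensor h).map (η.counitApp X).hom (η.counitApp Y).hom :=
  η.map_invIso _

/-- The unit constraint of the inverse. -/
def invUnit : M.unit ≅ (η.invApp 1).obj N.unit := η.invIso η.unitIso.symm

theorem map_invUnit : (app η.F 1).map η.invUnit.hom ≫ (η.counitApp N.unit).hom = η.unitIso.inv :=
  η.map_invIso _

theorem invAct_natural (g : G) {a a' : G} (h : g * a = a' * g) {X Y : N.ps.at_ a} (f : X ⟶ Y) :
    (η.invAct g h X).hom ≫ (η.invApp a').map ((N.ps.act g h).map f) =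
      (M.ps.act g h).map ((η.invApp a).map f) ≫ (η.invAct g h Y).hom :=
  invApp_ext (by
    rw [Functor.map_comp, Functor.map_comp, Category.assoc, Category.assoc, counitApp_natural,
      reassoc_of% η.map_invAct, map_invAct, ← Functor.map_comp, ← counitApp_natural,
      Functor.map_comp, reassoc_of% appAct_inv_natural])

theorem invAct_one {a : G} (h : 1 * a = a * 1) (X : N.ps.at_ a) :
    (η.invAct 1 h X).hom ≫ (η.invApp a).map (N.ps.actOne h X).hom =
      (M.ps.actOne h ((η.invApp a).obj X)).hom :=
  invApp_ext (by
    rw [Functor.map_comp, Category.assoc, counitApp_natural, reassoc_of% η.map_invAct,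
      actOne_natural, reassoc_of% appAct_inv_one])

theorem invAct_mul (g g' : G) {a a' a'' : G} (h : g * a = a' * g) (h' : g' * a' = a'' * g')
    (h'' : g' * g * a = a'' * (g' * g)) (X : N.ps.at_ a) :
    (η.invAct (g' * g) h'' X).hom ≫ (η.invApp a'').map (N.ps.actMul g g' h h' h'' X).hom =
      (M.ps.actMul g g' h h' h'' ((η.invApp a).obj X)).hom ≫
        (M.ps.act g' h').map (η.invAct g h X).hom ≫
          (η.invAct g' h' ((N.ps.act g h).obj X)).hom :=
  invApp_ext (by
    simp only [Functor.map_comp, Category.assoc]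
    rw [counitApp_natural, reassoc_of% η.map_invAct, actMul_natural, reassoc_of% appAct_inv_mul,
      map_invAct, reassoc_of% appAct_inv_natural, ← Functor.map_comp, ← Functor.map_comp,
      map_invAct])

theorem invTensor_natural {a b c : G} (h : a * b = c) {X X' : N.ps.at_ a} {Y Y' : N.ps.at_ b}
    (x : X ⟶ X') (y : Y ⟶ Y') :
    (M.tensor h).map ((η.invApp a).map x) ((η.invApp b).map y) ≫ (η.invTensor h X' Y').hom =
      (η.invTensor h X Y).hom ≫ (η.invApp c).map ((N.tensor h).map x y) :=
  invApp_ext (by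
    simp only [Functor.map_comp, Category.assoc]
    rw [counitApp_natural, reassoc_of% η.map_invTensor, map_invTensor,
      reassoc_of% η.tensorIso_inv_natural, ← LinCat.Bilin.map_comp, ← LinCat.Bilin.map_comp,
      counitApp_natural, counitApp_natural])

theorem invTensor_act (g : G) {a b c a' b' c' : G} (h : a * b = c) (h' : a' * b' = c')
    (ha : g * a = a' * g) (hb : g * b = b' * g) (hc : g * c = c' * g)
    (X : N.ps.at_ a) (Y : N.ps.at_ b) :
    (M.ps.act g hc).map (η.invTensor h X Y).hom ≫ (η.invAct g hc ((N.tensor h).obj X Y)).hom ≫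
        (η.invApp c').map (N.tensorAct g h h' ha hb hc X Y).hom =
      (M.tensorAct g h h' ha hb hc ((η.invApp a).obj X) ((η.invApp b).obj Y)).hom ≫
        (M.tensor h').map (η.invAct g ha X).hom (η.invAct g hb Y).hom ≫
          (η.invTensor h' ((N.ps.act g ha).obj X) ((N.ps.act g hb).obj Y)).hom :=
  invApp_ext (by
    simp only [Functor.map_comp, Category.assoc]
    rw [counitApp_natural, reassoc_of% η.map_invAct, reassoc_of% appAct_inv_natural,
      ← Functor.map_comp_assoc, map_invTensor, Functor.map_comp, Category.assoc,
      N.tensorAct_natural, reassoc_of% η.tensorIso_inv_act g h h' ha hb hc, map_invTensor,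
      reassoc_of% η.tensorIso_inv_natural, ← LinCat.Bilin.map_comp, ← LinCat.Bilin.map_comp,
      map_invAct, map_invAct])

theorem invUnit_act (g : G) (h : g * 1 = 1 * g) :
    (M.ps.act g h).map η.invUnit.hom ≫ (η.invAct g h N.unit).hom ≫
        (η.invApp 1).map (N.unitAct g h).hom = (M.unitAct g h).hom ≫ η.invUnit.hom :=
  invApp_ext (by
    simp only [Functor.map_comp, Category.assoc]
    rw [counitApp_natural, reassoc_of% η.map_invAct, reassoc_of% appAct_inv_natural,
      ← Functor.map_comp_assoc, map_invUnit, unitIso_inv_act])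

/-- On transposes the counits collect at the end of both sides. Naturality of the associator of `N`
moves them across it, and `assoc_inv` remains. -/
theorem invTensor_assoc {a b c ab bc abc : G} (h₁ : a * b = ab) (h₂ : ab * c = abc)
    (h₃ : b * c = bc) (h₄ : a * bc = abc) (X : N.ps.at_ a) (Y : N.ps.at_ b) (Z : N.ps.at_ c) :
    (M.tensor h₂).map (η.invTensor h₁ X Y).hom (𝟙 ((η.invApp c).obj Z)) ≫
        (η.invTensor h₂ ((N.tensor h₁).obj X Y) Z).hom ≫
          (η.invApp abc).map (N.assoc h₁ h₂ h₃ h₄ X Y Z).hom =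
      (M.assoc h₁ h₂ h₃ h₄ ((η.invApp a).obj X) ((η.invApp b).obj Y) ((η.invApp c).obj Z)).hom ≫
        (M.tensor h₄).map (𝟙 ((η.invApp a).obj X)) (η.invTensor h₃ Y Z).hom ≫
          (η.invTensor h₄ X ((N.tensor h₃).obj Y Z)).hom :=
  invApp_ext (by
    simp only [Functor.map_comp, Category.assoc]
    rw [counitApp_natural, reassoc_of% η.map_invTensor, reassoc_of% η.tensorIso_inv_natural,
      ← Category.assoc ((N.tensor h₂).map _ _), ← LinCat.Bilin.map_comp, map_invTensor,
      map_invTensor, reassoc_of% η.tensorIso_inv_natural, ← LinCat.Bilin.map_comp, map_invTensor,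
      CategoryTheory.Functor.map_id, CategoryTheory.Functor.map_id, Category.id_comp,
      -- An identity is inserted before the counit at `Z` so that the tensor splits into the inverse
      -- constraint of `η` followed by the three counits.
      Category.id_comp, ← Category.id_comp (η.counitApp Z).hom, LinCat.Bilin.map_comp,
      Category.assoc, N.assoc_natural, reassoc_of% η.assoc_inv h₁ h₂ h₃ h₄,
      ← LinCat.Bilin.map_comp, Category.id_comp, Category.id_comp])

theorem invTensor_left {a : G} (h : 1 * a = a) (X : N.ps.at_ a) :
    (M.left h ((η.invApp a).obj X)).hom =
      (M.tensor h).map η.invUnit.hom (𝟙 ((η.invApp a).obj X)) ≫ (η.invTensor h N.unit X).hom ≫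
        (η.invApp a).map (N.left h X).hom :=
  invApp_ext (by
    simp only [Functor.map_comp, Category.assoc]
    rw [counitApp_natural, reassoc_of% η.map_invTensor, reassoc_of% η.tensorIso_inv_natural,
      ← Category.assoc ((N.tensor h).map _ _), ← LinCat.Bilin.map_comp, map_invUnit,
      CategoryTheory.Functor.map_id, Category.id_comp, ← left_inv, Category.assoc, Category.assoc,
      ← N.left_natural, ← Category.assoc ((N.tensor h).map _ _), ← LinCat.Bilin.map_comp,
      Category.id_comp, Category.comp_id])

theorem invTensor_right {a : G} (h : a * 1 = a) (X : N.ps.at_ a) :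
    (M.right h ((η.invApp a).obj X)).hom =
      (M.tensor h).map (𝟙 ((η.invApp a).obj X)) η.invUnit.hom ≫ (η.invTensor h X N.unit).hom ≫
        (η.invApp a).map (N.right h X).hom :=
  invApp_ext (by
    simp only [Functor.map_comp, Category.assoc]
    rw [counitApp_natural, reassoc_of% η.map_invTensor, reassoc_of% η.tensorIso_inv_natural,
      ← Category.assoc ((N.tensor h).map _ _), ← LinCat.Bilin.map_comp, map_invUnit,
      CategoryTheory.Functor.map_id, Category.id_comp, ← right_inv, Category.assoc, Category.assoc,
      ← N.right_natural, ← Category.assoc ((N.tensor h).map _ _), ← LinCat.Bilin.map_comp,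
      Category.id_comp, Category.comp_id])

/-- The inverse, on underlying pseudofunctors. -/
def invData : HomData N.ps M.ps where
  fn a := { toFunctor := η.invApp a }
  act := η.invAct
  natural := η.invAct_natural
  one := η.invAct_one
  mul := η.invAct_mul

/-- The inverse of a morphism of monoidales whose components are equivalences. -/
def inv : Hom N M where
  F := η.invData.hom
  tensorIso := η.invTensor
  tensorIso_natural := η.invTensor_natural
  tensorIso_act := η.invTensor_act
  unitIso := η.invUnit
  unitIso_act := η.invUnit_act
  assoc := η.invTensor_assoc
  left := η.invTensor_left
  right := η.invTensor_right

/-- The components of the unit. -/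
def unitApp {a : G} (X : M.ps.at_ a) : X ≅ (η.invApp a).obj ((app η.F a).obj X) :=
  η.invIso (Iso.refl _)

theorem map_unitApp {a : G} (X : M.ps.at_ a) :
    (app η.F a).map (η.unitApp X).hom ≫ (η.counitApp ((app η.F a).obj X)).hom = 𝟙 _ :=
  η.map_invIso _

theorem unitApp_natural {a : G} {X Y : M.ps.at_ a} (f : X ⟶ Y) :
    f ≫ (η.unitApp Y).hom = (η.unitApp X).hom ≫ (η.invApp a).map ((app η.F a).map f) :=
  invApp_ext (by
    rw [Functor.map_comp, Functor.map_comp, Category.assoc, Category.assoc, counitApp_natural,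
      map_unitApp, reassoc_of% η.map_unitApp, Category.comp_id])

theorem unitApp_act (g : G) {a a' : G} (h : g * a = a' * g) (X : M.ps.at_ a) :
    (M.ps.act g h).map (η.unitApp X).hom ≫ (η.invAct g h ((app η.F a).obj X)).hom ≫
        (η.invApp a').map (appAct η.F g h X).hom = (η.unitApp ((M.ps.act g h).obj X)).hom :=
  invApp_ext (by
    simp only [Functor.map_comp, Category.assoc]
    rw [counitApp_natural, reassoc_of% η.map_invAct, reassoc_of% appAct_inv_natural,
      ← Functor.map_comp_assoc, map_unitApp, CategoryTheory.Functor.map_id, Category.id_comp,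
      Iso.inv_hom_id, map_unitApp])

theorem unitApp_tensor {a b c : G} (h : a * b = c) (X : M.ps.at_ a) (Y : M.ps.at_ b) :
    (η.unitApp ((M.tensor h).obj X Y)).hom =
      (M.tensor h).map (η.unitApp X).hom (η.unitApp Y).hom ≫
        (η.invTensor h ((app η.F a).obj X) ((app η.F b).obj Y)).hom ≫
          (η.invApp c).map (η.tensorIso h X Y).hom :=
  invApp_ext (by
    simp only [Functor.map_comp, Category.assoc]
    rw [counitApp_natural, reassoc_of% η.map_invTensor, reassoc_of% η.tensorIso_inv_natural,
      ← Category.assoc ((N.tensor h).map _ _), ← LinCat.Bilin.map_comp, map_unitApp, map_unitApp,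
      map_unitApp, LinCat.Bilin.map_id, Category.id_comp, Iso.inv_hom_id])

theorem unitApp_unit :
    (η.unitApp M.unit).hom = η.invUnit.hom ≫ (η.invApp 1).map η.unitIso.hom :=
  invApp_ext (by
    rw [Functor.map_comp, Category.assoc, counitApp_natural, reassoc_of% η.map_invUnit,
      Iso.inv_hom_id, map_unitApp])

/-- The unit of the equivalence. -/
def unitIso' : 𝟙 M ≅ (show M ⟶ N from η) ≫ (show N ⟶ M from η.inv) :=
  Monoidale.isoMk
    (Ps.isoMk (F := 𝟙 M.ps) (F' := η.F ≫ η.inv.F) η.unitApp η.unitApp_natural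
      (fun g a a' h X => by
        have e₁ := appAct_comp η.F η.inv.F g h X
        have e₂ := appAct_id M.ps g h X
        exact ((congrArg (fun r => (M.ps.act g h).map (η.unitApp X).hom ≫ r) e₁).trans
          (η.unitApp_act g h X)).trans ((congrArg (fun r => r ≫
            (η.unitApp ((M.ps.act g h).obj X)).hom) e₂).trans (Category.id_comp _)).symm))
    (fun h X Y => (Category.id_comp _).trans (η.unitApp_tensor h X Y))
    ((Category.id_comp _).trans η.unitApp_unit)

/-- The counit of the equivalence. -/
def counitIso' : (show N ⟶ M from η.inv) ≫ (show M ⟶ N from η) ≅ 𝟙 N :=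
  Monoidale.isoMk
    (Ps.isoMk (F := η.inv.F ≫ η.F) (F' := 𝟙 N.ps) η.counitApp η.counitApp_natural
      (fun g a a' h X => by
        have e₁ := appAct_comp η.inv.F η.F g h X
        have e₂ := appAct_id N.ps g h X
        have e₃ : ((appAct η.F g h ((η.invApp a).obj X)).hom ≫
            (app η.F a').map (η.invAct g h X).hom) ≫
              (η.counitApp ((N.ps.act g h).obj X)).hom = (N.ps.act g h).map (η.counitApp X).hom := by
          rw [Category.assoc, map_invAct, Iso.hom_inv_id_assoc]
        exact ((congrArg (fun r => (N.ps.act g h).map (η.counitApp X).hom ≫ r) e₂).trans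
          (Category.comp_id _)).trans (e₃.symm.trans (congrArg (fun r => r ≫
            (η.counitApp ((N.ps.act g h).obj X)).hom) e₁).symm)))
    (fun {a b c} h X Y => by
      have e : ((η.tensorIso h ((η.invApp a).obj X) ((η.invApp b).obj Y)).hom ≫
          (app η.F c).map (η.invTensor h X Y).hom) ≫ (η.counitApp ((N.tensor h).obj X Y)).hom =
            (N.tensor h).map (η.counitApp X).hom (η.counitApp Y).hom := by
        rw [Category.assoc, map_invTensor, Iso.hom_inv_id_assoc]
      exact e.trans (Category.comp_id _).symm)
    (by
      have e : (η.unitIso.hom ≫ (app η.F 1).map η.invUnit.hom) ≫ (η.counitApp N.unit).hom =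
          𝟙 N.unit := by
        rw [Category.assoc, map_invUnit, Iso.hom_inv_id]
      exact e)

/-- A morphism of monoidales whose components are equivalences is an equivalence. -/
def equivalence : Bicategory.Equivalence M N :=
  Bicategory.Equivalence.mkOfAdjointifyCounit η.unitIso' η.counitIso'

/-- Assertion 4 requires that `η` itself, and not some other 1-cell, be the equivalence. -/
theorem equivalence_hom : η.equivalence.hom = η := rfl

end Monoidale.Hom

end ComponentwiseEquivalence

open scoped CategoryTheory.Pseudofunctor.StrongTrans

/-! ### The local equivalence and the essential image of `H` -/

noncomputable section Biequivalence

variable {G : Type u} [Group G] {k : Type w} [CommRing k]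

/-- The components are inclusions of full subcategories, and the decomposition into homogeneous
objects is an axiom of `G`-crossed categories; its finite index set only has to be enumerated. -/
theorem CrossedCat.isCompletion_id (C : CrossedCat.{w, v, u} G k) :
    Monoidale.IsCompletion (𝟙 ((CrossedCat.homogFunctor G k).obj C)) where
  full a := inferInstanceAs (C.deg a).ι.Full
  faithful a := inferInstanceAs (C.deg a).ι.Faithful
  hom_eq_zero h X Y f := C.hom_eq_zero h X.property Y.property f
  exists_iso X := by
    obtain ⟨s, Y, hY, ⟨e⟩⟩ := C.exists_decomposition X
    let E : Fin s.card ≃ s := s.equivFin.symm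
    exact ⟨s.card, fun i => E i, fun i => ⟨Y (E i), hY (E i)⟩, ⟨e ≪≫
      biproduct.uniqueUpToIso (Y ∘ E) (((biproduct.bicone Y).whiskerIsBilimitIff E).symm
        (biproduct.isBilimit Y))⟩⟩

/-- Precomposition with the identity. -/
def CrossedCat.precompId (C D : CrossedCat.{w, v, u} G k) :
    (CrossedCat.homogFunctor G k).mapFunctor C D ⋙ Bicategory.precomp
      ((CrossedCat.homogFunctor G k).obj D) (𝟙 ((CrossedCat.homogFunctor G k).obj C)) ≅
        (CrossedCat.homogFunctor G k).mapFunctor C D :=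
  NatIso.ofComponents (fun F => Bicategory.leftUnitor ((CrossedCat.homogFunctor G k).map F))
    fun s => Bicategory.leftUnitor_naturality ((CrossedCat.homogFunctor G k).map₂ s)

/-- The universal property applied to the identity of `H C`: precomposing with an identity changes
the functor only by left unitors. -/
theorem CrossedCat.mapFunctor_isEquivalence (C D : CrossedCat.{w, v, u} G k) :
    ((CrossedCat.homogFunctor G k).mapFunctor C D).IsEquivalence :=
  have := C.isCompletion_id.isEquivalence D
  Functor.isEquivalence_of_iso (C.precompId D)

namespace Monoidale

variable {M N : Monoidale.{w, v, u} G k} {C : CrossedCat.{w, v, u} G k}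

/-- The natural isomorphism at a component of an invertible 2-cell. -/
def appIso {F F' : M ⟶ N} (r : F ≅ F') (a : G) :
    Ps.app (Hom.F F) a ≅ Ps.app (Hom.F F') a where
  hom := (r.hom.t.as.app ⟨⟨a⟩⟩).toNatTrans
  inv := (r.inv.t.as.app ⟨⟨a⟩⟩).toNatTrans
  hom_inv_id := congrArg (fun s : Hom₂ F F => (s.t.as.app ⟨⟨a⟩⟩).toNatTrans) r.hom_inv_id
  inv_hom_id := congrArg (fun s : Hom₂ F' F' => (s.t.as.app ⟨⟨a⟩⟩).toNatTrans) r.inv_hom_id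

/-- The equivalence of categories at a component of an equivalence. -/
def appEquivalence (e : Bicategory.Equivalence M N) (a : G) : M.ps.at_ a ≌ N.ps.at_ a :=
  CategoryTheory.Equivalence.mk (Ps.app (Hom.F e.hom) a) (Ps.app (Hom.F e.inv) a)
    (appIso e.unit a) (appIso e.counit a)

/-- An equivalence of monoidales gives equivalences of components, along which finite products can
be transported. In a preadditive category finite products are biproducts, so additivity of the
functors need not be discussed. -/
theorem HasDirectSums.of_equivalence (e : Bicategory.Equivalence M N) (hN : N.HasDirectSums) :
    M.HasDirectSums := fun a =>
  have := hN a
  have : HasFiniteProducts (M.ps.at_ a) :=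
    ⟨fun n => Adjunction.hasLimitsOfShape_of_equivalence (appEquivalence e a).functor⟩
  HasFiniteBiproducts.of_hasFiniteProducts

theorem hasDirectSums_homog (C : CrossedCat.{w, v, u} G k) : C.homog.HasDirectSums :=
  fun a => C.deg_hasFiniteBiproducts a

/-- Full faithfulness is part of being a completion. An object of degree `a` is a direct sum of
images of objects of `M a`, and an additive functor preserves the direct sum which these objects
have in `M a`. -/
theorem IsCompletion.app_isEquivalence {η : Hom M C.homog} (hη : IsCompletion (C := C) η)
    (hM : M.HasDirectSums) (a : G) : (Ps.app η.F a).IsEquivalence where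
  faithful :=
    have : (Ps.app η.F a ⋙ (C.deg a).ι).Faithful := hη.faithful a
    Functor.Faithful.of_comp _ (C.deg a).ι
  full :=
    let F : M.ps.at_ a ⥤ (C.deg a).FullSubcategory := Ps.app η.F a
    have : (F ⋙ (C.deg a).ι).Full := hη.full a
    Functor.Full.of_comp_faithful F (C.deg a).ι
  essSurj := ⟨fun X => by
    have := hM a
    have := C.deg_hasFiniteBiproducts a
    obtain ⟨⟨ι, Y, p, s, total⟩, h₁, h₂, h₃⟩ :=
      (Hom.toPre_isCompletion η hη).exists_resolution X.obj
    -- The presentation of a homogeneous object uses only generators of its own degree, so they all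
    -- lie in the single component `M a`.
    have hY : ∀ i, ∃ Z : M.ps.at_ a, Y i = Total.tot Z := fun i => by
      have h : M.pre.deg (Y i) = a := h₃ a X.property i
      generalize Y i = W at h
      obtain ⟨b, Z⟩ := W
      obtain rfl : b = a := h
      exact ⟨Z, rfl⟩
    choose Z hZ using hY
    obtain rfl : Y = fun i => Total.tot (Z i) := funext hZ
    classical
    let F : M.ps.at_ a ⥤ (C.deg a).FullSubcategory := Ps.app η.F a
    have : F.Additive := inferInstanceAs (Ps.app η.F a).Additive
    -- The presentation is a direct sum already in the full subcategory of degree `a`, with `X`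
    -- itself as vertex.
    let b : Bicone fun i => F.obj (Z i) :=
      { pt := X
        π := fun i => ObjectProperty.homMk (p i)
        ι := fun i => ObjectProperty.homMk (s i)
        ι_π := fun i j => by
          by_cases h : i = j
          · subst h
            rw [dif_pos rfl]
            exact ObjectProperty.hom_ext _ (h₂ i)
          · rw [dif_neg h]
            exact ObjectProperty.hom_ext _ (h₁ i j h) }
    have hb : b.IsBilimit := isBilimitOfTotal b (by
      refine (C.deg a).ι.map_injective ?_
      rw [Functor.map_sum]
      exact total)
    exact ⟨⨁ Z, ⟨F.mapBiproduct Z ≪≫ (biproduct.uniqueUpToIso _ hb).symm⟩⟩⟩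

theorem IsCompletion.hasDirectSums_iff {η : M ⟶ (CrossedCat.homogFunctor G k).obj C}
    (hη : IsCompletion η) : M.HasDirectSums ↔ ∃ e : Bicategory.Equivalence M
      ((CrossedCat.homogFunctor G k).obj C), e.hom = η :=
  ⟨fun hM =>
    have := app_isEquivalence (C := C) (η := η) hη hM
    ⟨Hom.equivalence (N := C.homog) η, Hom.equivalence_hom (N := C.homog) η⟩,
    fun ⟨e, _⟩ => .of_equivalence e (hasDirectSums_homog C)⟩

end Monoidale

end Biequivalence

end GCrossed

theorem mainTheorem4 (G : Type u) [Group G] (k : Type w) [CommRing k] :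
    (∀ C D : GCrossed.CrossedCat.{w, v, u} G k,
      ((GCrossed.CrossedCat.homogFunctor G k).mapFunctor C D).IsEquivalence) ∧
    (∀ M : GCrossed.Monoidale.{w, v, u} G k,
      M.HasDirectSums ↔ ∃ C : GCrossed.CrossedCat.{w, v, u} G k,
        Nonempty (CategoryTheory.Bicategory.Equivalence M
          ((GCrossed.CrossedCat.homogFunctor G k).obj C))) ∧
    (∀ M : GCrossed.Monoidale.{w, v, u} G k,
      ∃ (C : GCrossed.CrossedCat.{w, v, u} G k)
        (η : Quiver.Hom M ((GCrossed.CrossedCat.homogFunctor G k).obj C)),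
        GCrossed.Monoidale.IsCompletion η) ∧
    (∀ (M : GCrossed.Monoidale.{w, v, u} G k) (C : GCrossed.CrossedCat.{w, v, u} G k)
      (η : Quiver.Hom M ((GCrossed.CrossedCat.homogFunctor G k).obj C)),
      GCrossed.Monoidale.IsCompletion η →
        (∀ D : GCrossed.CrossedCat.{w, v, u} G k,
          (CategoryTheory.Functor.comp
            ((GCrossed.CrossedCat.homogFunctor G k).mapFunctor C D)
            (CategoryTheory.Bicategory.precomp
              ((GCrossed.CrossedCat.homogFunctor G k).obj D) η)).IsEquivalence) ∧
        (M.HasDirectSums ↔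
          ∃ e : CategoryTheory.Bicategory.Equivalence M
            ((GCrossed.CrossedCat.homogFunctor G k).obj C), e.hom = η)) ∧
    (∀ C : GCrossed.CrossedCat.{w, v, u} G k,
      GCrossed.Monoidale.IsCompletion
        (CategoryTheory.CategoryStruct.id
          ((GCrossed.CrossedCat.homogFunctor G k).obj C))) := by
  refine ⟨fun C D => C.mapFunctor_isEquivalence D, fun M => ⟨fun hM => ?_, ?_⟩,
    fun M => M.exists_isCompletion, fun M C η hη => ⟨fun D => hη.isEquivalence D,
      hη.hasDirectSums_iff⟩, fun C => C.isCompletion_id⟩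
  -- The completion of `M` serves as `C`: when the components have direct sums, its comparison
  -- 1-cell is an equivalence.
  · obtain ⟨C, η, hη⟩ := M.exists_isCompletion
    obtain ⟨e, -⟩ := hη.hasDirectSums_iff.1 hM
    exact ⟨C, ⟨e⟩⟩
  · rintro ⟨C, ⟨e⟩⟩
    exact .of_equivalence e (GCrossed.Monoidale.hasDirectSums_homog C)
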